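/- Let $M$ be a smooth (Hausdorff) $n$-dimensional manifold, $F$ a Finsler metric on $M$ (continuous on $TM$, smooth off the zero section, fiberwise positively homogeneous of degree one, positive on nonzero vectors, with $F^2$ fiberwise strongly convex), and $\gamma_0\colon[0,1]\to M$ a nonconstant affinely parametrized geodesic of $(M,F)$. Let $h$ be an auxiliary Riemannian metric on $M$ with exponential map $\exp$, let $E_1,\dots,E_n$ be smooth $h$-orthonormal vector fields along $\gamma_0$, and let $U\subset\mathbb R^n$ be the open Euclidean ball with centre $0$ and radius $\delta>0$, where $2\delta$ does not exceed the injectivity radius of $h$ at any point $\gamma_0(t)$, $t\in[0,1]$. Put $$\varphi(t,q)=\exp_{\gamma_0(t)}\Big(\sum_i q_iE_i(t)\Big),\qquad \tilde G(t,q,y)=F^2\big(\varphi(t,q),\mathrm d\varphi(t,q)[(1,y)]\big)$$ for $(t,q,y)\in[0,1]\times U\times\mathbb R^n$. Assume that the endpoints of $\gamma_0$ are not conjugate along $\gamma_0$, i.e. that, in the coordinates $\varphi$, the only solution $\xi$ of the Jacobi equation $\frac{\mathrm d}{\mathrm dt}(\tilde G_{yy}\dot\xi+\tilde G_{yq}\xi)=\tilde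 G_{qy}\dot\xi+\tilde G_{qq}\xi$ (derivatives of $\tilde G$ at $(t,0,0)$) on $[0,1]$ with $\xi(0)=\xi(1)=0$ is $\xi=0$. Let $U'$ be an open set with $0\in U'$ and $\overline{U'}\subset U$, let $\alpha\colon\mathbb R^n\to\mathbb R$ be smooth with $\alpha=1$ on $U'$ and $\alpha=0$ outside $U$, and let $$\mathcal L(t,q,y)=\alpha(q)\tilde G(t,q,y)+(1-\alpha(q))|y|^2,\qquad \mathcal A_{\mathcal L}(x)=\tfrac12\int_0^1\mathcal L(t,x,\dot x)\,\mathrm dt,\quad x\in H^1_0([0,1],\mathbb R^n).$$ Equip $H^1_0([0,1],\mathbb R^n)$ with the scalar product $\langle\xi,\eta\rangle=\frac12\int_0^1\tilde G_{yy}(t,0,0)[\dot\xi,\dot\eta]\,\mathrm dt$ and the associated norm $\|\cdot\|_0$, which is equivalent to the standard norm $\|\dot\xi\|_{L^2}$ (and equal to it if $E_1,\dots,E_n$ are orthonormal for the fundamental tensor $g_{\dot\gamma_0}=\frac12\partial^2_{vv}F^2(\dot\gamma_0)$); let $\nabla$ be the gradient with respect to it. Then $\mathcal A_{\mathcal L}$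 is differentiable near $0$ and twice Gateaux differentiable at $0$, and its second Gateaux differential at $0$ is represented, with respect to $\langle\cdot,\cdot\rangle$, by a bounded operator $A=I+K$ with $K$ compact. Moreover there exist a neighbourhood $\mathcal U'$ of $0$ in $H^1_0([0,1],\mathbb R^n)$, which may be chosen inside any prescribed neighbourhood $\mathcal B$ of $0$, and a constant $\mu_0>0$ such that $$\mathrm d\mathcal A_{\mathcal L}(x)[Ax]\ \ge\ \mu_0\,\|\nabla\mathcal A_{\mathcal L}(x)\|_0^2\qquad\text{for all }x\in\mathcal U'.$$ -/

import Mathlib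

open Set MeasureTheory Filter Topology
open scoped Manifold ContDiff ENNReal NNReal

noncomputable section

/-! ## The Sobolev space `H¹₀([0,1], ℝⁿ)` -/

/-- Euclidean `ℝⁿ`. -/
abbrev Euc (n : ℕ) : Type := EuclideanSpace ℝ (Fin n)

/-- `L²([0,1], ℝⁿ)`. -/
abbrev LTwo (n : ℕ) : Type := Lp (Euc n) 2 (volume.restrict (Icc (0 : ℝ) 1))

theorem LTwo.integrable {n : ℕ} (u : LTwo n) :
    Integrable (fun t => u t) (volume.restrict (Icc (0 : ℝ) 1)) :=
  (Lp.memLp u).integrable (by norm_num)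

/-- `H¹₀([0,1], ℝⁿ)`: a curve `x` of class `H¹` with `x 0 = x 1 = 0` is stored through its weak
derivative, that is an `L²` function of mean zero; the curve itself is the primitive
`H10.curve x`. The norm carried by the type is `‖ẋ‖_{L²}`. -/
def H10 (n : ℕ) : Submodule ℝ (LTwo n) where
  carrier := {u | ∫ t in Icc (0 : ℝ) 1, u t = 0}
  zero_mem' := by
    show ∫ t in Icc (0 : ℝ) 1, (0 : LTwo n) t = 0
    rw [integral_congr_ae (Lp.coeFn_zero _ _ _)]
    simp
  add_mem' := by
    intro u v hu hv
    simp only [mem_ofPred_eq] at *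
    rw [integral_congr_ae (Lp.coeFn_add u v)]
    simp only [Pi.add_apply]
    rw [integral_add u.integrable v.integrable, hu, hv, add_zero]
  smul_mem' := by
    intro c u hu
    simp only [mem_ofPred_eq] at *
    rw [integral_congr_ae (Lp.coeFn_smul c u)]
    simp only [Pi.smul_apply]
    rw [integral_smul, hu, smul_zero]

/-- The derivative `ẋ` of `x ∈ H¹₀` (a representative). -/
def H10.vel {n : ℕ} (x : H10 n) : ℝ → Euc n := fun t => (x : LTwo n) t

/-- The curve `t ↦ x(t)` underlying `x ∈ H¹₀`. -/
def H10.curve {n : ℕ} (x : H10 n) : ℝ → Euc n := fun t => ∫ s in (0 : ℝ)..t, H10.vel x s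

theorem H10.intervalIntegrable_vel {n : ℕ} (x : H10 n) :
    IntervalIntegrable (H10.vel x) volume 0 1 := by
  rw [intervalIntegrable_iff_integrableOn_Icc_of_le zero_le_one]
  exact LTwo.integrable (x : LTwo n)

theorem H10.curve_zero {n : ℕ} (x : H10 n) : H10.curve x 0 = 0 := by simp [H10.curve]

theorem H10.curve_one {n : ℕ} (x : H10 n) : H10.curve x 1 = 0 := by
  have h : ∫ t in Icc (0 : ℝ) 1, (x : LTwo n) t = 0 := x.2
  rw [H10.curve, intervalIntegral.integral_of_le zero_le_one, ← integral_Icc_eq_integral_Ioc]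
  exact h

theorem H10.ae_hasDerivAt_curve {n : ℕ} (x : H10 n) :
    ∀ᵐ t : ℝ, t ∈ Icc (0 : ℝ) 1 → HasDerivAt (H10.curve x) (H10.vel x t) t := by
  filter_upwards [(H10.intervalIntegrable_vel x).ae_hasDerivAt_integral] with t ht hmem
  rw [← uIcc_of_le (zero_le_one' ℝ)] at hmem
  exact ht hmem 0 (by simp)

/-- Every primitive `f(t) = ∫₀ᵗ v` of a square integrable `v` with `f 1 = 0` is the curve of an
element of `H10`. -/
theorem H10.exists_curve_eq {n : ℕ} (f v : ℝ → Euc n)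
    (hv : MemLp v 2 (volume.restrict (Icc (0 : ℝ) 1)))
    (hf : ∀ t ∈ Icc (0 : ℝ) 1, f t = ∫ s in (0 : ℝ)..t, v s) (h1 : f 1 = 0) :
    ∃ x : H10 n, EqOn (H10.curve x) f (Icc 0 1) := by
  have hae := (ae_restrict_iff' measurableSet_Icc).1 hv.coeFn_toLp
  have key : ∀ t ∈ Icc (0 : ℝ) 1, ∫ s in (0 : ℝ)..t, hv.toLp v s = f t := by
    intro t ht
    rw [hf t ht]
    apply intervalIntegral.integral_congr_ae
    filter_upwards [hae] with s hs hmem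
    rw [uIoc_of_le ht.1] at hmem
    exact hs ⟨hmem.1.le, hmem.2.trans ht.2⟩
  refine ⟨⟨hv.toLp v, ?_⟩, fun t ht => key t ht⟩
  show ∫ t in Icc (0 : ℝ) 1, hv.toLp v t = 0
  rw [integral_Icc_eq_integral_Ioc, ← intervalIntegral.integral_of_le zero_le_one,
    key 1 (by simp), h1]

/-! ## Finsler metrics, geodesics and the exponential map of an auxiliary Riemannian metric -/

section Manifold

variable {n : ℕ} {M : Type*} [TopologicalSpace M] [ChartedSpace (Euc n) M]
  [IsManifold 𝓘(ℝ, Euc n) ∞ M]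

/-- A Finsler metric on the `n`-dimensional manifold `M`: a continuous function on `TM`, smooth
away from the zero section, fiberwise positively homogeneous of degree one, positive on nonzero
vectors, and with fiberwise strongly convex square: the second derivative of
`s ↦ F²(v + s w)` at `s = 0` is positive for all `v ≠ 0` and `w ≠ 0`. -/
structure FinslerMetric (n : ℕ) (M : Type*) [TopologicalSpace M] [ChartedSpace (Euc n) M]
    [IsManifold 𝓘(ℝ, Euc n) ∞ M] where
  toFun : TangentBundle 𝓘(ℝ, Euc n) M → ℝ
  continuous_toFun : Continuous toFun
  smooth : ContMDiffOn (𝓘(ℝ, Euc n).tangent) 𝓘(ℝ, ℝ) ∞ toFun {u | u.2 ≠ 0}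
  pos : ∀ (p : M) (v : TangentSpace 𝓘(ℝ, Euc n) p), v ≠ 0 → 0 < toFun ⟨p, v⟩
  homogeneous : ∀ (p : M) (v : TangentSpace 𝓘(ℝ, Euc n) p) (c : ℝ), 0 ≤ c →
    toFun ⟨p, c • v⟩ = c * toFun ⟨p, v⟩
  strongly_convex : ∀ (p : M) (v w : TangentSpace 𝓘(ℝ, Euc n) p), v ≠ 0 → w ≠ 0 →
    0 < iteratedDeriv 2 (fun s : ℝ => toFun ⟨p, v + s • w⟩ ^ 2) 0

/-- Smooth Riemannian metrics on `M`. -/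
abbrev RiemMetric (n : ℕ) (M : Type*) [TopologicalSpace M] [ChartedSpace (Euc n) M]
    [IsManifold 𝓘(ℝ, Euc n) ∞ M] : Type _ :=
  Bundle.ContMDiffRiemannianMetric 𝓘(ℝ, Euc n) ∞ (Euc n) (TangentSpace 𝓘(ℝ, Euc n) : M → Type _)

/-- The velocity `(c(t), ċ(t)) ∈ TM` of a curve `c : [0,1] → M` (one-sided at the endpoints). -/
def velocity (n : ℕ) {M : Type*} [TopologicalSpace M] [ChartedSpace (Euc n) M]
    (c : ℝ → M) (t : ℝ) : TangentBundle 𝓘(ℝ, Euc n) M :=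
  tangentMapWithin 𝓘(ℝ, ℝ) 𝓘(ℝ, Euc n) c (Icc 0 1) ⟨t, (1 : ℝ)⟩

/-- The expression of an autonomous Lagrangian `L : TM → ℝ` in the chart of `M` around `p`,
as a function of (position, velocity). -/
def chartLagrangian (L : TangentBundle 𝓘(ℝ, Euc n) M → ℝ) (p : M) : Euc n × Euc n → ℝ :=
  fun z => L (tangentMap 𝓘(ℝ, Euc n) 𝓘(ℝ, Euc n) (extChartAt 𝓘(ℝ, Euc n) p).symm ⟨z.1, z.2⟩)

/-- `c : [0,1] → M` is a smooth solution of the Euler-Lagrange equation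
`d/dt (∂L/∂v) = ∂L/∂x` of `L : TM → ℝ`; at the time `t` the equation is read in the
chart around `c t`. -/
def IsExtremal (L : TangentBundle 𝓘(ℝ, Euc n) M → ℝ) (c : ℝ → M) : Prop :=
  ContMDiffOn 𝓘(ℝ, ℝ) 𝓘(ℝ, Euc n) ∞ c (Icc 0 1) ∧
  ∀ t ∈ Icc (0 : ℝ) 1,
    let x : ℝ → Euc n := fun s => extChartAt 𝓘(ℝ, Euc n) (c t) (c s)
    let x' : ℝ → Euc n := derivWithin x (Icc 0 1)
    let l := chartLagrangian L (c t)
    ∀ w : Euc n, HasDerivWithinAt (fun s => fderiv ℝ l (x s, x' s) (0, w))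
      (fderiv ℝ l (x t, x' t) (w, 0)) (Icc 0 1) t

/-- Geodesics `[0,1] → M` (affinely parametrized) of a Finsler metric: the extremals of `F²`. -/
def FinslerMetric.IsGeodesic (F : FinslerMetric n M) (c : ℝ → M) : Prop :=
  IsExtremal (fun u => F.toFun u ^ 2) c

/-- Geodesics `[0,1] → M` (affinely parametrized) of a Riemannian metric: the extremals of
`h(v,v)`. -/
def IsRiemGeodesic (h : RiemMetric n M) (c : ℝ → M) : Prop :=
  IsExtremal (fun u => h.inner u.1 u.2 u.2) c

/-- `u ∈ TM` is in the domain of the exponential map of `h`. -/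
def InExpDomain (h : RiemMetric n M) (u : TangentBundle 𝓘(ℝ, Euc n) M) : Prop :=
  ∃ c : ℝ → M, IsRiemGeodesic h c ∧ velocity n c 0 = u

open Classical in
/-- The exponential map of `h`: the endpoint at time `1` of the geodesic with initial velocity
`u ∈ TM` (and the base point of `u` outside of the domain of the exponential map). -/
def riemExp (h : RiemMetric n M) (u : TangentBundle 𝓘(ℝ, Euc n) M) : M :=
  if H : InExpDomain h u then H.choose 1 else u.1

/-- The exponential map of `h` at `p` is defined on the open `h`-ball of radius `r` in `T_pM` and
is there a diffeomorphism onto its image: it is smooth, injective and has injective (hence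
bijective) differentials. -/
def ExpDiffeoOnBall (h : RiemMetric n M) (p : M) (r : ℝ≥0) : Prop :=
  let e : Euc n → M := fun v => riemExp h ⟨p, v⟩
  let B : Set (Euc n) := {v | h.inner p v v < (r : ℝ) ^ 2}
  (∀ v ∈ B, InExpDomain h ⟨p, v⟩) ∧ InjOn e B ∧
  ContMDiffOn 𝓘(ℝ, Euc n) 𝓘(ℝ, Euc n) ∞ e B ∧
  ∀ v ∈ B, Function.Injective (mfderiv 𝓘(ℝ, Euc n) 𝓘(ℝ, Euc n) e v)

/-- The injectivity radius of `h` at `p`. -/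
def injRadius (h : RiemMetric n M) (p : M) : ℝ≥0∞ :=
  ⨆ (r : ℝ≥0) (_ : ExpDiffeoOnBall h p r), (r : ℝ≥0∞)

/-- `E₁, …, Eₙ` are smooth `h`-orthonormal vector fields along `γ : [0,1] → M`. -/
def IsOrthonormalFrameAlong (h : RiemMetric n M) (γ : ℝ → M)
    (E : Fin n → ∀ t : ℝ, TangentSpace 𝓘(ℝ, Euc n) (γ t)) : Prop :=
  (∀ i, ContMDiffOn 𝓘(ℝ, ℝ) (𝓘(ℝ, Euc n).tangent) ∞
    (fun t => (⟨γ t, E i t⟩ : TangentBundle 𝓘(ℝ, Euc n) M)) (Icc 0 1)) ∧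
  ∀ t ∈ Icc (0 : ℝ) 1, ∀ i j, h.inner (γ t) (E i t) (E j t) = if i = j then 1 else 0

/-- The coordinates `φ(t,q) = exp_{γ(t)} (P_t q)`, `P_t q = ∑ qᵢ Eᵢ(t)`, around `γ`. -/
def tubeMap (h : RiemMetric n M) (γ : ℝ → M)
    (E : Fin n → ∀ t : ℝ, TangentSpace 𝓘(ℝ, Euc n) (γ t)) : ℝ × Euc n → M :=
  fun z => riemExp h ⟨γ z.1, ∑ i, z.2 i • E i z.1⟩

/-- The Lagrangian `G(t,q,y) = F²(φ(t,q), dφ(t,q)[(1,y)])` on `[0,1] × U × ℝⁿ`, where `U` is the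
Euclidean ball of radius `δ`. -/
def tubeLagrangian (F : FinslerMetric n M) (h : RiemMetric n M) (γ : ℝ → M)
    (E : Fin n → ∀ t : ℝ, TangentSpace 𝓘(ℝ, Euc n) (γ t)) (δ : ℝ) (t : ℝ) (q y : Euc n) : ℝ :=
  F.toFun (tangentMapWithin 𝓘(ℝ, ℝ × Euc n) 𝓘(ℝ, Euc n) (tubeMap h γ E)
    (Icc 0 1 ×ˢ Metric.ball 0 δ) ⟨(t, q), ((1 : ℝ), y)⟩) ^ 2

end Manifold

/-! ## Time-dependent Lagrangians on `ℝⁿ` and their action -/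

section Action

variable {n : ℕ}

/-- The second differential of `L(t,·,·)` at `(q,y) = (0,0)`. -/
def hessAtZero (L : ℝ → Euc n → Euc n → ℝ) (t : ℝ) :
    (Euc n × Euc n) →L[ℝ] (Euc n × Euc n) →L[ℝ] ℝ :=
  fderiv ℝ (fderiv ℝ (fun z : Euc n × Euc n => L t z.1 z.2)) (0, 0)

/-- `ξ` is a Jacobi field along the curve `0`, that is, a solution on `[0,1]` of the linearized
Euler-Lagrange equation `d/dt (L_yy ξ' + L_yq ξ) = L_qy ξ' + L_qq ξ` at `(t,0,0)`. -/
def IsJacobiField (L : ℝ → Euc n → Euc n → ℝ) (ξ : ℝ → Euc n) : Prop :=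
  ContDiffOn ℝ 1 ξ (Icc 0 1) ∧
  ∀ t ∈ Icc (0 : ℝ) 1, ∀ w : Euc n,
    HasDerivWithinAt (fun s => hessAtZero L s (ξ s, derivWithin ξ (Icc 0 1) s) (0, w))
      (hessAtZero L t (ξ t, derivWithin ξ (Icc 0 1) t) (w, 0)) (Icc 0 1) t

/-- The endpoints `t = 0` and `t = 1` are not conjugate along the curve `0`: a Jacobi field that
vanishes at both of them vanishes identically. -/
def NonConjugate (L : ℝ → Euc n → Euc n → ℝ) : Prop :=
  ∀ ξ : ℝ → Euc n, IsJacobiField L ξ → ξ 0 = 0 → ξ 1 = 0 → ∀ t ∈ Icc (0 : ℝ) 1, ξ t = 0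

/-- The modified Lagrangian `α(q) G(t,q,y) + (1 - α(q)) |y|²`. -/
def modLagrangian (α : Euc n → ℝ) (G : ℝ → Euc n → Euc n → ℝ) (t : ℝ) (q y : Euc n) : ℝ :=
  α q * G t q y + (1 - α q) * ‖y‖ ^ 2

/-- The action functional `½ ∫₀¹ L(t, x, ẋ) dt` on `H¹₀([0,1], ℝⁿ)`. -/
def action (L : ℝ → Euc n → Euc n → ℝ) (x : H10 n) : ℝ :=
  (1 / 2) * ∫ t in (0 : ℝ)..1, L t (H10.curve x t) (H10.vel x t)

/-- The scalar product `⟨ξ, η⟩ = ½ ∫₀¹ G_yy(t,0,0)[ξ̇, η̇] dt` on `H¹₀([0,1], ℝⁿ)`. For the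
Lagrangian of a Finsler geodesic `γ` in the coordinates `φ`, the bilinear form `½ G_yy(t,0,0)`
is the fundamental tensor of `F` at `γ̇(t)` in the frame `E(t)`; it is the Euclidean one, and
the scalar product is `∫₀¹ ξ̇ · η̇ dt`, if the frame is orthonormal for the fundamental tensor. -/
def scalarProd (G : ℝ → Euc n → Euc n → ℝ) (ξ η : H10 n) : ℝ :=
  (1 / 2) * ∫ t in (0 : ℝ)..1, hessAtZero G t (0, H10.vel ξ t) (0, H10.vel η t)

/-- The bounded operator `A` represents, with respect to the scalar product `sp`, the second
Gateaux differential of `f` at `0`, i.e. the Gateaux differential at `0` of the map `x ↦ df(x)`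
into the dual space (`f` being differentiable near `0`). -/
def RepresentsSecondGateauxAtZero (f : H10 n → ℝ) (sp : H10 n → H10 n → ℝ)
    (A : H10 n →L[ℝ] H10 n) : Prop :=
  (∀ᶠ x in 𝓝 (0 : H10 n), DifferentiableAt ℝ f x) ∧
  ∀ ξ : H10 n, ∃ D : H10 n →L[ℝ] ℝ,
    HasDerivAt (fun s : ℝ => fderiv ℝ f (s • ξ)) D 0 ∧ ∀ η, D η = sp (A ξ) η

/-- `g` is the gradient of `f` at `x` with respect to the scalar product `sp`. -/
def IsGradientAt (f : H10 n → ℝ) (sp : H10 n → H10 n → ℝ) (x g : H10 n) : Prop :=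
  ∃ D : H10 n →L[ℝ] ℝ, HasFDerivAt f D x ∧ ∀ η, D η = sp g η

end Action

end

noncomputable section

/-! ## Hilbert space structure of `H¹₀` -/

/-! The estimate concerns only a small ball of H¹₀. There curves are uniformly small, so they stay
where the cut-off equals 1, and the modified action is the action of the tubular Lagrangian G. It
suffices to prove, near 0, that dA(x)[Ax] ≥ μ‖x‖² (`TameLagrangian.exists_actionDeriv_hessOp_ge`)
and ‖dA(x)‖ ≤ C‖x‖ (`TameLagrangian.exists_norm_actionDeriv_le`). By Riesz representation the second
bound also bounds the gradient, and the quotient of the two constants gives μ₀.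

The difficulty is that the second order expansion is not available as on a C² functional: F² is not
assumed smooth at zero velocity, and a small H¹ norm does not make velocities uniformly small. What
survives is recorded in `TameLagrangian`: DG is Lipschitz with controlled growth, G is uniformly
convex in the velocity, DG(t,·,·) is differentiable at (0,0), and the zero curve is an extremal. The
remainder of DG at (0,0) is then a bounded modulus, tending to zero pointwise, times the size of the
argument, plus a term quadratic in the velocity and paired with the position increment. Dominated
convergence makes it negligible when it is tested against strongly convergent directions
(`TameLagrangian.tendsto_remainder_div`), but not uniformly over the unit ball.

The second variation is Q(ξ,η) = ⟨Aξ,η⟩. After subtraction of the scalar product every term of Q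
contains a position factor, so A = I + K with K compact. The kernel of A consists of Jacobi fields
vanishing at both ends, hence is zero.

For the lower bound suppose dA(x_k)[Ax_k] < ‖x_k‖²/(k+1) with x_k → 0. Put v_k = x_k/‖x_k‖ and pass
to a weak limit u. Split Av_k = (v_k − u) + (u + Kv_k). The second summand converges strongly to Au,
so dA(x_k) on it, divided by ‖x_k‖, tends to Q(u,Au) = ⟨Au,Au⟩. On the first, merely weakly null,
summand convexity in the velocity replaces the expansion and gives at least (c/2)‖v_k − u‖² + o(1)
(`TameLagrangian.actionDeriv_lower_bound`). The sum is at most o(1), so Au = 0, hence u = 0, and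
then ‖v_k‖ = 1 contradicts c/2 ≤ 0.

It remains to see that G is tame (`tubeLagrangian_tameAt`). In a chart G(t,q,y) = l(z, v + Wy),
where l is F² in the chart and (z, v, W) depends on (t,q) through the exponential map. Compactness
of the unit sphere and homogeneity give the Lipschitz and convexity estimates for l down to zero
velocity. A nonconstant geodesic has constant nonzero speed, so l is smooth at its velocity. Joint
smoothness of the exponential map in base point and vector comes from the inverse function theorem
on C([0,1]) and uniqueness for the geodesic equation (`exists_local_exp`). The Euler–Lagrange
equation is carried to the tube by its covariance and by the vanishing of the mixed second
differential of exp at the zero section. -/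

/-- Lebesgue measure on `[0,1]`. -/
abbrev unitMeasure : Measure ℝ := volume.restrict (Icc (0 : ℝ) 1)

instance unitMeasure.isProbabilityMeasure : IsProbabilityMeasure unitMeasure :=
  ⟨by simp [unitMeasure]⟩

theorem ae_unitMeasure_mem : ∀ᵐ t ∂unitMeasure, t ∈ Icc (0 : ℝ) 1 :=
  ae_restrict_mem measurableSet_Icc

theorem intervalIntegral_eq_unitMeasure {V : Type*} [NormedAddCommGroup V] [NormedSpace ℝ V]
    (f : ℝ → V) : ∫ t in (0 : ℝ)..1, f t = ∫ t, f t ∂unitMeasure := by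
  rw [intervalIntegral.integral_of_le zero_le_one, ← integral_Icc_eq_integral_Ioc]

/-- Cauchy-Schwarz for real functions. -/
theorem integral_mul_le_sqrt {Ω : Type*} [MeasurableSpace Ω] {μ : Measure Ω} {f g : Ω → ℝ}
    (hf : MemLp f 2 μ) (hg : MemLp g 2 μ) :
    ∫ a, f a * g a ∂μ ≤ √(∫ a, f a ^ 2 ∂μ) * √(∫ a, g a ^ 2 ∂μ) := by
  have key : ∀ {f : Ω → ℝ} (hf : MemLp f 2 μ), ‖hf.toLp f‖ = √(∫ a, f a ^ 2 ∂μ) := by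
    intro f hf
    rw [norm_eq_sqrt_real_inner, L2.inner_def]
    congr 1
    apply integral_congr_ae
    filter_upwards [hf.coeFn_toLp] with a ha
    rw [ha]; simp [pow_two]
  have := real_inner_le_norm (hf.toLp f) (hg.toLp g)
  rw [key, key, L2.inner_def] at this
  refine le_trans (le_of_eq ?_) this
  apply integral_congr_ae
  filter_upwards [hf.coeFn_toLp, hg.coeFn_toLp] with a ha hb
  rw [ha, hb]; simp [mul_comm]

section Hilbert

variable {n : ℕ}

/-- The mean is a bounded functional on L² because the measure is finite. -/
theorem H10.isClosed : IsClosed (H10 n : Set (LTwo n)) := by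
  have hc : Continuous fun u : LTwo n => ∫ t in Icc (0 : ℝ) 1, u t := by
    have h1 : Continuous fun u : LTwo n => ∫ t, (u t) ∂unitMeasure := by
      let L : LTwo n →ₗ[ℝ] Euc n :=
        { toFun := fun u => ∫ t, (u t) ∂unitMeasure
          map_add' := fun u v => by
            rw [integral_congr_ae (Lp.coeFn_add u v)]
            exact integral_add u.integrable v.integrable
          map_smul' := fun c u => by
            rw [integral_congr_ae (Lp.coeFn_smul c u)]
            exact integral_smul c _ }
      refine (L.mkContinuous 1 fun u => ?_).continuous
      rw [one_mul]
      have h := (Lp.memLp u).mono_exponent (p := 1) (by norm_num)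
      calc ‖∫ t, u t ∂unitMeasure‖ ≤ ∫ t, ‖u t‖ ∂unitMeasure := norm_integral_le_integral_norm _
        _ = ENNReal.toReal (eLpNorm u 1 unitMeasure) := by
          rw [integral_norm_eq_lintegral_enorm (Lp.aestronglyMeasurable u),
            eLpNorm_one_eq_lintegral_enorm]
        _ ≤ ENNReal.toReal (eLpNorm u 2 unitMeasure) := by
          refine ENNReal.toReal_mono (Lp.memLp u).2.ne ?_
          exact eLpNorm_le_eLpNorm_of_exponent_le (by norm_num) (Lp.aestronglyMeasurable u)
        _ = ‖u‖ := rfl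
    exact h1
  exact isClosed_singleton.preimage hc (t := {0})

instance H10.completeSpace : CompleteSpace (H10 n) := H10.isClosed.completeSpace_coe

/-- Separability turns weak-* compactness of balls into sequential compactness, which both the
compactness of K and the final contradiction argument use. -/
instance H10.separableSpace : TopologicalSpace.SeparableSpace (H10 n) := by
  have : TopologicalSpace.SeparableSpace (Euc n) := inferInstance
  have : Fact ((2 : ℝ≥0∞) ≠ ⊤) := ⟨by norm_num⟩
  have : SecondCountableTopology (LTwo n) := Lp.SecondCountableTopology
  have : SecondCountableTopology (H10 n) := TopologicalSpace.Subtype.secondCountableTopology _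
  exact TopologicalSpace.SecondCountableTopology.to_separableSpace

theorem H10.memLp_vel (x : H10 n) : MemLp (H10.vel x) 2 unitMeasure := Lp.memLp (x : LTwo n)

theorem H10.memLp_norm_vel (x : H10 n) : MemLp (fun t => ‖H10.vel x t‖) 2 unitMeasure :=
  (H10.memLp_vel x).norm

theorem H10.integrable_vel (x : H10 n) : Integrable (H10.vel x) unitMeasure :=
  LTwo.integrable (x : LTwo n)

theorem H10.integrable_norm_vel_sq (x : H10 n) :
    Integrable (fun t => ‖H10.vel x t‖ ^ 2) unitMeasure := (H10.memLp_norm_vel x).integrable_sq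

theorem H10.inner_eq (x y : H10 n) :
    inner ℝ x y = ∫ t, inner ℝ (H10.vel x t) (H10.vel y t) ∂unitMeasure := rfl

theorem H10.integral_norm_vel_sq (x : H10 n) :
    ∫ t, ‖H10.vel x t‖ ^ 2 ∂unitMeasure = ‖x‖ ^ 2 := by
  rw [← real_inner_self_eq_norm_sq, H10.inner_eq]
  simp

theorem H10.integral_norm_vel_le (x : H10 n) : ∫ t, ‖H10.vel x t‖ ∂unitMeasure ≤ ‖x‖ := by
  have := integral_mul_le_sqrt (H10.memLp_norm_vel x) (memLp_const (1 : ℝ))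
  simpa [(H10.integral_norm_vel_sq x)] using this

theorem H10.vel_add (x y : H10 n) :
    ∀ᵐ t ∂unitMeasure, H10.vel (x + y) t = H10.vel x t + H10.vel y t :=
  Lp.coeFn_add (x : LTwo n) (y : LTwo n)

theorem H10.vel_sub (x y : H10 n) :
    ∀ᵐ t ∂unitMeasure, H10.vel (x - y) t = H10.vel x t - H10.vel y t :=
  Lp.coeFn_sub (x : LTwo n) (y : LTwo n)

theorem H10.vel_smul (r : ℝ) (x : H10 n) :
    ∀ᵐ t ∂unitMeasure, H10.vel (r • x) t = r • H10.vel x t :=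
  Lp.coeFn_smul r (x : LTwo n)

theorem H10.vel_zero : ∀ᵐ t ∂unitMeasure, H10.vel (0 : H10 n) t = 0 :=
  Lp.coeFn_zero _ _ _

theorem H10.curve_eq (x : H10 n) {t : ℝ} (ht : t ∈ Icc (0 : ℝ) 1) :
    H10.curve x t = ∫ s in Icc 0 t, H10.vel x s ∂unitMeasure := by
  rw [H10.curve, intervalIntegral.integral_of_le ht.1, ← integral_Icc_eq_integral_Ioc,
    Measure.restrict_restrict measurableSet_Icc, Icc_inter_Icc]
  simp [ht.2]

theorem H10.curve_add (x y : H10 n) {t : ℝ} (ht : t ∈ Icc (0 : ℝ) 1) :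
    H10.curve (x + y) t = H10.curve x t + H10.curve y t := by
  rw [curve_eq _ ht, curve_eq _ ht, curve_eq _ ht,
    integral_congr_ae (ae_restrict_of_ae (H10.vel_add x y)),
    integral_add (H10.integrable_vel x).integrableOn (H10.integrable_vel y).integrableOn]

theorem H10.curve_smul (r : ℝ) (x : H10 n) {t : ℝ} (ht : t ∈ Icc (0 : ℝ) 1) :
    H10.curve (r • x) t = r • H10.curve x t := by
  rw [curve_eq _ ht, curve_eq _ ht,
    integral_congr_ae (ae_restrict_of_ae (H10.vel_smul r x)), integral_smul]

theorem H10.curve_sub (x y : H10 n) {t : ℝ} (ht : t ∈ Icc (0 : ℝ) 1) :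
    H10.curve (x - y) t = H10.curve x t - H10.curve y t := by
  rw [curve_eq _ ht, curve_eq _ ht, curve_eq _ ht,
    integral_congr_ae (ae_restrict_of_ae (H10.vel_sub x y)),
    integral_sub (H10.integrable_vel x).integrableOn (H10.integrable_vel y).integrableOn]

/-- Cauchy–Schwarz on an interval of length one gives this Sobolev inequality with constant 1. It
lets an H¹ ball of radius ρ serve as a set of curves inside the Euclidean ball of radius ρ. -/
theorem H10.norm_curve_le (x : H10 n) {t : ℝ} (ht : t ∈ Icc (0 : ℝ) 1) :
    ‖H10.curve x t‖ ≤ ‖x‖ := by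
  rw [curve_eq _ ht]
  refine (norm_integral_le_integral_norm _).trans (le_trans ?_ (H10.integral_norm_vel_le x))
  exact setIntegral_le_integral (H10.integrable_vel x).norm (ae_of_all _ fun _ => norm_nonneg _)

theorem H10.continuousOn_curve (x : H10 n) : ContinuousOn (H10.curve x) (Icc 0 1) := by
  have := intervalIntegral.continuousOn_primitive_interval' ((H10.intervalIntegrable_vel x))
    (a := 0) (by simp)
  rwa [uIcc_of_le zero_le_one] at this

theorem H10.aestronglyMeasurable_vel (x : H10 n) :
    AEStronglyMeasurable (H10.vel x) unitMeasure := (H10.memLp_vel x).1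

theorem H10.aestronglyMeasurable_curve (x : H10 n) :
    AEStronglyMeasurable (H10.curve x) unitMeasure :=
  (H10.continuousOn_curve x).aestronglyMeasurable measurableSet_Icc

theorem H10.memLp_curve (x : H10 n) : MemLp (H10.curve x) 2 unitMeasure :=
  MemLp.of_bound (H10.aestronglyMeasurable_curve x) ‖x‖
    (ae_unitMeasure_mem.mono fun _ ht => (H10.norm_curve_le x) ht)

/-- Evaluation of curves at a time in `[0,1]`. -/
def H10.evalCLM (t : ℝ) (ht : t ∈ Icc (0 : ℝ) 1) : H10 n →L[ℝ] Euc n :=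
  LinearMap.mkContinuous
    { toFun := fun x => H10.curve x t
      map_add' := fun x y => H10.curve_add x y ht
      map_smul' := fun r x => H10.curve_smul r x ht } 1
    fun x => by simpa using (H10.norm_curve_le x) ht

/-- Bounded sequences in a separable Hilbert space have weakly convergent subsequences. -/
theorem exists_subseq_weakly_tendsto {H : Type*} [NormedAddCommGroup H] [InnerProductSpace ℝ H]
    [CompleteSpace H] [TopologicalSpace.SeparableSpace H] {R : ℝ} (u : ℕ → H)
    (hu : ∀ k, ‖u k‖ ≤ R) :
    ∃ (v : H) (φ : ℕ → ℕ), StrictMono φ ∧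
      ∀ f : H →L[ℝ] ℝ, Tendsto (fun k => f (u (φ k))) atTop (𝓝 (f v)) := by
  let T : H → WeakDual ℝ H := fun x => StrongDual.toWeakDual (InnerProductSpace.toDual ℝ H x)
  have hT : ∀ x y, T x y = inner ℝ x y := fun x y => by
    simp [T]
  have hs := WeakDual.isSeqCompact_closedBall ℝ H (0 : StrongDual ℝ H) R
  obtain ⟨a, -, φ, hφ, hlim⟩ := hs (x := fun k => T (u k)) (fun k => by
    simpa [T] using hu k)
  refine ⟨(InnerProductSpace.toDual ℝ H).symm (WeakDual.toStrongDual a), φ, hφ, fun f => ?_⟩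
  have h1 := ((WeakDual.eval_continuous ((InnerProductSpace.toDual ℝ H).symm f)).tendsto a).comp hlim
  have h2 : ∀ x, f x = inner ℝ x ((InnerProductSpace.toDual ℝ H).symm f) := fun x => by
    rw [real_inner_comm]; simp
  simp only [h2]
  simp only [Function.comp_def, hT] at h1
  convert! h1 using 2
  simp

theorem Euc.inner_eq_sum (v w : Euc n) : inner ℝ v w = ∑ i, v i * w i := by
  simp [PiLp.inner_apply, mul_comm]

/-- Integration by parts for primitives. -/
theorem integral_inner_primitive (Q v : ℝ → Euc n) (hQ : Integrable Q unitMeasure)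
    (hv : Integrable v unitMeasure) (hv1 : ∫ t, v t ∂unitMeasure = 0) :
    ∫ t, inner ℝ (Q t) (∫ s in (0 : ℝ)..t, v s) ∂unitMeasure =
      -∫ t, inner ℝ (∫ s in (0 : ℝ)..t, Q s) (v t) ∂unitMeasure := by
  have toInt : ∀ {f : ℝ → Euc n}, Integrable f unitMeasure → IntervalIntegrable f volume 0 1 :=
    fun h => (intervalIntegrable_iff_integrableOn_Icc_of_le zero_le_one).2 h
  have comp : ∀ {f : ℝ → Euc n} (i : Fin n), Integrable f unitMeasure →
      IntervalIntegrable (fun t => f t i) volume 0 1 := fun i h =>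
    (intervalIntegrable_iff_integrableOn_Icc_of_le zero_le_one).2
      ((EuclideanSpace.proj i : Euc n →L[ℝ] ℝ).integrable_comp h)
  have prim : ∀ {f : ℝ → Euc n} (i : Fin n), Integrable f unitMeasure → ∀ t ∈ Icc (0 : ℝ) 1,
      (∫ s in (0 : ℝ)..t, f s) i = ∫ s in (0 : ℝ)..t, f s i := by
    intro f i h t ht
    have h' : IntervalIntegrable f volume 0 t :=
      (toInt h).mono_set (by rw [uIcc_of_le ht.1, uIcc_of_le zero_le_one]; exact Icc_subset_Icc_right ht.2)
    exact ((EuclideanSpace.proj i : Euc n →L[ℝ] ℝ).intervalIntegral_comp_comm h').symm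
  -- Componentwise, for scalar absolutely continuous primitives. The boundary terms vanish: at 0
  -- both primitives are zero, at 1 the primitive of `v` is zero by `hv1`.
  have main : ∀ i, ∫ t in (0 : ℝ)..1, Q t i * (∫ s in (0 : ℝ)..t, v s i) =
      -∫ t in (0 : ℝ)..1, (∫ s in (0 : ℝ)..t, Q s i) * v t i := by
    intro i
    have aQ := (comp i hQ).absolutelyContinuousOnInterval_intervalIntegral (c := 0) (by simp)
    have av := (comp i hv).absolutelyContinuousOnInterval_intervalIntegral (c := 0) (by simp)
    have h := aQ.integral_mul_deriv_eq_deriv_mul av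
    have e1 : ∫ s in (0 : ℝ)..1, v s i = 0 := by
      rw [← prim i hv 1 (by simp), intervalIntegral_eq_unitMeasure, hv1]; rfl
    have e2 : ∫ t in (0 : ℝ)..1, (∫ s in (0 : ℝ)..t, Q s i) * deriv (fun t => ∫ s in (0 : ℝ)..t, v s i) t
        = ∫ t in (0 : ℝ)..1, (∫ s in (0 : ℝ)..t, Q s i) * v t i := by
      apply intervalIntegral.integral_congr_ae
      filter_upwards [(comp i hv).ae_hasDerivAt_integral] with t ht hmem
      rw [(ht (uIoc_subset_uIcc hmem) 0 (by simp)).deriv]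
    have e3 : ∫ t in (0 : ℝ)..1, deriv (fun t => ∫ s in (0 : ℝ)..t, Q s i) t * (∫ s in (0 : ℝ)..t, v s i)
        = ∫ t in (0 : ℝ)..1, Q t i * (∫ s in (0 : ℝ)..t, v s i) := by
      apply intervalIntegral.integral_congr_ae
      filter_upwards [(comp i hQ).ae_hasDerivAt_integral] with t ht hmem
      rw [(ht (uIoc_subset_uIcc hmem) 0 (by simp)).deriv]
    rw [e2, e3, e1] at h
    simp only [intervalIntegral.integral_same] at h
    linarith
  have i1 : ∀ i, Integrable (fun t => Q t i * ∫ s in (0 : ℝ)..t, v s i) unitMeasure := fun i => by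
    have av := (comp i hv).absolutelyContinuousOnInterval_intervalIntegral (c := 0) (by simp)
    exact (intervalIntegrable_iff_integrableOn_Icc_of_le zero_le_one).1
      ((comp i hQ).mul_continuousOn av.continuousOn)
  have i2 : ∀ i, Integrable (fun t => (∫ s in (0 : ℝ)..t, Q s i) * v t i) unitMeasure := fun i => by
    have aQ := (comp i hQ).absolutelyContinuousOnInterval_intervalIntegral (c := 0) (by simp)
    exact (intervalIntegrable_iff_integrableOn_Icc_of_le zero_le_one).1
      ((comp i hv).continuousOn_mul aQ.continuousOn)
  have e1 : ∫ t, inner ℝ (Q t) (∫ s in (0 : ℝ)..t, v s) ∂unitMeasure =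
      ∫ t, ∑ i, Q t i * (∫ s in (0 : ℝ)..t, v s i) ∂unitMeasure := by
    apply integral_congr_ae
    filter_upwards [ae_unitMeasure_mem] with t ht
    rw [Euc.inner_eq_sum]
    exact Finset.sum_congr rfl fun i _ => by rw [prim i hv t ht]
  have e2 : ∫ t, inner ℝ (∫ s in (0 : ℝ)..t, Q s) (v t) ∂unitMeasure =
      ∫ t, ∑ i, (∫ s in (0 : ℝ)..t, Q s i) * v t i ∂unitMeasure := by
    apply integral_congr_ae
    filter_upwards [ae_unitMeasure_mem] with t ht
    rw [Euc.inner_eq_sum]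
    exact Finset.sum_congr rfl fun i _ => by rw [prim i hQ t ht]
  rw [e1, e2, integral_finsetSum _ fun i _ => i1 i, integral_finsetSum _ fun i _ => i2 i,
    ← Finset.sum_neg_distrib]
  refine Finset.sum_congr rfl fun i _ => ?_
  have := main i
  rwa [intervalIntegral_eq_unitMeasure, intervalIntegral_eq_unitMeasure] at this

end Hilbert

end

noncomputable section

/-! ## One-jets of curves and integral bilinear forms -/

section Jets

variable {n : ℕ}

/-- The pair `(x(t), ẋ(t))`. -/
def H10.jet (x : H10 n) (t : ℝ) : Euc n × Euc n := (H10.curve x t, H10.vel x t)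

theorem H10.jet_add (x y : H10 n) :
    ∀ᵐ t ∂unitMeasure, H10.jet (x + y) t = H10.jet x t + H10.jet y t := by
  filter_upwards [H10.vel_add x y, ae_unitMeasure_mem] with t h ht
  simp [H10.jet, h, H10.curve_add x y ht]

theorem H10.jet_sub (x y : H10 n) :
    ∀ᵐ t ∂unitMeasure, H10.jet (x - y) t = H10.jet x t - H10.jet y t := by
  filter_upwards [H10.vel_sub x y, ae_unitMeasure_mem] with t h ht
  simp [H10.jet, h, H10.curve_sub x y ht]

theorem H10.jet_smul (r : ℝ) (x : H10 n) :
    ∀ᵐ t ∂unitMeasure, H10.jet (r • x) t = r • H10.jet x t := by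
  filter_upwards [H10.vel_smul r x, ae_unitMeasure_mem] with t h ht
  simp [H10.jet, h, H10.curve_smul r x ht]

theorem H10.aestronglyMeasurable_jet (x : H10 n) :
    AEStronglyMeasurable (H10.jet x) unitMeasure :=
  (H10.aestronglyMeasurable_curve x).prodMk (H10.aestronglyMeasurable_vel x)

theorem H10.norm_jet_sq_le (x : H10 n) {t : ℝ} (ht : t ∈ Icc (0 : ℝ) 1) :
    ‖H10.jet x t‖ ^ 2 ≤ ‖x‖ ^ 2 + ‖H10.vel x t‖ ^ 2 := by
  have h1 := H10.norm_curve_le x ht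
  rw [H10.jet, Prod.norm_mk]
  rcases max_choice ‖H10.curve x t‖ ‖H10.vel x t‖ with h | h <;> rw [h]
  · nlinarith [norm_nonneg (H10.curve x t), sq_nonneg ‖H10.vel x t‖]
  · nlinarith [sq_nonneg ‖x‖]

theorem H10.norm_vel_le_jet (x : H10 n) (t : ℝ) : ‖H10.vel x t‖ ≤ ‖H10.jet x t‖ :=
  norm_snd_le (H10.jet x t)

theorem H10.memLp_jet (x : H10 n) : MemLp (H10.jet x) 2 unitMeasure := by
  rw [memLp_two_iff_integrable_sq_norm (H10.aestronglyMeasurable_jet x)]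
  refine ((integrable_const (‖x‖ ^ 2)).add (H10.integrable_norm_vel_sq x)).mono'
    ((H10.aestronglyMeasurable_jet x).norm.pow 2) ?_
  filter_upwards [ae_unitMeasure_mem] with t ht
  rw [Real.norm_of_nonneg (by positivity)]
  exact H10.norm_jet_sq_le x ht

theorem H10.memLp_norm_jet (x : H10 n) : MemLp (fun t => ‖H10.jet x t‖) 2 unitMeasure :=
  (H10.memLp_jet x).norm

theorem H10.memLp_norm_curve (x : H10 n) : MemLp (fun t => ‖H10.curve x t‖) 2 unitMeasure :=
  (H10.memLp_curve x).norm

theorem H10.integral_norm_jet_sq_le (x : H10 n) :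
    ∫ t, ‖H10.jet x t‖ ^ 2 ∂unitMeasure ≤ 2 * ‖x‖ ^ 2 := by
  have h : ∫ t, ‖H10.jet x t‖ ^ 2 ∂unitMeasure ≤
      ∫ t, (‖x‖ ^ 2 + ‖H10.vel x t‖ ^ 2) ∂unitMeasure := by
    refine integral_mono_ae (H10.memLp_norm_jet x).integrable_sq
      ((integrable_const _).add (H10.integrable_norm_vel_sq x)) ?_
    filter_upwards [ae_unitMeasure_mem] with t ht
    exact H10.norm_jet_sq_le x ht
  rw [integral_add (integrable_const _) (H10.integrable_norm_vel_sq x),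
    H10.integral_norm_vel_sq] at h
  rw [integral_const, probReal_univ, one_smul] at h
  linarith

theorem H10.sqrt_integral_norm_jet_sq_le (x : H10 n) :
    √(∫ t, ‖H10.jet x t‖ ^ 2 ∂unitMeasure) ≤ 2 * ‖x‖ := by
  rw [Real.sqrt_le_left (by positivity)]
  nlinarith [H10.integral_norm_jet_sq_le x, sq_nonneg ‖x‖]

/-- Cauchy-Schwarz against the one-jet of a curve. -/
theorem H10.integral_mul_norm_jet_le {f : ℝ → ℝ} (hf : MemLp f 2 unitMeasure) (x : H10 n) :
    ∫ t, f t * ‖H10.jet x t‖ ∂unitMeasure ≤ √(∫ t, f t ^ 2 ∂unitMeasure) * (2 * ‖x‖) :=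
  (integral_mul_le_sqrt hf (H10.memLp_norm_jet x)).trans
    (mul_le_mul_of_nonneg_left (H10.sqrt_integral_norm_jet_sq_le x) (Real.sqrt_nonneg _))

/-- A field of bilinear forms that is continuous on `[0,1]`. -/
abbrev FormField (n : ℕ) : Type := ℝ → (Euc n × Euc n) →L[ℝ] (Euc n × Euc n) →L[ℝ] ℝ

theorem FormField.exists_bound {β : FormField n} (hβ : ContinuousOn β (Icc 0 1)) :
    ∃ M, 0 ≤ M ∧ ∀ t ∈ Icc (0 : ℝ) 1, ‖β t‖ ≤ M := by
  obtain ⟨M, hM⟩ := isCompact_Icc.exists_bound_of_continuousOn (f := β) hβ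
  exact ⟨M, (norm_nonneg _).trans (hM 0 (by simp)), hM⟩

theorem FormField.aestronglyMeasurable {β : FormField n} (hβ : ContinuousOn β (Icc 0 1))
    {u v : ℝ → Euc n × Euc n} (hu : AEStronglyMeasurable u unitMeasure)
    (hv : AEStronglyMeasurable v unitMeasure) :
    AEStronglyMeasurable (fun t => β t (u t) (v t)) unitMeasure := by
  have hb : AEStronglyMeasurable β unitMeasure := hβ.aestronglyMeasurable measurableSet_Icc
  have h1 : AEStronglyMeasurable (fun t => β t (u t)) unitMeasure :=
    (isBoundedBilinearMap_apply (𝕜 := ℝ)).continuous.comp_aestronglyMeasurable (hb.prodMk hu)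
  exact (isBoundedBilinearMap_apply (𝕜 := ℝ)).continuous.comp_aestronglyMeasurable (h1.prodMk hv)

theorem FormField.integrable {β : FormField n} (hβ : ContinuousOn β (Icc 0 1))
    {u v : ℝ → Euc n × Euc n} (hu : MemLp u 2 unitMeasure) (hv : MemLp v 2 unitMeasure) :
    Integrable (fun t => β t (u t) (v t)) unitMeasure := by
  obtain ⟨M, hM0, hM⟩ := FormField.exists_bound hβ
  refine ((hu.norm.integrable_mul hv.norm).const_mul M).mono'
    (FormField.aestronglyMeasurable hβ hu.1 hv.1) ?_
  filter_upwards [ae_unitMeasure_mem] with t ht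
  calc ‖β t (u t) (v t)‖ ≤ ‖β t‖ * ‖u t‖ * ‖v t‖ := (β t).le_opNorm₂ _ _
    _ ≤ M * ‖u t‖ * ‖v t‖ := by gcongr; exact hM t ht
    _ = _ := by simp [mul_assoc]

theorem FormField.exists_bound_integral {β : FormField n} (hβ : ContinuousOn β (Icc 0 1)) :
    ∃ M, 0 ≤ M ∧ ∀ ξ η : H10 n,
      ‖(1 / 2) * ∫ t, β t (H10.jet ξ t) (H10.jet η t) ∂unitMeasure‖ ≤ M * ‖ξ‖ * ‖η‖ := by
  obtain ⟨M, hM0, hM⟩ := FormField.exists_bound hβ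
  refine ⟨2 * M, by positivity, fun ξ η => ?_⟩
  have hi := (H10.memLp_norm_jet ξ).integrable_mul (H10.memLp_norm_jet η)
  have h1 : ‖∫ t, β t (H10.jet ξ t) (H10.jet η t) ∂unitMeasure‖ ≤
      ∫ t, M * (‖H10.jet ξ t‖ * ‖H10.jet η t‖) ∂unitMeasure := by
    refine norm_integral_le_of_norm_le (hi.const_mul M) ?_
    filter_upwards [ae_unitMeasure_mem] with t ht
    calc ‖β t (H10.jet ξ t) (H10.jet η t)‖ ≤ ‖β t‖ * ‖H10.jet ξ t‖ * ‖H10.jet η t‖ :=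
          (β t).le_opNorm₂ _ _
      _ ≤ M * ‖H10.jet ξ t‖ * ‖H10.jet η t‖ := by gcongr; exact hM t ht
      _ = _ := by ring
  rw [integral_const_mul] at h1
  have h2 := (H10.integral_mul_norm_jet_le (H10.memLp_norm_jet ξ) η).trans
    (mul_le_mul_of_nonneg_right (H10.sqrt_integral_norm_jet_sq_le ξ) (by positivity))
  rw [norm_mul, Real.norm_of_nonneg (by norm_num : (0 : ℝ) ≤ 1 / 2)]
  have h3 := h1.trans (mul_le_mul_of_nonneg_left h2 hM0)
  nlinarith [h3]

/-- The bilinear form `½ ∫ β(t)[(ξ,ξ̇),(η,η̇)] dt` on `H¹₀`, for `β` continuous on `[0,1]`. -/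
def integralForm (β : FormField n) (hβ : ContinuousOn β (Icc 0 1)) :
    H10 n →L[ℝ] H10 n →L[ℝ] ℝ :=
  LinearMap.mkContinuous₂
    (LinearMap.mk₂ ℝ
      (fun ξ η : H10 n => (1 / 2) * ∫ t, β t (H10.jet ξ t) (H10.jet η t) ∂unitMeasure)
      (fun ξ ξ' η => by
        rw [← mul_add, ← integral_add (FormField.integrable hβ (H10.memLp_jet ξ) (H10.memLp_jet η))
          (FormField.integrable hβ (H10.memLp_jet ξ') (H10.memLp_jet η))]
        congr 1
        refine integral_congr_ae ?_
        filter_upwards [H10.jet_add ξ ξ'] with t h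
        simp [h])
      (fun r ξ η => by
        rw [smul_eq_mul, mul_left_comm, ← integral_const_mul (μ := unitMeasure) r]
        congr 1
        refine integral_congr_ae ?_
        filter_upwards [H10.jet_smul r ξ] with t h
        simp [h])
      (fun ξ η η' => by
        rw [← mul_add, ← integral_add (FormField.integrable hβ (H10.memLp_jet ξ) (H10.memLp_jet η))
          (FormField.integrable hβ (H10.memLp_jet ξ) (H10.memLp_jet η'))]
        congr 1
        refine integral_congr_ae ?_
        filter_upwards [H10.jet_add η η'] with t h
        simp [h])
      (fun r ξ η => by
        rw [smul_eq_mul, mul_left_comm, ← integral_const_mul (μ := unitMeasure) r]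
        congr 1
        refine integral_congr_ae ?_
        filter_upwards [H10.jet_smul r η] with t h
        simp [h]))
    (FormField.exists_bound_integral hβ).choose
    (FormField.exists_bound_integral hβ).choose_spec.2

theorem integralForm_apply {β : FormField n} (hβ : ContinuousOn β (Icc 0 1)) (ξ η : H10 n) :
    integralForm β hβ ξ η =
      (1 / 2) * ∫ t, β t (H10.jet ξ t) (H10.jet η t) ∂unitMeasure := rfl

theorem integralForm_bound {β : FormField n} (hβ : ContinuousOn β (Icc 0 1)) :
    ∃ M, 0 ≤ M ∧ ∀ ξ η : H10 n, |integralForm β hβ ξ η| ≤ M * ‖ξ‖ * ‖η‖ :=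
  FormField.exists_bound_integral hβ

/-- A weakly null bounded sequence in `H¹₀` is strongly null in `L²`. -/
theorem H10.tendsto_integral_norm_curve_sq {w : ℕ → H10 n} {R : ℝ} (hR : ∀ k, ‖w k‖ ≤ R)
    (hw : ∀ f : H10 n →L[ℝ] ℝ, Tendsto (fun k => f (w k)) atTop (𝓝 0)) :
    Tendsto (fun k => ∫ t, ‖H10.curve (w k) t‖ ^ 2 ∂unitMeasure) atTop (𝓝 0) := by
  have h0 : (0 : ℝ) = ∫ _t : ℝ, (0 : ℝ) ∂unitMeasure := by simp
  rw [h0]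
  -- Evaluation at a time is a bounded functional, so weak convergence gives pointwise convergence
  -- of the curves, while the norm bound dominates them.
  refine tendsto_integral_of_dominated_convergence (fun _ => R ^ 2)
    (fun k => (H10.aestronglyMeasurable_curve (w k)).norm.pow 2) (integrable_const _)
    (fun k => ?_) ?_
  · filter_upwards [ae_unitMeasure_mem] with t ht
    rw [Real.norm_of_nonneg (by positivity)]
    exact pow_le_pow_left₀ (norm_nonneg _) ((H10.norm_curve_le _ ht).trans (hR k)) 2
  · filter_upwards [ae_unitMeasure_mem] with t ht
    have h1 : Tendsto (fun k => H10.curve (w k) t) atTop (𝓝 0) := by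
      have h2 : Tendsto (fun k => WithLp.ofLp (H10.curve (w k) t)) atTop (𝓝 0) := by
        rw [tendsto_pi_nhds]
        intro i
        exact hw ((EuclideanSpace.proj i : Euc n →L[ℝ] ℝ).comp (H10.evalCLM t ht))
      exact ((PiLp.continuous_toLp 2 (fun _ : Fin n => ℝ)).tendsto 0).comp h2
    simpa using (h1.norm.pow 2)

/-- Cauchy–Schwarz and the strong L² convergence of weakly null curves. Every error term with a
position factor is disposed of in this way; the other factor need only be bounded in L². -/
theorem H10.tendsto_integral_mul_norm_curve {w : ℕ → H10 n} {R : ℝ} (hR : ∀ k, ‖w k‖ ≤ R)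
    (hw : ∀ f : H10 n →L[ℝ] ℝ, Tendsto (fun k => f (w k)) atTop (𝓝 0))
    {f : ℕ → ℝ → ℝ} {R' : ℝ} (hf : ∀ k, MemLp (f k) 2 unitMeasure) (hf0 : ∀ k t, 0 ≤ f k t)
    (hf' : ∀ k, ∫ t, f k t ^ 2 ∂unitMeasure ≤ R') :
    Tendsto (fun k => ∫ t, f k t * ‖H10.curve (w k) t‖ ∂unitMeasure) atTop (𝓝 0) := by
  have h1 := (H10.tendsto_integral_norm_curve_sq hR hw).sqrt.const_mul (√R')
  rw [Real.sqrt_zero, mul_zero] at h1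
  refine squeeze_zero (fun k => integral_nonneg fun t => mul_nonneg (hf0 k t) (norm_nonneg _))
    (fun k => ?_) h1
  refine (integral_mul_le_sqrt (hf k) (H10.memLp_norm_curve (w k))).trans ?_
  exact mul_le_mul_of_nonneg_right (Real.sqrt_le_sqrt (hf' k)) (Real.sqrt_nonneg _)

/-- Operators on a separable Hilbert space that map weakly null bounded sequences to null
sequences are compact. -/
theorem isCompactOperator_of_weakly_null {H : Type*} [NormedAddCommGroup H]
    [InnerProductSpace ℝ H] [CompleteSpace H] [TopologicalSpace.SeparableSpace H]
    (K : H →L[ℝ] H)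
    (hK : ∀ (w : ℕ → H) (R : ℝ), (∀ k, ‖w k‖ ≤ R) →
      (∀ f : H →L[ℝ] ℝ, Tendsto (fun k => f (w k)) atTop (𝓝 0)) →
      Tendsto (fun k => K (w k)) atTop (𝓝 0)) : IsCompactOperator K := by
  refine (isCompactOperator_iff_isCompact_closure_image_closedBall (K : H →ₗ[ℝ] H) one_pos).2 ?_
  have hseq : ∀ y : ℕ → H, (∀ k, y k ∈ K '' Metric.closedBall 0 1) →
      ∃ a, ∃ φ : ℕ → ℕ, StrictMono φ ∧ Tendsto (y ∘ φ) atTop (𝓝 a) := by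
    intro y hy
    choose u hu huy using hy
    have hu1 : ∀ k, ‖u k‖ ≤ 1 := fun k => by simpa using hu k
    obtain ⟨v, φ, hφ, hv⟩ := exists_subseq_weakly_tendsto u hu1
    refine ⟨K v, φ, hφ, ?_⟩
    -- Subtracting the weak limit produces a weakly null sequence, so `K (u (φ k))` converges in
    -- norm to `K v`.
    have h := hK (fun k => u (φ k) - v) (1 + ‖v‖)
      (fun k => (norm_sub_le _ _).trans (by linarith [hu1 (φ k)]))
      (fun f => by simpa using (hv f).sub_const (f v))
    have h2 := h.add_const (K v)
    simp only [map_sub, sub_add_cancel, zero_add] at h2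
    exact h2.congr fun k => huy (φ k)
  -- A sequence in the closure is replaced by one in the image at distance at most 1/(k+1); the two
  -- have the same subsequential limits.
  refine IsSeqCompact.isCompact ?_
  intro y hy
  have hz : ∀ k : ℕ, ∃ z ∈ K '' Metric.closedBall 0 1, dist (y k) z < 1 / (k + 1 : ℝ) :=
    fun k => Metric.mem_closure_iff.1 (hy k) _ (by positivity)
  choose z hz hzd using hz
  obtain ⟨a, φ, hφ, ha⟩ := hseq z hz
  have hlim : Tendsto (y ∘ φ) atTop (𝓝 a) := by
    refine ha.congr_dist ?_
    refine squeeze_zero (fun _ => dist_nonneg) (fun k => ?_)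
      (tendsto_one_div_add_atTop_nhds_zero_nat.comp hφ.tendsto_atTop)
    simp only [Function.comp_apply]
    rw [dist_comm]
    exact (hzd (φ k)).le
  exact ⟨a, isClosed_closure.mem_of_tendsto hlim (Eventually.of_forall fun k => hy _), φ, hφ, hlim⟩

end Jets

end

noncomputable section

/-! ## Tame Lagrangians and the differential of the action -/

section Tame

variable {n : ℕ}

/-- The differential of `L(t,·,·)` at `z = (q,y)`. -/
def phaseDeriv (L : ℝ → Euc n → Euc n → ℝ) (t : ℝ) (z : Euc n × Euc n) :
    (Euc n × Euc n) →L[ℝ] ℝ :=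
  fderiv ℝ (fun z : Euc n × Euc n => L t z.1 z.2) z

/-- The set `[0,1] × B(0,ρ) × ℝⁿ`. -/
def tameDomain (n : ℕ) (ρ : ℝ) : Set (ℝ × (Euc n × Euc n)) :=
  Icc 0 1 ×ˢ (Metric.ball 0 ρ ×ˢ univ)

/-- A Lagrangian on `[0,1] × B(0,ρ) × ℝⁿ` which is `C¹` in `(q,y)` with derivatives of controlled
growth and modulus of continuity, fiberwise uniformly convex, twice differentiable at the zero
section of times, and of which the curve `0` is an extremal. -/
structure TameLagrangian (L : ℝ → Euc n → Euc n → ℝ) (ρ c C : ℝ) : Prop where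
  radius_pos : 0 < ρ
  radius_le : ρ ≤ 1
  convexity_pos : 0 < c
  bound_nonneg : 0 ≤ C
  differentiableAt : ∀ t ∈ Icc (0 : ℝ) 1, ∀ q ∈ Metric.ball (0 : Euc n) ρ, ∀ y,
    DifferentiableAt ℝ (fun z : Euc n × Euc n => L t z.1 z.2) (q, y)
  continuousOn : ContinuousOn (fun p : ℝ × (Euc n × Euc n) => L p.1 p.2.1 p.2.2) (tameDomain n ρ)
  continuousOn_deriv : ContinuousOn (fun p : ℝ × (Euc n × Euc n) => phaseDeriv L p.1 p.2)
    (tameDomain n ρ)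
  lipschitz_snd : ∀ t ∈ Icc (0 : ℝ) 1, ∀ q ∈ Metric.ball (0 : Euc n) ρ,
    ∀ q' ∈ Metric.ball (0 : Euc n) ρ, ∀ y y' w,
    |phaseDeriv L t (q, y) (0, w) - phaseDeriv L t (q', y') (0, w)| ≤
      C * (‖q - q'‖ * (1 + ‖y‖ + ‖y'‖) + ‖y - y'‖) * ‖w‖
  lipschitz_fst : ∀ t ∈ Icc (0 : ℝ) 1, ∀ q ∈ Metric.ball (0 : Euc n) ρ,
    ∀ q' ∈ Metric.ball (0 : Euc n) ρ, ∀ y y' w,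
    |phaseDeriv L t (q, y) (w, 0) - phaseDeriv L t (q', y') (w, 0)| ≤
      C * (‖q - q'‖ * (1 + ‖y‖ + ‖y'‖) ^ 2 + ‖y - y'‖ * (1 + ‖y‖ + ‖y'‖)) * ‖w‖
  monotone_snd : ∀ t ∈ Icc (0 : ℝ) 1, ∀ q ∈ Metric.ball (0 : Euc n) ρ, ∀ y y',
    c * ‖y - y'‖ ^ 2 ≤
      phaseDeriv L t (q, y) (0, y - y') - phaseDeriv L t (q, y') (0, y - y')
  differentiableAt_deriv : ∀ t ∈ Icc (0 : ℝ) 1, DifferentiableAt ℝ (phaseDeriv L t) (0, 0)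
  continuousOn_hess : ContinuousOn (hessAtZero L) (Icc 0 1)
  eulerLagrange : ∀ t ∈ Icc (0 : ℝ) 1, ∀ w,
    HasDerivWithinAt (fun s => phaseDeriv L s (0, 0) (0, w)) (phaseDeriv L t (0, 0) (w, 0))
      (Icc 0 1) t

theorem measurableSet_tameDomain (ρ : ℝ) : MeasurableSet (tameDomain n ρ) :=
  measurableSet_Icc.prod (Metric.isOpen_ball.measurableSet.prod MeasurableSet.univ)

/-- The law of `t ↦ (t, q t, y t)` is concentrated on the tame domain, so continuity of `f` there is
enough, whatever its values elsewhere. -/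
theorem aestronglyMeasurable_of_continuousOn_tameDomain {V : Type*} [TopologicalSpace V]
    [TopologicalSpace.PseudoMetrizableSpace V] {ρ : ℝ} {f : ℝ × (Euc n × Euc n) → V}
    (hf : ContinuousOn f (tameDomain n ρ)) {q y : ℝ → Euc n}
    (hq : AEStronglyMeasurable q unitMeasure) (hy : AEStronglyMeasurable y unitMeasure)
    (hqρ : ∀ t ∈ Icc (0 : ℝ) 1, q t ∈ Metric.ball (0 : Euc n) ρ) :
    AEStronglyMeasurable (fun t => f (t, (q t, y t))) unitMeasure := by
  have hg : AEMeasurable (fun t : ℝ => (t, (q t, y t))) unitMeasure :=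
    aemeasurable_id.prodMk (hq.aemeasurable.prodMk hy.aemeasurable)
  have h1 : AEStronglyMeasurable f
      ((Measure.map (fun t : ℝ => (t, (q t, y t))) unitMeasure).restrict (tameDomain n ρ)) :=
    hf.aestronglyMeasurable (measurableSet_tameDomain ρ)
  have h2 : (Measure.map (fun t : ℝ => (t, (q t, y t))) unitMeasure).restrict (tameDomain n ρ) =
      Measure.map (fun t : ℝ => (t, (q t, y t))) unitMeasure := by
    refine Measure.restrict_eq_self_of_ae_mem ?_
    refine (ae_map_iff (p := fun z => z ∈ tameDomain n ρ) hg (measurableSet_tameDomain ρ)).2 ?_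
    filter_upwards [ae_unitMeasure_mem] with t ht
    exact ⟨ht, hqρ t ht, mem_univ _⟩
  rw [h2] at h1
  exact h1.comp_aemeasurable hg

theorem clm_prod_apply {V : Type*} [AddCommGroup V] [TopologicalSpace V] [Module ℝ V]
    (f : (Euc n × Euc n) →L[ℝ] V) (z : Euc n × Euc n) : f z = f (z.1, 0) + f (0, z.2) := by
  rw [← map_add]; simp

namespace TameLagrangian

variable {L : ℝ → Euc n → Euc n → ℝ} {ρ c C : ℝ}

theorem curve_mem_ball {x : H10 n} (hx : ‖x‖ < ρ) {t : ℝ} (ht : t ∈ Icc (0 : ℝ) 1) :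
    H10.curve x t ∈ Metric.ball (0 : Euc n) ρ := by
  simpa using (H10.norm_curve_le x ht).trans_lt hx

theorem exists_bound_deriv_zero (T : TameLagrangian L ρ c C) :
    ∃ B, 0 ≤ B ∧ ∀ t ∈ Icc (0 : ℝ) 1, ‖phaseDeriv L t (0, 0)‖ ≤ B := by
  have h : ContinuousOn (fun t : ℝ => phaseDeriv L t (0, 0)) (Icc 0 1) :=
    T.continuousOn_deriv.comp (f := fun t : ℝ => (t, ((0 : Euc n), (0 : Euc n))))
      (by fun_prop) fun t ht => ⟨ht, by simpa using T.radius_pos, mem_univ _⟩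
  obtain ⟨B, hB⟩ := isCompact_Icc.exists_bound_of_continuousOn h
  exact ⟨B, (norm_nonneg _).trans (hB 0 (by simp)), hB⟩

/-- Since `ρ ≤ 1`, the mixed product ‖q‖‖y‖ of the Lipschitz bound is absorbed by ‖y‖. The position
derivative is treated likewise, at the price of a quadratic term in ‖y‖. -/
theorem abs_deriv_sub_zero_snd (T : TameLagrangian L ρ c C) {t : ℝ} (ht : t ∈ Icc (0 : ℝ) 1)
    {q : Euc n} (hq : q ∈ Metric.ball (0 : Euc n) ρ) (y w : Euc n) :
    |phaseDeriv L t (q, y) (0, w) - phaseDeriv L t (0, 0) (0, w)| ≤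
      2 * C * (‖q‖ + ‖y‖) * ‖w‖ := by
  have h := T.lipschitz_snd t ht q hq 0 (by simpa using T.radius_pos) y 0 w
  simp only [sub_zero, norm_zero, add_zero] at h
  have hq1 : ‖q‖ ≤ 1 := (mem_ball_zero_iff.1 hq).le.trans T.radius_le
  refine h.trans (mul_le_mul_of_nonneg_right ?_ (norm_nonneg _))
  rw [mul_comm 2 C, mul_assoc]
  refine mul_le_mul_of_nonneg_left ?_ T.bound_nonneg
  nlinarith [norm_nonneg q, norm_nonneg y, mul_le_mul_of_nonneg_right hq1 (norm_nonneg y)]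

theorem abs_deriv_sub_zero_fst (T : TameLagrangian L ρ c C) {t : ℝ} (ht : t ∈ Icc (0 : ℝ) 1)
    {q : Euc n} (hq : q ∈ Metric.ball (0 : Euc n) ρ) (y w : Euc n) :
    |phaseDeriv L t (q, y) (w, 0) - phaseDeriv L t (0, 0) (w, 0)| ≤
      3 * C * (‖q‖ + ‖y‖ + ‖y‖ ^ 2) * ‖w‖ := by
  have h := T.lipschitz_fst t ht q hq 0 (by simpa using T.radius_pos) y 0 w
  simp only [sub_zero, norm_zero, add_zero] at h
  have hq1 : ‖q‖ ≤ 1 := (mem_ball_zero_iff.1 hq).le.trans T.radius_le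
  refine h.trans (mul_le_mul_of_nonneg_right ?_ (norm_nonneg _))
  rw [mul_comm 3 C, mul_assoc]
  refine mul_le_mul_of_nonneg_left ?_ T.bound_nonneg
  nlinarith [norm_nonneg q, norm_nonneg y, mul_le_mul_of_nonneg_right hq1 (norm_nonneg y),
    mul_le_mul_of_nonneg_right hq1 (sq_nonneg ‖y‖)]

theorem aestronglyMeasurable_deriv (T : TameLagrangian L ρ c C) {q y : ℝ → Euc n}
    (hq : AEStronglyMeasurable q unitMeasure) (hy : AEStronglyMeasurable y unitMeasure)
    (hqρ : ∀ t ∈ Icc (0 : ℝ) 1, q t ∈ Metric.ball (0 : Euc n) ρ) :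
    AEStronglyMeasurable (fun t => phaseDeriv L t (q t, y t)) unitMeasure :=
  aestronglyMeasurable_of_continuousOn_tameDomain T.continuousOn_deriv hq hy hqρ

theorem aestronglyMeasurable_deriv_jet (T : TameLagrangian L ρ c C) {x : H10 n} (hx : ‖x‖ < ρ) :
    AEStronglyMeasurable (fun t => phaseDeriv L t (H10.jet x t)) unitMeasure :=
  T.aestronglyMeasurable_deriv (H10.aestronglyMeasurable_curve x) (H10.aestronglyMeasurable_vel x)
    fun _ ht => curve_mem_ball hx ht

/-- Comparison with the differential at (0,0). The growth is the natural one on H¹: the quadratic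
factor meets `w`, a bounded position increment, and the linear factor meets `w'`, a square
integrable velocity. -/
theorem abs_deriv_apply_le (T : TameLagrangian L ρ c C) :
    ∃ B, 0 ≤ B ∧ ∀ t ∈ Icc (0 : ℝ) 1, ∀ q ∈ Metric.ball (0 : Euc n) ρ, ∀ y w w',
      |phaseDeriv L t (q, y) (w, w')| ≤ B * ((1 + ‖y‖ ^ 2) * ‖w‖ + (1 + ‖y‖) * ‖w'‖) := by
  obtain ⟨B, hB0, hB⟩ := T.exists_bound_deriv_zero
  have hC := T.bound_nonneg
  refine ⟨B + 6 * C, by positivity, fun t ht q hq y w w' => ?_⟩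
  have h1 := T.abs_deriv_sub_zero_fst ht hq y w
  have h2 := T.abs_deriv_sub_zero_snd ht hq y w'
  have h3 : |phaseDeriv L t (0, 0) (w, 0)| ≤ B * ‖w‖ := by
    refine ((phaseDeriv L t (0, 0)).le_opNorm (w, 0)).trans ?_
    simpa using mul_le_mul_of_nonneg_right (hB t ht) (norm_nonneg w)
  have h4 : |phaseDeriv L t (0, 0) (0, w')| ≤ B * ‖w'‖ := by
    refine ((phaseDeriv L t (0, 0)).le_opNorm (0, w')).trans ?_
    simpa using mul_le_mul_of_nonneg_right (hB t ht) (norm_nonneg w')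
  have hq1 : ‖q‖ ≤ 1 := (mem_ball_zero_iff.1 hq).le.trans T.radius_le
  rw [clm_prod_apply]
  have hw := norm_nonneg w
  have hw' := norm_nonneg w'
  have hy := norm_nonneg y
  have e1 : |phaseDeriv L t (q, y) (w, 0)| ≤ (B + 6 * C) * (1 + ‖y‖ ^ 2) * ‖w‖ := by
    have := abs_sub_abs_le_abs_sub (phaseDeriv L t (q, y) (w, 0)) (phaseDeriv L t (0, 0) (w, 0))
    have h5 : |phaseDeriv L t (q, y) (w, 0)| ≤ (B + 3 * C * (‖q‖ + ‖y‖ + ‖y‖ ^ 2)) * ‖w‖ := by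
      linarith
    refine h5.trans (mul_le_mul_of_nonneg_right ?_ hw)
    nlinarith [mul_nonneg hB0 (sq_nonneg ‖y‖), mul_le_mul_of_nonneg_left hq1 hC,
      mul_nonneg hC (sq_nonneg (‖y‖ - 1))]
  have e2 : |phaseDeriv L t (q, y) (0, w')| ≤ (B + 6 * C) * (1 + ‖y‖) * ‖w'‖ := by
    have := abs_sub_abs_le_abs_sub (phaseDeriv L t (q, y) (0, w')) (phaseDeriv L t (0, 0) (0, w'))
    have h5 : |phaseDeriv L t (q, y) (0, w')| ≤ (B + 2 * C * (‖q‖ + ‖y‖)) * ‖w'‖ := by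
      linarith
    refine h5.trans (mul_le_mul_of_nonneg_right ?_ hw')
    nlinarith [mul_nonneg hB0 hy, mul_le_mul_of_nonneg_left hq1 hC, mul_nonneg hC hy]
  refine (abs_add_le _ _).trans ((add_le_add e1 e2).trans (le_of_eq (by ring)))

theorem integrable_deriv_jet (T : TameLagrangian L ρ c C) {x : H10 n} (hx : ‖x‖ < ρ) (η : H10 n) :
    Integrable (fun t => phaseDeriv L t (H10.jet x t) (H10.jet η t)) unitMeasure := by
  obtain ⟨B, hB0, hB⟩ := T.abs_deriv_apply_le
  have i1 : Integrable (fun t => (1 + ‖H10.vel x t‖ ^ 2) * ‖η‖) unitMeasure :=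
    ((integrable_const 1).add (H10.integrable_norm_vel_sq x)).mul_const _
  have i2 : Integrable (fun t => (1 + ‖H10.vel x t‖) * ‖H10.vel η t‖) unitMeasure :=
    ((memLp_const (1 : ℝ)).add (H10.memLp_norm_vel x)).integrable_mul (H10.memLp_norm_vel η)
  refine ((i1.add i2).const_mul B).mono' ?_ ?_
  · exact (isBoundedBilinearMap_apply (𝕜 := ℝ)).continuous.comp_aestronglyMeasurable
      ((T.aestronglyMeasurable_deriv_jet hx).prodMk (H10.aestronglyMeasurable_jet η))
  · filter_upwards [ae_unitMeasure_mem] with t ht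
    refine (hB t ht _ (curve_mem_ball hx ht) _ _ _).trans ?_
    have := H10.norm_curve_le η ht
    simp only [Pi.add_apply]
    gcongr

/-- The differential of the action at `x`. -/
def actionDeriv (L : ℝ → Euc n → Euc n → ℝ) (x η : H10 n) : ℝ :=
  (1 / 2) * ∫ t, phaseDeriv L t (H10.jet x t) (H10.jet η t) ∂unitMeasure

theorem exists_actionDeriv_clm (T : TameLagrangian L ρ c C) {x : H10 n} (hx : ‖x‖ < ρ) :
    ∃ D : H10 n →L[ℝ] ℝ, ∀ η, D η = actionDeriv L x η := by
  obtain ⟨B, hB0, hB⟩ := T.abs_deriv_apply_le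
  let D : H10 n →ₗ[ℝ] ℝ :=
    { toFun := actionDeriv L x
      map_add' := fun η η' => by
        rw [actionDeriv, actionDeriv, actionDeriv, ← mul_add,
          ← integral_add (T.integrable_deriv_jet hx η) (T.integrable_deriv_jet hx η')]
        congr 1
        refine integral_congr_ae ?_
        filter_upwards [H10.jet_add η η'] with t h
        rw [h, map_add]
      map_smul' := fun r η => by
        rw [actionDeriv, actionDeriv, RingHom.id_apply, smul_eq_mul, mul_left_comm,
          ← integral_const_mul (μ := unitMeasure) r]
        congr 1
        refine integral_congr_ae ?_
        filter_upwards [H10.jet_smul r η] with t h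
        rw [h, map_smul, smul_eq_mul] }
  refine ⟨D.mkContinuous (B * ((1 + ‖x‖ ^ 2) + (√(∫ t, (1 + ‖H10.vel x t‖) ^ 2 ∂unitMeasure)) * 2))
    fun η => ?_, fun η => rfl⟩
  have m1 : MemLp (fun t => 1 + ‖H10.vel x t‖) 2 unitMeasure :=
    (memLp_const (1 : ℝ)).add (H10.memLp_norm_vel x)
  have i1 : Integrable (fun t => (1 + ‖H10.vel x t‖ ^ 2) * ‖η‖) unitMeasure :=
    ((integrable_const 1).add (H10.integrable_norm_vel_sq x)).mul_const _
  have i2 : Integrable (fun t => (1 + ‖H10.vel x t‖) * ‖H10.jet η t‖) unitMeasure :=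
    m1.integrable_mul (H10.memLp_norm_jet η)
  have h1 : ‖∫ t, phaseDeriv L t (H10.jet x t) (H10.jet η t) ∂unitMeasure‖ ≤
      ∫ t, B * ((1 + ‖H10.vel x t‖ ^ 2) * ‖η‖ + (1 + ‖H10.vel x t‖) * ‖H10.jet η t‖)
        ∂unitMeasure := by
    refine norm_integral_le_of_norm_le ((i1.add i2).const_mul B) ?_
    filter_upwards [ae_unitMeasure_mem] with t ht
    refine (hB t ht _ (curve_mem_ball hx ht) _ _ _).trans ?_
    have := H10.norm_curve_le η ht
    have := H10.norm_vel_le_jet η t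
    gcongr
  rw [integral_const_mul, integral_add i1 i2, integral_mul_const,
    integral_add (integrable_const _) (H10.integrable_norm_vel_sq x), H10.integral_norm_vel_sq,
    integral_const, probReal_univ, one_smul] at h1
  have h2 := H10.integral_mul_norm_jet_le m1 η
  show ‖(1 / 2) * ∫ t, phaseDeriv L t (H10.jet x t) (H10.jet η t) ∂unitMeasure‖ ≤ _
  rw [norm_mul, Real.norm_of_nonneg (by norm_num : (0 : ℝ) ≤ 1 / 2)]
  have h3 := mul_le_mul_of_nonneg_left h2 hB0
  have h4 : 0 ≤ ‖∫ t, phaseDeriv L t (H10.jet x t) (H10.jet η t) ∂unitMeasure‖ := norm_nonneg _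
  nlinarith [h1, h3]

theorem integrable_lagrangian (T : TameLagrangian L ρ c C) {x : H10 n} (hx : ‖x‖ < ρ) :
    Integrable (fun t => L t (H10.curve x t) (H10.vel x t)) unitMeasure := by
  obtain ⟨B, hB0, hB⟩ := T.abs_deriv_apply_le
  have h0 : ContinuousOn (fun t : ℝ => L t 0 0) (Icc 0 1) :=
    T.continuousOn.comp (f := fun t : ℝ => (t, ((0 : Euc n), (0 : Euc n))))
      (by fun_prop) fun t ht => ⟨ht, by simpa using T.radius_pos, mem_univ _⟩
  obtain ⟨B', hB'⟩ := isCompact_Icc.exists_bound_of_continuousOn h0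
  have i1 : Integrable (fun t => 1 + ‖H10.vel x t‖ ^ 2) unitMeasure :=
    (integrable_const 1).add (H10.integrable_norm_vel_sq x)
  have i2 : Integrable (fun t => (1 + ‖H10.vel x t‖) * ‖H10.vel x t‖) unitMeasure :=
    ((memLp_const (1 : ℝ)).add (H10.memLp_norm_vel x)).integrable_mul (H10.memLp_norm_vel x)
  refine ((integrable_const B').add ((i1.add i2).const_mul B)).mono' ?_ ?_
  · exact aestronglyMeasurable_of_continuousOn_tameDomain T.continuousOn
      (H10.aestronglyMeasurable_curve x) (H10.aestronglyMeasurable_vel x)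
      fun _ ht => curve_mem_ball hx ht
  · filter_upwards [ae_unitMeasure_mem] with t ht
    set q := H10.curve x t
    set y := H10.vel x t
    have hq : ‖q‖ < ρ := mem_ball_zero_iff.1 (curve_mem_ball hx ht)
    -- The value at (q, y) is compared with the value at (0, 0) by the mean value inequality along
    -- the ray through the origin, which stays in the ball.
    have hseg : ∀ s ∈ Icc (0 : ℝ) 1, s • q ∈ Metric.ball (0 : Euc n) ρ := fun s hs => by
      rw [mem_ball_zero_iff, norm_smul, Real.norm_of_nonneg hs.1]
      nlinarith [norm_nonneg q, hs.2]
    have hd : ∀ s ∈ Icc (0 : ℝ) 1, HasDerivWithinAt (fun s : ℝ => L t (s • q) (s • y))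
        (phaseDeriv L t (s • q, s • y) (q, y)) (Icc 0 1) s := fun s hs => by
      have h1 := (T.differentiableAt t ht (s • q) (hseg s hs) (s • y)).hasFDerivAt
      have h2 : HasDerivAt (fun s : ℝ => (s • q, s • y)) (q, y) s := by
        simpa using ((hasDerivAt_id s).smul_const q).prodMk ((hasDerivAt_id s).smul_const y)
      exact (h1.comp_hasDerivAt s h2).hasDerivWithinAt
    have hbd : ∀ s ∈ Ico (0 : ℝ) 1, ‖phaseDeriv L t (s • q, s • y) (q, y)‖ ≤
        B * ((1 + ‖y‖ ^ 2) * 1 + (1 + ‖y‖) * ‖y‖) := fun s hs => by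
      refine (hB t ht _ (hseg s ⟨hs.1, hs.2.le⟩) _ _ _).trans ?_
      have e1 : ‖s • y‖ ≤ ‖y‖ := by
        rw [norm_smul, Real.norm_of_nonneg hs.1]; nlinarith [norm_nonneg y, hs.2]
      have e2 : ‖q‖ ≤ 1 := hq.le.trans T.radius_le
      gcongr
    have key := norm_image_sub_le_of_norm_deriv_le_segment_01' hd hbd
    simp only [one_smul, zero_smul, mul_one] at key
    have := norm_le_norm_add_norm_sub (L t 0 0) (L t q y)
    have h3 := hB' t ht
    simp only [Pi.add_apply]
    rw [norm_sub_rev] at this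
    linarith [norm_sub_rev (L t q y) (L t 0 0)]

theorem action_eq (x : H10 n) :
    action L x = (1 / 2) * ∫ t, L t (H10.curve x t) (H10.vel x t) ∂unitMeasure := by
  rw [action, intervalIntegral_eq_unitMeasure]

/-- Mean value inequality along the segment, applied to the function minus its linear part. The
number `r` is to be the H¹ norm of the increment; after Young's inequality on the product r‖y'‖ the
right side is quadratic in (r, ‖y'‖) with an integrable weight. -/
theorem abs_taylor_le (T : TameLagrangian L ρ c C) {t : ℝ} (ht : t ∈ Icc (0 : ℝ) 1)
    {q q' : Euc n} (hq : ‖q‖ < ρ) (hq' : ‖q + q'‖ < ρ) (y y' : Euc n) {r : ℝ} (hr : ‖q'‖ ≤ r) :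
    |L t (q + q') (y + y') - L t q y - phaseDeriv L t (q, y) (q', y')| ≤
      C * (2 * ‖y'‖ ^ 2 + 6 * r ^ 2 * (1 + 4 * ‖y‖ ^ 2 + ‖y'‖ ^ 2)) := by
  have hC := T.bound_nonneg
  have hseg : ∀ s ∈ Icc (0 : ℝ) 1, q + s • q' ∈ Metric.ball (0 : Euc n) ρ := fun s hs => by
    have h := (convex_ball (0 : Euc n) ρ) (mem_ball_zero_iff.2 hq) (mem_ball_zero_iff.2 hq')
      (a := 1 - s) (b := s) (by linarith [hs.2]) hs.1 (by ring)
    convert h using 1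
    module
  have hd : ∀ s ∈ Icc (0 : ℝ) 1, HasDerivWithinAt
      (fun s : ℝ => L t (q + s • q') (y + s • y') - s * phaseDeriv L t (q, y) (q', y'))
      (phaseDeriv L t (q + s • q', y + s • y') (q', y') - phaseDeriv L t (q, y) (q', y'))
      (Icc 0 1) s := fun s hs => by
    have h1 := (T.differentiableAt t ht _ (hseg s hs) (y + s • y')).hasFDerivAt
    have h2 : HasDerivAt (fun s : ℝ => (q + s • q', y + s • y')) (q', y') s := by
      simpa using (((hasDerivAt_id s).smul_const q').const_add q).prodMk
        (((hasDerivAt_id s).smul_const y').const_add y)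
    have h3 := (h1.comp_hasDerivAt s h2).sub
      ((hasDerivAt_id s).mul_const (phaseDeriv L t (q, y) (q', y')))
    rw [one_mul] at h3
    exact h3.hasDerivWithinAt
  have hr0 : 0 ≤ r := (norm_nonneg _).trans hr
  have hbd : ∀ s ∈ Ico (0 : ℝ) 1,
      ‖phaseDeriv L t (q + s • q', y + s • y') (q', y') - phaseDeriv L t (q, y) (q', y')‖ ≤
        C * (2 * ‖y'‖ ^ 2 + 6 * r ^ 2 * (1 + 4 * ‖y‖ ^ 2 + ‖y'‖ ^ 2)) := fun s hs => by
    have h1 := T.lipschitz_fst t ht _ (hseg s ⟨hs.1, hs.2.le⟩) q (mem_ball_zero_iff.2 hq)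
      (y + s • y') y q'
    have h2 := T.lipschitz_snd t ht _ (hseg s ⟨hs.1, hs.2.le⟩) q (mem_ball_zero_iff.2 hq)
      (y + s • y') y y'
    have e1 : ‖q + s • q' - q‖ ≤ r := by
      rw [add_sub_cancel_left, norm_smul, Real.norm_of_nonneg hs.1]
      nlinarith [norm_nonneg q', hs.2]
    have e2 : ‖y + s • y' - y‖ ≤ ‖y'‖ := by
      rw [add_sub_cancel_left, norm_smul, Real.norm_of_nonneg hs.1]
      nlinarith [norm_nonneg y', hs.2]
    have e3 : ‖y + s • y'‖ ≤ ‖y‖ + ‖y'‖ := by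
      refine (norm_add_le _ _).trans (add_le_add le_rfl ?_)
      rw [norm_smul, Real.norm_of_nonneg hs.1]
      nlinarith [norm_nonneg y', hs.2]
    set m := 1 + 2 * ‖y‖ + ‖y'‖ with hm
    have hm0 : 0 ≤ m := by positivity
    have h1' := h1.trans (show _ ≤ C * (r * m ^ 2 + ‖y'‖ * m) * r by
      have : 1 + ‖y + s • y'‖ + ‖y‖ ≤ m := by linarith
      gcongr)
    have h2' := h2.trans (show _ ≤ C * (r * m + ‖y'‖) * ‖y'‖ by
      have : 1 + ‖y + s • y'‖ + ‖y‖ ≤ m := by linarith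
      gcongr)
    rw [clm_prod_apply (phaseDeriv L t (q + s • q', y + s • y')),
      clm_prod_apply (phaseDeriv L t (q, y)), add_sub_add_comm]
    refine (norm_add_le _ _).trans ((add_le_add h1' h2').trans ?_)
    have hfin : (r * m ^ 2 + ‖y'‖ * m) * r + (r * m + ‖y'‖) * ‖y'‖ ≤
        2 * ‖y'‖ ^ 2 + 6 * r ^ 2 * (1 + 4 * ‖y‖ ^ 2 + ‖y'‖ ^ 2) := by
      have a1 : m ^ 2 ≤ 3 * (1 + 4 * ‖y‖ ^ 2 + ‖y'‖ ^ 2) := by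
        rw [hm]
        nlinarith [sq_nonneg (1 - 2 * ‖y‖), sq_nonneg (1 - ‖y'‖), sq_nonneg (2 * ‖y‖ - ‖y'‖)]
      nlinarith [sq_nonneg (r * m - ‖y'‖), mul_le_mul_of_nonneg_left a1 (sq_nonneg r)]
    calc C * (r * m ^ 2 + ‖y'‖ * m) * r + C * (r * m + ‖y'‖) * ‖y'‖
        = C * ((r * m ^ 2 + ‖y'‖ * m) * r + (r * m + ‖y'‖) * ‖y'‖) := by ring
      _ ≤ _ := mul_le_mul_of_nonneg_left hfin hC
  have key := norm_image_sub_le_of_norm_deriv_le_segment_01' hd hbd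
  simp only [one_smul, zero_smul, add_zero, zero_mul, sub_zero, one_mul] at key
  rwa [← Real.norm_eq_abs, sub_right_comm]

theorem hasFDerivAt_action (T : TameLagrangian L ρ c C) {x : H10 n} (hx : ‖x‖ < ρ)
    (D : H10 n →L[ℝ] ℝ) (hD : ∀ η, D η = actionDeriv L x η) : HasFDerivAt (action L) D x := by
  have hC := T.bound_nonneg
  have hev : ∀ᶠ ξ in 𝓝 (0 : H10 n), ‖x + ξ‖ < ρ ∧ ‖ξ‖ < 1 := by
    have h1 : Tendsto (fun ξ : H10 n => ‖x + ξ‖) (𝓝 0) (𝓝 ‖x + 0‖) := by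
      exact (continuous_const.add continuous_id).norm.tendsto 0
    have h2 : Tendsto (fun ξ : H10 n => ‖ξ‖) (𝓝 0) (𝓝 ‖(0 : H10 n)‖) := continuous_norm.tendsto 0
    rw [add_zero] at h1
    rw [norm_zero] at h2
    exact (h1.eventually_lt_const hx).and (h2.eventually_lt_const one_pos)
  rw [hasFDerivAt_iff_isLittleO_nhds_zero]
  -- The pointwise Taylor bound integrates to a constant times ‖ξ‖², since ∫‖ξ̇‖² is ‖ξ‖² and the
  -- weight has integral 1 + 4‖x‖² + ‖ξ‖². Thus the remainder is even quadratic at each fixed `x`.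
  have hO : (fun ξ : H10 n => action L (x + ξ) - action L x - D ξ) =O[𝓝 0]
      fun ξ => ‖ξ‖ ^ 2 := by
    refine Asymptotics.IsBigO.of_bound (C * (2 + 6 * (2 + 4 * ‖x‖ ^ 2))) ?_
    filter_upwards [hev] with ξ hξ
    have i3 := T.integrable_deriv_jet hx ξ
    have i1 := T.integrable_lagrangian hξ.1
    have i2 := T.integrable_lagrangian hx
    have i12 : Integrable (fun t => L t (H10.curve (x + ξ) t) (H10.vel (x + ξ) t) -
        L t (H10.curve x t) (H10.vel x t)) unitMeasure := i1.sub i2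
    rw [hD, action_eq, action_eq, actionDeriv, ← mul_sub, ← mul_sub, ← integral_sub i1 i2,
      ← integral_sub i12 i3]
    have iv := H10.integrable_norm_vel_sq ξ
    have ix := H10.integrable_norm_vel_sq x
    have j0 : Integrable (fun t => 1 + 4 * ‖H10.vel x t‖ ^ 2) unitMeasure :=
      (integrable_const 1).add (ix.const_mul 4)
    have j1 : Integrable (fun t => 1 + 4 * ‖H10.vel x t‖ ^ 2 + ‖H10.vel ξ t‖ ^ 2) unitMeasure := j0.add iv
    have ib : Integrable (fun t => C * (2 * ‖H10.vel ξ t‖ ^ 2 +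
        6 * ‖ξ‖ ^ 2 * (1 + 4 * ‖H10.vel x t‖ ^ 2 + ‖H10.vel ξ t‖ ^ 2))) unitMeasure :=
      ((iv.const_mul 2).add (j1.const_mul (6 * ‖ξ‖ ^ 2))).const_mul C
    have hb : ‖∫ t, (L t (H10.curve (x + ξ) t) (H10.vel (x + ξ) t) -
        L t (H10.curve x t) (H10.vel x t) - phaseDeriv L t (H10.jet x t) (H10.jet ξ t))
        ∂unitMeasure‖ ≤ ∫ t, C * (2 * ‖H10.vel ξ t‖ ^ 2 +
        6 * ‖ξ‖ ^ 2 * (1 + 4 * ‖H10.vel x t‖ ^ 2 + ‖H10.vel ξ t‖ ^ 2)) ∂unitMeasure := by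
      refine norm_integral_le_of_norm_le ib ?_
      filter_upwards [ae_unitMeasure_mem, H10.vel_add x ξ] with t ht hv
      have hm := curve_mem_ball hξ.1 ht
      rw [H10.curve_add x ξ ht] at hm ⊢
      rw [hv]
      exact T.abs_taylor_le ht (mem_ball_zero_iff.1 (curve_mem_ball hx ht))
        (mem_ball_zero_iff.1 hm) _ _ (H10.norm_curve_le ξ ht)
    have e1 : ∫ t, (1 + 4 * ‖H10.vel x t‖ ^ 2 + ‖H10.vel ξ t‖ ^ 2) ∂unitMeasure =
        1 + 4 * ‖x‖ ^ 2 + ‖ξ‖ ^ 2 := by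
      rw [integral_add j0 iv,
        integral_add (integrable_const 1) (ix.const_mul 4), integral_const_mul,
        H10.integral_norm_vel_sq, H10.integral_norm_vel_sq, integral_const, probReal_univ, one_smul]
    rw [integral_const_mul, integral_add (iv.const_mul 2) (j1.const_mul (6 * ‖ξ‖ ^ 2)),
      integral_const_mul, integral_const_mul, e1, H10.integral_norm_vel_sq] at hb
    rw [norm_mul, Real.norm_of_nonneg (by norm_num : (0 : ℝ) ≤ 1 / 2),
      Real.norm_of_nonneg (by positivity : (0 : ℝ) ≤ ‖ξ‖ ^ 2)]
    have h1 : ‖ξ‖ ^ 2 ≤ 1 := by nlinarith [norm_nonneg ξ, hξ.2]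
    have h2 : C * (2 * ‖ξ‖ ^ 2 + 6 * ‖ξ‖ ^ 2 * (1 + 4 * ‖x‖ ^ 2 + ‖ξ‖ ^ 2)) ≤
        C * (2 + 6 * (2 + 4 * ‖x‖ ^ 2)) * ‖ξ‖ ^ 2 := by
      rw [mul_assoc C]
      refine mul_le_mul_of_nonneg_left ?_ hC
      nlinarith [mul_le_mul_of_nonneg_left h1 (sq_nonneg ‖ξ‖)]
    have h3 := hb.trans h2
    refine le_trans ?_ h3
    linarith [norm_nonneg (∫ t, (L t (H10.curve (x + ξ) t) (H10.vel (x + ξ) t) -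
        L t (H10.curve x t) (H10.vel x t) - phaseDeriv L t (H10.jet x t) (H10.jet ξ t))
        ∂unitMeasure)]
  refine hO.trans_isLittleO ?_
  have := Asymptotics.isLittleO_pow_id (𝕜 := ℝ) (n := 2) (by norm_num)
  exact (this.comp_tendsto (tendsto_norm_zero (E := H10 n))).of_norm_right

end TameLagrangian

end Tame

end

noncomputable section

/-! ## The second variation at the zero curve -/

section SecondVariation

variable {n : ℕ}

theorem FormField.continuousOn_of_apply {β : FormField n}
    (h : ∀ z z', ContinuousOn (fun t => β t z z') (Icc 0 1)) : ContinuousOn β (Icc 0 1) := by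
  rw [continuousOn_clm_apply]
  intro z
  rw [continuousOn_clm_apply]
  exact h z

theorem FormField.continuousOn_apply {β : FormField n} (h : ContinuousOn β (Icc 0 1))
    {u v : ℝ → Euc n × Euc n} (hu : ContinuousOn u (Icc 0 1)) (hv : ContinuousOn v (Icc 0 1)) :
    ContinuousOn (fun t => β t (u t) (v t)) (Icc 0 1) :=
  (h.clm_apply hu).clm_apply hv

/-- The linear projection `(q,y) ↦ (0,y)`. -/
def velProj (n : ℕ) : (Euc n × Euc n) →L[ℝ] (Euc n × Euc n) :=
  (ContinuousLinearMap.inr ℝ (Euc n) (Euc n)).comp (ContinuousLinearMap.snd ℝ (Euc n) (Euc n))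

/-- The part of a form field that acts on velocities only. -/
def FormField.velPart (β : FormField n) : FormField n :=
  fun t => (β t).bilinearComp (velProj n) (velProj n)

/-- The form field `β[z, (0, y')]`. -/
def FormField.velRight (β : FormField n) : FormField n :=
  fun t => (β t).bilinearComp (ContinuousLinearMap.id ℝ _) (velProj n)

theorem FormField.velPart_apply (β : FormField n) (t : ℝ) (z z' : Euc n × Euc n) :
    β.velPart t z z' = β t (0, z.2) (0, z'.2) := rfl

theorem FormField.velRight_apply (β : FormField n) (t : ℝ) (z z' : Euc n × Euc n) :
    β.velRight t z z' = β t z (0, z'.2) := rfl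

theorem FormField.continuousOn_velPart {β : FormField n} (h : ContinuousOn β (Icc 0 1)) :
    ContinuousOn β.velPart (Icc 0 1) :=
  FormField.continuousOn_of_apply fun _ _ =>
    FormField.continuousOn_apply h continuousOn_const continuousOn_const

theorem FormField.continuousOn_velRight {β : FormField n} (h : ContinuousOn β (Icc 0 1)) :
    ContinuousOn β.velRight (Icc 0 1) :=
  FormField.continuousOn_of_apply fun _ _ =>
    FormField.continuousOn_apply h continuousOn_const continuousOn_const

namespace TameLagrangian

variable {L : ℝ → Euc n → Euc n → ℝ} {ρ c C : ℝ}

/-- The second variation `½ ∫ D²L(t,0,0)[(ξ,ξ̇),(η,η̇)] dt`. -/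
def hessForm (T : TameLagrangian L ρ c C) : H10 n →L[ℝ] H10 n →L[ℝ] ℝ :=
  integralForm (hessAtZero L) T.continuousOn_hess

/-- The scalar product `½ ∫ L_yy(t,0,0)[ξ̇,η̇] dt`, as a continuous bilinear form. -/
def spForm (T : TameLagrangian L ρ c C) : H10 n →L[ℝ] H10 n →L[ℝ] ℝ :=
  integralForm (FormField.velPart (hessAtZero L)) (FormField.continuousOn_velPart T.continuousOn_hess)

theorem spForm_apply (T : TameLagrangian L ρ c C) (ξ η : H10 n) :
    T.spForm ξ η = scalarProd L ξ η := by
  rw [scalarProd, intervalIntegral_eq_unitMeasure]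
  rfl

/-- Monotonicity of the fibre differential between 0 and `s • w`, divided by s² and taken to the
limit as s decreases to 0. -/
theorem hess_vel_ge (T : TameLagrangian L ρ c C) {t : ℝ} (ht : t ∈ Icc (0 : ℝ) 1) (w : Euc n) :
    c * ‖w‖ ^ 2 ≤ hessAtZero L t (0, w) (0, w) := by
  have h1 : HasFDerivAt (phaseDeriv L t) (hessAtZero L t) (0, 0) :=
    (T.differentiableAt_deriv t ht).hasFDerivAt
  have h2 : HasDerivAt (fun s : ℝ => ((0 : Euc n), s • w)) (0, w) 0 := by
    simpa using (hasDerivAt_const (0 : ℝ) (0 : Euc n)).prodMk ((hasDerivAt_id (0 : ℝ)).smul_const w)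
  have h3 : HasDerivAt (fun s : ℝ => phaseDeriv L t (0, s • w)) (hessAtZero L t (0, w)) 0 := by
    refine HasFDerivAt.comp_hasDerivAt (f := fun s : ℝ => ((0 : Euc n), s • w)) 0 ?_ h2
    show HasFDerivAt (phaseDeriv L t) _ ((0 : Euc n), (0 : ℝ) • w)
    rw [zero_smul]
    exact h1
  have h4 : HasDerivAt (fun s : ℝ => phaseDeriv L t (0, s • w) (0, w))
      (hessAtZero L t (0, w) (0, w)) 0 := by
    simpa using h3.clm_apply (hasDerivAt_const (0 : ℝ) ((0 : Euc n), w))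
  have h5 := (hasDerivAt_iff_tendsto_slope_zero.1 h4).mono_left
    (nhdsWithin_mono (0 : ℝ) (s := Ioi 0) fun s hs => (ne_of_gt hs))
  refine ge_of_tendsto h5 ?_
  filter_upwards [self_mem_nhdsWithin] with s hs
  have hs : 0 < s := hs
  have h6 := T.monotone_snd t ht 0 (by simpa using T.radius_pos) (s • w) 0
  simp only [sub_zero, norm_smul, Real.norm_of_nonneg hs.le] at h6
  have h7 : ∀ f : (Euc n × Euc n) →L[ℝ] ℝ, f (0, s • w) = s * f (0, w) := fun f => by
    have : ((0 : Euc n), s • w) = s • ((0 : Euc n), w) := by simp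
    rw [this, map_smul, smul_eq_mul]
  rw [h7, h7] at h6
  simp only [zero_add, zero_smul, smul_eq_mul]
  rw [le_inv_mul_iff₀ hs]
  have h8 : s * (s * (c * ‖w‖ ^ 2)) ≤ s * (phaseDeriv L t (0, s • w) (0, w) -
      phaseDeriv L t (0, 0) (0, w)) := by nlinarith [h6]
  exact le_of_mul_le_mul_left h8 hs

theorem spForm_ge (T : TameLagrangian L ρ c C) (ξ : H10 n) :
    c / 2 * ‖ξ‖ ^ 2 ≤ T.spForm ξ ξ := by
  have hi := FormField.integrable (FormField.continuousOn_velPart T.continuousOn_hess)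
    (H10.memLp_jet ξ) (H10.memLp_jet ξ)
  have h : ∫ t, c * ‖H10.vel ξ t‖ ^ 2 ∂unitMeasure ≤
      ∫ t, FormField.velPart (hessAtZero L) t (H10.jet ξ t) (H10.jet ξ t) ∂unitMeasure := by
    refine integral_mono_ae ((H10.integrable_norm_vel_sq ξ).const_mul c) hi ?_
    filter_upwards [ae_unitMeasure_mem] with t ht
    exact T.hess_vel_ge ht _
  rw [integral_const_mul, H10.integral_norm_vel_sq] at h
  rw [spForm, integralForm_apply]
  linarith

theorem spForm_le (T : TameLagrangian L ρ c C) :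
    ∃ M, 0 ≤ M ∧ ∀ ξ, T.spForm ξ ξ ≤ M * ‖ξ‖ ^ 2 := by
  obtain ⟨M, hM0, hM⟩ := integralForm_bound (FormField.continuousOn_velPart T.continuousOn_hess)
  refine ⟨M, hM0, fun ξ => (le_abs_self _).trans ((hM ξ ξ).trans (le_of_eq (by ring)))⟩

theorem isCoercive_spForm (T : TameLagrangian L ρ c C) : IsCoercive T.spForm :=
  ⟨c / 2, by linarith [T.convexity_pos], fun ξ => by
    have := T.spForm_ge ξ
    rwa [pow_two, ← mul_assoc] at this⟩

/-- The Riesz representation of functionals with respect to the scalar product. -/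
theorem exists_gradient (T : TameLagrangian L ρ c C) (D : H10 n →L[ℝ] ℝ) :
    ∃ g : H10 n, (∀ η, D η = T.spForm g η) ∧ c / 2 * ‖g‖ ≤ ‖D‖ := by
  have hc := T.convexity_pos
  have hg : ∀ η, D η = T.spForm (T.isCoercive_spForm.continuousLinearEquivOfBilin.symm
      ((InnerProductSpace.toDual ℝ (H10 n)).symm D)) η := fun η => by
    rw [← IsCoercive.continuousLinearEquivOfBilin_apply T.isCoercive_spForm]
    simp
  refine ⟨_, hg, ?_⟩
  set g := T.isCoercive_spForm.continuousLinearEquivOfBilin.symm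
      ((InnerProductSpace.toDual ℝ (H10 n)).symm D)
  rcases eq_or_ne g 0 with h0 | h0
  · rw [h0, norm_zero, mul_zero]; exact D.opNorm_nonneg
  -- Coercivity tested on `g` itself gives (c/2)‖g‖² ≤ D g ≤ ‖D‖‖g‖, and one factor ‖g‖ is
  -- cancelled.
  · have h1 := T.spForm_ge g
    rw [← hg g] at h1
    have h2 := (le_abs_self (D g)).trans (D.le_opNorm g)
    have h3 : 0 < ‖g‖ := norm_pos_iff.2 h0
    nlinarith

/-- The operator representing the second variation with respect to the scalar product. -/
def hessOp (T : TameLagrangian L ρ c C) : H10 n →L[ℝ] H10 n :=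
  (T.isCoercive_spForm.continuousLinearEquivOfBilin.symm : H10 n →L[ℝ] H10 n).comp
    (InnerProductSpace.continuousLinearMapOfBilin (𝕜 := ℝ) T.hessForm)

theorem spForm_hessOp (T : TameLagrangian L ρ c C) (ξ η : H10 n) :
    T.spForm (T.hessOp ξ) η = T.hessForm ξ η := by
  rw [← IsCoercive.continuousLinearEquivOfBilin_apply T.isCoercive_spForm]
  simp only [hessOp, ContinuousLinearMap.comp_apply, ContinuousLinearEquiv.coe_coe,
    ContinuousLinearEquiv.apply_symm_apply]
  exact InnerProductSpace.continuousLinearMapOfBilin_apply T.hessForm ξ η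

/-- The velocity–velocity parts cancel. Each remaining term contains the position of `ξ` or of `η`,
and is therefore small along weakly null sequences. -/
theorem hessForm_sub_spForm_le (T : TameLagrangian L ρ c C) {M : ℝ}
    (hM : ∀ t ∈ Icc (0 : ℝ) 1, ‖hessAtZero L t‖ ≤ M) (ξ η : H10 n) :
    T.hessForm ξ η - T.spForm ξ η ≤
      M * (∫ t, ‖H10.jet η t‖ * ‖H10.curve ξ t‖ ∂unitMeasure) +
      M * (∫ t, ‖H10.vel ξ t‖ * ‖H10.curve η t‖ ∂unitMeasure) := by
  have hM0 : 0 ≤ M := (hessAtZero L 0).opNorm_nonneg.trans (hM 0 (by simp))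
  have i1 := FormField.integrable T.continuousOn_hess (H10.memLp_jet ξ) (H10.memLp_jet η)
  have i2 := FormField.integrable (FormField.continuousOn_velPart T.continuousOn_hess)
    (H10.memLp_jet ξ) (H10.memLp_jet η)
  have i3 : Integrable (fun t => ‖H10.jet η t‖ * ‖H10.curve ξ t‖) unitMeasure :=
    (H10.memLp_norm_jet η).integrable_mul (H10.memLp_norm_curve ξ)
  have i4 : Integrable (fun t => ‖H10.vel ξ t‖ * ‖H10.curve η t‖) unitMeasure :=
    (H10.memLp_norm_vel ξ).integrable_mul (H10.memLp_norm_curve η)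
  rw [hessForm, spForm, integralForm_apply, integralForm_apply, ← mul_sub, ← integral_sub i1 i2]
  have h : ∫ t, (hessAtZero L t (H10.jet ξ t) (H10.jet η t) -
      FormField.velPart (hessAtZero L) t (H10.jet ξ t) (H10.jet η t)) ∂unitMeasure ≤
      ∫ t, (M * (‖H10.jet η t‖ * ‖H10.curve ξ t‖) + M * (‖H10.vel ξ t‖ * ‖H10.curve η t‖))
        ∂unitMeasure := by
    refine integral_mono_ae (i1.sub i2) ((i3.const_mul M).add (i4.const_mul M)) ?_
    filter_upwards [ae_unitMeasure_mem] with t ht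
    have e : hessAtZero L t (H10.jet ξ t) (H10.jet η t) -
        FormField.velPart (hessAtZero L) t (H10.jet ξ t) (H10.jet η t) =
        hessAtZero L t (H10.curve ξ t, 0) (H10.jet η t) +
        hessAtZero L t (0, H10.vel ξ t) (H10.curve η t, 0) := by
      rw [FormField.velPart_apply, clm_prod_apply (hessAtZero L t) (H10.jet ξ t),
        add_apply,
        clm_prod_apply (hessAtZero L t (0, (H10.jet ξ t).2)) (H10.jet η t)]
      simp only [H10.jet]
      ring
    simp only [e]
    have b1 := ((hessAtZero L t).le_opNorm₂ (H10.curve ξ t, 0) (H10.jet η t)).trans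
      (mul_le_mul_of_nonneg_right (mul_le_mul_of_nonneg_right (hM t ht) (norm_nonneg _))
        (norm_nonneg _))
    have b2 := ((hessAtZero L t).le_opNorm₂ (0, H10.vel ξ t) (H10.curve η t, 0)).trans
      (mul_le_mul_of_nonneg_right (mul_le_mul_of_nonneg_right (hM t ht) (norm_nonneg _))
        (norm_nonneg _))
    simp only [Prod.norm_mk, norm_zero, norm_nonneg, sup_of_le_left, sup_of_le_right] at b1 b2
    have c1 := (le_abs_self _).trans b1
    have c2 := (le_abs_self _).trans b2
    linarith
  rw [integral_add (i3.const_mul M) (i4.const_mul M), integral_const_mul, integral_const_mul] at h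
  have p3 : 0 ≤ ∫ t, ‖H10.jet η t‖ * ‖H10.curve ξ t‖ ∂unitMeasure :=
    integral_nonneg fun t => by positivity
  have p4 : 0 ≤ ∫ t, ‖H10.vel ξ t‖ * ‖H10.curve η t‖ ∂unitMeasure :=
    integral_nonneg fun t => by positivity
  nlinarith [mul_nonneg hM0 p3, mul_nonneg hM0 p4]

/-- The second variation is a compact perturbation of the identity. -/
theorem tendsto_hessOp_sub_id (T : TameLagrangian L ρ c C) (w : ℕ → H10 n) (R : ℝ)
    (hR : ∀ k, ‖w k‖ ≤ R)
    (hw : ∀ f : H10 n →L[ℝ] ℝ, Tendsto (fun k => f (w k)) atTop (𝓝 0)) :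
    Tendsto (fun k => (T.hessOp - ContinuousLinearMap.id ℝ (H10 n)) (w k)) atTop (𝓝 0) := by
  obtain ⟨M, hM0, hM⟩ := FormField.exists_bound T.continuousOn_hess
  have hc := T.convexity_pos
  set K := T.hessOp - ContinuousLinearMap.id ℝ (H10 n) with hK
  have hR0 : 0 ≤ R := (norm_nonneg _).trans (hR 0)
  have hKR : ∀ k, ‖K (w k)‖ ≤ ‖K‖ * R := fun k =>
    (K.le_opNorm _).trans (mul_le_mul_of_nonneg_left (hR k) K.opNorm_nonneg)
  have hKw : ∀ f : H10 n →L[ℝ] ℝ, Tendsto (fun k => f (K (w k))) atTop (𝓝 0) :=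
    fun f => hw (f.comp K)
  have l1 := H10.tendsto_integral_mul_norm_curve hR hw (f := fun k t => ‖H10.jet (K (w k)) t‖)
    (R' := 2 * (‖K‖ * R) ^ 2) (fun k => H10.memLp_norm_jet _) (fun k t => norm_nonneg _)
    (fun k => (H10.integral_norm_jet_sq_le _).trans (by gcongr; exact hKR k))
  have l2 := H10.tendsto_integral_mul_norm_curve hKR hKw (f := fun k t => ‖H10.vel (w k) t‖)
    (R' := R ^ 2) (fun k => H10.memLp_norm_vel _) (fun k t => norm_nonneg _)
    (fun k => by rw [H10.integral_norm_vel_sq]; gcongr; exact hR k)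
  have l3 := ((l1.const_mul M).add (l2.const_mul M)).const_mul (2 / c)
  simp only [mul_zero, add_zero] at l3
  -- Test K w with itself: (c/2)‖Kw‖² ≤ ⟨Kw, Kw⟩ = Q(w, Kw) − ⟨w, Kw⟩. The right side has a position
  -- factor of `w` or of `K w`, and both sequences are weakly null and bounded.
  have l4 : Tendsto (fun k => ‖K (w k)‖ ^ 2) atTop (𝓝 0) := by
    refine squeeze_zero (fun k => by positivity) (fun k => ?_) l3
    have h1 := T.spForm_ge (K (w k))
    have h2 : T.spForm (K (w k)) (K (w k)) =
        T.hessForm (w k) (K (w k)) - T.spForm (w k) (K (w k)) := by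
      rw [← spForm_hessOp, hK]
      simp
    have h3 := T.hessForm_sub_spForm_le hM (w k) (K (w k))
    have h4 := h1.trans (h2.le.trans h3)
    calc ‖K (w k)‖ ^ 2 = 2 / c * (c / 2 * ‖K (w k)‖ ^ 2) := by field_simp
      _ ≤ _ := mul_le_mul_of_nonneg_left h4 (by positivity)
  rw [tendsto_zero_iff_norm_tendsto_zero]
  have := l4.sqrt
  simpa [Real.sqrt_sq] using this

theorem isCompactOperator_hessOp_sub_id (T : TameLagrangian L ρ c C) :
    IsCompactOperator (T.hessOp - ContinuousLinearMap.id ℝ (H10 n)) :=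
  isCompactOperator_of_weakly_null _ T.tendsto_hessOp_sub_id

end TameLagrangian

end SecondVariation

end

noncomputable section

/-! ## Nonlinear remainder of the differential of the action -/

section Remainder

variable {n : ℕ}

/-- The gradient vector of a functional on `ℝⁿ`. -/
def rieszVec (n : ℕ) : ((Euc n) →L[ℝ] ℝ) →L[ℝ] Euc n :=
  LinearMap.toContinuousLinearMap
    { toFun := fun f => (InnerProductSpace.toDual ℝ (Euc n)).symm f
      map_add' := fun f g => map_add _ f g
      map_smul' := fun r f => by simp }

theorem inner_rieszVec (f : (Euc n) →L[ℝ] ℝ) (w : Euc n) : inner ℝ (rieszVec n f) w = f w :=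
  InnerProductSpace.toDual_symm_apply (x := w) (y := f)

/-- Primitives from weak derivatives tested against constant vectors. -/
theorem eq_add_integral_of_hasDerivWithinAt_inner {P Q : ℝ → Euc n}
    (hQ : ContinuousOn Q (Icc 0 1))
    (h : ∀ t ∈ Icc (0 : ℝ) 1, ∀ w, HasDerivWithinAt (fun s => inner ℝ (P s) w)
      (inner ℝ (Q t) w) (Icc 0 1) t) {t : ℝ} (ht : t ∈ Icc (0 : ℝ) 1) :
    P t = P 0 + ∫ s in (0 : ℝ)..t, Q s := by
  refine ext_inner_right ℝ fun w => ?_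
  have hsub : Icc 0 t ⊆ Icc (0 : ℝ) 1 := Icc_subset_Icc_right ht.2
  have hQi : IntervalIntegrable Q volume 0 t :=
    ContinuousOn.intervalIntegrable (by rw [uIcc_of_le ht.1]; exact hQ.mono hsub)
  have hcQ : ContinuousOn (fun s => inner ℝ (Q s) w) (Icc 0 t) :=
    (hQ.mono hsub).inner continuousOn_const
  have h1 : ∫ s in (0 : ℝ)..t, inner ℝ (Q s) w = inner ℝ (P t) w - inner ℝ (P 0) w := by
    refine intervalIntegral.integral_eq_sub_of_hasDerivAt_of_le ht.1
      (f := fun s => inner ℝ (P s) w) (fun s hs => ?_) (fun s hs => ?_)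
      (ContinuousOn.intervalIntegrable (by rw [uIcc_of_le ht.1]; exact hcQ))
    · exact (h s (hsub hs) w).continuousWithinAt.mono hsub
    · exact (h s (hsub (Ioo_subset_Icc_self hs)) w).hasDerivAt
        (Icc_mem_nhds hs.1 (hs.2.trans_le ht.2))
  have h2 : inner ℝ (∫ s in (0 : ℝ)..t, Q s) w = ∫ s in (0 : ℝ)..t, inner ℝ (Q s) w := by
    have := ((innerSL ℝ w).intervalIntegral_comp_comm hQi)
    simp only [innerSL_apply_apply] at this
    rw [real_inner_comm, ← this]
    exact intervalIntegral.integral_congr fun s _ => real_inner_comm _ _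
  rw [inner_add_left, h2, h1]
  ring

theorem H10.integral_vel (η : H10 n) : ∫ t, H10.vel η t ∂unitMeasure = 0 := η.2

namespace TameLagrangian

variable {L : ℝ → Euc n → Euc n → ℝ} {ρ c C : ℝ}

/-- The zero curve is a critical point of the action. -/
theorem actionDeriv_zero (T : TameLagrangian L ρ c C) (η : H10 n) : actionDeriv L 0 η = 0 := by
  have hD : ContinuousOn (fun t : ℝ => phaseDeriv L t (0, 0)) (Icc 0 1) :=
    T.continuousOn_deriv.comp (f := fun t : ℝ => (t, ((0 : Euc n), (0 : Euc n))))
      (by fun_prop) fun t ht => ⟨ht, by simpa using T.radius_pos, mem_univ _⟩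
  let Q : ℝ → Euc n := fun t =>
    rieszVec n ((phaseDeriv L t (0, 0)).comp (ContinuousLinearMap.inl ℝ (Euc n) (Euc n)))
  let P : ℝ → Euc n := fun t =>
    rieszVec n ((phaseDeriv L t (0, 0)).comp (ContinuousLinearMap.inr ℝ (Euc n) (Euc n)))
  have hQ : ContinuousOn Q (Icc 0 1) :=
    (rieszVec n).continuous.comp_continuousOn (hD.clm_comp continuousOn_const)
  have hQw : ∀ t w, inner ℝ (Q t) w = phaseDeriv L t (0, 0) (w, 0) := fun t w => by
    simp [Q, inner_rieszVec]
  have hPw : ∀ t w, inner ℝ (P t) w = phaseDeriv L t (0, 0) (0, w) := fun t w => by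
    simp [P, inner_rieszVec]
  -- The Euler–Lagrange equation in integrated form: the momentum is a constant plus the primitive
  -- of the force. Against a test curve the primitive cancels the force by parts, and the constant
  -- meets a velocity of mean zero.
  have hP : ∀ t ∈ Icc (0 : ℝ) 1, P t = P 0 + ∫ s in (0 : ℝ)..t, Q s := fun t ht =>
    eq_add_integral_of_hasDerivWithinAt_inner hQ (fun t ht w => by
      simp only [hPw, hQw]
      exact T.eulerLagrange t ht w) ht
  have hQi : Integrable Q unitMeasure := hQ.integrableOn_Icc
  have hPc : ContinuousOn P (Icc 0 1) :=
    (rieszVec n).continuous.comp_continuousOn (hD.clm_comp continuousOn_const)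
  have hprim : ContinuousOn (fun t => ∫ s in (0 : ℝ)..t, Q s) (Icc 0 1) :=
    (hPc.sub (continuousOn_const (c := P 0))).congr fun t ht => by simp [hP t ht]
  have hibp := integral_inner_primitive Q (H10.vel η) hQi (H10.integrable_vel η)
    (H10.integral_vel η)
  have key : ∀ᵐ t ∂unitMeasure, phaseDeriv L t (H10.jet 0 t) (H10.jet η t) =
      inner ℝ (Q t) (H10.curve η t) + (inner ℝ (P 0) (H10.vel η t) +
        inner ℝ (∫ s in (0 : ℝ)..t, Q s) (H10.vel η t)) := by
    filter_upwards [ae_unitMeasure_mem, H10.vel_zero (n := n)] with t ht h0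
    have hc0 : H10.curve (0 : H10 n) t = 0 := by
      have := H10.norm_curve_le (0 : H10 n) ht
      simpa using this
    rw [← inner_add_left, ← hP t ht, hQw, hPw, H10.jet, h0, hc0, clm_prod_apply]
    rfl
  have hbd : ∀ {f : ℝ → Euc n} {v : ℝ → Euc n}, ContinuousOn f (Icc 0 1) →
      MemLp v 2 unitMeasure → Integrable (fun t => inner ℝ (f t) (v t)) unitMeasure := by
    intro f v hf hv
    obtain ⟨M, hM⟩ := isCompact_Icc.exists_bound_of_continuousOn hf
    have hfm : MemLp f 2 unitMeasure :=
      MemLp.of_bound (hf.aestronglyMeasurable measurableSet_Icc) M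
        (ae_unitMeasure_mem.mono fun t ht => hM t ht)
    refine (hfm.norm.integrable_mul hv.norm).mono' (hfm.1.inner hv.1) ?_
    exact ae_of_all _ fun t => norm_inner_le_norm _ _
  have i1 := hbd hQ (H10.memLp_curve η)
  have i2 := hbd (continuousOn_const (c := P 0)) (H10.memLp_vel η)
  have i3 := hbd hprim (H10.memLp_vel η)
  have i23 : Integrable (fun t => inner ℝ (P 0) (H10.vel η t) +
        inner ℝ (∫ s in (0 : ℝ)..t, Q s) (H10.vel η t)) unitMeasure := i2.add i3
  rw [actionDeriv, integral_congr_ae key, integral_add i1 i23, integral_add i2 i3,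
    integral_inner (H10.integrable_vel η), H10.integral_vel, inner_zero_right]
  have : ∫ t, inner ℝ (Q t) (H10.curve η t) ∂unitMeasure =
      -∫ t, inner ℝ (∫ s in (0 : ℝ)..t, Q s) (H10.vel η t) ∂unitMeasure := hibp
  rw [this]
  ring

/-- The remainder of the first order expansion of `D L(t,·,·)` at `(0,0)`. -/
def remainder (L : ℝ → Euc n → Euc n → ℝ) (t : ℝ) (z : Euc n × Euc n) :
    (Euc n × Euc n) →L[ℝ] ℝ :=
  phaseDeriv L t z - phaseDeriv L t (0, 0) - hessAtZero L t z

/-- A bounded modulus for the remainder. -/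
def modulus (L : ℝ → Euc n → Euc n → ℝ) (B : ℝ) (t : ℝ) (z : Euc n × Euc n) : ℝ :=
  min B (‖remainder L t z‖ / ‖z‖)

theorem modulus_nonneg {B : ℝ} (hB : 0 ≤ B) (t : ℝ) (z : Euc n × Euc n) :
    0 ≤ modulus L B t z := le_min hB (div_nonneg (ContinuousLinearMap.opNorm_nonneg _) (norm_nonneg _))

theorem modulus_le (B t : ℝ) (z : Euc n × Euc n) : modulus L B t z ≤ B := min_le_left _ _

theorem abs_modulus_le {B : ℝ} (hB : 0 ≤ B) (t : ℝ) (z : Euc n × Euc n) :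
    ‖modulus L B t z‖ ≤ B := by
  rw [Real.norm_of_nonneg (modulus_nonneg hB t z)]; exact modulus_le B t z

theorem remainder_zero (t : ℝ) : remainder L t 0 = 0 := by
  rw [remainder, map_zero, sub_zero]
  exact sub_self _

/-- Differentiability of the phase differential at (0,0) says exactly that the quotient tends to
zero. The truncation at `B` keeps the modulus bounded for large velocities, as dominated convergence
requires. -/
theorem tendsto_modulus (T : TameLagrangian L ρ c C) {B : ℝ} (hB : 0 ≤ B) {t : ℝ}
    (ht : t ∈ Icc (0 : ℝ) 1) : Tendsto (modulus L B t) (𝓝 0) (𝓝 0) := by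
  have h1 : HasFDerivAt (phaseDeriv L t) (hessAtZero L t) (0, 0) :=
    (T.differentiableAt_deriv t ht).hasFDerivAt
  have h2 := hasFDerivAt_iff_tendsto.1 h1
  refine squeeze_zero (fun z => modulus_nonneg hB t z) (fun z => min_le_right _ _) ?_
  refine h2.congr fun z => ?_
  have : z - (0, 0) = z := sub_zero z
  rw [this, remainder, div_eq_inv_mul]

/-- If the quotient is the smaller entry of the minimum, modulus times norm is the norm of the
remainder itself. Otherwise the modulus is the constant, and the global growth bounds suffice. The
position derivative grows quadratically in `y`, beyond any linear bound; this is the extra term,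
harmless because it meets only `w`. -/
theorem exists_remainder_bound (T : TameLagrangian L ρ c C) :
    ∃ B, 0 ≤ B ∧ ∀ t ∈ Icc (0 : ℝ) 1, ∀ q ∈ Metric.ball (0 : Euc n) ρ, ∀ y w w',
      |remainder L t (q, y) (w, w')| ≤
        modulus L B t (q, y) * ‖(q, y)‖ * (2 * ‖(w, w')‖) + B * ‖y‖ ^ 2 * ‖w‖ := by
  obtain ⟨M, hM0, hM⟩ := FormField.exists_bound T.continuousOn_hess
  have hC := T.bound_nonneg
  refine ⟨6 * C + M, by positivity, fun t ht q hq y w w' => ?_⟩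
  have hB : 0 ≤ 6 * C + M := by positivity
  have hz0 := norm_nonneg (q, y)
  have hw : ‖w‖ ≤ ‖(w, w')‖ := norm_fst_le (w, w')
  have hw' : ‖w'‖ ≤ ‖(w, w')‖ := norm_snd_le (w, w')
  have hqz : ‖q‖ ≤ ‖(q, y)‖ := norm_fst_le (q, y)
  have hyz : ‖y‖ ≤ ‖(q, y)‖ := norm_snd_le (q, y)
  rcases eq_or_ne (q, y) 0 with hz | hz
  · rw [hz, remainder_zero]
    have : 0 ≤ (6 * C + M) * ‖y‖ ^ 2 * ‖w‖ := by positivity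
    simpa using this
  have hzp : 0 < ‖(q, y)‖ := norm_pos_iff.2 hz
  rcases min_choice (6 * C + M) (‖remainder L t (q, y)‖ / ‖(q, y)‖) with h | h
  · have hm : modulus L (6 * C + M) t (q, y) = 6 * C + M := h
    rw [hm, clm_prod_apply]
    have a1 := T.abs_deriv_sub_zero_fst ht hq y w
    have a2 := T.abs_deriv_sub_zero_snd ht hq y w'
    have a3 : |hessAtZero L t (q, y) (w, 0)| ≤ M * ‖(q, y)‖ * ‖w‖ := by
      refine ((hessAtZero L t).le_opNorm₂ (q, y) (w, 0)).trans ?_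
      have : ‖((w, 0) : Euc n × Euc n)‖ = ‖w‖ := by simp
      rw [this]
      gcongr
      exact hM t ht
    have a4 : |hessAtZero L t (q, y) (0, w')| ≤ M * ‖(q, y)‖ * ‖w'‖ := by
      refine ((hessAtZero L t).le_opNorm₂ (q, y) (0, w')).trans ?_
      have : ‖((0, w') : Euc n × Euc n)‖ = ‖w'‖ := by simp
      rw [this]
      gcongr
      exact hM t ht
    have b1 : |remainder L t (q, y) (w, 0)| ≤
        (6 * C + M) * ‖(q, y)‖ * ‖w‖ + (6 * C + M) * ‖y‖ ^ 2 * ‖w‖ := by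
      have e : |remainder L t (q, y) (w, 0)| ≤ 3 * C * (‖q‖ + ‖y‖ + ‖y‖ ^ 2) * ‖w‖ +
          M * ‖(q, y)‖ * ‖w‖ := (abs_sub _ _).trans (add_le_add a1 a3)
      have e2 : 3 * C * (‖q‖ + ‖y‖ + ‖y‖ ^ 2) ≤ 6 * C * ‖(q, y)‖ + (6 * C + M) * ‖y‖ ^ 2 := by
        nlinarith [mul_le_mul_of_nonneg_left hqz hC, mul_le_mul_of_nonneg_left hyz hC,
          mul_nonneg hC (sq_nonneg ‖y‖), mul_nonneg hM0 (sq_nonneg ‖y‖)]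
      have e3 := mul_le_mul_of_nonneg_right e2 (norm_nonneg w)
      nlinarith [e, e3]
    have b2 : |remainder L t (q, y) (0, w')| ≤ (6 * C + M) * ‖(q, y)‖ * ‖w'‖ := by
      have e : |remainder L t (q, y) (0, w')| ≤ 2 * C * (‖q‖ + ‖y‖) * ‖w'‖ +
          M * ‖(q, y)‖ * ‖w'‖ := (abs_sub _ _).trans (add_le_add a2 a4)
      have e2 : 2 * C * (‖q‖ + ‖y‖) ≤ 6 * C * ‖(q, y)‖ := by
        nlinarith [mul_le_mul_of_nonneg_left hqz hC, mul_le_mul_of_nonneg_left hyz hC,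
          mul_nonneg hC hz0]
      have e3 := mul_le_mul_of_nonneg_right e2 (norm_nonneg w')
      nlinarith [e, e3]
    have p : 0 ≤ (6 * C + M) * ‖(q, y)‖ := mul_nonneg hB hz0
    have := (abs_add_le (remainder L t (q, y) (w, 0)) (remainder L t (q, y) (0, w'))).trans
      (add_le_add b1 b2)
    simp only
    nlinarith [mul_le_mul_of_nonneg_left hw p, mul_le_mul_of_nonneg_left hw' p]
  · have hm : modulus L (6 * C + M) t (q, y) = ‖remainder L t (q, y)‖ / ‖(q, y)‖ := h
    rw [hm, div_mul_cancel₀ _ hzp.ne']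
    have e := (remainder L t (q, y)).le_opNorm (w, w')
    have p1 : 0 ≤ ‖remainder L t (q, y)‖ * ‖(w, w')‖ :=
      mul_nonneg (ContinuousLinearMap.opNorm_nonneg _) (norm_nonneg _)
    have p2 : 0 ≤ (6 * C + M) * ‖y‖ ^ 2 * ‖w‖ := by positivity
    rw [Real.norm_eq_abs] at e
    linarith

theorem aestronglyMeasurable_modulus (T : TameLagrangian L ρ c C) {q y : ℝ → Euc n}
    (hq : AEStronglyMeasurable q unitMeasure) (hy : AEStronglyMeasurable y unitMeasure)
    (hqρ : ∀ t ∈ Icc (0 : ℝ) 1, q t ∈ Metric.ball (0 : Euc n) ρ) (B : ℝ) :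
    AEStronglyMeasurable (fun t => modulus L B t (q t, y t)) unitMeasure := by
  have h1 := T.aestronglyMeasurable_deriv hq hy hqρ
  have h2 := T.aestronglyMeasurable_deriv (q := fun _ => 0) (y := fun _ => 0)
    aestronglyMeasurable_const aestronglyMeasurable_const
    fun t _ => by simpa using T.radius_pos
  have hb : AEStronglyMeasurable (hessAtZero L) unitMeasure :=
    T.continuousOn_hess.aestronglyMeasurable measurableSet_Icc
  have h3 : AEStronglyMeasurable (fun t => hessAtZero L t (q t, y t)) unitMeasure :=
    (isBoundedBilinearMap_apply (𝕜 := ℝ)).continuous.comp_aestronglyMeasurable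
      (hb.prodMk (hq.prodMk hy))
  have h4 : AEStronglyMeasurable (fun t => remainder L t (q t, y t)) unitMeasure :=
    (h1.sub h2).sub h3
  have h5 : AEMeasurable (fun t => ‖remainder L t (q t, y t)‖ / ‖(q t, y t)‖) unitMeasure :=
    h4.norm.aemeasurable.div (hq.prodMk hy).norm.aemeasurable
  exact (aemeasurable_const.min h5).aestronglyMeasurable

theorem aestronglyMeasurable_modulus_jet (T : TameLagrangian L ρ c C) {x : H10 n} (hx : ‖x‖ < ρ)
    (B : ℝ) : AEStronglyMeasurable (fun t => modulus L B t (H10.jet x t)) unitMeasure :=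
  T.aestronglyMeasurable_modulus (H10.aestronglyMeasurable_curve x)
    (H10.aestronglyMeasurable_vel x) (fun _ ht => curve_mem_ball hx ht) B

theorem memLp_modulus_mul {B : ℝ} (hB : 0 ≤ B) {z : ℝ → Euc n × Euc n}
    (hz : AEStronglyMeasurable (fun t => modulus L B t (z t)) unitMeasure) {f : ℝ → ℝ}
    (hf : MemLp f 2 unitMeasure) :
    MemLp (fun t => modulus L B t (z t) * f t) 2 unitMeasure :=
  hf.of_le_mul (hz.mul hf.1) (c := B) (ae_of_all _ fun t => by
    rw [norm_mul]
    exact mul_le_mul_of_nonneg_right (abs_modulus_le hB t (z t)) (norm_nonneg _))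

/-- Dominated convergence for the modulus. -/
theorem tendsto_integral_modulus {ι : Type*} {l : Filter ι} [l.IsCountablyGenerated]
    (T : TameLagrangian L ρ c C) {B : ℝ} (hB : 0 ≤ B) {z : ι → ℝ → Euc n × Euc n}
    (hz : ∀ᶠ k in l, AEStronglyMeasurable (fun t => modulus L B t (z k t)) unitMeasure)
    (hz0 : ∀ᵐ t ∂unitMeasure, Tendsto (fun k => z k t) l (𝓝 0)) {f : ℝ → ℝ}
    (hf : MemLp f 2 unitMeasure) :
    Tendsto (fun k => ∫ t, (modulus L B t (z k t) * f t) ^ 2 ∂unitMeasure) l (𝓝 0) := by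
  have h0 : (0 : ℝ) = ∫ _t : ℝ, (0 : ℝ) ∂unitMeasure := by simp
  rw [h0]
  refine tendsto_integral_filter_of_dominated_convergence (fun t => B ^ 2 * f t ^ 2)
    (hz.mono fun k hk => (hk.mul hf.1).pow 2) (Eventually.of_forall fun k => ?_)
    (hf.integrable_sq.const_mul _) ?_
  · refine ae_of_all _ fun t => ?_
    rw [Real.norm_of_nonneg (sq_nonneg _), mul_pow]
    have := modulus_nonneg (L := L) hB t (z k t)
    have := modulus_le (L := L) B t (z k t)
    gcongr
  · filter_upwards [hz0, ae_unitMeasure_mem] with t ht htm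
    have := (((T.tendsto_modulus hB htm).comp ht).mul_const (f t)).pow 2
    simpa using this

/-- The constant term of the expansion integrates to zero because the zero curve is critical. -/
theorem actionDeriv_eq (T : TameLagrangian L ρ c C) {x : H10 n} (hx : ‖x‖ < ρ) (η : H10 n) :
    Integrable (fun t => remainder L t (H10.jet x t) (H10.jet η t)) unitMeasure ∧
    actionDeriv L x η = T.hessForm x η +
      (1 / 2) * ∫ t, remainder L t (H10.jet x t) (H10.jet η t) ∂unitMeasure := by
  have i1 := T.integrable_deriv_jet hx η
  have i0 := T.integrable_deriv_jet (x := 0) (by simpa using T.radius_pos) η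
  have i2 := FormField.integrable T.continuousOn_hess (H10.memLp_jet x) (H10.memLp_jet η)
  have e : (fun t => remainder L t (H10.jet x t) (H10.jet η t)) =ᵐ[unitMeasure]
      fun t => phaseDeriv L t (H10.jet x t) (H10.jet η t) -
        phaseDeriv L t (H10.jet 0 t) (H10.jet η t) -
        hessAtZero L t (H10.jet x t) (H10.jet η t) := by
    filter_upwards [H10.jet_smul (0 : ℝ) (0 : H10 n)] with t h0
    rw [zero_smul, zero_smul] at h0
    rw [h0]
    rfl
  have i10 : Integrable (fun t => phaseDeriv L t (H10.jet x t) (H10.jet η t) -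
        phaseDeriv L t (H10.jet 0 t) (H10.jet η t)) unitMeasure := i1.sub i0
  refine ⟨(i10.sub i2).congr e.symm, ?_⟩
  have h0 := T.actionDeriv_zero η
  rw [actionDeriv] at h0
  rw [integral_congr_ae e, integral_sub i10 i2, integral_sub i1 i0, actionDeriv, hessForm,
    integralForm_apply]
  linarith

theorem abs_integral_remainder_le (T : TameLagrangian L ρ c C) {B : ℝ} (hB0 : 0 ≤ B)
    (hB : ∀ t ∈ Icc (0 : ℝ) 1, ∀ q ∈ Metric.ball (0 : Euc n) ρ, ∀ y w w',
      |remainder L t (q, y) (w, w')| ≤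
        modulus L B t (q, y) * ‖(q, y)‖ * (2 * ‖(w, w')‖) + B * ‖y‖ ^ 2 * ‖w‖)
    {x : H10 n} (hx : ‖x‖ < ρ) (η : H10 n) :
    |∫ t, remainder L t (H10.jet x t) (H10.jet η t) ∂unitMeasure| ≤
      2 * (∫ t, (modulus L B t (H10.jet x t) * ‖H10.jet x t‖) * ‖H10.jet η t‖ ∂unitMeasure) +
        B * ‖x‖ ^ 2 * ‖η‖ := by
  have m1 := memLp_modulus_mul hB0 (T.aestronglyMeasurable_modulus_jet hx B)
    (H10.memLp_norm_jet x)
  have i1 : Integrable (fun t => (modulus L B t (H10.jet x t) * ‖H10.jet x t‖) * ‖H10.jet η t‖)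
    unitMeasure := m1.integrable_mul (H10.memLp_norm_jet η)
  have i2 : Integrable (fun t => B * ‖H10.vel x t‖ ^ 2 * ‖η‖) unitMeasure :=
    ((H10.integrable_norm_vel_sq x).const_mul B).mul_const _
  have h : ‖∫ t, remainder L t (H10.jet x t) (H10.jet η t) ∂unitMeasure‖ ≤
      ∫ t, (2 * ((modulus L B t (H10.jet x t) * ‖H10.jet x t‖) * ‖H10.jet η t‖) +
        B * ‖H10.vel x t‖ ^ 2 * ‖η‖) ∂unitMeasure := by
    refine norm_integral_le_of_norm_le ((i1.const_mul 2).add i2) ?_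
    filter_upwards [ae_unitMeasure_mem] with t ht
    refine (hB t ht _ (curve_mem_ball hx ht) _ _ _).trans (add_le_add (le_of_eq ?_) ?_)
    · simp only [H10.jet]
      ring
    · have := H10.norm_curve_le η ht
      gcongr
  rw [integral_add (i1.const_mul 2) i2, integral_const_mul, integral_mul_const,
    integral_const_mul, H10.integral_norm_vel_sq] at h
  exact h

theorem eventually_norm_lt (T : TameLagrangian L ρ c C) :
    ∀ᶠ x in 𝓝 (0 : H10 n), ‖x‖ < ρ := by
  filter_upwards [Metric.ball_mem_nhds (0 : H10 n) T.radius_pos] with x hx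
  simpa using hx

theorem differentiableAt_action (T : TameLagrangian L ρ c C) {x : H10 n} (hx : ‖x‖ < ρ) :
    DifferentiableAt ℝ (action L) x := by
  obtain ⟨D, hD⟩ := T.exists_actionDeriv_clm hx
  exact (T.hasFDerivAt_action hx D hD).differentiableAt

theorem fderiv_action_apply (T : TameLagrangian L ρ c C) {x : H10 n} (hx : ‖x‖ < ρ) (η : H10 n) :
    fderiv ℝ (action L) x η = actionDeriv L x η := by
  obtain ⟨D, hD⟩ := T.exists_actionDeriv_clm hx
  rw [(T.hasFDerivAt_action hx D hD).fderiv, hD]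

/-- The differential of the action is Gateaux differentiable at the zero curve. -/
theorem hasDerivAt_fderiv_action (T : TameLagrangian L ρ c C) (ξ : H10 n) :
    HasDerivAt (fun s : ℝ => fderiv ℝ (action L) (s • ξ)) (T.hessForm ξ) 0 := by
  obtain ⟨B, hB0, hB⟩ := T.exists_remainder_bound
  have h0 : fderiv ℝ (action L) 0 = 0 := by
    ext η
    rw [T.fderiv_action_apply (by simpa using T.radius_pos), T.actionDeriv_zero]
    rfl
  have hlim : Tendsto (fun s : ℝ => s • ξ) (𝓝 0) (𝓝 0) := by
    have : Continuous fun s : ℝ => s • ξ := by fun_prop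
    simpa using this.tendsto 0
  have hev : ∀ᶠ s in 𝓝 (0 : ℝ), ‖s • ξ‖ < ρ := hlim.eventually T.eventually_norm_lt
  refine (hasDerivAt_iff_tendsto (𝕜 := ℝ) (F := H10 n →L[ℝ] ℝ)).2 ?_
  simp only [zero_smul, h0, sub_zero]
  have hmeas : ∀ᶠ s in 𝓝 (0 : ℝ), AEStronglyMeasurable
      (fun t => modulus L B t (s • H10.jet ξ t)) unitMeasure := by
    filter_upwards [hev] with s hs
    refine (T.aestronglyMeasurable_modulus_jet hs B).congr ?_
    filter_upwards [H10.jet_smul s ξ] with t h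
    rw [h]
  -- With `ξ` fixed, the factor ‖jet ξ‖ is a dominating function, so the remainder at sξ divided by
  -- s tends to zero uniformly over the unit ball of test directions. The argument depends on `ξ`,
  -- hence yields only Gateaux differentiability.
  have hdct := T.tendsto_integral_modulus (l := 𝓝 (0 : ℝ)) hB0 (z := fun s t => s • H10.jet ξ t)
    hmeas (ae_of_all _ fun t => by
      have : Continuous fun s : ℝ => s • H10.jet ξ t := by fun_prop
      simpa using this.tendsto 0) (H10.memLp_norm_jet ξ)
  have hub : Tendsto (fun s : ℝ =>
      √(∫ t, (modulus L B t (s • H10.jet ξ t) * ‖H10.jet ξ t‖) ^ 2 ∂unitMeasure) * 2 +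
        B * |s| * ‖ξ‖ ^ 2) (𝓝 0) (𝓝 0) := by
    have a1 := hdct.sqrt.mul_const 2
    have a2 : Tendsto (fun s : ℝ => B * |s| * ‖ξ‖ ^ 2) (𝓝 0) (𝓝 (B * |0| * ‖ξ‖ ^ 2)) := by
      have : Continuous fun s : ℝ => B * |s| * ‖ξ‖ ^ 2 := by fun_prop
      exact this.tendsto 0
    simpa using a1.add a2
  refine squeeze_zero' (Eventually.of_forall fun s =>
    mul_nonneg (by positivity) (ContinuousLinearMap.opNorm_nonneg _)) ?_ hub
  filter_upwards [hev, hmeas] with s hs hms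
  rcases eq_or_ne s 0 with rfl | hs0
  · simp only [norm_zero, inv_zero, zero_mul, abs_zero, mul_zero, add_zero]
    positivity
  have hs0' : 0 < |s| := abs_pos.2 hs0
  rw [Real.norm_eq_abs, inv_mul_le_iff₀ hs0']
  refine ContinuousLinearMap.opNorm_le_bound _ (by positivity) fun η => ?_
  have e1 : (fderiv ℝ (action L) (s • ξ) - s • T.hessForm ξ) η =
      (1 / 2) * ∫ t, remainder L t (H10.jet (s • ξ) t) (H10.jet η t) ∂unitMeasure := by
    have := (T.actionDeriv_eq hs η).2
    rw [sub_apply, T.fderiv_action_apply hs, this, map_smul]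
    simp
  rw [e1, norm_mul, Real.norm_of_nonneg (by norm_num : (0 : ℝ) ≤ 1 / 2), Real.norm_eq_abs]
  have e2 := T.abs_integral_remainder_le hB0 hB hs η
  have m1 := memLp_modulus_mul hB0 hms (H10.memLp_norm_jet ξ)
  have e3 : ∫ t, (modulus L B t (H10.jet (s • ξ) t) * ‖H10.jet (s • ξ) t‖) * ‖H10.jet η t‖
      ∂unitMeasure = |s| * ∫ t, (modulus L B t (s • H10.jet ξ t) * ‖H10.jet ξ t‖) * ‖H10.jet η t‖
      ∂unitMeasure := by
    rw [← integral_const_mul]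
    refine integral_congr_ae ?_
    filter_upwards [H10.jet_smul s ξ] with t h
    rw [h, norm_smul, Real.norm_eq_abs]
    ring
  have e4 := H10.integral_mul_norm_jet_le m1 η
  rw [e3, norm_smul, Real.norm_eq_abs] at e2
  have e5 := mul_le_mul_of_nonneg_left e4 hs0'.le
  have e6 : B * (|s| * ‖ξ‖) ^ 2 * ‖η‖ = |s| * (B * |s| * ‖ξ‖ ^ 2) * ‖η‖ := by ring
  rw [e6] at e2
  have p : 0 ≤ |s| * (B * |s| * ‖ξ‖ ^ 2) * ‖η‖ := by positivity
  nlinarith [e2, e5, p]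

end TameLagrangian

end Remainder

end

noncomputable section

/-! ## Nondegeneracy and the main estimate -/

section Nondegenerate

variable {n : ℕ}

theorem H10.exists_vel_eq {v : ℝ → Euc n} (hv : MemLp v 2 unitMeasure)
    (h0 : ∫ t, v t ∂unitMeasure = 0) : ∃ η : H10 n, H10.vel η =ᵐ[unitMeasure] v := by
  refine ⟨⟨hv.toLp v, ?_⟩, hv.coeFn_toLp⟩
  show ∫ t, hv.toLp v t ∂unitMeasure = 0
  rw [integral_congr_ae hv.coeFn_toLp, h0]

theorem intervalIntegral_congr_ae_unitMeasure {f g : ℝ → Euc n} (h : f =ᵐ[unitMeasure] g) {t : ℝ}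
    (ht : t ∈ Icc (0 : ℝ) 1) : ∫ s in (0 : ℝ)..t, f s = ∫ s in (0 : ℝ)..t, g s := by
  have h' := (ae_restrict_iff' measurableSet_Icc).1 h
  apply intervalIntegral.integral_congr_ae
  filter_upwards [h'] with s hs hmem
  rw [uIoc_of_le ht.1] at hmem
  exact hs ⟨hmem.1.le, hmem.2.trans ht.2⟩

theorem hasDerivWithinAt_primitive {p : ℝ → Euc n} (hp : ContinuousOn p (Icc 0 1)) {t : ℝ}
    (ht : t ∈ Icc (0 : ℝ) 1) :
    HasDerivWithinAt (fun t => ∫ s in (0 : ℝ)..t, p s) (p t) (Icc 0 1) t := by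
  let p' : ℝ → Euc n := IccExtend zero_le_one ((Icc (0 : ℝ) 1).domRestrict p)
  have hp' : Continuous p' := hp.domRestrict.Icc_extend'
  have he : ∀ s ∈ Icc (0 : ℝ) 1, p' s = p s := fun s hs => by
    simp [p', IccExtend_of_mem zero_le_one _ hs]
  have h1 : HasDerivWithinAt (fun t => ∫ s in (0 : ℝ)..t, p' s) (p' t) (Icc 0 1) t :=
    (hp'.integral_hasStrictDerivAt 0 t).hasDerivAt.hasDerivWithinAt
  rw [he t ht] at h1
  have hc : ∀ s ∈ Icc (0 : ℝ) 1, ∫ r in (0 : ℝ)..s, p r = ∫ r in (0 : ℝ)..s, p' r := fun s hs =>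
    intervalIntegral.integral_congr fun r hr => by
      rw [uIcc_of_le hs.1] at hr
      exact (he r ⟨hr.1, hr.2.trans hs.2⟩).symm
  exact h1.congr hc (hc t ht)

/-- The fundamental lemma of the calculus of variations, in the form of du Bois-Reymond. -/
theorem ae_eq_const_add_primitive {P Q : ℝ → Euc n} (hP : MemLp P 2 unitMeasure)
    (hQ : Integrable Q unitMeasure)
    (h : ∀ η : H10 n, ∫ t, inner ℝ (Q t) (H10.curve η t) ∂unitMeasure +
      ∫ t, inner ℝ (P t) (H10.vel η t) ∂unitMeasure = 0) :
    ∃ m : Euc n, ∀ᵐ t ∂unitMeasure, P t = m + ∫ s in (0 : ℝ)..t, Q s := by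
  have hQ' : IntervalIntegrable Q volume 0 1 :=
    (intervalIntegrable_iff_integrableOn_Icc_of_le zero_le_one).2 hQ
  have hprim : ContinuousOn (fun t => ∫ s in (0 : ℝ)..t, Q s) (Icc 0 1) := by
    have := intervalIntegral.continuousOn_primitive_interval' hQ' (a := 0) (by simp)
    rwa [uIcc_of_le zero_le_one] at this
  obtain ⟨M, hM⟩ := isCompact_Icc.exists_bound_of_continuousOn hprim
  have hpm : MemLp (fun t => ∫ s in (0 : ℝ)..t, Q s) 2 unitMeasure :=
    MemLp.of_bound (hprim.aestronglyMeasurable measurableSet_Icc) M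
      (ae_unitMeasure_mem.mono fun t ht => hM t ht)
  set f : ℝ → Euc n := fun t => P t - ∫ s in (0 : ℝ)..t, Q s with hf
  have hfm : MemLp f 2 unitMeasure := hP.sub hpm
  set m : Euc n := ∫ t, f t ∂unitMeasure with hm
  have hfi : Integrable f unitMeasure := hfm.integrable (by norm_num)
  have hvm : MemLp (fun t => f t - m) 2 unitMeasure := hfm.sub (memLp_const m)
  have hvi : Integrable (fun t => f t - m) unitMeasure := hvm.integrable (by norm_num)
  have hv0 : ∫ t, (f t - m) ∂unitMeasure = 0 := by
    rw [integral_sub hfi (integrable_const _), integral_const, probReal_univ, one_smul, ← hm,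
      sub_self]
  have hIntegrable : ∀ {a b : ℝ → Euc n}, MemLp a 2 unitMeasure → MemLp b 2 unitMeasure →
      Integrable (fun t => inner ℝ (a t) (b t)) unitMeasure := fun ha hb =>
    (ha.norm.integrable_mul hb.norm).mono' (ha.1.inner hb.1)
      (ae_of_all _ fun t => norm_inner_le_norm _ _)
  -- The test curve has velocity `f` minus its mean, which is admissible because it has mean zero.
  -- Testing with it makes the variance of `f` vanish.
  obtain ⟨η, hη⟩ := H10.exists_vel_eq hvm hv0
  have h1 := h η
  have h2 : ∫ t, inner ℝ (Q t) (H10.curve η t) ∂unitMeasure =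
      -∫ t, inner ℝ (∫ s in (0 : ℝ)..t, Q s) (H10.vel η t) ∂unitMeasure :=
    integral_inner_primitive Q (H10.vel η) hQ (H10.integrable_vel η) (H10.integral_vel η)
  have h3 : ∫ t, inner ℝ (f t) (H10.vel η t) ∂unitMeasure = 0 := by
    rw [h2] at h1
    have e : ∀ t, inner ℝ (f t) (H10.vel η t) = inner ℝ (P t) (H10.vel η t) -
        inner ℝ (∫ s in (0 : ℝ)..t, Q s) (H10.vel η t) := fun t => inner_sub_left _ _ _
    simp only [e]
    rw [integral_sub (hIntegrable hP (H10.memLp_vel η)) (hIntegrable hpm (H10.memLp_vel η))]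
    linarith
  have h4 : ∫ t, ‖f t - m‖ ^ 2 ∂unitMeasure = 0 := by
    have e : (fun t => ‖f t - m‖ ^ 2) =ᵐ[unitMeasure]
        fun t => inner ℝ (f t) (H10.vel η t) - inner ℝ m (f t - m) := by
      filter_upwards [hη] with t ht
      rw [ht, ← inner_sub_left, real_inner_self_eq_norm_sq]
    rw [integral_congr_ae e, integral_sub (hIntegrable hfm (H10.memLp_vel η))
      (hIntegrable (memLp_const m) hvm), h3, integral_inner hvi, hv0, inner_zero_right, sub_zero]
  have h5 := (integral_eq_zero_iff_of_nonneg (fun t => by positivity)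
    (hvm.norm.integrable_sq)).1 h4
  refine ⟨m, ?_⟩
  filter_upwards [h5] with t ht
  have : f t - m = 0 := by simpa using ht
  rw [← sub_eq_zero.1 this, hf]
  simp

namespace TameLagrangian

variable {L : ℝ → Euc n → Euc n → ℝ} {ρ c C : ℝ}

/-- If the endpoints are not conjugate, the second variation is nondegenerate. -/
theorem eq_zero_of_hessOp_eq_zero (T : TameLagrangian L ρ c C) (hN : NonConjugate L) {u : H10 n}
    (hu : T.hessOp u = 0) : u = 0 := by
  have hweak : ∀ η : H10 n,
      ∫ t, hessAtZero L t (H10.jet u t) (H10.jet η t) ∂unitMeasure = 0 := fun η => by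
    have h1 := T.spForm_hessOp u η
    rw [hu, map_zero, hessForm, integralForm_apply] at h1
    simpa using h1.symm
  obtain ⟨M, hM0, hM⟩ := FormField.exists_bound T.continuousOn_hess
  let posPart : ((Euc n × Euc n) →L[ℝ] ℝ) →L[ℝ] Euc n := (rieszVec n).comp
    ((ContinuousLinearMap.compL ℝ (Euc n) (Euc n × Euc n) ℝ).flip
      (ContinuousLinearMap.inl ℝ (Euc n) (Euc n)))
  let velPart : ((Euc n × Euc n) →L[ℝ] ℝ) →L[ℝ] Euc n := (rieszVec n).comp
    ((ContinuousLinearMap.compL ℝ (Euc n) (Euc n × Euc n) ℝ).flip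
      (ContinuousLinearMap.inr ℝ (Euc n) (Euc n)))
  have hpos : ∀ f w, inner ℝ (posPart f) w = f (w, 0) := fun f w => by
    simp [posPart, inner_rieszVec]
  have hvel : ∀ f w, inner ℝ (velPart f) w = f (0, w) := fun f w => by
    simp [velPart, inner_rieszVec]
  have hjm : MemLp (fun t => hessAtZero L t (H10.jet u t)) 2 unitMeasure := by
    refine (H10.memLp_jet u).of_le_mul (c := M) ?_ ?_
    · exact (isBoundedBilinearMap_apply (𝕜 := ℝ)).continuous.comp_aestronglyMeasurable
        ((T.continuousOn_hess.aestronglyMeasurable measurableSet_Icc).prodMk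
          (H10.aestronglyMeasurable_jet u))
    · filter_upwards [ae_unitMeasure_mem] with t ht
      exact ((hessAtZero L t).le_opNorm _).trans
        (mul_le_mul_of_nonneg_right (hM t ht) (norm_nonneg _))
  set P : ℝ → Euc n := fun t => velPart (hessAtZero L t (H10.jet u t)) with hPdef
  set Q : ℝ → Euc n := fun t => posPart (hessAtZero L t (H10.jet u t)) with hQdef
  have hP : MemLp P 2 unitMeasure := velPart.comp_memLp' hjm
  have hQ2 : MemLp Q 2 unitMeasure := posPart.comp_memLp' hjm
  have hQ : Integrable Q unitMeasure := hQ2.integrable (by norm_num)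
  have hIntegrable : ∀ {a b : ℝ → Euc n}, MemLp a 2 unitMeasure → MemLp b 2 unitMeasure →
      Integrable (fun t => inner ℝ (a t) (b t)) unitMeasure := fun ha hb =>
    (ha.norm.integrable_mul hb.norm).mono' (ha.1.inner hb.1)
      (ae_of_all _ fun t => norm_inner_le_norm _ _)
  -- The weak Jacobi equation determines the momentum almost everywhere as a constant plus the
  -- primitive of the force.
  obtain ⟨m, hm⟩ := ae_eq_const_add_primitive hP hQ fun η => by
    rw [← integral_add (hIntegrable hQ2 (H10.memLp_curve η)) (hIntegrable hP (H10.memLp_vel η)), ← hweak η]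
    congr 1
    ext t
    rw [hQdef, hPdef, hpos, hvel, clm_prod_apply _ (H10.jet η t)]
    rfl
  let a : ℝ → Euc n →L[ℝ] Euc n := fun t => (velPart.comp (hessAtZero L t)).comp
    (ContinuousLinearMap.inr ℝ (Euc n) (Euc n))
  have haw : ∀ t v w, inner ℝ (a t v) w = hessAtZero L t (0, v) (0, w) := fun t v w => by
    simp [a, hvel]
  have hac : ContinuousOn a (Icc 0 1) :=
    (continuousOn_const.clm_comp T.continuousOn_hess).clm_comp continuousOn_const
  -- The Legendre condition: the velocity block of the Hessian is positive definite, so it is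
  -- injective and, in finite dimension, invertible.
  have hau : ∀ t ∈ Icc (0 : ℝ) 1, IsUnit (a t) := fun t ht => by
    have hinj : Function.Injective (a t) := by
      rw [injective_iff_map_eq_zero]
      intro v hv
      have h1 := T.hess_vel_ge ht v
      rw [← haw, hv, inner_zero_left] at h1
      have hc := T.convexity_pos
      have : ‖v‖ ^ 2 ≤ 0 := by
        by_contra hcon
        push Not at hcon
        nlinarith
      simpa using this
    exact ContinuousLinearMap.isUnit_iff_bijective.2
      ⟨hinj, (LinearMap.injective_iff_surjective (f := ((a t : Euc n →L[ℝ] Euc n) : Euc n →ₗ[ℝ] Euc n))).1 hinj⟩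
  let R : ℝ → Euc n := fun t => m + ∫ s in (0 : ℝ)..t, Q s
  have hprim : ContinuousOn (fun t => ∫ s in (0 : ℝ)..t, Q s) (Icc 0 1) := by
    have hQ' : IntervalIntegrable Q volume 0 1 :=
      (intervalIntegrable_iff_integrableOn_Icc_of_le zero_le_one).2 hQ
    have := intervalIntegral.continuousOn_primitive_interval' hQ' (a := 0) (by simp)
    rwa [uIcc_of_le zero_le_one] at this
  -- Solving the momentum relation for the velocity gives an expression in continuous quantities
  -- only. It is a continuous representative of the velocity of `u`, so the curve is C¹.
  let p : ℝ → Euc n := fun t =>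
    Ring.inverse (a t) (R t - velPart (hessAtZero L t (H10.curve u t, 0)))
  have hinv : ContinuousOn (fun t => Ring.inverse (a t)) (Icc 0 1) := fun t ht => by
    obtain ⟨U, hU⟩ := hau t ht
    have := (NormedRing.inverse_continuousAt U)
    rw [hU] at this
    exact this.comp_continuousWithinAt (hac t ht)
  have hpc : ContinuousOn p (Icc 0 1) := by
    refine hinv.clm_apply ((continuousOn_const.add hprim).sub ?_)
    exact velPart.continuous.comp_continuousOn (T.continuousOn_hess.clm_apply
      ((H10.continuousOn_curve u).prodMk continuousOn_const))
  have hsplit : ∀ t q v, velPart (hessAtZero L t (q, v)) =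
      a t v + velPart (hessAtZero L t (q, 0)) := fun t q v => by
    rw [clm_prod_apply (hessAtZero L t) (q, v), map_add, add_comm]
    rfl
  have hup : H10.vel u =ᵐ[unitMeasure] p := by
    filter_upwards [hm, ae_unitMeasure_mem] with t ht htI
    have h1 : a t (H10.vel u t) = R t - velPart (hessAtZero L t (H10.curve u t, 0)) := by
      rw [eq_sub_iff_add_eq, ← hsplit]
      exact ht
    show _ = Ring.inverse (a t) _
    rw [← h1, ← mul_apply_eq_comp, Ring.inverse_mul_cancel _ (hau t htI)]
    rfl
  have hcurve : ∀ t ∈ Icc (0 : ℝ) 1, H10.curve u t = ∫ s in (0 : ℝ)..t, p s := fun t ht =>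
    intervalIntegral_congr_ae_unitMeasure hup ht
  have hder : ∀ t ∈ Icc (0 : ℝ) 1, HasDerivWithinAt (H10.curve u) (p t) (Icc 0 1) t :=
    fun t ht => (hasDerivWithinAt_primitive hpc ht).congr hcurve (hcurve t ht)
  have hud : UniqueDiffOn ℝ (Icc (0 : ℝ) 1) := uniqueDiffOn_Icc one_pos
  have hdw : ∀ t ∈ Icc (0 : ℝ) 1, derivWithin (H10.curve u) (Icc 0 1) t = p t := fun t ht =>
    (hder t ht).derivWithin (hud t ht)
  have hpR : ∀ t ∈ Icc (0 : ℝ) 1, velPart (hessAtZero L t (H10.curve u t, p t)) = R t := by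
    intro t ht
    rw [hsplit]
    have : a t (p t) = R t - velPart (hessAtZero L t (H10.curve u t, 0)) := by
      show a t (Ring.inverse (a t) _) = _
      rw [← mul_apply_eq_comp, Ring.mul_inverse_cancel _ (hau t ht)]
      rfl
    rw [this, sub_add_cancel]
  -- The same force, computed with the continuous velocity `p`. Its primitive is differentiable at
  -- every time, not just almost every, as the Jacobi equation demands.
  let Q' : ℝ → Euc n := fun t => posPart (hessAtZero L t (H10.curve u t, p t))
  have hQ'c : ContinuousOn Q' (Icc 0 1) := posPart.continuous.comp_continuousOn
    (T.continuousOn_hess.clm_apply ((H10.continuousOn_curve u).prodMk hpc))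
  have hQQ' : Q =ᵐ[unitMeasure] Q' := by
    filter_upwards [hup] with t ht
    simp only [hQdef, Q', H10.jet, ht]
  have hjac : IsJacobiField L (H10.curve u) := by
    refine ⟨?_, fun t ht w => ?_⟩
    · rw [show (1 : WithTop ℕ∞) = 0 + 1 from rfl, contDiffOn_succ_iff_derivWithin hud]
      refine ⟨fun t ht => (hder t ht).differentiableWithinAt, by simp, ?_⟩
      rw [contDiffOn_zero]
      exact hpc.congr hdw
    · have h1 : HasDerivWithinAt (fun s => inner ℝ (R s) w) (inner ℝ (Q' t) w) (Icc 0 1) t := by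
        have h2 : HasDerivWithinAt R (Q' t) (Icc 0 1) t := by
          refine ((hasDerivWithinAt_primitive hQ'c ht).const_add m).congr (fun s hs => ?_) ?_
          · show m + _ = _
            rw [intervalIntegral_congr_ae_unitMeasure hQQ' hs]
          · show m + _ = _
            rw [intervalIntegral_congr_ae_unitMeasure hQQ' ht]
        simpa using h2.inner ℝ (hasDerivWithinAt_const t (Icc (0 : ℝ) 1) w)
      rw [hdw t ht, ← hpos]
      refine h1.congr (fun s hs => ?_) ?_
      · rw [hdw s hs, ← hvel, hpR s hs]
      · rw [hdw t ht, ← hvel, hpR t ht]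
  have hzero := hN _ hjac (H10.curve_zero u) (H10.curve_one u)
  have hp0 : ∀ t ∈ Icc (0 : ℝ) 1, p t = 0 := fun t ht => by
    have h1 : HasDerivWithinAt (H10.curve u) 0 (Icc 0 1) t :=
      (hasDerivWithinAt_const t (Icc (0 : ℝ) 1) (0 : Euc n)).congr hzero (hzero t ht)
    rw [← hdw t ht, h1.derivWithin (hud t ht)]
  have h0 : ∫ t, ‖H10.vel u t‖ ^ 2 ∂unitMeasure = 0 := by
    have : (fun t => ‖H10.vel u t‖ ^ 2) =ᵐ[unitMeasure] fun _ => 0 := by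
      filter_upwards [hup, ae_unitMeasure_mem] with t h1 h2
      rw [h1, hp0 t h2]
      simp
    rw [integral_congr_ae this]
    simp
  rw [H10.integral_norm_vel_sq] at h0
  simpa using h0

end TameLagrangian

end Nondegenerate

end

noncomputable section

/-! ### Coercivity of the differential of the action in the direction Ax. -/

section LowerBound

variable {n : ℕ}

namespace TameLagrangian

variable {L : ℝ → Euc n → Euc n → ℝ} {ρ c C : ℝ}

/-- The remainder is negligible on strongly convergent directions. -/
theorem tendsto_remainder_div (T : TameLagrangian L ρ c C) {x : ℕ → H10 n}
    (hx : ∀ k, ‖x k‖ < ρ) (hx0 : ∀ k, x k ≠ 0) (hxl : Tendsto (fun k => ‖x k‖) atTop (𝓝 0))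
    (hae : ∀ᵐ t ∂unitMeasure, Tendsto (fun k => H10.jet (x k) t) atTop (𝓝 0))
    {η : ℕ → H10 n} {ζ : H10 n} (hη : Tendsto η atTop (𝓝 ζ)) :
    Tendsto (fun k => (∫ t, remainder L t (H10.jet (x k) t) (H10.jet (η k) t) ∂unitMeasure) / ‖x k‖)
      atTop (𝓝 0) := by
  obtain ⟨B, hB0, hB⟩ := T.exists_remainder_bound
  have hm : ∀ k, AEStronglyMeasurable (fun t => modulus L B t (H10.jet (x k) t)) unitMeasure :=
    fun k => T.aestronglyMeasurable_modulus_jet (hx k) B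
  have hdct := T.tendsto_integral_modulus (l := atTop) hB0 (z := fun k t => H10.jet (x k) t)
    (Eventually.of_forall hm) hae (H10.memLp_norm_jet ζ)
  have hηζ : Tendsto (fun k => ‖η k - ζ‖) atTop (𝓝 0) := by
    have := (hη.sub_const ζ).norm
    simpa using this
  have hub : Tendsto (fun k => 4 * √(∫ t, (modulus L B t (H10.jet (x k) t) * ‖H10.jet ζ t‖) ^ 2
      ∂unitMeasure) + 8 * B * ‖η k - ζ‖ + B * ‖x k‖ * ‖η k‖) atTop (𝓝 0) := by
    have := ((hdct.sqrt.const_mul 4).add (hηζ.const_mul (8 * B))).add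
      ((hxl.const_mul B).mul hη.norm)
    simpa using this
  refine squeeze_zero_norm (fun k => ?_) hub
  have hxk : 0 < ‖x k‖ := norm_pos_iff.2 (hx0 k)
  rw [norm_div, norm_norm, div_le_iff₀ hxk, Real.norm_eq_abs]
  have e1 := T.abs_integral_remainder_le hB0 hB (hx k) (η k)
  have m1 := memLp_modulus_mul hB0 (hm k) (H10.memLp_norm_jet ζ)
  have m2 := memLp_modulus_mul hB0 (hm k) (H10.memLp_norm_jet (x k))
  have i1 : Integrable (fun t => (modulus L B t (H10.jet (x k) t) * ‖H10.jet (x k) t‖) *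
      ‖H10.jet (η k) t‖) unitMeasure := m2.integrable_mul (H10.memLp_norm_jet _)
  have i2 : Integrable (fun t => (modulus L B t (H10.jet (x k) t) * ‖H10.jet ζ t‖) *
      ‖H10.jet (x k) t‖) unitMeasure := m1.integrable_mul (H10.memLp_norm_jet _)
  have i3 : Integrable (fun t => ‖H10.jet (x k) t‖ * ‖H10.jet (η k - ζ) t‖) unitMeasure :=
    (H10.memLp_norm_jet _).integrable_mul (H10.memLp_norm_jet _)
  -- Split the direction into its limit `ζ` and the error `η k - ζ`. With `ζ` the modulus multiplies
  -- a fixed square integrable function; with the error it is bounded by `B`, and the error is small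
  -- in norm. The jet of `x k` itself only enters through its L² size.
  have e2 : ∫ t, (modulus L B t (H10.jet (x k) t) * ‖H10.jet (x k) t‖) * ‖H10.jet (η k) t‖
      ∂unitMeasure ≤ ∫ t, ((modulus L B t (H10.jet (x k) t) * ‖H10.jet ζ t‖) *
        ‖H10.jet (x k) t‖ + B * (‖H10.jet (x k) t‖ * ‖H10.jet (η k - ζ) t‖)) ∂unitMeasure := by
    refine integral_mono_ae i1 (i2.add (i3.const_mul B)) ?_
    filter_upwards [H10.jet_sub (η k) ζ] with t ht
    have h1 : ‖H10.jet (η k) t‖ ≤ ‖H10.jet ζ t‖ + ‖H10.jet (η k - ζ) t‖ := by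
      rw [ht]
      exact norm_le_norm_add_norm_sub' _ _
    have h2 := modulus_nonneg (L := L) hB0 t (H10.jet (x k) t)
    have h3 := modulus_le (L := L) B t (H10.jet (x k) t)
    have h4 := norm_nonneg (H10.jet (x k) t)
    have h5 := norm_nonneg (H10.jet (η k - ζ) t)
    calc modulus L B t (H10.jet (x k) t) * ‖H10.jet (x k) t‖ * ‖H10.jet (η k) t‖
        ≤ modulus L B t (H10.jet (x k) t) * ‖H10.jet (x k) t‖ *
          (‖H10.jet ζ t‖ + ‖H10.jet (η k - ζ) t‖) := by gcongr
      _ = modulus L B t (H10.jet (x k) t) * ‖H10.jet ζ t‖ * ‖H10.jet (x k) t‖ +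
          modulus L B t (H10.jet (x k) t) * (‖H10.jet (x k) t‖ * ‖H10.jet (η k - ζ) t‖) := by ring
      _ ≤ _ := by gcongr
  rw [integral_add i2 (i3.const_mul B), integral_const_mul] at e2
  have e3 := H10.integral_mul_norm_jet_le m1 (x k)
  have e4 := (H10.integral_mul_norm_jet_le (H10.memLp_norm_jet (x k)) (η k - ζ)).trans
    (mul_le_mul_of_nonneg_right (H10.sqrt_integral_norm_jet_sq_le (x k)) (by positivity))
  have e5 := mul_le_mul_of_nonneg_left e4 hB0
  nlinarith [e1, e2, e3, e5]

/-- Here u is the future weak limit, w the weakly null part, and r(u + w) the small curve. The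
velocity is moved from r(u' + w') to ru' by monotonicity, which costs nothing and yields c‖w'‖².
Only at the velocity ru', where u' is fixed, is the differential expanded at the origin; there the
modulus can be controlled by dominated convergence. All other terms carry a position factor w or an
extra power of r. -/
theorem lagrangian_lower_bound (T : TameLagrangian L ρ c C) {M B : ℝ}
    (hM : ∀ t ∈ Icc (0 : ℝ) 1, ‖hessAtZero L t‖ ≤ M)
    (hB : ∀ t ∈ Icc (0 : ℝ) 1, ∀ q ∈ Metric.ball (0 : Euc n) ρ, ∀ y w w',
      |remainder L t (q, y) (w, w')| ≤
        modulus L B t (q, y) * ‖(q, y)‖ * (2 * ‖(w, w')‖) + B * ‖y‖ ^ 2 * ‖w‖)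
    (hB0 : 0 ≤ B) {t : ℝ} (ht : t ∈ Icc (0 : ℝ) 1) {r : ℝ} (hr : 0 < r)
    (u u' w w' : Euc n) {b : ℝ} (hb : ‖w‖ ≤ b) (huw : ‖u + w‖ ≤ 1) (hur : r < ρ) :
    r * (c * ‖w'‖ ^ 2 + hessAtZero L t (u, u') (0, w') - M * (‖w'‖ * ‖w‖) -
        2 * (modulus L B t (r • (u + w), r • u') * (1 + ‖(u, u')‖) * ‖w'‖) -
        3 * C * ((1 + ‖u' + w'‖) * ‖w‖) - 3 * C * r * b * ‖u' + w'‖ ^ 2) ≤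
      phaseDeriv L t (r • (u + w), r • (u' + w')) (w, w') - phaseDeriv L t (0, 0) (w, w') := by
  have hq : r • (u + w) ∈ Metric.ball (0 : Euc n) ρ := by
    rw [mem_ball_zero_iff, norm_smul, Real.norm_of_nonneg hr.le]
    nlinarith [norm_nonneg (u + w)]
  have hqn : ‖r • (u + w)‖ ≤ r := by
    rw [norm_smul, Real.norm_of_nonneg hr.le]
    nlinarith [norm_nonneg (u + w)]
  have hyn : ‖r • (u' + w')‖ = r * ‖u' + w'‖ := by rw [norm_smul, Real.norm_of_nonneg hr.le]
  have hC := T.bound_nonneg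
  have a1 : r * (c * ‖w'‖ ^ 2) ≤ phaseDeriv L t (r • (u + w), r • (u' + w')) (0, w') -
      phaseDeriv L t (r • (u + w), r • u') (0, w') := by
    have h := T.monotone_snd t ht _ hq (r • (u' + w')) (r • u')
    have e : r • (u' + w') - r • u' = r • w' := by module
    have h7 : ∀ f : (Euc n × Euc n) →L[ℝ] ℝ, f (0, r • w') = r * f (0, w') := fun f => by
      have : ((0 : Euc n), r • w') = r • ((0 : Euc n), w') := by simp
      rw [this, map_smul, smul_eq_mul]
    rw [e, h7, h7, norm_smul, Real.norm_of_nonneg hr.le] at h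
    refine le_of_mul_le_mul_left ?_ hr
    nlinarith [h]
  have a2 : phaseDeriv L t (r • (u + w), r • u') (0, w') - phaseDeriv L t (0, 0) (0, w') =
      r * (hessAtZero L t (u, u') (0, w') + hessAtZero L t (w, 0) (0, w')) +
        remainder L t (r • (u + w), r • u') (0, w') := by
    have e : (r • (u + w), r • u') = r • ((u, u') + (w, (0 : Euc n))) := by simp
    have e2 : remainder L t (r • (u + w), r • u') (0, w') =
      phaseDeriv L t (r • (u + w), r • u') (0, w') - phaseDeriv L t (0, 0) (0, w') -
        hessAtZero L t (r • (u + w), r • u') (0, w') := rfl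
    rw [e2, e, map_smul, map_add]
    simp only [_root_.smul_apply, add_apply, smul_eq_mul]
    ring
  have a3 : |hessAtZero L t (w, 0) (0, w')| ≤ M * (‖w'‖ * ‖w‖) := by
    have := (hessAtZero L t).le_opNorm₂ (w, 0) (0, w')
    have e1 : ‖((w, 0) : Euc n × Euc n)‖ = ‖w‖ := by simp
    have e2 : ‖((0, w') : Euc n × Euc n)‖ = ‖w'‖ := by simp
    rw [e1, e2] at this
    refine this.trans ?_
    rw [mul_comm ‖w'‖, ← mul_assoc]
    gcongr
    exact hM t ht
  have a4 : |remainder L t (r • (u + w), r • u') (0, w')| ≤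
      r * (2 * (modulus L B t (r • (u + w), r • u') * (1 + ‖(u, u')‖) * ‖w'‖)) := by
    have h := hB t ht _ hq (r • u') 0 w'
    have e2 : ‖((0, w') : Euc n × Euc n)‖ = ‖w'‖ := by simp
    rw [e2, norm_zero, mul_zero, add_zero] at h
    refine h.trans ?_
    have h1 : ‖(r • (u + w), r • u')‖ ≤ r * (1 + ‖(u, u')‖) := by
      rw [Prod.norm_mk]
      refine max_le (hqn.trans ?_) ?_
      · nlinarith [norm_nonneg (u, u')]
      · rw [norm_smul, Real.norm_of_nonneg hr.le]
        have : ‖u'‖ ≤ ‖(u, u')‖ := norm_snd_le (u, u')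
        gcongr
        linarith
    have h2 := modulus_nonneg (L := L) hB0 t (r • (u + w), r • u')
    calc _ ≤ modulus L B t (r • (u + w), r • u') * (r * (1 + ‖(u, u')‖)) * (2 * ‖w'‖) := by
            gcongr
      _ = _ := by ring
  -- The position derivative contains r²‖u' + w'‖², merely integrable. It is paired with the uniform
  -- bound `b` of `w` rather than with its L² norm, and keeps a spare factor r.
  have a5 : |phaseDeriv L t (r • (u + w), r • (u' + w')) (w, 0) - phaseDeriv L t (0, 0) (w, 0)| ≤
      r * (3 * C * ((1 + ‖u' + w'‖) * ‖w‖) + 3 * C * r * b * ‖u' + w'‖ ^ 2) := by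
    refine (T.abs_deriv_sub_zero_fst ht hq (r • (u' + w')) w).trans ?_
    rw [hyn]
    have h1 : 3 * C * (‖r • (u + w)‖ + r * ‖u' + w'‖ + (r * ‖u' + w'‖) ^ 2) * ‖w‖ ≤
        3 * C * (r + r * ‖u' + w'‖ + (r * ‖u' + w'‖) ^ 2) * ‖w‖ := by gcongr
    have h2 : 3 * C * (r * ‖u' + w'‖) ^ 2 * ‖w‖ ≤ 3 * C * (r * ‖u' + w'‖) ^ 2 * b := by gcongr
    nlinarith [h1, h2]
  rw [clm_prod_apply _ (w, w'), clm_prod_apply (phaseDeriv L t (0, 0)) (w, w')]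
  have b3 := neg_le_of_abs_le a3
  have b4 := neg_le_of_abs_le a4
  have b5 := neg_le_of_abs_le a5
  have b3' := mul_le_mul_of_nonneg_left b3 hr.le
  nlinarith [a1, a2, b3', b4, b5]

theorem memLp_one_add_norm_vel (v : H10 n) :
    MemLp (fun t => 1 + ‖H10.vel v t‖) 2 unitMeasure :=
  (memLp_const (1 : ℝ)).add (H10.memLp_norm_vel v)

theorem memLp_one_add_norm_jet (u : H10 n) :
    MemLp (fun t => 1 + ‖H10.jet u t‖) 2 unitMeasure :=
  (memLp_const (1 : ℝ)).add (H10.memLp_norm_jet u)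

theorem smul_curve_mem_ball {r : ℝ} (hr : 0 < r) (hrρ : r < ρ) {v : H10 n} (hv : ‖v‖ = 1) {t : ℝ}
    (ht : t ∈ Icc (0 : ℝ) 1) : r • H10.curve v t ∈ Metric.ball (0 : Euc n) ρ := by
  rw [mem_ball_zero_iff, norm_smul, Real.norm_of_nonneg hr.le]
  have := H10.norm_curve_le v ht
  rw [hv] at this
  nlinarith [norm_nonneg (H10.curve v t)]

theorem aestronglyMeasurable_modulus_smul (T : TameLagrangian L ρ c C) (B : ℝ) {r : ℝ}
    (hr : 0 < r) (hrρ : r < ρ) {v : H10 n} (hv : ‖v‖ = 1) (u : H10 n) :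
    AEStronglyMeasurable
      (fun t => modulus L B t (r • H10.curve v t, r • H10.vel u t)) unitMeasure :=
  T.aestronglyMeasurable_modulus ((H10.aestronglyMeasurable_curve v).const_smul r)
    ((H10.aestronglyMeasurable_vel u).const_smul r)
    (fun _ ht => smul_curve_mem_ball hr hrρ hv ht) B

theorem integrable_hess_jet_vel (T : TameLagrangian L ρ c C) (u w : H10 n) :
    Integrable (fun t => hessAtZero L t (H10.jet u t) (0, H10.vel w t)) unitMeasure := by
  have h := FormField.integrable (FormField.continuousOn_velRight T.continuousOn_hess)
    (H10.memLp_jet u) (H10.memLp_jet w)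
  simp only [FormField.velRight_apply] at h
  exact h

theorem integral_combination_le {f₁ f₂ f₃ f₄ f₅ f₆ g₁ g₀ : ℝ → ℝ} {a b d e r : ℝ}
    (h₁ : Integrable f₁ unitMeasure) (h₂ : Integrable f₂ unitMeasure)
    (h₃ : Integrable f₃ unitMeasure) (h₄ : Integrable f₄ unitMeasure)
    (h₅ : Integrable f₅ unitMeasure) (h₆ : Integrable f₆ unitMeasure)
    (k₁ : Integrable g₁ unitMeasure) (k₀ : Integrable g₀ unitMeasure)
    (h : ∀ᵐ t ∂unitMeasure,
      r * (a * f₁ t + f₂ t - b * f₃ t - 2 * f₄ t - d * f₅ t - e * f₆ t) ≤ g₁ t - g₀ t) :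
    r * (a * (∫ t, f₁ t ∂unitMeasure) + (∫ t, f₂ t ∂unitMeasure) - b * (∫ t, f₃ t ∂unitMeasure) -
      2 * (∫ t, f₄ t ∂unitMeasure) - d * (∫ t, f₅ t ∂unitMeasure) -
      e * (∫ t, f₆ t ∂unitMeasure)) ≤ (∫ t, g₁ t ∂unitMeasure) - ∫ t, g₀ t ∂unitMeasure := by
  have m₀ := (h₁.const_mul a).add h₂
  have m₁ := m₀.sub (h₃.const_mul b)
  have m₂ := m₁.sub (h₄.const_mul 2)
  have m₃ := m₂.sub (h₅.const_mul d)
  have m₄ := m₃.sub (h₆.const_mul e)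
  have key := integral_mono_ae (m₄.const_mul r) (k₁.sub k₀) h
  rw [integral_const_mul, integral_sub' m₃ (h₆.const_mul e),
    integral_sub' m₂ (h₅.const_mul d), integral_sub' m₁ (h₄.const_mul 2),
    integral_sub' m₀ (h₃.const_mul b), integral_add' (h₁.const_mul a) h₂, integral_const_mul,
    integral_const_mul, integral_const_mul, integral_const_mul, integral_const_mul,
    integral_sub' k₁ k₀] at key
  exact key

/-- The pointwise bound is integrated along v = u + w, the differential at the zero curve drops out
by criticality, and everything is divided by r. The last error has become a multiple of r because
∫‖v̇‖² = 1. -/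
theorem integral_lower_bound (T : TameLagrangian L ρ c C) {M B : ℝ}
    (hM : ∀ t ∈ Icc (0 : ℝ) 1, ‖hessAtZero L t‖ ≤ M)
    (hB : ∀ t ∈ Icc (0 : ℝ) 1, ∀ q ∈ Metric.ball (0 : Euc n) ρ, ∀ y w w',
      |remainder L t (q, y) (w, w')| ≤
        modulus L B t (q, y) * ‖(q, y)‖ * (2 * ‖(w, w')‖) + B * ‖y‖ ^ 2 * ‖w‖)
    (hB0 : 0 ≤ B) {r : ℝ} (hr : 0 < r) (hrρ : r < ρ) {u v w : H10 n} (hv : ‖v‖ = 1)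
    (hw : w = v - u) {b : ℝ} (hb : ‖w‖ ≤ b) :
    c / 2 * ‖w‖ ^ 2 +
      ((1 / 2) * (∫ t, hessAtZero L t (H10.jet u t) (0, H10.vel w t) ∂unitMeasure) -
      M / 2 * (∫ t, ‖H10.vel w t‖ * ‖H10.curve w t‖ ∂unitMeasure) -
      (∫ t, (modulus L B t (r • H10.curve v t, r • H10.vel u t) * (1 + ‖H10.jet u t‖)) *
        ‖H10.vel w t‖ ∂unitMeasure) -
      3 * C / 2 * (∫ t, (1 + ‖H10.vel v t‖) * ‖H10.curve w t‖ ∂unitMeasure) -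
      3 * C / 2 * b * r) ≤ actionDeriv L (r • v) w / r := by
  have hxk : ‖r • v‖ < ρ := by
    rw [norm_smul, hv, mul_one, Real.norm_of_nonneg hr.le]; exact hrρ
  have j1 := T.integrable_deriv_jet hxk w
  have j0 := T.integrable_deriv_jet (x := 0) (by simpa using T.radius_pos) w
  have iw := H10.integrable_norm_vel_sq w
  have iv := H10.integrable_norm_vel_sq v
  have i0 : Integrable (fun t => hessAtZero L t (H10.jet u t) (0, H10.vel w t)) unitMeasure :=
    T.integrable_hess_jet_vel u w
  have i1 : Integrable (fun t => ‖H10.vel w t‖ * ‖H10.curve w t‖) unitMeasure :=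
    (H10.memLp_norm_vel _).integrable_mul (H10.memLp_norm_curve _)
  have i2 : Integrable (fun t => (modulus L B t (r • H10.curve v t, r • H10.vel u t) *
      (1 + ‖H10.jet u t‖)) * ‖H10.vel w t‖) unitMeasure :=
    (memLp_modulus_mul hB0 (T.aestronglyMeasurable_modulus_smul B hr hrρ hv u)
      (memLp_one_add_norm_jet u)).integrable_mul (H10.memLp_norm_vel _)
  have i3 : Integrable (fun t => (1 + ‖H10.vel v t‖) * ‖H10.curve w t‖) unitMeasure :=
    (memLp_one_add_norm_vel v).integrable_mul (H10.memLp_norm_curve _)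
  have key := integral_combination_le iw i0 i1 i2 i3 iv j1 j0 (a := c) (b := M) (d := 3 * C)
    (e := 3 * C * r * b) (r := r) (by
    filter_upwards [ae_unitMeasure_mem, H10.jet_smul r v, H10.vel_sub v u,
      H10.jet_smul (0 : ℝ) (0 : H10 n)] with t ht h1 h2 h0
    rw [zero_smul, zero_smul] at h0
    have hvk : H10.vel v t = H10.vel u t + H10.vel w t := by rw [hw, h2]; abel
    have hck : H10.curve v t = H10.curve u t + H10.curve w t := by
      rw [hw, H10.curve_sub v u ht]; abel
    have hlow := T.lagrangian_lower_bound hM hB hB0 ht hr (H10.curve u t) (H10.vel u t)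
      (H10.curve w t) (H10.vel w t) ((H10.norm_curve_le w ht).trans hb)
      (by rw [← hck]; exact (H10.norm_curve_le v ht).trans hv.le) hrρ
    rw [← hvk, ← hck] at hlow
    rw [h1, h0]
    exact hlow)
  have hA0 := T.actionDeriv_zero w
  rw [actionDeriv] at hA0
  rw [H10.integral_norm_vel_sq, H10.integral_norm_vel_sq, hv] at key
  rw [le_div_iff₀ hr, actionDeriv]
  clear j1 j0 iw iv i0 i1 i2 i3 hM hB
  generalize (∫ t, hessAtZero L t (H10.jet u t) (0, H10.vel w t) ∂unitMeasure) = X2 at *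
  generalize (∫ t, ‖H10.vel w t‖ * ‖H10.curve w t‖ ∂unitMeasure) = X3 at *
  generalize (∫ t, (modulus L B t (r • H10.curve v t, r • H10.vel u t) * (1 + ‖H10.jet u t‖)) *
        ‖H10.vel w t‖ ∂unitMeasure) = X4 at *
  generalize (∫ t, (1 + ‖H10.vel v t‖) * ‖H10.curve w t‖ ∂unitMeasure) = X5 at *
  linarith only [key, hA0]

theorem tendsto_integral_one_add_norm_vel {v w : ℕ → H10 n} (hv : ∀ k, ‖v k‖ = 1) {b : ℝ}
    (hb : ∀ k, ‖w k‖ ≤ b)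
    (hw0 : ∀ f : H10 n →L[ℝ] ℝ, Tendsto (fun k => f (w k)) atTop (𝓝 0)) :
    Tendsto (fun k => ∫ t, (1 + ‖H10.vel (v k) t‖) * ‖H10.curve (w k) t‖ ∂unitMeasure)
      atTop (𝓝 0) := by
  -- The value 4 is ∫(2 + 2‖v̇‖²), which dominates the square of 1 + ‖v̇‖.
  refine H10.tendsto_integral_mul_norm_curve hb hw0 (R' := 4)
    (fun k => memLp_one_add_norm_vel (v k)) (fun k t => by positivity) (fun k => ?_)
  have iv := H10.integrable_norm_vel_sq (v k)
  have h : ∫ t, (1 + ‖H10.vel (v k) t‖) ^ 2 ∂unitMeasure ≤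
      ∫ t, (2 + 2 * ‖H10.vel (v k) t‖ ^ 2) ∂unitMeasure := by
    refine integral_mono (memLp_one_add_norm_vel (v k)).integrable_sq
      ((integrable_const 2).add (iv.const_mul 2)) fun t => ?_
    simp only
    nlinarith [sq_nonneg (1 - ‖H10.vel (v k) t‖)]
  rw [integral_add (integrable_const _) (iv.const_mul 2), integral_const_mul,
    H10.integral_norm_vel_sq, hv k, integral_const, probReal_univ, one_smul] at h
  linarith

theorem tendsto_integral_modulus_smul (T : TameLagrangian L ρ c C) {B : ℝ} (hB0 : 0 ≤ B)
    {r : ℕ → ℝ} (hr : ∀ k, 0 < r k) (hrρ : ∀ k, r k < ρ) (hr0 : Tendsto r atTop (𝓝 0))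
    {v w : ℕ → H10 n} (hv : ∀ k, ‖v k‖ = 1) (u : H10 n) {b : ℝ} (hb : ∀ k, ‖w k‖ ≤ b) :
    Tendsto (fun k => ∫ t, (modulus L B t (r k • H10.curve (v k) t, r k • H10.vel u t) *
      (1 + ‖H10.jet u t‖)) * ‖H10.vel (w k) t‖ ∂unitMeasure) atTop (𝓝 0) := by
  have hzm : ∀ k, AEStronglyMeasurable
      (fun t => modulus L B t (r k • H10.curve (v k) t, r k • H10.vel u t)) unitMeasure := fun k =>
    T.aestronglyMeasurable_modulus_smul B (hr k) (hrρ k) (hv k) u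
  -- The velocities of the `v k` do not occur: the positions are bounded by `r k`, and the velocity
  -- is `r k` times a fixed function. Pointwise convergence therefore needs no further subsequence.
  have hz0 : ∀ᵐ t ∂unitMeasure, Tendsto
      (fun k => (r k • H10.curve (v k) t, r k • H10.vel u t)) atTop (𝓝 0) := by
    filter_upwards [ae_unitMeasure_mem] with t ht
    refine Tendsto.prodMk_nhds ?_ ?_
    · refine squeeze_zero_norm (fun k => ?_) hr0
      rw [norm_smul, Real.norm_of_nonneg (hr k).le]
      have := H10.norm_curve_le (v k) ht
      rw [hv k] at this
      nlinarith [hr k]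
    · simpa using hr0.smul_const (H10.vel u t)
  have hdct := T.tendsto_integral_modulus (l := atTop) hB0 (Eventually.of_forall hzm) hz0
    (memLp_one_add_norm_jet u)
  have h := hdct.sqrt.mul_const b
  rw [Real.sqrt_zero, zero_mul] at h
  refine squeeze_zero (fun k => integral_nonneg fun t => ?_) (fun k => ?_) h
  · exact mul_nonneg (mul_nonneg (modulus_nonneg hB0 _ _) (by positivity)) (norm_nonneg _)
  · refine (integral_mul_le_sqrt (memLp_modulus_mul hB0 (hzm k) (memLp_one_add_norm_jet u))
      (H10.memLp_norm_vel (w k))).trans ?_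
    rw [H10.integral_norm_vel_sq, Real.sqrt_sq (norm_nonneg _)]
    exact mul_le_mul_of_nonneg_left (hb k) (Real.sqrt_nonneg _)

/-- The errors vanish for separate reasons: the linear term is a bounded functional of a weakly null
sequence, two terms contain the curve of v_k − u, the modulus term obeys dominated convergence, and
the last one is a multiple of r_k. -/
theorem actionDeriv_lower_bound (T : TameLagrangian L ρ c C) {r : ℕ → ℝ} (hr : ∀ k, 0 < r k)
    (hrρ : ∀ k, r k < ρ) (hr0 : Tendsto r atTop (𝓝 0)) {v : ℕ → H10 n} (hv : ∀ k, ‖v k‖ = 1)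
    {u : H10 n} (hvu : ∀ f : H10 n →L[ℝ] ℝ, Tendsto (fun k => f (v k)) atTop (𝓝 (f u))) :
    ∃ e : ℕ → ℝ, Tendsto e atTop (𝓝 0) ∧
      ∀ k, c / 2 * ‖v k - u‖ ^ 2 + e k ≤ actionDeriv L (r k • v k) (v k - u) / r k := by
  obtain ⟨B, hB0, hB⟩ := T.exists_remainder_bound
  obtain ⟨M, hM0, hM⟩ := FormField.exists_bound T.continuousOn_hess
  have hb : ∀ k, ‖v k - u‖ ≤ 1 + ‖u‖ := fun k => (norm_sub_le _ _).trans (by rw [hv k])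
  have hw0 : ∀ f : H10 n →L[ℝ] ℝ, Tendsto (fun k => f (v k - u)) atTop (𝓝 0) := fun f => by
    simpa using (hvu f).sub_const (f u)
  have l0 : Tendsto (fun k => (1 / 2) *
      ∫ t, hessAtZero L t (H10.jet u t) (0, H10.vel (v k - u) t) ∂unitMeasure) atTop (𝓝 0) :=
    hw0 (integralForm (FormField.velRight (hessAtZero L))
      (FormField.continuousOn_velRight T.continuousOn_hess) u)
  have l1 := H10.tendsto_integral_mul_norm_curve hb hw0 (R' := (1 + ‖u‖) ^ 2)
    (f := fun k t => ‖H10.vel (v k - u) t‖)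
    (fun k => H10.memLp_norm_vel _) (fun k t => norm_nonneg _)
    (fun k => by rw [H10.integral_norm_vel_sq]; gcongr; exact hb k)
  have l2 := T.tendsto_integral_modulus_smul hB0 hr hrρ hr0 hv u hb
  have l3 := tendsto_integral_one_add_norm_vel hv hb hw0
  have l4 := (((l0.sub (l1.const_mul (M / 2))).sub l2).sub (l3.const_mul (3 * C / 2))).sub
    (hr0.const_mul (3 * C / 2 * (1 + ‖u‖)))
  simp only [mul_zero, sub_zero] at l4
  exact ⟨_, l4, fun k => T.integral_lower_bound hM hB hB0 (hr k) (hrρ k) (hv k) rfl (hb k)⟩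

/-- Blow-up by contradiction. The decomposition A v_k = (v_k − u) + (u + K v_k) separates the
direction on which convexity acts from the one on which the differential can be linearized. -/
theorem exists_actionDeriv_hessOp_ge (T : TameLagrangian L ρ c C) (hN : NonConjugate L) :
    ∃ μ, 0 < μ ∧ ∃ r, 0 < r ∧ r ≤ ρ ∧ ∀ x : H10 n, ‖x‖ < r →
      μ * ‖x‖ ^ 2 ≤ actionDeriv L x (T.hessOp x) := by
  by_contra hcon
  push Not at hcon
  have hρ := T.radius_pos
  have hc := T.convexity_pos
  have hseq : ∀ k : ℕ, ∃ x : H10 n, ‖x‖ < min ρ (1 / (k + 1 : ℝ)) ∧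
      actionDeriv L x (T.hessOp x) < 1 / (k + 1 : ℝ) * ‖x‖ ^ 2 := fun k =>
    hcon (1 / (k + 1 : ℝ)) (by positivity) (min ρ (1 / (k + 1 : ℝ)))
      (lt_min hρ (by positivity)) (min_le_left _ _)
  choose x hx hlt using hseq
  have hxρ : ∀ k, ‖x k‖ < ρ := fun k => (hx k).trans_le (min_le_left _ _)
  have hx0 : ∀ k, x k ≠ 0 := fun k h => by
    have := hlt k
    rw [h, map_zero, T.actionDeriv_zero] at this
    simp at this
  have hxl : Tendsto (fun k => ‖x k‖) atTop (𝓝 0) :=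
    squeeze_zero (fun k => norm_nonneg _) (fun k => ((hx k).trans_le (min_le_right _ _)).le)
      tendsto_one_div_add_atTop_nhds_zero_nat
  have hxp : ∀ k, 0 < ‖x k‖ := fun k => norm_pos_iff.2 (hx0 k)
  obtain ⟨u, φ, hφ, hu⟩ := exists_subseq_weakly_tendsto (R := 1) (fun k => ‖x k‖⁻¹ • x k)
    (fun k => by rw [norm_smul, norm_inv, norm_norm, inv_mul_cancel₀ (hxp k).ne'])
  -- Norm convergence to zero in L² gives velocities tending to zero almost everywhere after passing
  -- to a further subsequence; this feeds dominated convergence for the remainder.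
  have hLp : Tendsto (fun k => (x (φ k) : LTwo n)) atTop (𝓝 0) := by
    rw [tendsto_zero_iff_norm_tendsto_zero]
    exact hxl.comp hφ.tendsto_atTop
  obtain ⟨ψ, hψ, hae⟩ := (tendstoInMeasure_of_tendsto_Lp hLp).exists_seq_tendsto_ae
  set σ : ℕ → ℕ := fun k => φ (ψ k) with hσ
  have hσt : Tendsto σ atTop atTop := hφ.tendsto_atTop.comp hψ.tendsto_atTop
  set r : ℕ → ℝ := fun k => ‖x (σ k)‖ with hr
  set v : ℕ → H10 n := fun k => ‖x (σ k)‖⁻¹ • x (σ k) with hv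
  have hrp : ∀ k, 0 < r k := fun k => hxp _
  have hrl : Tendsto r atTop (𝓝 0) := hxl.comp hσt
  have hv1 : ∀ k, ‖v k‖ = 1 := fun k => by
    rw [hv]; simp only; rw [norm_smul, norm_inv, norm_norm, inv_mul_cancel₀ (hxp _).ne']
  have hrv : ∀ k, r k • v k = x (σ k) := fun k => by
    simp only [hr, hv, smul_smul]
    rw [mul_inv_cancel₀ (hxp _).ne', one_smul]
  have hvu : ∀ f : H10 n →L[ℝ] ℝ, Tendsto (fun k => f (v k)) atTop (𝓝 (f u)) := fun f =>
    (hu f).comp hψ.tendsto_atTop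
  have hrρ : ∀ k, r k < ρ := fun k => hxρ _
  have hxσ : Tendsto (fun k => ‖x (σ k)‖) atTop (𝓝 0) := hrl
  clear_value v r
  obtain ⟨e, he, hlow⟩ := T.actionDeriv_lower_bound hrp hrρ hrl hv1 hvu
  set K := T.hessOp - ContinuousLinearMap.id ℝ (H10 n) with hK
  have hAK : ∀ y, T.hessOp y = y + K y := fun y => by simp [hK]
  have hKv : Tendsto (fun k => K (v k)) atTop (𝓝 (K u)) := by
    have h := T.tendsto_hessOp_sub_id (fun k => v k - u) (1 + ‖u‖)
      (fun k => (norm_sub_le _ _).trans (by rw [hv1 k]))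
      (fun f => by simpa using (hvu f).sub_const (f u))
    have h2 := h.add_const (K u)
    simp only [map_sub, zero_add] at h2
    simpa [hK] using h2
  -- Compactness of K enters here: weak convergence of `v k` becomes strong convergence of `K (v
  -- k)`, and the limit u + Ku is Au.
  have hη : Tendsto (fun k => u + K (v k)) atTop (𝓝 (T.hessOp u)) := by
    rw [hAK u]
    exact hKv.const_add u
  have hjet : ∀ᵐ t ∂unitMeasure, Tendsto (fun k => H10.jet (x (σ k)) t) atTop (𝓝 0) := by
    have h0 := Lp.coeFn_zero (Euc n) 2 unitMeasure
    filter_upwards [hae, ae_unitMeasure_mem, h0] with t h1 ht h0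
    rw [h0] at h1
    refine Tendsto.prodMk_nhds ?_ h1
    exact squeeze_zero_norm (fun k => H10.norm_curve_le _ ht) hxσ
  have hrem := T.tendsto_remainder_div (fun k => hxρ (σ k)) (fun k => hx0 (σ k)) hxσ hjet hη
  have hform : Tendsto (fun k => T.hessForm (v k) (u + K (v k))) atTop
      (𝓝 (T.hessForm u (T.hessOp u))) := by
    obtain ⟨M, hM0, hM⟩ := integralForm_bound T.continuousOn_hess
    have h1 : Tendsto (fun k => T.hessForm (v k) (T.hessOp u)) atTop
        (𝓝 (T.hessForm u (T.hessOp u))) := hvu (T.hessForm.flip (T.hessOp u))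
    have h2 : Tendsto (fun k => T.hessForm (v k) (u + K (v k) - T.hessOp u)) atTop (𝓝 0) := by
      have h3 : Tendsto (fun k => M * ‖u + K (v k) - T.hessOp u‖) atTop (𝓝 0) := by
        have := ((hη.sub_const (T.hessOp u)).norm).const_mul M
        simpa using this
      refine squeeze_zero_norm (fun k => ?_) h3
      have := hM (v k) (u + K (v k) - T.hessOp u)
      rwa [hv1 k, mul_one] at this
    have := h1.add h2
    rw [add_zero] at this
    refine this.congr fun k => ?_
    rw [← map_add]
    congr 1
    abel
  -- In the strongly convergent direction the differential is its linear part up to o(1), so the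
  -- limit is Q(u, Au), which equals ⟨Au, Au⟩.
  have hstrong : Tendsto (fun k => actionDeriv L (x (σ k)) (u + K (v k)) / r k) atTop
      (𝓝 (T.spForm (T.hessOp u) (T.hessOp u))) := by
    rw [T.spForm_hessOp]
    have := hform.add (hrem.const_mul (1 / 2))
    rw [mul_zero, add_zero] at this
    refine this.congr fun k => ?_
    rw [(T.actionDeriv_eq (hxρ (σ k)) _).2, add_div, mul_div_assoc]
    have e1 : T.hessForm (x (σ k)) (u + K (v k)) = r k * T.hessForm (v k) (u + K (v k)) := by
      have : T.hessForm (x (σ k)) = r k • T.hessForm (v k) := by rw [← hrv k, map_smul]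
      rw [this]
      rfl
    rw [e1, mul_div_cancel_left₀ _ (hrp k).ne', congrFun hr k]
  -- The negated estimate divided by ‖x‖²: one factor normalizes the direction Ax to Av, the other
  -- normalizes the differential.
  have hup : ∀ k, c / 2 * ‖v k - u‖ ^ 2 + e k + actionDeriv L (x (σ k)) (u + K (v k)) / r k ≤
      1 / ((σ k : ℝ) + 1) := fun k => by
    obtain ⟨D, hD⟩ := T.exists_actionDeriv_clm (hxρ (σ k))
    have h1 := hlow k
    rw [hrv k] at h1
    have h2 : actionDeriv L (x (σ k)) (v k - u) + actionDeriv L (x (σ k)) (u + K (v k)) =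
        actionDeriv L (x (σ k)) (T.hessOp (x (σ k))) / r k := by
      have h3 : T.hessOp (x (σ k)) = r k • T.hessOp (v k) := by rw [← map_smul, hrv k]
      rw [← hD, ← hD, ← hD, h3, D.map_smul, smul_eq_mul, mul_div_cancel_left₀ _ (hrp k).ne',
        ← map_add, hAK (v k)]
      congr 1
      abel
    have h4 : actionDeriv L (x (σ k)) (T.hessOp (x (σ k))) / r k / r k ≤ 1 / ((σ k : ℝ) + 1) := by
      rw [div_div, div_le_iff₀ (mul_pos (hrp k) (hrp k))]
      have := (hlt (σ k)).le
      rw [pow_two] at this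
      rw [congrFun hr k]
      exact this
    have h5 : actionDeriv L (x (σ k)) (v k - u) / r k +
        actionDeriv L (x (σ k)) (u + K (v k)) / r k ≤ 1 / ((σ k : ℝ) + 1) := by
      rw [← add_div, h2]; exact h4
    linarith
  have hlim : Tendsto (fun k => 1 / ((σ k : ℝ) + 1) - e k -
      actionDeriv L (x (σ k)) (u + K (v k)) / r k) atTop
      (𝓝 (-T.spForm (T.hessOp u) (T.hessOp u))) := by
    have := ((tendsto_one_div_add_atTop_nhds_zero_nat (𝕜 := ℝ)).comp hσt).sub he |>.sub hstrong
    simpa using this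
  -- Dropping the nonnegative convexity term and passing to the limit leaves ⟨Au, Au⟩ ≤ 0.
  have hnn : 0 ≤ -T.spForm (T.hessOp u) (T.hessOp u) :=
    ge_of_tendsto' hlim fun k => by nlinarith [hup k, sq_nonneg ‖v k - u‖]
  have hAu : T.hessOp u = 0 := by
    have h1 := T.spForm_ge (T.hessOp u)
    have h2 : ‖T.hessOp u‖ ^ 2 ≤ 0 := by
      by_contra h
      push Not at h
      nlinarith
    simpa using h2
  have hu0 := T.eq_zero_of_hessOp_eq_zero hN hAu
  rw [hAu, map_zero] at hlim
  -- Now u = 0, so the convexity term is c/2 for every index, since the `v k` are unit vectors,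
  -- while the upper bound tends to zero.
  have hcl : c / 2 ≤ -(0 : H10 n →L[ℝ] ℝ) 0 :=
    ge_of_tendsto' hlim fun k => by
      have := hup k
      rw [hu0, sub_zero, hv1 k] at this
      rw [hu0]
      linarith
  simp at hcl
  linarith

/-- Here the modulus is just bounded by `B`, and ‖x‖² ≤ ‖x‖ on the ball. The remainder then
contributes at most (8B + B)/2, rounded up to 5B. -/
theorem exists_norm_actionDeriv_le (T : TameLagrangian L ρ c C) :
    ∃ M, 0 ≤ M ∧ ∀ x : H10 n, ‖x‖ < ρ → ∀ η, |actionDeriv L x η| ≤ M * ‖x‖ * ‖η‖ := by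
  obtain ⟨B, hB0, hB⟩ := T.exists_remainder_bound
  obtain ⟨M, hM0, hM⟩ := integralForm_bound T.continuousOn_hess
  refine ⟨M + 5 * B, by positivity, fun x hx η => ?_⟩
  rw [(T.actionDeriv_eq hx η).2]
  have h1 := T.abs_integral_remainder_le hB0 hB hx η
  have i1 : Integrable (fun t => (modulus L B t (H10.jet x t) * ‖H10.jet x t‖) * ‖H10.jet η t‖)
    unitMeasure := (memLp_modulus_mul hB0 (T.aestronglyMeasurable_modulus_jet hx B)
      (H10.memLp_norm_jet x)).integrable_mul (H10.memLp_norm_jet η)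
  have i2 : Integrable (fun t => ‖H10.jet x t‖ * ‖H10.jet η t‖) unitMeasure :=
    (H10.memLp_norm_jet _).integrable_mul (H10.memLp_norm_jet _)
  have h2 : ∫ t, (modulus L B t (H10.jet x t) * ‖H10.jet x t‖) * ‖H10.jet η t‖ ∂unitMeasure ≤
      ∫ t, B * (‖H10.jet x t‖ * ‖H10.jet η t‖) ∂unitMeasure := by
    refine integral_mono i1 (i2.const_mul B) fun t => ?_
    have := modulus_le (L := L) B t (H10.jet x t)
    simp only
    rw [← mul_assoc]
    gcongr
  rw [integral_const_mul] at h2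
  have h3 := (H10.integral_mul_norm_jet_le (H10.memLp_norm_jet x) η).trans
    (mul_le_mul_of_nonneg_right (H10.sqrt_integral_norm_jet_sq_le x) (by positivity))
  have h4 := mul_le_mul_of_nonneg_left h3 hB0
  have h5 := hM x η
  have hx1 : ‖x‖ ≤ 1 := hx.le.trans T.radius_le
  have h6 : B * ‖x‖ ^ 2 * ‖η‖ ≤ B * ‖x‖ * ‖η‖ := by
    have : ‖x‖ ^ 2 ≤ ‖x‖ := by nlinarith [norm_nonneg x]
    gcongr
  refine (abs_add_le _ _).trans ?_
  rw [abs_mul, abs_of_nonneg (by norm_num : (0 : ℝ) ≤ 1 / 2)]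
  have h7 : |T.hessForm x η| ≤ M * ‖x‖ * ‖η‖ := h5
  have h8 : 0 ≤ B * ‖x‖ * ‖η‖ := by positivity
  linarith [h1, h2, h4, h6, h7]

end TameLagrangian

end LowerBound

/-- The gradient estimate for an action functional that agrees near the zero curve with the
action of a tame Lagrangian. -/
theorem TameLagrangian.gradient_estimate {n : ℕ} {L : ℝ → Euc n → Euc n → ℝ} {ρ c C : ℝ}
    (T : TameLagrangian L ρ c C) (hN : NonConjugate L) {f : H10 n → ℝ}
    (hf : ∀ x, ‖x‖ < ρ → f x = action L x) :
    (∃ c C : ℝ, 0 < c ∧ ∀ x, c * ‖x‖ ^ 2 ≤ scalarProd L x x ∧ scalarProd L x x ≤ C * ‖x‖ ^ 2) ∧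
    ∃ A : H10 n →L[ℝ] H10 n,
      RepresentsSecondGateauxAtZero f (scalarProd L) A ∧
      (∃ K : H10 n →L[ℝ] H10 n, IsCompactOperator K ∧ A = ContinuousLinearMap.id ℝ (H10 n) + K) ∧
      ∀ 𝓑 ∈ 𝓝 (0 : H10 n), ∃ 𝓤 ∈ 𝓝 (0 : H10 n), 𝓤 ⊆ 𝓑 ∧ ∃ μ₀ : ℝ, 0 < μ₀ ∧
        ∀ x ∈ 𝓤, ∃ g : H10 n, IsGradientAt f (scalarProd L) x g ∧
          fderiv ℝ f x (A x) ≥ μ₀ * scalarProd L g g := by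
  have hc := T.convexity_pos
  have hfe : ∀ x : H10 n, ‖x‖ < ρ → f =ᶠ[𝓝 x] action L := fun x hx => by
    have : Metric.ball (0 : H10 n) ρ ∈ 𝓝 x := Metric.isOpen_ball.mem_nhds (by simpa using hx)
    filter_upwards [this] with y hy
    exact hf y (by simpa using hy)
  have hfd : ∀ x : H10 n, ‖x‖ < ρ → fderiv ℝ f x = fderiv ℝ (action L) x := fun x hx =>
    (hfe x hx).fderiv_eq
  obtain ⟨M, hM0, hM⟩ := T.spForm_le
  refine ⟨⟨c / 2, M, by linarith, fun x => ?_⟩, T.hessOp, ⟨?_, fun ξ => ?_⟩, ?_, ?_⟩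
  · rw [← T.spForm_apply]
    exact ⟨T.spForm_ge x, hM x⟩
  · filter_upwards [T.eventually_norm_lt] with x hx
    exact (T.differentiableAt_action hx).congr_of_eventuallyEq (hfe x hx)
  · refine ⟨T.hessForm ξ, ?_, fun η => ?_⟩
    · refine HasDerivAt.congr_of_eventuallyEq (𝕜 := ℝ) (F := H10 n →L[ℝ] ℝ)
        (T.hasDerivAt_fderiv_action ξ) ?_
      have hlim : Tendsto (fun s : ℝ => s • ξ) (𝓝 0) (𝓝 0) := by
        have : Continuous fun s : ℝ => s • ξ := by fun_prop
        simpa using this.tendsto 0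
      filter_upwards [hlim.eventually T.eventually_norm_lt] with s hs
      exact hfd _ hs
    · rw [← T.spForm_apply, T.spForm_hessOp]
  · exact ⟨_, T.isCompactOperator_hessOp_sub_id, by simp⟩
  · intro 𝓑 h𝓑
    obtain ⟨μ, hμ, r, hr, hrρ, hlow⟩ := T.exists_actionDeriv_hessOp_ge hN
    obtain ⟨B, hB0, hB⟩ := T.exists_norm_actionDeriv_le
    -- The gradient satisfies ‖g‖ ≤ (2/c)B‖x‖, so ⟨g, g⟩ is at most M((2/c)B)²‖x‖². The summand 1
    -- only keeps the denominator positive.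
    refine ⟨𝓑 ∩ Metric.ball 0 r, inter_mem h𝓑 (Metric.ball_mem_nhds _ hr), inter_subset_left,
      μ / (M * (2 / c * B) ^ 2 + 1), by positivity, fun x hx => ?_⟩
    have hxr : ‖x‖ < r := by simpa using hx.2
    have hxρ : ‖x‖ < ρ := hxr.trans_le hrρ
    obtain ⟨D, hD⟩ := T.exists_actionDeriv_clm hxρ
    have hDf := (T.hasFDerivAt_action hxρ D hD).congr_of_eventuallyEq (hfe x hxρ)
    obtain ⟨g, hg, hgn⟩ := T.exists_gradient D
    refine ⟨g, ⟨D, hDf, fun η => by rw [hg, T.spForm_apply]⟩, ?_⟩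
    rw [hDf.fderiv, hD, ← T.spForm_apply]
    refine le_trans ?_ (hlow x hxr)
    have hDn : ‖D‖ ≤ B * ‖x‖ := by
      refine ContinuousLinearMap.opNorm_le_bound _ (by positivity) fun η => ?_
      rw [hD]
      exact hB x hxρ η
    have hgx : ‖g‖ ≤ 2 / c * B * ‖x‖ := by
      have h1 := hgn.trans hDn
      calc ‖g‖ = 2 / c * (c / 2 * ‖g‖) := by field_simp
        _ ≤ 2 / c * (B * ‖x‖) := mul_le_mul_of_nonneg_left h1 (by positivity)
        _ = _ := by ring
    have hgg : T.spForm g g ≤ (M * (2 / c * B) ^ 2 + 1) * ‖x‖ ^ 2 := by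
      have h1 : ‖g‖ ^ 2 ≤ (2 / c * B * ‖x‖) ^ 2 := pow_le_pow_left₀ (norm_nonneg _) hgx 2
      have h2 := (hM g).trans (mul_le_mul_of_nonneg_left h1 hM0)
      nlinarith [sq_nonneg ‖x‖]
    calc μ / (M * (2 / c * B) ^ 2 + 1) * T.spForm g g
        ≤ μ / (M * (2 / c * B) ^ 2 + 1) * ((M * (2 / c * B) ^ 2 + 1) * ‖x‖ ^ 2) :=
          mul_le_mul_of_nonneg_left hgg (by positivity)
      _ = μ * ‖x‖ ^ 2 := by
          have : M * (2 / c * B) ^ 2 + 1 ≠ 0 := by positivity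
          field_simp

end

noncomputable section

/-! ## Smooth dependence of solutions of ordinary differential equations -/

section Superposition

variable {K : Type*} [TopologicalSpace K] [CompactSpace K]

/-- Pointwise evaluation of a continuous family of operators on a continuous map. -/
def ContinuousMap.evalFamily (E F : Type*) [NormedAddCommGroup E] [NormedSpace ℝ E]
    [NormedAddCommGroup F] [NormedSpace ℝ F] :
    C(K, E →L[ℝ] F) →L[ℝ] C(K, E) →L[ℝ] C(K, F) :=
  LinearMap.mkContinuous₂
    (LinearMap.mk₂ ℝ (fun (A : C(K, E →L[ℝ] F)) (w : C(K, E)) =>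
        (⟨fun t => A t (w t), A.continuous.clm_apply w.continuous⟩ : C(K, F)))
      (fun _ _ _ => by ext t; simp) (fun _ _ _ => by ext t; simp)
      (fun _ _ _ => by ext t; simp) (fun _ _ _ => by ext t; simp)) 1
    (fun A w => by
      rw [ContinuousMap.norm_le _ (by positivity), one_mul]
      intro t
      exact (ContinuousLinearMap.le_opNorm _ _).trans
        (mul_le_mul (A.norm_coe_le_norm t) (w.norm_coe_le_norm t) (norm_nonneg _)
          ((norm_nonneg _).trans (A.norm_coe_le_norm t))))

/-- The superposition operator `z ↦ f ∘ z`. -/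
def superposition {E F : Type*} [TopologicalSpace E] [TopologicalSpace F] (f : E → F)
    (hf : Continuous f) (z : C(K, E)) : C(K, F) := (⟨f, hf⟩ : C(E, F)).comp z

variable {E : Type} [NormedAddCommGroup E] [NormedSpace ℝ E]

/-- Compact support makes f' globally Lipschitz, so the Taylor remainder is quadratic uniformly in
the time and around every curve. -/
theorem hasFDerivAt_superposition {F : Type} [NormedAddCommGroup F] [NormedSpace ℝ F] {f : E → F}
    (hf : ContDiff ℝ ∞ f) (hs : HasCompactSupport f) (z : C(K, E)) :
    HasFDerivAt (superposition (K := K) f hf.continuous)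
      (ContinuousMap.evalFamily E F
        (superposition (fderiv ℝ f) (hf.continuous_fderiv (by simp)) z)) z := by
  have hf1 : ContDiff ℝ 1 (fderiv ℝ f) :=
    (hf.fderiv_right (m := ∞) (by simp)).of_le (by simp)
  obtain ⟨C, hC⟩ := ContDiff.lipschitzWith_of_hasCompactSupport (hs.fderiv ℝ) hf1 (by simp)
  rw [hasFDerivAt_iff_isLittleO_nhds_zero]
  refine Asymptotics.IsBigO.trans_isLittleO (g := fun w : C(K, E) => ‖w‖ ^ 2) ?_ ?_
  · refine Asymptotics.IsBigO.of_bound C (Eventually.of_forall fun w => ?_)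
    rw [ContinuousMap.norm_le _ (by positivity)]
    intro t
    have hb : ∀ y ∈ segment ℝ (z t) (z t + w t), ‖fderiv ℝ f y - fderiv ℝ f (z t)‖ ≤ C * ‖w t‖ := by
      intro y hy
      rw [← dist_eq_norm]
      refine (hC.dist_le_mul _ _).trans (mul_le_mul_of_nonneg_left ?_ C.2)
      have := dist_add_dist_of_mem_segment hy
      rw [dist_self_add_right] at this
      rw [dist_comm]
      linarith [dist_nonneg (x := y) (y := z t + w t)]
    have := (convex_segment (𝕜 := ℝ) (z t) (z t + w t)).norm_image_sub_le_of_norm_fderiv_le'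
      (f := f) (φ := fderiv ℝ f (z t)) (fun y _ => (hf.differentiable (by simp)) y) hb
      (left_mem_segment ℝ _ _) (right_mem_segment ℝ _ _)
    have hw := w.norm_coe_le_norm t
    rw [add_sub_cancel_left] at this
    calc _ = ‖f (z t + w t) - f (z t) - fderiv ℝ f (z t) (w t)‖ := rfl
      _ ≤ C * ‖w t‖ * ‖w t‖ := this
      _ ≤ C * ‖w‖ * ‖w‖ := by gcongr
      _ = C * ‖‖w‖ ^ 2‖ := by rw [Real.norm_of_nonneg (by positivity)]; ring
  · exact Asymptotics.isLittleO_norm_pow_id one_lt_two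

/-- The differential of a superposition operator is the superposition with f' followed by a bounded
linear map, so regularity climbs by induction. The target changes from `F` to operators into `F` at
each step, hence is quantified inside. -/
theorem contDiff_superposition_nat (k : ℕ) : ∀ {F : Type} [NormedAddCommGroup F] [NormedSpace ℝ F]
    {f : E → F} (hf : ContDiff ℝ ∞ f), HasCompactSupport f →
    ContDiff ℝ k (superposition (K := K) f hf.continuous) := by
  induction k with
  | zero =>
    intro F _ _ f hf hs
    refine contDiff_zero.2 ?_
    exact continuous_iff_continuousAt.2 fun z => (hasFDerivAt_superposition hf hs z).continuousAt
  | succ k ih =>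
    intro F _ _ f hf hs
    have hf' : ContDiff ℝ ∞ (fderiv ℝ f) := hf.fderiv_right (by simp)
    rw [Nat.cast_succ, contDiff_succ_iff_hasFDerivAt]
    have hk : ContDiff ℝ k (fun A => ContinuousMap.evalFamily (K := K) E F A) :=
      ContinuousLinearMap.contDiff _
    exact ⟨fun z => ContinuousMap.evalFamily E F (superposition (fderiv ℝ f) hf'.continuous z),
      hk.comp (ih hf' (hs.fderiv ℝ)),
      fun z => hasFDerivAt_superposition hf hs z⟩

theorem contDiff_superposition {F : Type} [NormedAddCommGroup F] [NormedSpace ℝ F]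
    {f : E → F} (hf : ContDiff ℝ ∞ f) (hs : HasCompactSupport f) :
    ContDiff ℝ ∞ (superposition (K := K) f hf.continuous) :=
  contDiff_infty.2 fun k => contDiff_superposition_nat k hf hs

end Superposition

section Primitive

variable {E : Type*} [NormedAddCommGroup E] [NormedSpace ℝ E] [CompleteSpace E]

/-- The primitive `t ↦ ∫₀ᵗ z` of a continuous function on `[0,1]`. -/
def primitiveCLM (E : Type*) [NormedAddCommGroup E] [NormedSpace ℝ E] [CompleteSpace E] :
    C(Icc (0 : ℝ) 1, E) →L[ℝ] C(Icc (0 : ℝ) 1, E) :=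
  LinearMap.mkContinuous
    { toFun := fun z => ⟨fun t => ∫ s in (0 : ℝ)..t, IccExtend zero_le_one z s, by
        have h : Continuous (IccExtend (zero_le_one' ℝ) z) := z.continuous.Icc_extend'
        exact (intervalIntegral.continuous_primitive
          (fun a b => h.intervalIntegrable a b) 0).comp continuous_subtype_val⟩
      map_add' := fun z w => by
        ext t
        have hz : Continuous (IccExtend (zero_le_one' ℝ) z) := z.continuous.Icc_extend'
        have hw : Continuous (IccExtend (zero_le_one' ℝ) w) := w.continuous.Icc_extend'
        exact intervalIntegral.integral_add (hz.intervalIntegrable _ _) (hw.intervalIntegrable _ _)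
      map_smul' := fun c z => by
        ext t
        exact intervalIntegral.integral_smul c _ } 1
    (fun z => by
      rw [ContinuousMap.norm_le _ (by positivity), one_mul]
      intro t
      refine (intervalIntegral.norm_integral_le_of_norm_le_const (C := ‖z‖)
        fun s _ => z.norm_coe_le_norm _).trans ?_
      rw [sub_zero, abs_of_nonneg t.2.1]
      exact mul_le_of_le_one_right (norm_nonneg _) t.2.2)

theorem primitiveCLM_apply (z : C(Icc (0 : ℝ) 1, E)) (t : Icc (0 : ℝ) 1) :
    primitiveCLM E z t = ∫ s in (0 : ℝ)..t, IccExtend zero_le_one z s := rfl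

theorem hasDerivWithinAt_primitiveCLM (z : C(Icc (0 : ℝ) 1, E)) {t : ℝ} (ht : t ∈ Icc (0 : ℝ) 1) :
    HasDerivWithinAt (IccExtend zero_le_one (primitiveCLM E z)) (z ⟨t, ht⟩) (Icc 0 1) t := by
  have h : Continuous (IccExtend (zero_le_one' ℝ) z) := z.continuous.Icc_extend'
  have h1 := (h.integral_hasStrictDerivAt 0 t).hasDerivAt.hasDerivWithinAt (s := Icc (0 : ℝ) 1)
  rw [IccExtend_of_mem _ _ ht] at h1
  refine h1.congr (fun s hs => ?_) ?_
  · rw [IccExtend_of_mem _ _ hs, primitiveCLM_apply]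
  · rw [IccExtend_of_mem _ _ ht, primitiveCLM_apply]

end Primitive

/-! ### The initial value problem as an equation for continuous curves. -/

section LocalFlow

section Drift

variable {E : Type*} [NormedAddCommGroup E] [NormedSpace ℝ E]

/-- The vector field `(x, v) ↦ (v, 0)` of the equation `x'' = 0`. -/
def driftCLM (E : Type*) [NormedAddCommGroup E] [NormedSpace ℝ E] : E × E →L[ℝ] E × E :=
  (ContinuousLinearMap.inl ℝ E E).comp (ContinuousLinearMap.snd ℝ E E)

@[simp]
theorem driftCLM_apply (z : E × E) : driftCLM E z = (z.2, 0) := rfl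

theorem continuous_driftCLM_comp (w : C(Icc (0 : ℝ) 1, E × E)) :
    Continuous fun s => driftCLM E (IccExtend (zero_le_one' ℝ) w s) :=
  (driftCLM E).continuous.comp w.continuous.Icc_extend'

variable [CompleteSpace E]

/-- The operator `w ↦ ∫₀ᵗ (w₂, 0)`. -/
def driftPrimitive (E : Type*) [NormedAddCommGroup E] [NormedSpace ℝ E] [CompleteSpace E] :
    C(Icc (0 : ℝ) 1, E × E) →L[ℝ] C(Icc (0 : ℝ) 1, E × E) :=
  (primitiveCLM (E × E)).comp ((driftCLM E).compLeftContinuous ℝ (Icc (0 : ℝ) 1))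

theorem driftPrimitive_apply (w : C(Icc (0 : ℝ) 1, E × E)) (t : Icc (0 : ℝ) 1) :
    driftPrimitive E w t =
      ∫ s in (0 : ℝ)..t, driftCLM E (IccExtend zero_le_one w s) := rfl

/-- The drift (x, v) ↦ (v, 0) squares to zero and commutes with integration. Hence 1 − D has the
inverse 1 + D. -/
theorem driftPrimitive_driftPrimitive (w : C(Icc (0 : ℝ) 1, E × E)) :
    driftPrimitive E (driftPrimitive E w) = 0 := by
  ext1 t
  rw [driftPrimitive_apply]
  have h : ∀ s, driftCLM E (IccExtend zero_le_one (driftPrimitive E w) s) = 0 := by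
    intro s
    rw [IccExtend_apply, driftPrimitive_apply, ← ContinuousLinearMap.intervalIntegral_comp_comm _
      ((continuous_driftCLM_comp w).intervalIntegrable _ _)]
    simp
  simp [h]

theorem driftPrimitive_const (z : E × E) :
    driftPrimitive E (ContinuousMap.const _ z) ⟨1, by simp⟩ = (z.2, 0) := by
  rw [driftPrimitive_apply]
  show ∫ s in (0 : ℝ)..1, driftCLM E z = _
  simp

/-- `1 - driftPrimitive` as an isomorphism. -/
def subDriftEquiv (E : Type*) [NormedAddCommGroup E] [NormedSpace ℝ E] [CompleteSpace E] :
    C(Icc (0 : ℝ) 1, E × E) ≃L[ℝ] C(Icc (0 : ℝ) 1, E × E) :=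
  ContinuousLinearEquiv.equivOfInverse (ContinuousLinearMap.id ℝ _ - driftPrimitive E)
    (ContinuousLinearMap.id ℝ _ + driftPrimitive E)
    (fun w => by simp [driftPrimitive_driftPrimitive w])
    (fun w => by simp [driftPrimitive_driftPrimitive w])

end Drift

variable {E : Type} [NormedAddCommGroup E] [NormedSpace ℝ E] [CompleteSpace E]

/-- The map `z ↦ z - ∫₀ᵗ (z₂, f(z))`, whose value is constant precisely at the solutions of
`x' = v`, `v' = f(x, v)`. -/
def flowDefect (f : E × E → E) (hf : Continuous f) (z : C(Icc (0 : ℝ) 1, E × E)) :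
    C(Icc (0 : ℝ) 1, E × E) :=
  z - (driftPrimitive E z + (primitiveCLM (E × E)).comp
    ((ContinuousLinearMap.inr ℝ E E).compLeftContinuous ℝ (Icc (0 : ℝ) 1)) (superposition f hf z))

theorem contDiff_flowDefect {f : E × E → E} (hf : ContDiff ℝ ∞ f) (hs : HasCompactSupport f) :
    ContDiff ℝ ∞ (flowDefect f hf.continuous) :=
  contDiff_id.sub ((driftPrimitive E).contDiff.add
    ((ContinuousLinearMap.contDiff _).comp (contDiff_superposition hf hs)))

/-- At a constant curve where the differential of the force vanishes, the equation linearizes to x''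
= 0. The linearization is invertible on the whole of [0,1], so time need not be shortened; smallness
is asked of the initial velocity instead. -/
theorem hasFDerivAt_flowDefect {f : E × E → E} (hf : ContDiff ℝ ∞ f) (hs : HasCompactSupport f)
    {z : E × E} (hz : fderiv ℝ f z = 0) :
    HasFDerivAt (flowDefect f hf.continuous) (subDriftEquiv E : _ →L[ℝ] _)
      (ContinuousMap.const (Icc (0 : ℝ) 1) z) := by
  have h := hasFDerivAt_superposition (K := Icc (0 : ℝ) 1) hf hs (ContinuousMap.const _ z)
  have h0 : superposition (K := Icc (0 : ℝ) 1) (fderiv ℝ f) (hf.continuous_fderiv (by simp))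
      (ContinuousMap.const _ z) = 0 := by
    ext1 t
    exact hz
  rw [h0, map_zero] at h
  have := (hasFDerivAt_id (𝕜 := ℝ) (ContinuousMap.const (Icc (0 : ℝ) 1) z)).sub
    ((driftPrimitive E).hasFDerivAt.add (((primitiveCLM (E × E)).comp
      ((ContinuousLinearMap.inr ℝ E E).compLeftContinuous ℝ (Icc (0 : ℝ) 1))).hasFDerivAt.comp _ h))
  refine this.congr_fderiv ?_
  ext1 w
  simp [subDriftEquiv]

theorem flowDefect_const {f : E × E → E} (hf : Continuous f) {z : E × E} (hz : f z = 0)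
    (hz2 : z.2 = 0) :
    flowDefect f hf (ContinuousMap.const _ z) = ContinuousMap.const _ z := by
  have h0 : superposition (K := Icc (0 : ℝ) 1) f hf (ContinuousMap.const _ z) = 0 := by
    ext1 t
    exact hz
  have h1 : driftPrimitive E (ContinuousMap.const _ z) = 0 := by
    ext1 t
    rw [driftPrimitive_apply]
    show ∫ s in (0 : ℝ)..t, driftCLM E z = _
    simp [hz2]
  rw [flowDefect, h0, h1, map_zero, add_zero, sub_zero]

theorem flowDefect_eq_const_iff {f : E × E → E} {hf : Continuous f} {z : C(Icc (0 : ℝ) 1, E × E)}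
    {a : E × E} (h : flowDefect f hf z = ContinuousMap.const _ a) :
    z ⟨0, by simp⟩ = a ∧ ∀ t, ∀ ht : t ∈ Icc (0 : ℝ) 1,
      HasDerivWithinAt (IccExtend zero_le_one z) ((z ⟨t, ht⟩).2, f (z ⟨t, ht⟩)) (Icc 0 1) t := by
  set X : C(Icc (0 : ℝ) 1, E × E) := (driftCLM E).compLeftContinuous ℝ (Icc (0 : ℝ) 1) z +
    (ContinuousLinearMap.inr ℝ E E).compLeftContinuous ℝ (Icc (0 : ℝ) 1) (superposition f hf z)
    with hX
  have hz : z = ContinuousMap.const _ a + primitiveCLM (E × E) X := by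
    rw [← h, flowDefect, hX, map_add, driftPrimitive]
    simp
  constructor
  · rw [hz, ContinuousMap.add_apply, primitiveCLM_apply]
    simp
  · intro t ht
    have h1 := (hasDerivWithinAt_primitiveCLM X ht).const_add a
    have h2 : X ⟨t, ht⟩ = ((z ⟨t, ht⟩).2, f (z ⟨t, ht⟩)) := by
      show ((z ⟨t, ht⟩).2, (0 : E)) + ((0 : E), f (z ⟨t, ht⟩)) = _
      simp
    rw [h2] at h1
    refine h1.congr_of_mem (fun s hs => ?_) ht
    rw [IccExtend_of_mem _ _ hs, IccExtend_of_mem _ _ hs]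
    conv_lhs => rw [hz]
    rfl

/-- Smooth local solutions of `x' = v`, `v' = f(x, v)` on `[0,1]` for small initial velocities, for
a force that vanishes to second order at zero velocity. -/
theorem exists_smooth_local_flow {f : E × E → E} (hf : ContDiff ℝ ∞ f) (hs : HasCompactSupport f)
    {x₀ : E} (h0 : ∀ᶠ x in 𝓝 x₀, f (x, 0) = 0 ∧ fderiv ℝ f (x, 0) = 0) :
    ∃ ζ : E × E → C(Icc (0 : ℝ) 1, E × E), ContDiffAt ℝ ∞ ζ (x₀, 0) ∧
      ζ (x₀, 0) = ContinuousMap.const _ (x₀, 0) ∧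
      (∀ᶠ z in 𝓝 (x₀, (0 : E)), ζ z ⟨0, by simp⟩ = z ∧ ∀ t, ∀ ht : t ∈ Icc (0 : ℝ) 1,
        HasDerivWithinAt (IccExtend zero_le_one (ζ z)) ((ζ z ⟨t, ht⟩).2, f (ζ z ⟨t, ht⟩))
          (Icc 0 1) t) ∧
      (∀ᶠ x in 𝓝 x₀, ζ (x, 0) = ContinuousMap.const _ (x, 0) ∧
        ∀ z, fderiv ℝ ζ (x, 0) z ⟨1, by simp⟩ = (z.1 + z.2, z.2)) := by
  set Θ := flowDefect f hf.continuous with hΘ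
  have hc : ContDiff ℝ ∞ Θ := contDiff_flowDefect hf hs
  set c : E × E →L[ℝ] C(Icc (0 : ℝ) 1, E × E) := ContinuousLinearMap.const ℝ (Icc (0 : ℝ) 1) with hcdef
  have hca : ∀ z, c z = ContinuousMap.const _ z := fun z => rfl
  have hat : ContDiffAt ℝ ∞ Θ (c (x₀, 0)) := hc.contDiffAt
  have hd : HasFDerivAt Θ (subDriftEquiv E : _ →L[ℝ] _) (c (x₀, 0)) :=
    hasFDerivAt_flowDefect hf hs h0.self_of_nhds.2
  have hn : (∞ : WithTop ℕ∞) ≠ 0 := by simp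
  have hst := hat.hasStrictFDerivAt' hd hn
  -- The solution with initial value z is the local inverse of the defect map at the constant curve
  -- z, so it inherits smooth dependence on z.
  set Λ := hat.localInverse hd hn with hΛ
  have hΛs : ContDiffAt ℝ ∞ Λ (Θ (c (x₀, 0))) := hat.to_localInverse hd hn
  have hval : ∀ᶠ x in 𝓝 x₀, Θ (c (x, 0)) = c (x, 0) :=
    h0.mono fun x hx => flowDefect_const hf.continuous hx.1 rfl
  have hval0 := hval.self_of_nhds
  rw [hval0] at hΛs
  have hleft : ∀ᶠ z in 𝓝 (c (x₀, 0)), Λ (Θ z) = z := hst.eventually_left_inverse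
  have hright : ∀ᶠ w in 𝓝 (c (x₀, 0)), Θ (Λ w) = w := by
    have := hst.eventually_right_inverse
    rw [hval0] at this
    exact this
  have hx0 : Tendsto (fun x : E => (x, (0 : E))) (𝓝 x₀) (𝓝 (x₀, 0)) :=
    (continuous_id.prodMk continuous_const).tendsto _
  have hright' : ∀ᶠ z in 𝓝 (x₀, (0 : E)), Θ (Λ (c z)) = c z :=
    c.continuous.continuousAt.eventually hright
  have hconst : ∀ᶠ x in 𝓝 x₀, Λ (c (x, 0)) = c (x, 0) := by
    have h1 : ∀ᶠ x in 𝓝 x₀, Λ (Θ (c (x, 0))) = c (x, 0) :=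
      hx0.eventually (c.continuous.continuousAt.eventually hleft)
    filter_upwards [h1, hval] with x h2 h3
    rwa [h3] at h2
  have hζ : ContDiffAt ℝ ∞ (fun z => Λ (c z)) (x₀, 0) :=
    ContDiffAt.comp (x₀, (0 : E)) hΛs c.contDiff.contDiffAt
  refine ⟨fun z => Λ (c z), hζ, hconst.self_of_nhds, ?_, ?_⟩
  · filter_upwards [hright'] with z hz
    exact flowDefect_eq_const_iff hz
  · have hdiff : ∀ᶠ z in 𝓝 (x₀, (0 : E)), DifferentiableAt ℝ (fun z => Λ (c z)) z := by
      filter_upwards [(hζ.of_le (m := 1) (by simp)).eventually (by simp)] with z hz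
      exact hz.differentiableAt (by simp)
    filter_upwards [hconst, h0, hx0.eventually hdiff, hx0.eventually hright'.eventually_nhds]
      with x h1 h2 h3 h4
    refine ⟨h1, fun z => ?_⟩
    have hd1 : HasFDerivAt Θ (subDriftEquiv E : _ →L[ℝ] _) (Λ (c (x, 0))) := by
      rw [h1]
      exact hasFDerivAt_flowDefect hf hs h2.2
    -- Differentiating the identity between the defect of the solution and the constant curve z
    -- determines the differential at all nearby zero velocities: (1 − D)⁻¹ = 1 + D, which at time 1
    -- sends (z₁, z₂) to (z₁ + z₂, z₂).
    have hd2 := hd1.comp (x, (0 : E)) h3.hasFDerivAt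
    have hd3 : HasFDerivAt (Θ ∘ fun z => Λ (c z)) c (x, (0 : E)) :=
      c.hasFDerivAt.congr_of_eventuallyEq h4
    have heq := DFunLike.congr_fun (hd2.unique hd3) z
    have h5 : fderiv ℝ (fun z => Λ (c z)) (x, 0) z = (subDriftEquiv E).symm (c z) := by
      rw [← heq]
      simp
    rw [h5]
    have h6 : (subDriftEquiv E).symm (c z) = c z + driftPrimitive E (c z) := rfl
    rw [h6, ContinuousMap.add_apply, hca, driftPrimitive_const]
    ext <;> simp

end LocalFlow

end

noncomputable section

/-! ## Charts of a manifold and of its tangent bundle -/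

section Charts

variable {n : ℕ} {M : Type*} [TopologicalSpace M] [ChartedSpace (Euc n) M]

/-- The inverse of the chart of `TM` given by the chart of `M` around `p`. -/
def chartLift (p : M) (z : Euc n × Euc n) : TangentBundle 𝓘(ℝ, Euc n) M :=
  tangentMap 𝓘(ℝ, Euc n) 𝓘(ℝ, Euc n) (extChartAt 𝓘(ℝ, Euc n) p).symm ⟨z.1, z.2⟩

/-- The chart of `TM` given by the chart of `M` around `p`. -/
def chartCoord (p : M) (u : TangentBundle 𝓘(ℝ, Euc n) M) : Euc n × Euc n :=
  (extChartAt 𝓘(ℝ, Euc n) p u.1,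
    mfderiv 𝓘(ℝ, Euc n) 𝓘(ℝ, Euc n) (extChartAt 𝓘(ℝ, Euc n) p) u.1 u.2)

theorem isOpen_source (p : M) : IsOpen (extChartAt 𝓘(ℝ, Euc n) p).source :=
  isOpen_extChartAt_source p

theorem isOpen_target (p : M) : IsOpen (extChartAt 𝓘(ℝ, Euc n) p).target :=
  isOpen_extChartAt_target p

theorem isOpen_target_prod (p : M) :
    IsOpen ((extChartAt 𝓘(ℝ, Euc n) p).target ×ˢ (univ : Set (Euc n))) :=
  (isOpen_target p).prod isOpen_univ

theorem chartCoord_eq (p : M) (u : TangentBundle 𝓘(ℝ, Euc n) M) :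
    (⟨(chartCoord p u).1, (chartCoord p u).2⟩ : TangentBundle 𝓘(ℝ, Euc n) (Euc n)) =
      tangentMap 𝓘(ℝ, Euc n) 𝓘(ℝ, Euc n) (extChartAt 𝓘(ℝ, Euc n) p) u := rfl

/-- The differential of the inverse chart around `p`. -/
def liftCLM (p : M) (x : Euc n) :
    Euc n →L[ℝ] TangentSpace 𝓘(ℝ, Euc n) ((extChartAt 𝓘(ℝ, Euc n) p).symm x) :=
  mfderiv 𝓘(ℝ, Euc n) 𝓘(ℝ, Euc n) (extChartAt 𝓘(ℝ, Euc n) p).symm x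

theorem chartLift_eq (p : M) (x v : Euc n) :
    chartLift p (x, v) = ⟨(extChartAt 𝓘(ℝ, Euc n) p).symm x, liftCLM p x v⟩ := rfl

variable [IsManifold 𝓘(ℝ, Euc n) ∞ M]

theorem mdifferentiableAt_chart {p x : M} (hx : x ∈ (extChartAt 𝓘(ℝ, Euc n) p).source) :
    MDifferentiableAt 𝓘(ℝ, Euc n) 𝓘(ℝ, Euc n) (extChartAt 𝓘(ℝ, Euc n) p) x :=
  mdifferentiableAt_extChartAt (by rwa [extChartAt_source] at hx)

theorem mdifferentiableAt_chart_symm {p : M} {x : Euc n}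
    (hx : x ∈ (extChartAt 𝓘(ℝ, Euc n) p).target) :
    MDifferentiableAt 𝓘(ℝ, Euc n) 𝓘(ℝ, Euc n) (extChartAt 𝓘(ℝ, Euc n) p).symm x :=
  ((contMDiffOn_extChartAt_symm (n := ∞) p).contMDiffAt
    ((isOpen_target p).mem_nhds hx)).mdifferentiableAt (by simp)

theorem contMDiffOn_chartLift (p : M) :
    ContMDiffOn 𝓘(ℝ, Euc n × Euc n) (𝓘(ℝ, Euc n).tangent) ∞ (chartLift p)
      ((extChartAt 𝓘(ℝ, Euc n) p).target ×ˢ (univ : Set (Euc n))) := by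
  have h1 := (contMDiffOn_extChartAt_symm (n := ∞) (I := 𝓘(ℝ, Euc n)) p).contMDiffOn_tangentMapWithin
    (m := ∞) (by simp) (isOpen_target p).uniqueMDiffOn
  have h2 : ContMDiff 𝓘(ℝ, Euc n × Euc n) (𝓘(ℝ, Euc n).tangent) ∞
      (fun z : Euc n × Euc n => (⟨z.1, z.2⟩ : TangentBundle 𝓘(ℝ, Euc n) (Euc n))) := by
    have := contMDiff_tangentBundleModelSpaceHomeomorph_symm (n := ∞) (I := 𝓘(ℝ, Euc n))
    rw [modelWithCornersSelf_prod]
    exact this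
  refine (h1.comp h2.contMDiffOn (fun z hz => hz.1)).congr fun z hz => ?_
  exact (tangentMapWithin_eq_tangentMap ((isOpen_target p).uniqueMDiffWithinAt hz.1)
    (mdifferentiableAt_chart_symm hz.1)).symm

theorem contMDiffOn_chartCoord (p : M) :
    ContMDiffOn (𝓘(ℝ, Euc n).tangent) 𝓘(ℝ, Euc n × Euc n) ∞ (chartCoord p)
      {u : TangentBundle 𝓘(ℝ, Euc n) M | u.1 ∈ (extChartAt 𝓘(ℝ, Euc n) p).source} := by
  have h0 := (contMDiffOn_extChartAt (n := ∞) (I := 𝓘(ℝ, Euc n)) (x := p))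
  rw [← extChartAt_source (I := 𝓘(ℝ, Euc n))] at h0
  have h1 := h0.contMDiffOn_tangentMapWithin (m := ∞) (by simp) (isOpen_source p).uniqueMDiffOn
  have h2 : ContMDiff (𝓘(ℝ, Euc n).tangent) 𝓘(ℝ, Euc n × Euc n) ∞
      (fun z : TangentBundle 𝓘(ℝ, Euc n) (Euc n) => ((z.1, z.2) : Euc n × Euc n)) := by
    have := contMDiff_tangentBundleModelSpaceHomeomorph (n := ∞) (I := 𝓘(ℝ, Euc n))
    rw [modelWithCornersSelf_prod]
    exact this
  refine (h2.comp_contMDiffOn h1).congr fun u hu => ?_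
  have := (tangentMapWithin_eq_tangentMap ((isOpen_source p).uniqueMDiffWithinAt hu)
    (mdifferentiableAt_chart hu))
  simp only [Function.comp]
  rw [this]
  rfl

theorem chartLift_chartCoord {p : M} {u : TangentBundle 𝓘(ℝ, Euc n) M}
    (hu : u.1 ∈ (extChartAt 𝓘(ℝ, Euc n) p).source) : chartLift p (chartCoord p u) = u := by
  have h1 := tangentMap_comp_at u
    (mdifferentiableAt_chart_symm ((extChartAt 𝓘(ℝ, Euc n) p).map_source hu))
    (mdifferentiableAt_chart hu)
  have hs := (isOpen_source p).uniqueMDiffWithinAt (I := 𝓘(ℝ, Euc n)) hu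
  rw [chartLift, chartCoord_eq, ← h1, ← tangentMapWithin_eq_tangentMap hs
    ((mdifferentiableAt_chart_symm ((extChartAt 𝓘(ℝ, Euc n) p).map_source hu)).comp _
      (mdifferentiableAt_chart hu)),
    tangentMapWithin_congr (f := (extChartAt 𝓘(ℝ, Euc n) p).symm ∘ extChartAt 𝓘(ℝ, Euc n) p)
      (f₁ := id) (fun x hx => (extChartAt 𝓘(ℝ, Euc n) p).left_inv hx) u hu,
    tangentMapWithin_id hs]

theorem chartCoord_chartLift {p : M} {z : Euc n × Euc n}
    (hz : z.1 ∈ (extChartAt 𝓘(ℝ, Euc n) p).target) : chartCoord p (chartLift p z) = z := by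
  have hz' := (extChartAt 𝓘(ℝ, Euc n) p).map_target hz
  have h1 := tangentMap_comp_at (⟨z.1, z.2⟩ : TangentBundle 𝓘(ℝ, Euc n) (Euc n))
    (mdifferentiableAt_chart hz') (mdifferentiableAt_chart_symm hz)
  have hs := (isOpen_target p).uniqueMDiffWithinAt (I := 𝓘(ℝ, Euc n)) hz
  have h2 := tangentMapWithin_eq_tangentMap
    (p := (⟨z.1, z.2⟩ : TangentBundle 𝓘(ℝ, Euc n) (Euc n))) hs
    ((mdifferentiableAt_chart hz').comp _ (mdifferentiableAt_chart_symm hz))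
  have h3 := tangentMapWithin_congr (I := 𝓘(ℝ, Euc n)) (I' := 𝓘(ℝ, Euc n))
    (f := extChartAt 𝓘(ℝ, Euc n) p ∘ (extChartAt 𝓘(ℝ, Euc n) p).symm)
    (f₁ := id) (fun x hx => (extChartAt 𝓘(ℝ, Euc n) p).right_inv hx)
    (⟨z.1, z.2⟩ : TangentBundle 𝓘(ℝ, Euc n) (Euc n)) hz
  replace h1 := (tangentMapWithin_id hs).symm.trans (h3.symm.trans (h2.trans h1))
  exact (congrArg (fun w : TangentBundle 𝓘(ℝ, Euc n) (Euc n) => ((w.1, w.2) : Euc n × Euc n)) h1).symm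

theorem liftCLM_injective {p : M} {x : Euc n} (hx : x ∈ (extChartAt 𝓘(ℝ, Euc n) p).target) :
    Function.Injective (liftCLM p x) := by
  intro v w h
  have : chartLift p (x, v) = chartLift p (x, w) := by rw [chartLift_eq, chartLift_eq, h]
  have h2 := congrArg (chartCoord p) this
  rw [chartCoord_chartLift hx, chartCoord_chartLift hx] at h2
  exact (Prod.mk.inj h2).2

/-- The coordinates of the velocity of a curve. -/
theorem chartCoord_velocity {p : M} {c : ℝ → M} {t : ℝ} (ht : t ∈ Icc (0 : ℝ) 1)
    (hc : MDifferentiableWithinAt 𝓘(ℝ, ℝ) 𝓘(ℝ, Euc n) c (Icc 0 1) t)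
    (hp : c t ∈ (extChartAt 𝓘(ℝ, Euc n) p).source) :
    chartCoord p (velocity n c t) = (extChartAt 𝓘(ℝ, Euc n) p (c t),
      derivWithin (fun s => extChartAt 𝓘(ℝ, Euc n) p (c s)) (Icc 0 1) t) := by
  have hu : UniqueMDiffWithinAt 𝓘(ℝ, ℝ) (Icc (0 : ℝ) 1) t :=
    uniqueMDiffWithinAt_iff_uniqueDiffWithinAt.2 (uniqueDiffOn_Icc zero_lt_one t ht)
  have h := (mdifferentiableAt_chart hp).comp_mdifferentiableWithinAt t hc
  have h1 : mfderivWithin 𝓘(ℝ, ℝ) 𝓘(ℝ, Euc n) (extChartAt 𝓘(ℝ, Euc n) p ∘ c) (Icc 0 1) t =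
      (mfderiv 𝓘(ℝ, Euc n) 𝓘(ℝ, Euc n) (extChartAt 𝓘(ℝ, Euc n) p) (c t)).comp
        (mfderivWithin 𝓘(ℝ, ℝ) 𝓘(ℝ, Euc n) c (Icc 0 1) t) :=
    mfderiv_comp_mfderivWithin t (mdifferentiableAt_chart hp) hc hu
  rw [mfderivWithin_eq_fderivWithin] at h1
  refine Prod.ext rfl ?_
  rw [derivWithin]
  exact (DFunLike.congr_fun h1 (1 : ℝ)).symm

end Charts

end

noncomputable section

/-! ### Covariance of the Euler–Lagrange equation under changes of chart. -/

section EulerLagrange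

theorem two_le_infty : (2 : WithTop ℕ∞) ≤ ((⊤ : ℕ∞) : WithTop ℕ∞) := by
  exact WithTop.coe_le_coe.2 (le_top : (2 : ℕ∞) ≤ ⊤)

variable {n : ℕ}

/-- The product rule for a momentum `s ↦ ℓ s` known only on constant vectors. -/
theorem hasDerivWithinAt_momentum_apply {ℓ : ℝ → Euc n × Euc n →L[ℝ] ℝ} {S : Set ℝ} {t : ℝ}
    (h : ∀ w : Euc n, HasDerivWithinAt (fun s => ℓ s (0, w)) (ℓ t (w, 0)) S t)
    {β : ℝ → Euc n} {β' : Euc n} (hβ : HasDerivWithinAt β β' S t) :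
    HasDerivWithinAt (fun s => ℓ s (0, β s)) (ℓ t (β t, β')) S t := by
  set b := EuclideanSpace.basisFun (Fin n) ℝ with hb
  have hexp : ∀ v : Euc n, v = ∑ i, v i • b i := fun v => by
    conv_lhs => rw [← b.sum_repr v]
    simp [hb]
  have h1 : ∀ s v, ℓ s (0, v) = ∑ i, v i * ℓ s (0, b i) := by
    intro s v
    have : ((0 : Euc n), v) = ∑ i, v i • ((0 : Euc n), b i) := by
      conv_lhs => rw [hexp v]
      refine Prod.ext ?_ ?_
      · rw [Prod.fst_sum]; simp
      · rw [Prod.snd_sum]; simp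
    rw [this, map_sum]
    simp only [map_smul, smul_eq_mul]
  have h2 : ∀ s v, ℓ s (v, 0) = ∑ i, v i * ℓ s (b i, 0) := by
    intro s v
    have : (v, (0 : Euc n)) = ∑ i, v i • (b i, (0 : Euc n)) := by
      conv_lhs => rw [hexp v]
      refine Prod.ext ?_ ?_
      · rw [Prod.fst_sum]; simp
      · rw [Prod.snd_sum]; simp
    rw [this, map_sum]
    simp only [map_smul, smul_eq_mul]
  have hβi : ∀ i, HasDerivWithinAt (fun s => β s i) (β' i) S t := fun i =>
    (EuclideanSpace.proj (𝕜 := ℝ) i).hasFDerivAt.comp_hasDerivWithinAt t hβ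
  have h3 := HasDerivWithinAt.fun_sum (u := Finset.univ) fun i _ => (hβi i).mul (h (b i))
  have h4 : ∑ i, (β' i * ℓ t (0, b i) + β t i * ℓ t (b i, 0)) = ℓ t (β t, β') := by
    have : (β t, β') = (β t, (0 : Euc n)) + (0, β') := by simp
    rw [this, map_add, h1, h2, Finset.sum_add_distrib, add_comm]
  rw [h4] at h3
  exact h3.congr (fun s _ => h1 s (β s)) (h1 t (β t))

/-- The action `(x, v) ↦ (τ x, Dτ(x) v)` of a map on positions and velocities. -/
def phaseMap {E F : Type*} [NormedAddCommGroup E] [NormedSpace ℝ E] [NormedAddCommGroup F]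
    [NormedSpace ℝ F] (τ : E → F) (z : E × E) : F × F :=
  (τ z.1, fderiv ℝ τ z.1 z.2)

theorem hasFDerivAt_phaseMap {τ : Euc n → Euc n} {x v : Euc n} (hτ : ContDiffAt ℝ ∞ τ x) :
    HasFDerivAt (phaseMap τ)
      (((fderiv ℝ τ x).comp (ContinuousLinearMap.fst ℝ (Euc n) (Euc n))).prod
        (((fderiv ℝ (fderiv ℝ τ) x).flip v).comp (ContinuousLinearMap.fst ℝ (Euc n) (Euc n)) +
          (fderiv ℝ τ x).comp (ContinuousLinearMap.snd ℝ (Euc n) (Euc n)))) (x, v) := by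
  have h1 : HasFDerivAt τ (fderiv ℝ τ x) x := (hτ.differentiableAt (by simp)).hasFDerivAt
  have h2 : HasFDerivAt (fderiv ℝ τ) (fderiv ℝ (fderiv ℝ τ) x) x :=
    ((hτ.fderiv_right (m := ∞) (by simp)).differentiableAt (by simp)).hasFDerivAt
  have h3 := (h2.comp (x, v) (hasFDerivAt_fst (𝕜 := ℝ) (p := (x, v)))).clm_apply
    (hasFDerivAt_snd (𝕜 := ℝ) (p := (x, v)))
  have h4 := (h1.comp (x, v) (hasFDerivAt_fst (𝕜 := ℝ) (p := (x, v)))).prodMk h3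
  refine h4.congr_fderiv ?_
  ext w <;> simp

theorem fderiv_comp_phaseMap {τ : Euc n → Euc n} {x v : Euc n} (hτ : ContDiffAt ℝ ∞ τ x)
    {l : Euc n × Euc n → ℝ} (hl : DifferentiableAt ℝ l (phaseMap τ (x, v))) (w w' : Euc n) :
    fderiv ℝ (fun z => l (phaseMap τ z)) (x, v) (w, w') =
      fderiv ℝ l (phaseMap τ (x, v))
        (fderiv ℝ τ x w, fderiv ℝ (fderiv ℝ τ) x w v + fderiv ℝ τ x w') := by
  have h := hl.hasFDerivAt.comp (x, v) (hasFDerivAt_phaseMap hτ (v := v))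
  have h2 : fderiv ℝ (fun z => l (phaseMap τ z)) (x, v) = _ := h.fderiv
  rw [h2]
  simp

end EulerLagrange

section Charts

variable {n : ℕ} {M : Type*} [TopologicalSpace M] [ChartedSpace (Euc n) M]

theorem eventually_mem_source {c : ℝ → M} {t : ℝ} {p : M}
    (hc : ContMDiffOn 𝓘(ℝ, ℝ) 𝓘(ℝ, Euc n) ∞ c (Icc 0 1)) (ht : t ∈ Icc (0 : ℝ) 1)
    (hp : c t ∈ (extChartAt 𝓘(ℝ, Euc n) p).source) :
    ∀ᶠ s in 𝓝[Icc 0 1] t, c s ∈ (extChartAt 𝓘(ℝ, Euc n) p).source :=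
  (hc.continuousOn t ht).eventually ((isOpen_source p).mem_nhds hp)

variable [IsManifold 𝓘(ℝ, Euc n) ∞ M]

/-- The change of charts from the chart around `p₀` to the one around `p`. -/
def chartChange (p₀ p : M) : Euc n → Euc n :=
  extChartAt 𝓘(ℝ, Euc n) p ∘ (extChartAt 𝓘(ℝ, Euc n) p₀).symm

theorem contDiffAt_chartChange {p₀ p x : M} (h₀ : x ∈ (extChartAt 𝓘(ℝ, Euc n) p₀).source)
    (h : x ∈ (extChartAt 𝓘(ℝ, Euc n) p).source) :
    ContDiffAt ℝ ∞ (chartChange (n := n) p₀ p) (extChartAt 𝓘(ℝ, Euc n) p₀ x) := by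
  have h1 := contMDiffOn_extChartAt (n := ∞) (I := 𝓘(ℝ, Euc n)) (x := p)
  rw [← extChartAt_source (I := 𝓘(ℝ, Euc n))] at h1
  have h2 : ContMDiffAt 𝓘(ℝ, Euc n) 𝓘(ℝ, Euc n) ∞ (extChartAt 𝓘(ℝ, Euc n) p₀).symm
      (extChartAt 𝓘(ℝ, Euc n) p₀ x) :=
    (contMDiffOn_extChartAt_symm (n := ∞) p₀).contMDiffAt
      ((isOpen_target p₀).mem_nhds ((extChartAt 𝓘(ℝ, Euc n) p₀).map_source h₀))
  have h3 : ContMDiffAt 𝓘(ℝ, Euc n) 𝓘(ℝ, Euc n) ∞ (extChartAt 𝓘(ℝ, Euc n) p)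
      ((extChartAt 𝓘(ℝ, Euc n) p₀).symm (extChartAt 𝓘(ℝ, Euc n) p₀ x)) := by
    rw [(extChartAt 𝓘(ℝ, Euc n) p₀).left_inv h₀]
    exact h1.contMDiffAt ((isOpen_source p).mem_nhds h)
  exact (h3.comp _ h2).contDiffAt

theorem chartCoord_chartLift_eq_phaseMap {p₀ p : M} {z : Euc n × Euc n}
    (h₀ : z.1 ∈ (extChartAt 𝓘(ℝ, Euc n) p₀).target)
    (h : (extChartAt 𝓘(ℝ, Euc n) p₀).symm z.1 ∈ (extChartAt 𝓘(ℝ, Euc n) p).source) :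
    chartCoord p (chartLift p₀ z) = phaseMap (chartChange p₀ p) z := by
  refine Prod.ext rfl ?_
  have h1 : mfderiv 𝓘(ℝ, Euc n) 𝓘(ℝ, Euc n) (chartChange (n := n) p₀ p) z.1 =
      (mfderiv 𝓘(ℝ, Euc n) 𝓘(ℝ, Euc n) (extChartAt 𝓘(ℝ, Euc n) p)
        ((extChartAt 𝓘(ℝ, Euc n) p₀).symm z.1)).comp
        (mfderiv 𝓘(ℝ, Euc n) 𝓘(ℝ, Euc n) (extChartAt 𝓘(ℝ, Euc n) p₀).symm z.1) :=
    mfderiv_comp z.1 (mdifferentiableAt_chart h) (mdifferentiableAt_chart_symm h₀)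
  rw [mfderiv_eq_fderiv] at h1
  exact (DFunLike.congr_fun h1 z.2).symm

theorem chartLift_eq_chartLift_phaseMap {p₀ p : M} {z : Euc n × Euc n}
    (h₀ : z.1 ∈ (extChartAt 𝓘(ℝ, Euc n) p₀).target)
    (h : (extChartAt 𝓘(ℝ, Euc n) p₀).symm z.1 ∈ (extChartAt 𝓘(ℝ, Euc n) p).source) :
    chartLift p₀ z = chartLift p (phaseMap (chartChange p₀ p) z) := by
  rw [← chartCoord_chartLift_eq_phaseMap h₀ h, chartLift_chartCoord]
  exact h

theorem contDiffWithinAt_chart_comp {c : ℝ → M} {t : ℝ} {p : M}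
    (hc : ContMDiffOn 𝓘(ℝ, ℝ) 𝓘(ℝ, Euc n) ∞ c (Icc 0 1)) (ht : t ∈ Icc (0 : ℝ) 1)
    (hp : c t ∈ (extChartAt 𝓘(ℝ, Euc n) p).source) :
    ContDiffWithinAt ℝ ∞ (fun s => extChartAt 𝓘(ℝ, Euc n) p (c s)) (Icc 0 1) t := by
  have h1 := contMDiffOn_extChartAt (n := ∞) (I := 𝓘(ℝ, Euc n)) (x := p)
  rw [← extChartAt_source (I := 𝓘(ℝ, Euc n))] at h1
  exact ((h1.contMDiffAt ((isOpen_source p).mem_nhds hp)).comp_contMDiffWithinAt t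
    (hc t ht)).contDiffWithinAt

theorem contDiffWithinAt_derivWithin {x : ℝ → Euc n} {t : ℝ} (ht : t ∈ Icc (0 : ℝ) 1)
    (hx : ContDiffWithinAt ℝ ∞ x (Icc 0 1) t) :
    ContDiffWithinAt ℝ ∞ (derivWithin x (Icc 0 1)) (Icc 0 1) t :=
  hx.derivWithin (uniqueDiffOn_Icc zero_lt_one) (by simp) ht

theorem phaseMap_chartChange_curve {c : ℝ → M} {t : ℝ} {p₀ p : M}
    (hc : ContMDiffOn 𝓘(ℝ, ℝ) 𝓘(ℝ, Euc n) ∞ c (Icc 0 1)) (ht : t ∈ Icc (0 : ℝ) 1)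
    (h₀ : c t ∈ (extChartAt 𝓘(ℝ, Euc n) p₀).source)
    (h : c t ∈ (extChartAt 𝓘(ℝ, Euc n) p).source) :
    phaseMap (chartChange p₀ p) (extChartAt 𝓘(ℝ, Euc n) p₀ (c t),
      derivWithin (fun s => extChartAt 𝓘(ℝ, Euc n) p₀ (c s)) (Icc 0 1) t) =
      (extChartAt 𝓘(ℝ, Euc n) p (c t),
        derivWithin (fun s => extChartAt 𝓘(ℝ, Euc n) p (c s)) (Icc 0 1) t) := by
  have hd := (hc t ht).mdifferentiableWithinAt (by simp)
  rw [← chartCoord_velocity ht hd h₀, ← chartCoord_velocity ht hd h,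
    ← chartCoord_chartLift_eq_phaseMap, chartLift_chartCoord]
  · exact h₀
  · exact (extChartAt 𝓘(ℝ, Euc n) p₀).map_source h₀
  · show (extChartAt 𝓘(ℝ, Euc n) p₀).symm (extChartAt 𝓘(ℝ, Euc n) p₀ (c t)) ∈ _
    rwa [(extChartAt 𝓘(ℝ, Euc n) p₀).left_inv h₀]

/-- The Euler-Lagrange equation holds in every chart. -/
theorem IsExtremal.eulerLagrange {L : TangentBundle 𝓘(ℝ, Euc n) M → ℝ}
    (hL : ∀ p : M, DifferentiableOn ℝ (chartLagrangian L p)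
      ((extChartAt 𝓘(ℝ, Euc n) p).target ×ˢ (univ : Set (Euc n))))
    {c : ℝ → M} (hc : IsExtremal L c) {t : ℝ} (ht : t ∈ Icc (0 : ℝ) 1) {p₀ : M}
    (h₀ : c t ∈ (extChartAt 𝓘(ℝ, Euc n) p₀).source) (w : Euc n) :
    HasDerivWithinAt (fun s => fderiv ℝ (chartLagrangian L p₀)
        (extChartAt 𝓘(ℝ, Euc n) p₀ (c s),
          derivWithin (fun s => extChartAt 𝓘(ℝ, Euc n) p₀ (c s)) (Icc 0 1) s) (0, w))
      (fderiv ℝ (chartLagrangian L p₀)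
        (extChartAt 𝓘(ℝ, Euc n) p₀ (c t),
          derivWithin (fun s => extChartAt 𝓘(ℝ, Euc n) p₀ (c s)) (Icc 0 1) t) (w, 0))
      (Icc 0 1) t := by
  set p := c t with hp
  set x : ℝ → Euc n := fun s => extChartAt 𝓘(ℝ, Euc n) p₀ (c s) with hx
  set x' := derivWithin x (Icc 0 1) with hx'
  set y : ℝ → Euc n := fun s => extChartAt 𝓘(ℝ, Euc n) p (c s) with hy
  set y' := derivWithin y (Icc 0 1) with hy'
  set τ := chartChange (n := n) p₀ p with hτ
  have hsrc : c t ∈ (extChartAt 𝓘(ℝ, Euc n) p).source := mem_extChartAt_source _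
  have hEL : ∀ w, HasDerivWithinAt (fun s => fderiv ℝ (chartLagrangian L p) (y s, y' s) (0, w))
      (fderiv ℝ (chartLagrangian L p) (y t, y' t) (w, 0)) (Icc 0 1) t := hc.2 t ht
  -- On the overlap the two Lagrangians differ by the substitution (x, v) ↦ (τx, τ'v). A velocity
  -- variation transforms by τ', whereas a position variation also moves the velocity, by τ''.
  have key : ∀ s ∈ Icc (0 : ℝ) 1, c s ∈ (extChartAt 𝓘(ℝ, Euc n) p₀).source →
      c s ∈ (extChartAt 𝓘(ℝ, Euc n) p).source → ∀ w w',
      fderiv ℝ (chartLagrangian L p₀) (x s, x' s) (w, w') =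
        fderiv ℝ (chartLagrangian L p) (y s, y' s)
          (fderiv ℝ τ (x s) w, fderiv ℝ (fderiv ℝ τ) (x s) w (x' s) + fderiv ℝ τ (x s) w') := by
    intro s hs h1 h2 w w'
    have hph : phaseMap τ (x s, x' s) = (y s, y' s) := phaseMap_chartChange_curve hc.1 hs h1 h2
    have hτs : ContDiffAt ℝ ∞ τ (x s) := contDiffAt_chartChange h1 h2
    have hxs : x s ∈ (extChartAt 𝓘(ℝ, Euc n) p₀).target :=
      (extChartAt 𝓘(ℝ, Euc n) p₀).map_source h1
    have hev : chartLagrangian L p₀ =ᶠ[𝓝 (x s, x' s)]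
        fun z => chartLagrangian L p (phaseMap τ z) := by
      have ho : IsOpen ((extChartAt 𝓘(ℝ, Euc n) p₀).target ∩
          (extChartAt 𝓘(ℝ, Euc n) p₀).symm ⁻¹' (extChartAt 𝓘(ℝ, Euc n) p).source) :=
        (continuousOn_extChartAt_symm p₀).isOpen_inter_preimage (isOpen_target p₀)
          (isOpen_source p)
      have hm : x s ∈ ((extChartAt 𝓘(ℝ, Euc n) p₀).target ∩
          (extChartAt 𝓘(ℝ, Euc n) p₀).symm ⁻¹' (extChartAt 𝓘(ℝ, Euc n) p).source) := by
        refine ⟨hxs, ?_⟩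
        show (extChartAt 𝓘(ℝ, Euc n) p₀).symm (extChartAt 𝓘(ℝ, Euc n) p₀ (c s)) ∈
          (extChartAt 𝓘(ℝ, Euc n) p).source
        rwa [(extChartAt 𝓘(ℝ, Euc n) p₀).left_inv h1]
      have hmem := (ho.preimage continuous_fst).mem_nhds (show (x s, x' s) ∈ Prod.fst ⁻¹' _ from hm)
      filter_upwards [hmem] with z hz
      exact congrArg L (chartLift_eq_chartLift_phaseMap hz.1 hz.2)
    have hys : y s ∈ (extChartAt 𝓘(ℝ, Euc n) p).target :=
      (extChartAt 𝓘(ℝ, Euc n) p).map_source h2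
    have hld : DifferentiableAt ℝ (chartLagrangian L p) (phaseMap τ (x s, x' s)) := by
      rw [hph]
      exact (hL p).differentiableAt ((isOpen_target_prod p).mem_nhds ⟨hys, mem_univ _⟩)
    rw [hev.fderiv_eq, fderiv_comp_phaseMap hτs hld, hph]
  have hxd : HasDerivWithinAt x (x' t) (Icc 0 1) t :=
    ((contDiffWithinAt_chart_comp hc.1 ht h₀).differentiableWithinAt (by simp)).hasDerivWithinAt
  have hτt : ContDiffAt ℝ ∞ τ (x t) := contDiffAt_chartChange h₀ hsrc
  -- A constant test vector in one chart is a moving one in the other. The product rule produces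
  -- τ''(x', w), which matches the τ''(w, x') of the position variation by symmetry.
  have hβ : HasDerivWithinAt (fun s => fderiv ℝ τ (x s) w)
      (fderiv ℝ (fderiv ℝ τ) (x t) (x' t) w) (Icc 0 1) t := by
    have h2 : HasFDerivAt (fderiv ℝ τ) (fderiv ℝ (fderiv ℝ τ) (x t)) (x t) :=
      ((hτt.fderiv_right (m := ∞) (by simp)).differentiableAt (by simp)).hasFDerivAt
    have h3 := h2.comp_hasDerivWithinAt t hxd
    simpa using h3.clm_apply (hasDerivWithinAt_const t (Icc (0 : ℝ) 1) w)
  have hsymm : fderiv ℝ (fderiv ℝ τ) (x t) (x' t) w = fderiv ℝ (fderiv ℝ τ) (x t) w (x' t) :=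
    (hτt.isSymmSndFDerivAt (by simpa using two_le_infty)).eq _ _
  have h := hasDerivWithinAt_momentum_apply hEL hβ
  rw [hsymm] at h
  rw [key t ht h₀ hsrc w 0, map_zero, add_zero]
  refine h.congr_of_eventuallyEq_of_mem ?_ ht
  filter_upwards [eventually_mem_source hc.1 ht h₀, eventually_mem_source hc.1 ht hsrc,
    self_mem_nhdsWithin] with s h1 h2 hs
  rw [key s hs h1 h2 0 w]
  simp

end Charts

end

noncomputable section

set_option maxSynthPendingDepth 3

/-! ## The geodesic equation of a Riemannian metric in a chart -/

section MetricCoefficients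

variable {E : Type*} [NormedAddCommGroup E] [NormedSpace ℝ E]

/-- Smooth metric coefficients on an open set `T` of a vector space. -/
structure IsMetricOn (g : E → E →L[ℝ] E →L[ℝ] ℝ) (T : Set E) : Prop where
  isOpen : IsOpen T
  contDiffOn : ContDiffOn ℝ ∞ g T
  symm : ∀ x v w, g x v w = g x w v
  pos : ∀ x ∈ T, ∀ v, v ≠ 0 → 0 < g x v v

/-- Polarization. It is needed because smoothness of the coefficients is read off from the smooth
function u ↦ h(u, u) on the tangent bundle. -/
theorem contDiffOn_of_quadratic [FiniteDimensional ℝ E] {g : E → E →L[ℝ] E →L[ℝ] ℝ} {T : Set E}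
    (hs : ∀ x v w, g x v w = g x w v) (hg : ∀ v, ContDiffOn ℝ ∞ (fun x => g x v v) T) :
    ContDiffOn ℝ ∞ g T := by
  refine contDiffOn_clm_apply.2 fun v => contDiffOn_clm_apply.2 fun w => ?_
  have : (fun x => g x v w) = fun x => (1 / 4 : ℝ) *
      (g x (v + w) (v + w) - g x (v - w) (v - w)) := by
    funext x
    simp only [map_add, map_sub, add_apply, sub_apply]
    rw [hs x w v]
    ring
  rw [this]
  exact contDiffOn_const.mul ((hg _).sub (hg _))

/-- The covector `½ ∂g(v,v) - ∂_v g(v,·)`. -/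
def christoffelForm (g : E → E →L[ℝ] E →L[ℝ] ℝ) (z : E × E) : E →L[ℝ] ℝ :=
  (1 / 2 : ℝ) • ((fderiv ℝ g z.1).flip z.2).flip z.2 - fderiv ℝ g z.1 z.2 z.2

theorem christoffelForm_apply (g : E → E →L[ℝ] E →L[ℝ] ℝ) (x v w : E) :
    christoffelForm g (x, v) w = (1 / 2) * fderiv ℝ g x w v v - fderiv ℝ g x v v w := rfl

/-- The right hand side `f` of the geodesic equation `x'' = f(x, x')`. -/
def geodesicForce (g : E → E →L[ℝ] E →L[ℝ] ℝ) (z : E × E) : E :=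
  (g z.1).inverse (christoffelForm g z)

theorem geodesicForce_smul (g : E → E →L[ℝ] E →L[ℝ] ℝ) (x v : E) (s : ℝ) :
    geodesicForce g (x, s • v) = s ^ 2 • geodesicForce g (x, v) := by
  have : christoffelForm g (x, s • v) = s ^ 2 • christoffelForm g (x, v) := by
    ext w
    rw [_root_.smul_apply, christoffelForm_apply, christoffelForm_apply]
    simp only [map_smul, _root_.smul_apply, smul_eq_mul]
    ring
  rw [geodesicForce, this, map_smul]
  rfl

namespace IsMetricOn

variable {g : E → E →L[ℝ] E →L[ℝ] ℝ} {T : Set E}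

theorem hasFDerivAt (hg : IsMetricOn g T) {x : E} (hx : x ∈ T) : HasFDerivAt g (fderiv ℝ g x) x :=
  ((hg.contDiffOn.differentiableOn (by simp)).differentiableAt (hg.isOpen.mem_nhds hx)).hasFDerivAt

theorem fderiv_quadratic (hg : IsMetricOn g T) {x : E} (hx : x ∈ T) (v w w' : E) :
    fderiv ℝ (fun z : E × E => g z.1 z.2 z.2) (x, v) (w, w') =
      fderiv ℝ g x w v v + 2 * g x v w' := by
  have h1 := (((hg.hasFDerivAt hx).comp (x, v) (hasFDerivAt_fst (𝕜 := ℝ) (p := (x, v)))).clm_apply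
    (hasFDerivAt_snd (𝕜 := ℝ) (p := (x, v)))).clm_apply (hasFDerivAt_snd (𝕜 := ℝ) (p := (x, v)))
  have h2 : fderiv ℝ (fun z : E × E => g z.1 z.2 z.2) (x, v) = _ := h1.fderiv
  rw [h2]
  simp only [add_apply, ContinuousLinearMap.comp_apply, ContinuousLinearMap.flip_apply,
    ContinuousLinearMap.coe_fst', ContinuousLinearMap.coe_snd', Function.comp]
  rw [hg.symm x w' v]
  ring

variable [FiniteDimensional ℝ E]

theorem exists_equiv (hg : IsMetricOn g T) {x : E} (hx : x ∈ T) :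
    ∃ e : E ≃L[ℝ] (E →L[ℝ] ℝ), (e : E →L[ℝ] (E →L[ℝ] ℝ)) = g x := by
  have hinj : Function.Injective (g x : E →ₗ[ℝ] (E →L[ℝ] ℝ)) := by
    rw [injective_iff_map_eq_zero]
    intro v hv
    by_contra hne
    have h2 := hg.pos x hx v hne
    rw [show g x v = 0 from hv] at h2
    simp at h2
  have hdim : Module.finrank ℝ E = Module.finrank ℝ (E →L[ℝ] ℝ) := by
    rw [← (LinearMap.toContinuousLinearMap (𝕜 := ℝ) (E := E) (F' := ℝ)).finrank_eq]
    exact (Subspace.dual_finrank_eq (K := ℝ) (V := E)).symm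
  exact ⟨(LinearMap.linearEquivOfInjective (g x : E →ₗ[ℝ] (E →L[ℝ] ℝ)) hinj
    hdim).toContinuousLinearEquiv, by ext; rfl⟩

theorem eq_geodesicForce (hg : IsMetricOn g T) {x v a : E} (hx : x ∈ T)
    (h : ∀ w, g x a w = christoffelForm g (x, v) w) : a = geodesicForce g (x, v) := by
  obtain ⟨e, he⟩ := hg.exists_equiv hx
  have h' : g x a = christoffelForm g (x, v) := ContinuousLinearMap.ext h
  rw [geodesicForce, ← h', ← he, ContinuousLinearMap.inverse_equiv]
  simp

theorem contDiffOn_geodesicForce (hg : IsMetricOn g T) :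
    ContDiffOn ℝ ∞ (geodesicForce g) (T ×ˢ (univ : Set E)) := by
  have hg' : ContDiffOn ℝ ∞ (fderiv ℝ g) T :=
    hg.contDiffOn.fderiv_of_isOpen hg.isOpen (by simp)
  have hfst : MapsTo Prod.fst (T ×ˢ (univ : Set E)) T := fun z hz => hz.1
  have h1 : ContDiffOn ℝ ∞ (fun z : E × E => fderiv ℝ g z.1) (T ×ˢ (univ : Set E)) :=
    hg'.comp contDiff_fst.contDiffOn hfst
  have hc : ContDiffOn ℝ ∞ (christoffelForm g) (T ×ˢ (univ : Set E)) := by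
    refine contDiffOn_clm_apply.2 fun w => ?_
    have hs : ContDiffOn ℝ ∞ (fun z : E × E => z.2) (T ×ˢ (univ : Set E)) :=
      contDiff_snd.contDiffOn
    exact (contDiffOn_const.mul (((h1.clm_apply contDiffOn_const).clm_apply hs).clm_apply hs)).sub
      (((h1.clm_apply hs).clm_apply hs).clm_apply contDiffOn_const)
  have he : ContDiffOn ℝ ∞ (fun z : E × E => (g z.1).inverse) (T ×ˢ (univ : Set E)) := by
    have : CompleteSpace E := FiniteDimensional.complete ℝ E
    have h3 : ContDiffOn ℝ ∞ (fun x => (g x).inverse) T := by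
      intro x hx
      obtain ⟨e, he⟩ := hg.exists_equiv hx
      have h4 : ContDiffAt ℝ ∞ (ContinuousLinearMap.inverse : (E →L[ℝ] E →L[ℝ] ℝ) → _) (g x) := by
        rw [← he]
        exact contDiffAt_map_inverse e
      exact h4.comp_contDiffWithinAt x (hg.contDiffOn x hx)
    exact h3.comp contDiff_fst.contDiffOn hfst
  exact he.clm_apply hc

/-- The force is quadratic in the velocity, so along (x + sw₁, sw₂) it is s² times a differentiable
function of s. This second order vanishing is what makes the flow equation linearize to x'' = 0. -/
theorem fderiv_geodesicForce_zero (hg : IsMetricOn g T) {x : E} (hx : x ∈ T) :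
    fderiv ℝ (geodesicForce g) (x, 0) = 0 := by
  have hd : DifferentiableOn ℝ (geodesicForce g) (T ×ˢ (univ : Set E)) :=
    hg.contDiffOn_geodesicForce.differentiableOn (by simp)
  have hdiff : ∀ v : E, DifferentiableAt ℝ (geodesicForce g) (x, v) := fun v =>
    hd.differentiableAt ((hg.isOpen.prod isOpen_univ).mem_nhds ⟨hx, mem_univ _⟩)
  refine ContinuousLinearMap.ext fun w => ?_
  have h1 : HasDerivAt (fun s : ℝ => (x + s • w.1, s • w.2)) w 0 := by
    have := (((hasDerivAt_id (0 : ℝ)).smul_const w.1).const_add x).prodMk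
      ((hasDerivAt_id (0 : ℝ)).smul_const w.2)
    simpa using this
  have h2 : HasDerivAt (fun s : ℝ => (x + s • w.1, w.2)) (w.1, 0) 0 := by
    have := (((hasDerivAt_id (0 : ℝ)).smul_const w.1).const_add x).prodMk
      (hasDerivAt_const (0 : ℝ) w.2)
    simpa using this
  have e1 : HasDerivAt (fun s : ℝ => geodesicForce g (x + s • w.1, s • w.2))
      (fderiv ℝ (geodesicForce g) (x, 0) w) 0 := by
    have h0 : HasFDerivAt (geodesicForce g) (fderiv ℝ (geodesicForce g) (x, 0))
        (x + (0 : ℝ) • w.1, (0 : ℝ) • w.2) := by simpa using (hdiff 0).hasFDerivAt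
    exact h0.comp_hasDerivAt (0 : ℝ) h1
  have e2 : HasDerivAt (fun s : ℝ => geodesicForce g (x + s • w.1, w.2))
      (fderiv ℝ (geodesicForce g) (x, w.2) (w.1, 0)) 0 := by
    have h0 : HasFDerivAt (geodesicForce g) (fderiv ℝ (geodesicForce g) (x, w.2))
        (x + (0 : ℝ) • w.1, w.2) := by simpa using (hdiff w.2).hasFDerivAt
    exact h0.comp_hasDerivAt (0 : ℝ) h2
  have e3 := (hasDerivAt_pow 2 (0 : ℝ)).smul e2
  have e4 : HasDerivAt (fun s : ℝ => geodesicForce g (x + s • w.1, s • w.2)) 0 0 := by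
    have : (fun s : ℝ => geodesicForce g (x + s • w.1, s • w.2)) =
        fun s : ℝ => s ^ 2 • geodesicForce g (x + s • w.1, w.2) := by
      funext s
      exact geodesicForce_smul g _ _ s
    rw [this]
    convert! e3 using 1
    simp
  exact e1.unique e4

/-- The Euler-Lagrange equation of `g(x)(x', x')` is the geodesic equation. -/
theorem geodesic_equation (hg : IsMetricOn g T) {x x' : ℝ → E} {x'' : E} {t : ℝ} {S : Set ℝ}
    (hS : UniqueDiffWithinAt ℝ S t) (ht : t ∈ S) (hx : HasDerivWithinAt x (x' t) S t)
    (hx' : HasDerivWithinAt x' x'' S t) (hmem : ∀ᶠ s in 𝓝[S] t, x s ∈ T)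
    (hEL : ∀ w, HasDerivWithinAt
      (fun s => fderiv ℝ (fun z : E × E => g z.1 z.2 z.2) (x s, x' s) (0, w))
      (fderiv ℝ (fun z : E × E => g z.1 z.2 z.2) (x t, x' t) (w, 0)) S t) :
    x'' = geodesicForce g (x t, x' t) := by
  have htT : x t ∈ T := hmem.self_of_nhdsWithin ht
  refine hg.eq_geodesicForce htT fun w => ?_
  rw [christoffelForm_apply]
  -- The derivative of the momentum 2g(x)(x', w) is computed by the product rule and by the
  -- Euler–Lagrange equation; equality of the two determines x''.
  have h1 := ((((hg.hasFDerivAt htT).comp_hasDerivWithinAt t hx).clm_apply hx').clm_apply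
    (hasDerivWithinAt_const t S w)).const_mul 2
  have h2 := (hEL w).congr_of_eventuallyEq_of_mem (f₁ := fun s => 2 * g (x s) (x' s) w)
    (by
      filter_upwards [hmem] with s hs
      rw [hg.fderiv_quadratic hs (x' s) 0 w]
      simp) ht
  have h3 := hS.eq_deriv _ h1 h2
  rw [hg.fderiv_quadratic htT] at h3
  simp only [Function.comp, add_apply, map_zero, add_zero, mul_zero] at h3
  linarith

end IsMetricOn

end MetricCoefficients

/-! ### Riemannian metrics and their geodesics in charts. -/

section Geodesic

variable {n : ℕ} {M : Type*} [TopologicalSpace M] [ChartedSpace (Euc n) M]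
  [IsManifold 𝓘(ℝ, Euc n) ∞ M]

theorem contMDiff_riemMetric (h : RiemMetric n M) :
    ContMDiff (𝓘(ℝ, Euc n).tangent) 𝓘(ℝ, ℝ) ∞
      (fun u : TangentBundle 𝓘(ℝ, Euc n) M => h.inner u.1 u.2 u.2) := by
  intro u
  have hb : ContMDiffAt (𝓘(ℝ, Euc n).tangent) 𝓘(ℝ, Euc n) ∞
      (fun u : TangentBundle 𝓘(ℝ, Euc n) M => u.1) u :=
    (Bundle.contMDiff_proj (TangentSpace 𝓘(ℝ, Euc n))).contMDiffAt
  have hid : ContMDiffAt (𝓘(ℝ, Euc n).tangent) (𝓘(ℝ, Euc n).prod 𝓘(ℝ, Euc n)) ∞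
      (fun u : TangentBundle 𝓘(ℝ, Euc n) M =>
        (Bundle.TotalSpace.mk' (Euc n) u.1 u.2 :
          Bundle.TotalSpace (Euc n) (TangentSpace 𝓘(ℝ, Euc n) : M → Type _))) u :=
    contMDiffAt_id
  have : ContMDiffAt (𝓘(ℝ, Euc n).tangent) (𝓘(ℝ, Euc n).prod 𝓘(ℝ, ℝ)) ∞
      (fun u : TangentBundle 𝓘(ℝ, Euc n) M =>
        Bundle.TotalSpace.mk' ℝ (E := Bundle.Trivial M ℝ) u.1 (h.inner u.1 u.2 u.2)) u := by
    apply ContMDiffAt.clm_bundle_apply₂ (F₁ := Euc n) (F₂ := Euc n)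
    · exact ContMDiffAt.comp u h.contMDiff.contMDiffAt hb
    · exact hid
    · exact hid
  simp only [Bundle.contMDiffAt_totalSpace] at this
  exact this.2

theorem contDiffOn_chartLagrangian_riemMetric (h : RiemMetric n M) (p : M) :
    ContDiffOn ℝ ∞ (chartLagrangian (fun u => h.inner u.1 u.2 u.2) p)
      ((extChartAt 𝓘(ℝ, Euc n) p).target ×ˢ (univ : Set (Euc n))) :=
  contMDiffOn_iff_contDiffOn.1 ((contMDiff_riemMetric h).comp_contMDiffOn (contMDiffOn_chartLift p))

/-- The coefficients of a Riemannian metric in the chart around `p`. -/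
def metricCoeff (h : RiemMetric n M) (p : M) (x : Euc n) : Euc n →L[ℝ] Euc n →L[ℝ] ℝ :=
  ContinuousLinearMap.bilinearComp (E := Euc n) (F := Euc n)
    (h.inner ((extChartAt 𝓘(ℝ, Euc n) p).symm x)) (liftCLM p x) (liftCLM p x)

theorem metricCoeff_apply (h : RiemMetric n M) (p : M) (x v w : Euc n) :
    metricCoeff h p x v w =
      h.inner ((extChartAt 𝓘(ℝ, Euc n) p).symm x) (liftCLM p x v) (liftCLM p x w) := rfl

theorem chartLagrangian_riemMetric (h : RiemMetric n M) (p : M) (x v : Euc n) :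
    chartLagrangian (fun u => h.inner u.1 u.2 u.2) p (x, v) = metricCoeff h p x v v := rfl

theorem chartLagrangian_riemMetric_eq (h : RiemMetric n M) (p : M) :
    chartLagrangian (fun u => h.inner u.1 u.2 u.2) p = fun z => metricCoeff h p z.1 z.2 z.2 := by
  funext z
  rw [← chartLagrangian_riemMetric]

theorem metricCoeff_symm (h : RiemMetric n M) (p : M) (x v w : Euc n) :
    metricCoeff h p x v w = metricCoeff h p x w v := by
  rw [metricCoeff_apply, metricCoeff_apply, h.symm]

theorem metricCoeff_pos (h : RiemMetric n M) {p : M} {x : Euc n}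
    (hx : x ∈ (extChartAt 𝓘(ℝ, Euc n) p).target) {v : Euc n} (hv : v ≠ 0) :
    0 < metricCoeff h p x v v := by
  rw [metricCoeff_apply]
  refine h.pos _ _ fun h0 => hv (liftCLM_injective hx ?_)
  rw [map_zero]
  exact h0

theorem contDiffOn_metricCoeff_apply (h : RiemMetric n M) (p : M) (v : Euc n) :
    ContDiffOn ℝ ∞ (fun x => metricCoeff h p x v v) (extChartAt 𝓘(ℝ, Euc n) p).target := by
  simp_rw [← chartLagrangian_riemMetric h p]
  exact (contDiffOn_chartLagrangian_riemMetric h p).comp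
    (contDiff_id.prodMk contDiff_const).contDiffOn (fun _ hx => ⟨hx, mem_univ _⟩)

theorem isMetricOn_metricCoeff (h : RiemMetric n M) (p : M) :
    IsMetricOn (metricCoeff h p) (extChartAt 𝓘(ℝ, Euc n) p).target where
  isOpen := isOpen_target p
  contDiffOn := contDiffOn_of_quadratic (metricCoeff_symm h p)
    (contDiffOn_metricCoeff_apply h p)
  symm := metricCoeff_symm h p
  pos := fun _ hx _ hv => metricCoeff_pos h hx hv

/-- Riemannian geodesics satisfy the geodesic equation in every chart. -/
theorem IsRiemGeodesic.geodesic_equation {h : RiemMetric n M} {c : ℝ → M}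
    (hc : IsRiemGeodesic h c) {t : ℝ} (ht : t ∈ Icc (0 : ℝ) 1) {p : M}
    (hp : c t ∈ (extChartAt 𝓘(ℝ, Euc n) p).source) :
    let x : ℝ → Euc n := fun s => extChartAt 𝓘(ℝ, Euc n) p (c s)
    let x' : ℝ → Euc n := derivWithin x (Icc 0 1)
    HasDerivWithinAt x (x' t) (Icc 0 1) t ∧
      HasDerivWithinAt x' (geodesicForce (metricCoeff h p) (x t, x' t)) (Icc 0 1) t := by
  intro x x'
  have hL : ∀ p : M, DifferentiableOn ℝ (chartLagrangian (fun u => h.inner u.1 u.2 u.2) p)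
      ((extChartAt 𝓘(ℝ, Euc n) p).target ×ˢ (univ : Set (Euc n))) := fun p =>
    (contDiffOn_chartLagrangian_riemMetric h p).differentiableOn (by simp)
  have hx := contDiffWithinAt_chart_comp hc.1 ht hp
  have hxd : HasDerivWithinAt x (x' t) (Icc 0 1) t :=
    (hx.differentiableWithinAt (by simp)).hasDerivWithinAt
  have hx'd : HasDerivWithinAt x' (derivWithin x' (Icc 0 1) t) (Icc 0 1) t :=
    ((contDiffWithinAt_derivWithin ht hx).differentiableWithinAt (by simp)).hasDerivWithinAt
  have hEL := fun w => IsExtremal.eulerLagrange hL hc ht hp w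
  rw [chartLagrangian_riemMetric_eq] at hEL
  have heq := (isMetricOn_metricCoeff h p).geodesic_equation (uniqueDiffOn_Icc zero_lt_one t ht) ht
    hxd hx'd ((eventually_mem_source hc.1 ht hp).mono fun s hs =>
      (extChartAt 𝓘(ℝ, Euc n) p).map_source hs) hEL
  rw [← heq]
  exact ⟨hxd, hx'd⟩

end Geodesic

end

noncomputable section

set_option maxSynthPendingDepth 3

/-! ## The exponential map near the zero section -/

section Extension

/-- A function that is smooth near a point agrees near the point with a compactly supported
smooth function. -/
theorem exists_smooth_compactSupport_eventuallyEq {E F : Type*} [NormedAddCommGroup E]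
    [NormedSpace ℝ E] [FiniteDimensional ℝ E] [NormedAddCommGroup F] [NormedSpace ℝ F] {f : E → F}
    {U : Set E} (hU : IsOpen U) (hf : ContDiffOn ℝ ∞ f U) {x : E} (hx : x ∈ U) :
    ∃ k : E → F, ContDiff ℝ ∞ k ∧ HasCompactSupport k ∧ k =ᶠ[𝓝 x] f := by
  obtain ⟨r, hr, hrU⟩ := Metric.isOpen_iff.1 hU x hx
  let ψ : ContDiffBump x := ⟨r / 4, r / 2, by positivity, by linarith⟩
  have hsub : tsupport ψ ⊆ U := by
    rw [ψ.tsupport_eq]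
    exact (Metric.closedBall_subset_ball (by show r / 2 < r; linarith)).trans hrU
  refine ⟨fun z => ψ z • f z, ?_, ψ.hasCompactSupport.smul_right, ?_⟩
  · rw [contDiff_iff_contDiffAt]
    intro z
    by_cases hz : z ∈ U
    · exact ψ.contDiff.contDiffAt.smul (hf.contDiffAt (hU.mem_nhds hz))
    · have : (fun z => ψ z • f z) =ᶠ[𝓝 z] fun _ => 0 := by
        filter_upwards [(isClosed_tsupport ψ).isOpen_compl.mem_nhds fun h => hz (hsub h)] with y hy
        rw [image_eq_zero_of_notMem_tsupport hy, zero_smul]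
      exact contDiffAt_const.congr_of_eventuallyEq this
  · filter_upwards [ψ.eventuallyEq_one] with z hz
    rw [hz, Pi.one_apply, one_smul]

end Extension

section LocalExp

variable {n : ℕ} {M : Type*} [TopologicalSpace M] [ChartedSpace (Euc n) M]
  [IsManifold 𝓘(ℝ, Euc n) ∞ M]

/-- A solution of the geodesic equation in a chart agrees with the geodesic that has the same
initial velocity. -/
theorem IsRiemGeodesic.eq_of_chart_solution [T2Space M] {h : RiemMetric n M} {c : ℝ → M}
    (hc : IsRiemGeodesic h c) {p : M} {k : Euc n × Euc n → Euc n} {K : ℝ≥0}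
    (hk : LipschitzWith K k) {V : Set (Euc n × Euc n)} (hV : IsOpen V)
    (hVk : ∀ z ∈ V, z.1 ∈ (extChartAt 𝓘(ℝ, Euc n) p).target ∧
      k z = geodesicForce (metricCoeff h p) z)
    {Z : ℝ → Euc n × Euc n} (hZV : ∀ t ∈ Icc (0 : ℝ) 1, Z t ∈ V)
    (hZ : ∀ t ∈ Icc (0 : ℝ) 1, HasDerivWithinAt Z ((Z t).2, k (Z t)) (Icc 0 1) t)
    (h0 : (velocity n c 0).1 ∈ (extChartAt 𝓘(ℝ, Euc n) p).source)
    (hZ0 : chartCoord p (velocity n c 0) = Z 0) :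
    c 1 = (extChartAt 𝓘(ℝ, Euc n) p).symm (Z 1).1 := by
  set x : ℝ → Euc n := fun s => extChartAt 𝓘(ℝ, Euc n) p (c s) with hx
  set x' : ℝ → Euc n := derivWithin x (Icc 0 1) with hx'
  have hcc : ContinuousOn c (Icc 0 1) := hc.1.continuousOn
  have hZc : ContinuousOn Z (Icc 0 1) := fun t ht => (hZ t ht).continuousWithinAt
  have hgc : ContinuousOn (fun s => (extChartAt 𝓘(ℝ, Euc n) p).symm (Z s).1) (Icc 0 1) :=
    (continuousOn_extChartAt_symm p).comp (continuous_fst.comp_continuousOn hZc)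
      fun t ht => (hVk _ (hZV t ht)).1
  have hmem : ∀ s ∈ Icc (0 : ℝ) 1, c s = (extChartAt 𝓘(ℝ, Euc n) p).symm (Z s).1 →
      c s ∈ (extChartAt 𝓘(ℝ, Euc n) p).source := fun s hs h => by
    rw [h]
    exact (extChartAt 𝓘(ℝ, Euc n) p).map_target (hVk _ (hZV s hs)).1
  have hx'c : ∀ s ∈ Icc (0 : ℝ) 1, c s ∈ (extChartAt 𝓘(ℝ, Euc n) p).source →
      ContinuousWithinAt x' (Icc 0 1) s := fun s hs h =>
    (contDiffWithinAt_derivWithin hs (contDiffWithinAt_chart_comp hc.1 hs h)).continuousWithinAt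
  -- Continuation: the geodesic is not known to remain in the chart, so the times at which position
  -- and velocity agree are shown to be closed, to contain 0 and to be open to the right.
  set S : Set ℝ := {s | c s = (extChartAt 𝓘(ℝ, Euc n) p).symm (Z s).1 ∧ x' s = (Z s).2} with hS
  have hclosed : IsClosed (S ∩ Icc 0 1) := by
    refine isClosed_of_closure_subset fun s hs => ?_
    have hsI : s ∈ Icc (0 : ℝ) 1 :=
      isClosed_Icc.closure_subset_iff.2 inter_subset_right hs
    have hne : (𝓝[S ∩ Icc 0 1] s).NeBot := mem_closure_iff_nhdsWithin_neBot.1 hs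
    -- Positions first, by uniqueness of limits in `M`. This puts the geodesic back into the chart
    -- at the limit time, where its coordinate velocity is continuous and can be passed to the
    -- limit.
    have e1 : c s = (extChartAt 𝓘(ℝ, Euc n) p).symm (Z s).1 := by
      refine tendsto_nhds_unique (l := 𝓝[S ∩ Icc 0 1] s) ((hcc s hsI).mono inter_subset_right)
        (Tendsto.congr' ?_ ((hgc s hsI).mono inter_subset_right))
      filter_upwards [self_mem_nhdsWithin] with r hr
      exact hr.1.1.symm
    refine ⟨⟨e1, ?_⟩, hsI⟩
    refine tendsto_nhds_unique (l := 𝓝[S ∩ Icc 0 1] s) ((hx'c s hsI (hmem s hsI e1)).mono inter_subset_right)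
      (Tendsto.congr' ?_ ((continuous_snd.comp_continuousOn hZc s hsI).mono inter_subset_right))
    filter_upwards [self_mem_nhdsWithin] with r hr
    exact hr.1.2.symm
  have h0I : (0 : ℝ) ∈ Icc (0 : ℝ) 1 := by simp
  have h0S : (0 : ℝ) ∈ S := by
    have h1 := chartCoord_velocity h0I ((hc.1 0 h0I).mdifferentiableWithinAt (by simp)) h0
    rw [hZ0] at h1
    refine ⟨?_, by rw [h1]⟩
    rw [h1]
    exact ((extChartAt 𝓘(ℝ, Euc n) p).left_inv h0).symm
  have hright : ∀ s ∈ S ∩ Ico 0 1, S ∈ 𝓝[>] s := by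
    rintro s ⟨hsS, hs⟩
    have hsI : s ∈ Icc (0 : ℝ) 1 := ⟨hs.1, hs.2.le⟩
    have hsrc := hmem s hsI hsS.1
    have hphase : ContinuousWithinAt (fun r => (x r, x' r)) (Icc 0 1) s :=
      (contDiffWithinAt_chart_comp hc.1 hsI hsrc).continuousWithinAt.prodMk (hx'c s hsI hsrc)
    have hxs : (x s, x' s) = Z s := by
      refine Prod.ext ?_ hsS.2
      show extChartAt 𝓘(ℝ, Euc n) p (c s) = (Z s).1
      rw [hsS.1]
      exact (extChartAt 𝓘(ℝ, Euc n) p).right_inv (hVk _ (hZV s hsI)).1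
    have hev : ∀ᶠ r in 𝓝[Icc 0 1] s, c r ∈ (extChartAt 𝓘(ℝ, Euc n) p).source ∧ (x r, x' r) ∈ V :=
      (eventually_mem_source hc.1 hsI hsrc).and
        (hphase.eventually (hV.mem_nhds (by simpa only [hxs] using hZV s hsI)))
    have hev2 : ∀ᶠ r in 𝓝[≥] s, r ∈ Icc (0 : ℝ) 1 ∧
        c r ∈ (extChartAt 𝓘(ℝ, Euc n) p).source ∧ (x r, x' r) ∈ V := by
      have hle : 𝓝[≥] s ≤ 𝓝[Icc 0 1] s := by
        refine nhdsWithin_le_of_mem ?_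
        exact mem_of_superset (Icc_mem_nhdsGE hs.2) (Icc_subset_Icc_left hs.1)
      exact hle (eventually_mem_nhdsWithin.and hev)
    obtain ⟨b, hb, hsb⟩ := (mem_nhdsGE_iff_exists_Icc_subset).1 hev2
    have hodeder : ∀ {g : ℝ → Euc n × Euc n} {g' : Euc n × Euc n} {r : ℝ}, r ∈ Ico s b →
        HasDerivWithinAt g g' (Icc 0 1) r → HasDerivWithinAt g g' (Ici r) r := by
      intro g g' r hr hd
      have hr1 : r < 1 := hr.2.trans_le (hsb ⟨hb.le, le_rfl⟩).1.2
      refine hd.mono_of_mem_nhdsWithin ?_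
      exact mem_of_superset (Icc_mem_nhdsGE hr1) (Icc_subset_Icc_left (hs.1.trans hr.1))
    -- On a short interval both curves stay where the geodesic equation is governed by the Lipschitz
    -- force `k`, so the uniqueness theorem applies.
    have heq : EqOn (fun r => (x r, x' r)) Z (Icc s b) := by
      have hX : LipschitzWith (max 1 K) (fun z : Euc n × Euc n => (z.2, k z)) :=
        LipschitzWith.prod_snd.prodMk hk
      refine ODE_solution_unique_of_mem_Icc_right (v := fun _ z => (z.2, k z)) (s := fun _ => univ)
        (K := max 1 K) (fun _ _ => hX.lipschitzOnWith) ?_ ?_ (fun _ _ => mem_univ _)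
        (hZc.mono fun r hr => (hsb hr).1) (fun r hr => hodeder hr (hZ r (hsb ⟨hr.1, hr.2.le⟩).1))
        (fun _ _ => mem_univ _) hxs
      · intro r hr
        have := hsb hr
        exact (((contDiffWithinAt_chart_comp hc.1 this.1 this.2.1).continuousWithinAt.prodMk
          (hx'c r this.1 this.2.1)).mono fun q hq => (hsb hq).1)
      · intro r hr
        have hr' := hsb ⟨hr.1, hr.2.le⟩
        have hg := hc.geodesic_equation hr'.1 hr'.2.1
        refine hodeder hr ?_
        simp only
        rw [(hVk _ hr'.2.2).2]
        exact hg.1.prodMk hg.2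
    refine mem_of_superset (Icc_mem_nhdsGT hb) fun r hr => ?_
    have h1 := heq hr
    refine ⟨?_, by rw [← h1]⟩
    rw [← h1]
    exact ((extChartAt 𝓘(ℝ, Euc n) p).left_inv (hsb hr).2.1).symm
  exact (hclosed.Icc_subset_of_forall_mem_nhdsWithin h0S hright (by simp : (1 : ℝ) ∈ Icc (0 : ℝ) 1)).1

/-- The exponential map of `h` is smooth near the zero section, in charts. -/
theorem exists_local_exp [T2Space M] (h : RiemMetric n M) (p : M) :
    ∃ e : Euc n × Euc n → Euc n,
      ContDiffAt ℝ ∞ e (extChartAt 𝓘(ℝ, Euc n) p p, 0) ∧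
      (∀ᶠ x in 𝓝 (extChartAt 𝓘(ℝ, Euc n) p p), e (x, 0) = x ∧
        ∀ z, fderiv ℝ e (x, 0) z = z.1 + z.2) ∧
      ∀ᶠ z in 𝓝 (extChartAt 𝓘(ℝ, Euc n) p p, (0 : Euc n)),
        ∀ u : TangentBundle 𝓘(ℝ, Euc n) M, u.1 ∈ (extChartAt 𝓘(ℝ, Euc n) p).source →
          chartCoord p u = z → InExpDomain h u →
          riemExp h u = (extChartAt 𝓘(ℝ, Euc n) p).symm (e z) := by
  set x₀ := extChartAt 𝓘(ℝ, Euc n) p p with hx₀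
  set T := (extChartAt 𝓘(ℝ, Euc n) p).target with hT
  have hxT : x₀ ∈ T := mem_extChartAt_target p
  have hg := isMetricOn_metricCoeff h p
  -- A compactly supported force is needed for the global superposition operator. It is the true
  -- geodesic force only near (x₀, 0), which is why trajectories must be confined later.
  obtain ⟨k, hk, hks, hkeq⟩ := exists_smooth_compactSupport_eventuallyEq (isOpen_target_prod p)
    hg.contDiffOn_geodesicForce (x := (x₀, (0 : Euc n))) ⟨hxT, mem_univ _⟩
  obtain ⟨K, hK⟩ := ContDiff.lipschitzWith_of_hasCompactSupport hks hk (by simp)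
  have hTn : ∀ᶠ z in 𝓝 (x₀, (0 : Euc n)), z.1 ∈ T :=
    continuous_fst.continuousAt.eventually ((isOpen_target p).mem_nhds hxT)
  have hx0 : Tendsto (fun x : Euc n => (x, (0 : Euc n))) (𝓝 x₀) (𝓝 (x₀, 0)) :=
    (continuous_id.prodMk continuous_const).tendsto _
  have hk0 : ∀ᶠ x in 𝓝 x₀, k (x, 0) = 0 ∧ fderiv ℝ k (x, 0) = 0 := by
    filter_upwards [hx0.eventually hkeq.eventually_nhds, (isOpen_target p).mem_nhds hxT]
      with x h1 h2
    refine ⟨?_, ?_⟩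
    · rw [h1.self_of_nhds]
      have := geodesicForce_smul (metricCoeff h p) x (0 : Euc n) 0
      simpa using this
    · have h3 : k =ᶠ[𝓝 (x, (0 : Euc n))] geodesicForce (metricCoeff h p) := h1
      rw [h3.fderiv_eq, hg.fderiv_geodesicForce_zero h2]
  obtain ⟨ζ, hζ, hζ0, hζode, hζ1⟩ := exists_smooth_local_flow hk hks hk0
  set one : Icc (0 : ℝ) 1 := ⟨1, by simp⟩ with hone
  set ev : C(Icc (0 : ℝ) 1, Euc n × Euc n) →L[ℝ] Euc n :=
    (ContinuousLinearMap.fst ℝ (Euc n) (Euc n)).comp (ContinuousMap.evalCLM ℝ one) with hev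
  obtain ⟨V, hVsub, hVo, hVm⟩ := eventually_nhds_iff.1 (hTn.and hkeq)
  refine ⟨fun z => ev (ζ z), ev.contDiff.contDiffAt.comp _ hζ, ?_, ?_⟩
  · have hdiff : ∀ᶠ z in 𝓝 (x₀, (0 : Euc n)), DifferentiableAt ℝ ζ z := by
      filter_upwards [(hζ.of_le (m := 1) (by simp)).eventually (by simp)] with z hz
      exact hz.differentiableAt (by simp)
    filter_upwards [hζ1, hx0.eventually hdiff] with x h1 h2
    refine ⟨?_, fun z => ?_⟩
    · show (ζ (x, 0) one).1 = x
      rw [h1.1]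
      rfl
    · have h3 : fderiv ℝ (fun z => ev (ζ z)) (x, 0) = ev.comp (fderiv ℝ ζ (x, 0)) :=
        (ev.hasFDerivAt.comp _ h2.hasFDerivAt).fderiv
      rw [h3]
      show (fderiv ℝ ζ (x, 0) z one).1 = _
      rw [h1.2 z]
  -- The solutions depend continuously on z in the supremum norm and reduce to a constant at (x₀,
  -- 0), so for small data they remain in `V` during all of [0,1].
  · have hVt : ∀ᶠ z in 𝓝 (x₀, (0 : Euc n)), ∀ t, ζ z t ∈ V := by
      obtain ⟨r, hr, hrV⟩ := Metric.isOpen_iff.1 hVo _ hVm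
      have h1 := hζ.continuousAt.eventually (Metric.ball_mem_nhds (ζ (x₀, 0)) hr)
      filter_upwards [h1] with z hz t
      refine hrV ?_
      have h2 := (ContinuousMap.dist_apply_le_dist t).trans_lt hz
      rw [hζ0] at h2
      exact h2
    filter_upwards [hζode, hVt] with z hz hzV u hu huz hexp
    rw [riemExp, dif_pos hexp]
    -- The exponential map uses some chosen geodesic with the given initial velocity; uniqueness
    -- identifies its endpoint whatever the choice.
    have hspec := hexp.choose_spec
    set c := hexp.choose with hc
    have h01 : (0 : ℝ) ∈ Icc (0 : ℝ) 1 := by simp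
    have := hspec.1.eq_of_chart_solution hK hVo hVsub (Z := IccExtend zero_le_one (ζ z))
      (fun t ht => by rw [IccExtend_of_mem _ _ ht]; exact hzV _)
      (fun t ht => by rw [IccExtend_of_mem _ _ ht]; exact hz.2 t ht)
      (by rw [hspec.2]; exact hu)
      (by rw [hspec.2, huz, IccExtend_of_mem _ _ h01, hz.1])
    rw [this, IccExtend_of_mem _ _ (by simp : (1 : ℝ) ∈ Icc (0 : ℝ) 1)]
    rfl

end LocalExp

end

noncomputable section

set_option maxSynthPendingDepth 3

/-! ## Lagrangians that are homogeneous of degree two in the velocity -/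

section Homogeneous

variable {E : Type*} [NormedAddCommGroup E] [NormedSpace ℝ E]

/-- A Lagrangian on `T × E` that is smooth away from zero velocity, positively homogeneous of
degree two, and has positive definite second differential in the velocity. -/
structure HomogeneousLagrangian (l : E × E → ℝ) (T : Set E) : Prop where
  isOpen : IsOpen T
  contDiffOn : ContDiffOn ℝ ∞ l (T ×ˢ {0}ᶜ)
  smul : ∀ x ∈ T, ∀ v, ∀ s : ℝ, 0 ≤ s → l (x, s • v) = s ^ 2 * l (x, v)
  hess_pos : ∀ x ∈ T, ∀ v w, v ≠ 0 → w ≠ 0 → 0 < fderiv ℝ (fderiv ℝ l) (x, v) (0, w) (0, w)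

theorem norm_unit {v : E} (hv : v ≠ 0) : ‖‖v‖⁻¹ • v‖ = 1 := by
  rw [norm_smul, norm_inv, norm_norm, inv_mul_cancel₀ (norm_ne_zero_iff.2 hv)]

theorem norm_smul_unit {v : E} (hv : v ≠ 0) : ‖v‖ • (‖v‖⁻¹ • v) = v := by
  rw [smul_smul, mul_inv_cancel₀ (norm_ne_zero_iff.2 hv), one_smul]

/-- Radial projection is Lipschitz with constant 2/‖v‖. This converts estimates on the compact unit
sphere into estimates for all nonzero velocities. -/
theorem norm_mul_norm_unit_sub_le {v v' : E} (hv : v ≠ 0) (hv' : v' ≠ 0) :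
    ‖v‖ * ‖‖v‖⁻¹ • v - ‖v'‖⁻¹ • v'‖ ≤ 2 * ‖v - v'‖ := by
  have h1 : ‖v‖ • (‖v‖⁻¹ • v - ‖v'‖⁻¹ • v') = (v - v') - (‖v‖ - ‖v'‖) • (‖v'‖⁻¹ • v') := by
    rw [smul_sub, norm_smul_unit hv, sub_smul, norm_smul_unit hv']
    abel
  have h2 : ‖‖v‖ • (‖v‖⁻¹ • v - ‖v'‖⁻¹ • v')‖ ≤ ‖v - v'‖ + ‖v - v'‖ := by
    rw [h1]
    refine (norm_sub_le _ _).trans (add_le_add le_rfl ?_)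
    rw [norm_smul, norm_unit hv', mul_one, Real.norm_eq_abs]
    exact abs_norm_sub_norm_le v v'
  rw [norm_smul, norm_norm] at h2
  linarith

/-- A smooth function is Lipschitz and bounded on a compact set. -/
theorem exists_lipschitz_bound_of_compact {G F : Type*} [NormedAddCommGroup G] [NormedSpace ℝ G]
    [NormedAddCommGroup F] [NormedSpace ℝ F] {g : G → F} {U S : Set G} (hU : IsOpen U)
    (hg : ContDiffOn ℝ ∞ g U) (hS : IsCompact S) (hSU : S ⊆ U) :
    ∃ K : ℝ, 0 ≤ K ∧ (∀ z ∈ S, ∀ z' ∈ S, ‖g z - g z'‖ ≤ K * ‖z - z'‖) ∧ ∀ z ∈ S, ‖g z‖ ≤ K := by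
  have hloc : LocallyLipschitzOn S g := by
    intro z hz
    obtain ⟨K, t, ht, hK⟩ := ((hg.contDiffAt (hU.mem_nhds (hSU hz))).of_le
      (m := 1) (by simp)).exists_lipschitzOnWith
    exact ⟨K, t, mem_nhdsWithin_of_mem_nhds ht, hK⟩
  obtain ⟨K, hK⟩ := hloc.exists_lipschitzOnWith_of_compact hS
  obtain ⟨B, hB⟩ := hS.exists_bound_of_continuousOn (hg.continuousOn.mono hSU)
  refine ⟨max K B, le_max_of_le_left K.2, fun z hz z' hz' => ?_, fun z hz =>
    (hB z hz).trans (le_max_right _ _)⟩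
  have := hK.dist_le_mul z hz z' hz'
  rw [dist_eq_norm, dist_eq_norm] at this
  exact this.trans (mul_le_mul_of_nonneg_right (le_max_left _ _) (norm_nonneg _))

/-- The estimate for homogeneous functions underlying their Lipschitz continuity. -/
theorem norm_mul_norm_unit_sub_image_le {F : Type*} [NormedAddCommGroup F] {g : E × E → F}
    {B : Set E} {K : ℝ} (hK0 : 0 ≤ K)
    (hK : ∀ z ∈ B ×ˢ Metric.sphere (0 : E) 1, ∀ z' ∈ B ×ˢ Metric.sphere (0 : E) 1,
      ‖g z - g z'‖ ≤ K * ‖z - z'‖)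
    {x x' v v' : E} (hx : x ∈ B) (hx' : x' ∈ B) (hv : v ≠ 0) (hv' : v' ≠ 0) :
    ‖v‖ * ‖g (x, ‖v‖⁻¹ • v) - g (x', ‖v'‖⁻¹ • v')‖ ≤ K * (‖x - x'‖ * ‖v‖ + 2 * ‖v - v'‖) := by
  have h1 := hK (x, ‖v‖⁻¹ • v) ⟨hx, by simpa using norm_unit hv⟩ (x', ‖v'‖⁻¹ • v')
    ⟨hx', by simpa using norm_unit hv'⟩
  have h2 : ‖((x, ‖v‖⁻¹ • v) : E × E) - (x', ‖v'‖⁻¹ • v')‖ ≤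
      ‖x - x'‖ + ‖‖v‖⁻¹ • v - ‖v'‖⁻¹ • v'‖ := by
    rw [Prod.mk_sub_mk, Prod.norm_mk]
    exact max_le (by linarith [norm_nonneg (‖v‖⁻¹ • v - ‖v'‖⁻¹ • v')])
      (by linarith [norm_nonneg (x - x')])
  have h3 := norm_mul_norm_unit_sub_le hv hv'
  calc ‖v‖ * ‖g (x, ‖v‖⁻¹ • v) - g (x', ‖v'‖⁻¹ • v')‖
      ≤ ‖v‖ * (K * (‖x - x'‖ + ‖‖v‖⁻¹ • v - ‖v'‖⁻¹ • v'‖)) := by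
        gcongr; exact h1.trans (mul_le_mul_of_nonneg_left h2 hK0)
    _ = K * (‖x - x'‖ * ‖v‖ + ‖v‖ * ‖‖v‖⁻¹ • v - ‖v'‖⁻¹ • v'‖) := by ring
    _ ≤ _ := by gcongr

/-- Lipschitz estimate for functions homogeneous of degree one in the second variable. -/
theorem norm_sub_le_of_homogeneous_one {F : Type*} [NormedAddCommGroup F] [NormedSpace ℝ F]
    {g : E × E → F} {B : Set E} {K : ℝ} (hK0 : 0 ≤ K)
    (hK : ∀ z ∈ B ×ˢ Metric.sphere (0 : E) 1, ∀ z' ∈ B ×ˢ Metric.sphere (0 : E) 1,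
      ‖g z - g z'‖ ≤ K * ‖z - z'‖)
    (hb : ∀ z ∈ B ×ˢ Metric.sphere (0 : E) 1, ‖g z‖ ≤ K)
    (hg : ∀ x ∈ B, ∀ v : E, ∀ s : ℝ, 0 ≤ s → g (x, s • v) = s • g (x, v))
    {x x' : E} (hx : x ∈ B) (hx' : x' ∈ B) (v v' : E) :
    ‖g (x, v) - g (x', v')‖ ≤ 3 * K * (‖x - x'‖ * ‖v‖ + ‖v - v'‖) := by
  have h0 : ∀ y ∈ B, g (y, 0) = 0 := fun y hy => by simpa using hg y hy 0 0 le_rfl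
  have hnorm : ∀ y ∈ B, ∀ u : E, ‖g (y, u)‖ ≤ K * ‖u‖ := by
    intro y hy u
    by_cases hu : u = 0
    · rw [hu, h0 y hy]; simp
    · rw [← norm_smul_unit hu, hg y hy _ _ (norm_nonneg _), norm_smul, norm_norm,
        norm_smul_unit hu, mul_comm]
      exact mul_le_mul_of_nonneg_right (hb _ ⟨hy, by simpa using norm_unit hu⟩) (norm_nonneg _)
  by_cases hv : v = 0
  · subst hv
    rw [h0 x hx, zero_sub, norm_neg]
    have := hnorm x' hx' v'
    have e : ‖(0 : E) - v'‖ = ‖v'‖ := by simp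
    rw [e, norm_zero]
    nlinarith [mul_nonneg hK0 (norm_nonneg v')]
  by_cases hv' : v' = 0
  · subst hv'
    rw [h0 x' hx', sub_zero, sub_zero]
    have := hnorm x hx v
    nlinarith [norm_nonneg v, mul_nonneg (norm_nonneg (x - x')) (norm_nonneg v)]
  have key := norm_mul_norm_unit_sub_image_le hK0 hK hx hx' hv hv'
  have h1 : g (x, v) - g (x', v') = ‖v‖ • (g (x, ‖v‖⁻¹ • v) - g (x', ‖v'‖⁻¹ • v')) +
      (‖v‖ - ‖v'‖) • g (x', ‖v'‖⁻¹ • v') := by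
    rw [smul_sub, sub_smul, ← hg x hx _ _ (norm_nonneg _), ← hg x' hx' _ ‖v'‖ (norm_nonneg _),
      norm_smul_unit hv, norm_smul_unit hv']
    abel
  rw [h1]
  refine (norm_add_le _ _).trans ?_
  rw [norm_smul, norm_smul, norm_norm, Real.norm_eq_abs]
  have h2 : |‖v‖ - ‖v'‖| * ‖g (x', ‖v'‖⁻¹ • v')‖ ≤ ‖v - v'‖ * K :=
    mul_le_mul (abs_norm_sub_norm_le _ _) (hb _ ⟨hx', by simpa using norm_unit hv'⟩)
      (norm_nonneg _) (norm_nonneg _)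
  nlinarith [mul_nonneg hK0 (mul_nonneg (norm_nonneg (x - x')) (norm_nonneg v))]

/-- Lipschitz estimate for functions homogeneous of degree two in the second variable. -/
theorem norm_sub_le_of_homogeneous_two {F : Type*} [NormedAddCommGroup F] [NormedSpace ℝ F]
    {g : E × E → F} {B : Set E} {K : ℝ} (hK0 : 0 ≤ K)
    (hK : ∀ z ∈ B ×ˢ Metric.sphere (0 : E) 1, ∀ z' ∈ B ×ˢ Metric.sphere (0 : E) 1,
      ‖g z - g z'‖ ≤ K * ‖z - z'‖)
    (hb : ∀ z ∈ B ×ˢ Metric.sphere (0 : E) 1, ‖g z‖ ≤ K)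
    (hg : ∀ x ∈ B, ∀ v : E, ∀ s : ℝ, 0 ≤ s → g (x, s • v) = s ^ 2 • g (x, v))
    {x x' : E} (hx : x ∈ B) (hx' : x' ∈ B) (v v' : E) :
    ‖g (x, v) - g (x', v')‖ ≤
      3 * K * (‖x - x'‖ * ‖v‖ ^ 2 + ‖v - v'‖ * (‖v‖ + ‖v'‖)) := by
  have h0 : ∀ y ∈ B, g (y, 0) = 0 := fun y hy => by simpa using hg y hy 0 0 le_rfl
  have hnorm : ∀ y ∈ B, ∀ u : E, ‖g (y, u)‖ ≤ K * ‖u‖ ^ 2 := by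
    intro y hy u
    by_cases hu : u = 0
    · rw [hu, h0 y hy]; simp
    · rw [← norm_smul_unit hu, hg y hy _ _ (norm_nonneg _), norm_smul, norm_pow, norm_norm,
        norm_smul_unit hu, mul_comm]
      exact mul_le_mul_of_nonneg_right (hb _ ⟨hy, by simpa using norm_unit hu⟩) (by positivity)
  by_cases hv : v = 0
  · subst hv
    rw [h0 x hx, zero_sub, norm_neg]
    have := hnorm x' hx' v'
    have e : ‖(0 : E) - v'‖ = ‖v'‖ := by simp
    rw [e, norm_zero]
    nlinarith [mul_nonneg hK0 (sq_nonneg ‖v'‖)]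
  by_cases hv' : v' = 0
  · subst hv'
    rw [h0 x' hx', sub_zero, sub_zero, norm_zero]
    have := hnorm x hx v
    nlinarith [mul_nonneg hK0 (sq_nonneg ‖v‖),
      mul_nonneg hK0 (mul_nonneg (norm_nonneg (x - x')) (sq_nonneg ‖v‖))]
  have key := mul_le_mul_of_nonneg_left (norm_mul_norm_unit_sub_image_le hK0 hK hx hx' hv hv')
    (norm_nonneg v)
  have h1 : g (x, v) - g (x', v') = ‖v‖ ^ 2 • (g (x, ‖v‖⁻¹ • v) - g (x', ‖v'‖⁻¹ • v')) +
      (‖v‖ ^ 2 - ‖v'‖ ^ 2) • g (x', ‖v'‖⁻¹ • v') := by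
    rw [smul_sub, sub_smul, ← hg x hx _ _ (norm_nonneg _), ← hg x' hx' _ ‖v'‖ (norm_nonneg _),
      norm_smul_unit hv, norm_smul_unit hv']
    abel
  rw [h1]
  refine (norm_add_le _ _).trans ?_
  rw [norm_smul, norm_smul, norm_pow, norm_norm, Real.norm_eq_abs]
  have h3 : |‖v‖ ^ 2 - ‖v'‖ ^ 2| ≤ ‖v - v'‖ * (‖v‖ + ‖v'‖) := by
    have : ‖v‖ ^ 2 - ‖v'‖ ^ 2 = (‖v‖ - ‖v'‖) * (‖v‖ + ‖v'‖) := by ring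
    rw [this, abs_mul, abs_of_nonneg (by positivity : 0 ≤ ‖v‖ + ‖v'‖)]
    exact mul_le_mul_of_nonneg_right (abs_norm_sub_norm_le _ _) (by positivity)
  have h2 : |‖v‖ ^ 2 - ‖v'‖ ^ 2| * ‖g (x', ‖v'‖⁻¹ • v')‖ ≤ ‖v - v'‖ * (‖v‖ + ‖v'‖) * K :=
    mul_le_mul h3 (hb _ ⟨hx', by simpa using norm_unit hv'⟩) (norm_nonneg _) (by positivity)
  have h4 : K * (‖v - v'‖ * ‖v'‖) ≥ 0 := by positivity
  have h5 : K * (‖x - x'‖ * ‖v‖ ^ 2) ≥ 0 := by positivity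
  nlinarith [key, h2, h4, h5]

theorem hasDerivAt_line (x v w : E) (r : ℝ) :
    HasDerivAt (fun r : ℝ => (x, v + r • w)) ((0 : E), w) r := by
  simpa using (hasDerivAt_const r x).prodMk (((hasDerivAt_id r).smul_const w).const_add v)

/-- The second derivative of a function along a line of the fibre. -/
theorem hasDerivAt_fderiv_line {l : E × E → ℝ} {x v w : E} {r : ℝ}
    (hl : ContDiffAt ℝ ∞ l (x, v + r • w)) :
    HasDerivAt (fun r : ℝ => fderiv ℝ l (x, v + r • w) (0, w))
      (fderiv ℝ (fderiv ℝ l) (x, v + r • w) (0, w) (0, w)) r := by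
  have h0 : HasFDerivAt (fderiv ℝ l) (fderiv ℝ (fderiv ℝ l) (x, v + r • w)) (x, v + r • w) :=
    ((hl.fderiv_right (m := ∞) (by simp)).differentiableAt (by simp)).hasFDerivAt
  have h2 : HasDerivAt (fun r : ℝ => fderiv ℝ l (x, v + r • w))
      (fderiv ℝ (fderiv ℝ l) (x, v + r • w) (0, w)) r :=
    h0.comp_hasDerivAt r (hasDerivAt_line x v w r)
  exact (ContinuousLinearMap.apply ℝ ℝ ((0 : E), w)).hasFDerivAt.comp_hasDerivAt r h2

namespace HomogeneousLagrangian

variable {l : E × E → ℝ} {T : Set E}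

theorem isOpen_prod (hl : HomogeneousLagrangian l T) : IsOpen (T ×ˢ ({0}ᶜ : Set E)) :=
  hl.isOpen.prod isOpen_compl_singleton

theorem contDiffAt (hl : HomogeneousLagrangian l T) {x v : E} (hx : x ∈ T) (hv : v ≠ 0) :
    ContDiffAt ℝ ∞ l (x, v) :=
  hl.contDiffOn.contDiffAt (hl.isOpen_prod.mem_nhds ⟨hx, hv⟩)

theorem contDiffOn_fderiv (hl : HomogeneousLagrangian l T) :
    ContDiffOn ℝ ∞ (fderiv ℝ l) (T ×ˢ {0}ᶜ) :=
  hl.contDiffOn.fderiv_of_isOpen hl.isOpen_prod (by simp)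

theorem apply_zero (hl : HomogeneousLagrangian l T) {x : E} (hx : x ∈ T) : l (x, 0) = 0 := by
  simpa using hl.smul x hx 0 0 le_rfl

theorem hasDerivAt_momentum (hl : HomogeneousLagrangian l T) {x v : E} (hx : x ∈ T) (w : E) (r : ℝ)
    (hv : v + r • w ≠ 0) : HasDerivAt (fun r : ℝ => fderiv ℝ l (x, v + r • w) (0, w))
      (fderiv ℝ (fderiv ℝ l) (x, v + r • w) (0, w) (0, w)) r :=
  hasDerivAt_fderiv_line (hl.contDiffAt hx hv)

variable [FiniteDimensional ℝ E]

theorem exists_norm_le (hl : HomogeneousLagrangian l T) {B : Set E} (hB : IsCompact B)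
    (hBT : B ⊆ T) : ∃ K, 0 ≤ K ∧ ∀ x ∈ B, ∀ v, ‖l (x, v)‖ ≤ K * ‖v‖ ^ 2 := by
  obtain ⟨K, hK0, -, hK⟩ := exists_lipschitz_bound_of_compact hl.isOpen_prod hl.contDiffOn
    (hB.prod (isCompact_sphere (0 : E) 1)) (fun z hz => ⟨hBT hz.1, by
      have := hz.2
      intro h0
      rw [mem_singleton_iff] at h0
      rw [h0] at this
      simp at this⟩)
  refine ⟨K, hK0, fun x hx u => ?_⟩
  by_cases hu : u = 0
  · rw [hu, hl.apply_zero (hBT hx)]; simp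
  · rw [← norm_smul_unit hu, hl.smul x (hBT hx) _ _ (norm_nonneg _), norm_mul, norm_pow, norm_norm,
      norm_smul_unit hu, mul_comm]
    exact mul_le_mul_of_nonneg_right (hK _ ⟨hx, by simpa using norm_unit hu⟩) (by positivity)

/-- Homogeneity bounds l by K‖v‖², uniformly for x near the base point, so l is differentiable at
zero velocity although it is assumed smooth only away from it. -/
theorem hasFDerivAt_zero (hl : HomogeneousLagrangian l T) {x : E} (hx : x ∈ T) :
    HasFDerivAt l (0 : E × E →L[ℝ] ℝ) (x, 0) := by
  obtain ⟨r, hr, hrT⟩ := Metric.nhds_basis_closedBall.mem_iff.1 (hl.isOpen.mem_nhds hx)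
  obtain ⟨K, hK0, hK⟩ := hl.exists_norm_le (isCompact_closedBall x r) hrT
  rw [hasFDerivAt_iff_isLittleO]
  refine Asymptotics.IsBigO.trans_isLittleO (g := fun z : E × E => ‖z - (x, 0)‖ ^ 2) ?_ ?_
  · refine Asymptotics.IsBigO.of_bound K ?_
    have : ∀ᶠ z : E × E in 𝓝 (x, 0), z.1 ∈ Metric.closedBall x r :=
      continuous_fst.continuousAt.eventually (Metric.closedBall_mem_nhds x hr)
    filter_upwards [this] with z hz
    rw [hl.apply_zero hx, zero_apply, sub_zero, sub_zero, norm_pow, norm_norm]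
    refine (hK z.1 hz z.2).trans ?_
    gcongr
    have := norm_snd_le (z - (x, 0))
    simpa using this
  · have h := (Asymptotics.isLittleO_norm_pow_id (E' := E × E) one_lt_two).comp_tendsto
      (tendsto_sub_nhds_zero_iff.2 (tendsto_id (x := 𝓝 ((x, 0) : E × E))))
    exact h

theorem differentiableAt (hl : HomogeneousLagrangian l T) {x : E} (hx : x ∈ T) (v : E) :
    DifferentiableAt ℝ l (x, v) := by
  by_cases hv : v = 0
  · rw [hv]; exact (hl.hasFDerivAt_zero hx).differentiableAt
  · exact (hl.contDiffAt hx hv).differentiableAt (by simp)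

theorem fderiv_smul (hl : HomogeneousLagrangian l T) {x : E} (hx : x ∈ T) (v w w' : E) {s : ℝ}
    (hs : 0 ≤ s) : fderiv ℝ l (x, s • v) (w, s • w') = s ^ 2 * fderiv ℝ l (x, v) (w, w') := by
  set Λ : E × E →L[ℝ] E × E := (ContinuousLinearMap.fst ℝ E E).prod
    (s • ContinuousLinearMap.snd ℝ E E) with hΛ
  have h1 : HasFDerivAt (fun z => l (Λ z)) ((fderiv ℝ l (x, s • v)).comp Λ) (x, v) :=
    HasFDerivAt.comp (x, v) (hl.differentiableAt hx (s • v)).hasFDerivAt Λ.hasFDerivAt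
  have h2 : HasFDerivAt (fun z => s ^ 2 * l z) (s ^ 2 • fderiv ℝ l (x, v)) (x, v) :=
    (hl.differentiableAt hx v).hasFDerivAt.const_mul _
  have h3 : (fun z => l (Λ z)) =ᶠ[𝓝 (x, v)] fun z => s ^ 2 * l z := by
    filter_upwards [continuous_fst.continuousAt.eventually (hl.isOpen.mem_nhds hx)] with z hz
    exact hl.smul z.1 hz z.2 s hs
  have h4 := h1.unique (h2.congr_of_eventuallyEq h3)
  exact DFunLike.congr_fun h4 (w, w')

theorem fderiv_smul_snd (hl : HomogeneousLagrangian l T) {x : E} (hx : x ∈ T) (v w : E) {s : ℝ}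
    (hs : 0 ≤ s) : fderiv ℝ l (x, s • v) (0, w) = s * fderiv ℝ l (x, v) (0, w) := by
  rcases hs.eq_or_lt with h0 | h0
  · rw [← h0, zero_smul, (hl.hasFDerivAt_zero hx).fderiv]; simp
  · have := hl.fderiv_smul hx v 0 w hs
    have e : ((0 : E), s • w) = s • ((0 : E), w) := by simp
    rw [e, map_smul, smul_eq_mul] at this
    exact mul_left_cancel₀ h0.ne' (by rw [this]; ring)

theorem fderiv_smul_fst (hl : HomogeneousLagrangian l T) {x : E} (hx : x ∈ T) (v w : E) {s : ℝ}
    (hs : 0 ≤ s) : fderiv ℝ l (x, s • v) (w, 0) = s ^ 2 * fderiv ℝ l (x, v) (w, 0) := by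
  simpa using hl.fderiv_smul hx v w 0 hs

/-- Euler's identity. -/
theorem euler (hl : HomogeneousLagrangian l T) {x : E} (hx : x ∈ T) (v : E) :
    fderiv ℝ l (x, v) (0, v) = 2 * l (x, v) := by
  have h1 : HasDerivAt (fun s : ℝ => (x, s • v)) ((0 : E), v) 1 := by
    simpa using (hasDerivAt_const (1 : ℝ) x).prodMk ((hasDerivAt_id (1 : ℝ)).smul_const v)
  have h0 : HasFDerivAt l (fderiv ℝ l (x, v)) (x, (1 : ℝ) • v) := by
    simpa using (hl.differentiableAt hx v).hasFDerivAt
  have h2 := h0.comp_hasDerivAt (1 : ℝ) h1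
  have h3 : HasDerivAt (fun s : ℝ => s ^ 2 * l (x, v)) (2 * l (x, v)) 1 := by
    simpa using (hasDerivAt_pow 2 (1 : ℝ)).mul_const (l (x, v))
  refine h2.unique (h3.congr_of_eventuallyEq ?_)
  filter_upwards [lt_mem_nhds (zero_lt_one' ℝ)] with s hs
  exact hl.smul x hx v s hs.le

theorem hess_smul (hl : HomogeneousLagrangian l T) {x v : E} (hx : x ∈ T) (hv : v ≠ 0) (w : E)
    {s : ℝ} (hs : 0 < s) : fderiv ℝ (fderiv ℝ l) (x, s • v) (0, w) (0, w) =
      fderiv ℝ (fderiv ℝ l) (x, v) (0, w) (0, w) := by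
  have h1 := hl.hasDerivAt_momentum hx (v := s • v) w 0 (by simpa using ⟨hs.ne', hv⟩)
  have h2 := hl.hasDerivAt_momentum hx (v := v) w 0 (by simpa using hv)
  simp only [zero_smul, add_zero] at h1 h2
  have hi : HasDerivAt (fun r : ℝ => s⁻¹ * r) s⁻¹ 0 := by
    simpa using (hasDerivAt_id (0 : ℝ)).const_mul s⁻¹
  have h3 : HasDerivAt (fun r : ℝ => s * fderiv ℝ l (x, v + (s⁻¹ * r) • w) (0, w))
      (s * (fderiv ℝ (fderiv ℝ l) (x, v) (0, w) (0, w) * s⁻¹)) 0 := by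
    have h2' : HasDerivAt (fun r : ℝ => fderiv ℝ l (x, v + r • w) (0, w))
      (fderiv ℝ (fderiv ℝ l) (x, v) (0, w) (0, w)) (s⁻¹ * 0) := by simpa using h2
    exact (h2'.comp (0 : ℝ) hi).const_mul s
  have h4 : (fun r : ℝ => fderiv ℝ l (x, s • v + r • w) (0, w)) =
      fun r : ℝ => s * fderiv ℝ l (x, v + (s⁻¹ * r) • w) (0, w) := by
    funext r
    rw [← hl.fderiv_smul_snd hx _ _ hs.le, smul_add, smul_smul, mul_inv_cancel_left₀ hs.ne']
  rw [h4] at h1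
  rw [h1.unique h3]
  field_simp

/-- Along its own ray the momentum in direction v is linear. The identity replaces the Hessian at
zero velocity, which need not exist. -/
theorem hess_self (hl : HomogeneousLagrangian l T) {x v : E} (hx : x ∈ T) (hv : v ≠ 0) :
    fderiv ℝ (fderiv ℝ l) (x, v) (0, v) (0, v) = fderiv ℝ l (x, v) (0, v) := by
  have h2 := hl.hasDerivAt_momentum hx (v := v) v 0 (by simpa using hv)
  simp only [zero_smul, add_zero] at h2
  have h3 : HasDerivAt (fun r : ℝ => (1 + r) * fderiv ℝ l (x, v) (0, v))
      (fderiv ℝ l (x, v) (0, v)) 0 := by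
    simpa using ((hasDerivAt_id (0 : ℝ)).const_add 1).mul_const (fderiv ℝ l (x, v) (0, v))
  refine h2.unique (h3.congr_of_eventuallyEq ?_)
  filter_upwards [lt_mem_nhds (show (-1 : ℝ) < 0 by norm_num)] with r hr
  rw [← hl.fderiv_smul_snd hx _ _ (by linarith), add_smul, one_smul]

/-- The Hessian form is homogeneous of degree zero in v and quadratic in w, so its minimum over a
compact set times two unit spheres controls it everywhere. -/
theorem exists_hess_ge (hl : HomogeneousLagrangian l T) {B : Set E} (hB : IsCompact B)
    (hBT : B ⊆ T) : ∃ c, 0 < c ∧ ∀ x ∈ B, ∀ v w, v ≠ 0 →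
      c * ‖w‖ ^ 2 ≤ fderiv ℝ (fderiv ℝ l) (x, v) (0, w) (0, w) := by
  have hsph : ∀ u ∈ Metric.sphere (0 : E) 1, u ≠ 0 := fun u hu h0 => by simp [h0] at hu
  have hcont : ContinuousOn (fun z : (E × E) × E => fderiv ℝ (fderiv ℝ l) z.1 (0, z.2) (0, z.2))
      ((B ×ˢ Metric.sphere (0 : E) 1) ×ˢ Metric.sphere (0 : E) 1) := by
    have h2 : ContinuousOn (fderiv ℝ (fderiv ℝ l)) (T ×ˢ {0}ᶜ) :=
      hl.contDiffOn_fderiv.continuousOn_fderiv_of_isOpen hl.isOpen_prod (by simp)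
    have h3 : ContinuousOn (fun z : (E × E) × E => fderiv ℝ (fderiv ℝ l) z.1)
        ((B ×ˢ Metric.sphere (0 : E) 1) ×ˢ Metric.sphere (0 : E) 1) :=
      h2.comp continuousOn_fst fun z hz => ⟨hBT hz.1.1, hsph _ hz.1.2⟩
    have h4 : ContinuousOn (fun z : (E × E) × E => ((0 : E), z.2))
        ((B ×ˢ Metric.sphere (0 : E) 1) ×ˢ Metric.sphere (0 : E) 1) :=
      continuousOn_const.prodMk continuousOn_snd
    exact (h3.clm_apply h4).clm_apply h4
  obtain ⟨c, hc0, hc⟩ := ((hB.prod (isCompact_sphere (0 : E) 1)).prod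
    (isCompact_sphere (0 : E) 1)).exists_forall_le' hcont
    (fun z hz => hl.hess_pos z.1.1 (hBT hz.1.1) z.1.2 z.2 (hsph _ hz.1.2) (hsph _ hz.2))
  refine ⟨c, hc0, fun x hx v w hv => ?_⟩
  by_cases hw : w = 0
  · subst hw
    have : ((0 : E), (0 : E)) = 0 := rfl
    rw [this, map_zero]
    simp
  have h1 := hc ((x, ‖v‖⁻¹ • v), ‖w‖⁻¹ • w)
    ⟨⟨hx, by simpa using norm_unit hv⟩, by simpa using norm_unit hw⟩
  simp only at h1
  rw [hl.hess_smul (hBT hx) hv _ (inv_pos.2 (norm_pos_iff.2 hv))] at h1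
  have e : ((0 : E), ‖w‖⁻¹ • w) = ‖w‖⁻¹ • ((0 : E), w) := by simp
  rw [e, map_smul, map_smul, _root_.smul_apply, smul_eq_mul, smul_eq_mul] at h1
  have hw' : 0 < ‖w‖ := norm_pos_iff.2 hw
  have h2 := mul_le_mul_of_nonneg_right h1 (sq_nonneg ‖w‖)
  have h3 : ‖w‖⁻¹ * (‖w‖⁻¹ * fderiv ℝ (fderiv ℝ l) (x, v) (0, w) (0, w)) * ‖w‖ ^ 2 =
      fderiv ℝ (fderiv ℝ l) (x, v) (0, w) (0, w) := by field_simp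
  rwa [h3] at h2

/-- If the segment from v' to v misses the origin, this is the mean value theorem. If it meets the
origin, then v = bd and v' = −ad with a + b = 1, and on each half ray the momentum is linear, so
Euler's relation supplies the bound without differentiating at zero. -/
theorem monotone_of_hess_ge (hl : HomogeneousLagrangian l T) {c : ℝ} {x : E} (hx : x ∈ T)
    (hc : ∀ v w, v ≠ 0 → c * ‖w‖ ^ 2 ≤ fderiv ℝ (fderiv ℝ l) (x, v) (0, w) (0, w)) (v v' : E) :
    c * ‖v - v'‖ ^ 2 ≤ fderiv ℝ l (x, v) (0, v - v') - fderiv ℝ l (x, v') (0, v - v') := by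
  set d := v - v' with hd
  by_cases hd0 : d = 0
  · rw [hd0]
    have : ((0 : E), (0 : E)) = 0 := rfl
    simp [this]
  by_cases h0 : (0 : E) ∈ segment ℝ v v'
  · obtain ⟨a, b, ha, hb, hab, h⟩ := h0
    have hv : v = b • d := by
      have : v = (a + b) • v - (a • v + b • v') := by rw [h, hab]; simp
      rw [this, hd]
      module
    have hv' : v' = a • (-d) := by
      have : v' = (a + b) • v' - (a • v + b • v') := by rw [h, hab]; simp
      rw [this, hd]
      module
    have e1 := hc d d hd0
    rw [hl.hess_self hx hd0] at e1
    have hnd : -d ≠ 0 := neg_ne_zero.2 hd0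
    have e2 := hc (-d) (-d) hnd
    rw [hl.hess_self hx hnd, norm_neg] at e2
    have e3 : fderiv ℝ l (x, -d) (0, -d) = -fderiv ℝ l (x, -d) (0, d) := by
      have : ((0 : E), -d) = -((0 : E), d) := by simp
      rw [this, map_neg]
    rw [hv, hv', hl.fderiv_smul_snd hx _ _ hb, hl.fderiv_smul_snd hx _ _ ha]
    have e4 : c * ‖d‖ ^ 2 = b * (c * ‖d‖ ^ 2) + a * (c * ‖d‖ ^ 2) := by
      rw [← add_mul, add_comm b a, hab, one_mul]
    rw [e4]
    nlinarith [mul_le_mul_of_nonneg_left e1 hb, mul_le_mul_of_nonneg_left e2 ha]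
  · have hne : ∀ r ∈ Icc (0 : ℝ) 1, v' + r • d ≠ 0 := by
      intro r hr h
      refine h0 ⟨r, 1 - r, hr.1, by linarith [hr.2], by ring, ?_⟩
      rw [← h, hd]
      module
    obtain ⟨r, hr, hslope⟩ := exists_hasDerivAt_eq_slope
      (fun r : ℝ => fderiv ℝ l (x, v' + r • d) (0, d))
      (fun r => fderiv ℝ (fderiv ℝ l) (x, v' + r • d) (0, d) (0, d)) zero_lt_one
      (fun r hr => (hl.hasDerivAt_momentum hx d r (hne r hr)).continuousAt.continuousWithinAt)
      (fun r hr => hl.hasDerivAt_momentum hx d r (hne r ⟨hr.1.le, hr.2.le⟩))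
    have h1 := hc (v' + r • d) d (hne r ⟨hr.1.le, hr.2.le⟩)
    rw [hslope] at h1
    have e : v' + d = v := by rw [hd]; abel
    simpa [e] using h1

/-- Lipschitz and monotonicity estimates for the differential of a homogeneous Lagrangian. -/
theorem exists_estimates (hl : HomogeneousLagrangian l T) {B : Set E} (hB : IsCompact B)
    (hBT : B ⊆ T) : ∃ c K : ℝ, 0 < c ∧ 0 ≤ K ∧
      (∀ x ∈ B, ∀ x' ∈ B, ∀ v v' w, |fderiv ℝ l (x, v) (0, w) - fderiv ℝ l (x', v') (0, w)| ≤
        K * (‖x - x'‖ * ‖v‖ + ‖v - v'‖) * ‖w‖) ∧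
      (∀ x ∈ B, ∀ x' ∈ B, ∀ v v' w, |fderiv ℝ l (x, v) (w, 0) - fderiv ℝ l (x', v') (w, 0)| ≤
        K * (‖x - x'‖ * ‖v‖ ^ 2 + ‖v - v'‖ * (‖v‖ + ‖v'‖)) * ‖w‖) ∧
      ∀ x ∈ B, ∀ v v', c * ‖v - v'‖ ^ 2 ≤
        fderiv ℝ l (x, v) (0, v - v') - fderiv ℝ l (x, v') (0, v - v') := by
  obtain ⟨c, hc0, hc⟩ := hl.exists_hess_ge hB hBT
  have hsub : B ×ˢ Metric.sphere (0 : E) 1 ⊆ T ×ˢ {0}ᶜ := fun z hz =>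
    ⟨hBT hz.1, fun h0 => by
      have h2 := hz.2
      rw [mem_singleton_iff.1 h0] at h2
      simp at h2⟩
  have hS := hB.prod (isCompact_sphere (0 : E) 1)
  have hv : ContDiffOn ℝ ∞ (fun z => (fderiv ℝ l z).comp (ContinuousLinearMap.inr ℝ E E))
      (T ×ˢ {0}ᶜ) := hl.contDiffOn_fderiv.clm_comp contDiffOn_const
  have hx : ContDiffOn ℝ ∞ (fun z => (fderiv ℝ l z).comp (ContinuousLinearMap.inl ℝ E E))
      (T ×ˢ {0}ᶜ) := hl.contDiffOn_fderiv.clm_comp contDiffOn_const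
  obtain ⟨K₁, hK₁, hL₁, hb₁⟩ := exists_lipschitz_bound_of_compact hl.isOpen_prod hv hS hsub
  obtain ⟨K₂, hK₂, hL₂, hb₂⟩ := exists_lipschitz_bound_of_compact hl.isOpen_prod hx hS hsub
  refine ⟨c, 3 * max K₁ K₂, hc0, by positivity, ?_, ?_, fun x hx v v' =>
    hl.monotone_of_hess_ge (hBT hx) (hc x hx) v v'⟩
  · intro x hx x' hx' v v' w
    have h1 := norm_sub_le_of_homogeneous_one hK₁ hL₁ hb₁ (fun y hy u s hs => by
      ext w
      simpa using hl.fderiv_smul_snd (hBT hy) u w hs) hx hx' v v'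
    have h2 := ContinuousLinearMap.le_of_opNorm_le _ h1 w
    refine (le_of_eq ?_).trans (h2.trans ?_)
    · rw [Real.norm_eq_abs]; rfl
    · gcongr
      exact le_max_left _ _
  · intro x hx x' hx' v v' w
    have h1 := norm_sub_le_of_homogeneous_two hK₂ hL₂ hb₂ (fun y hy u s hs => by
      ext w
      simpa using hl.fderiv_smul_fst (hBT hy) u w hs) hx hx' v v'
    have h2 := ContinuousLinearMap.le_of_opNorm_le _ h1 w
    refine (le_of_eq ?_).trans (h2.trans ?_)
    · rw [Real.norm_eq_abs]; rfl
    · gcongr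
      exact le_max_right _ _

end HomogeneousLagrangian

end Homogeneous

end

noncomputable section

set_option maxSynthPendingDepth 3

/-! ## Finsler metrics in charts, and the velocity of Finsler geodesics -/

section Finsler

variable {n : ℕ} {M : Type*} [TopologicalSpace M] [ChartedSpace (Euc n) M]
  [IsManifold 𝓘(ℝ, Euc n) ∞ M]

theorem FinslerMetric.contDiffOn_chart (F : FinslerMetric n M) (p : M) :
    ContDiffOn ℝ ∞ (chartLagrangian (fun u => F.toFun u ^ 2) p)
      ((extChartAt 𝓘(ℝ, Euc n) p).target ×ˢ {0}ᶜ) := by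
  have h1 : ContMDiffOn 𝓘(ℝ, Euc n × Euc n) 𝓘(ℝ, ℝ) ∞ (F.toFun ∘ chartLift p)
      ((extChartAt 𝓘(ℝ, Euc n) p).target ×ˢ {0}ᶜ) := by
    refine F.smooth.comp ((contMDiffOn_chartLift p).mono (prod_mono subset_rfl (subset_univ _))) ?_
    rintro ⟨x, v⟩ ⟨hx, hv⟩ h0
    refine hv (liftCLM_injective hx ?_)
    rw [map_zero]
    exact h0
  exact (contMDiffOn_iff_contDiffOn.1 h1).pow 2

theorem FinslerMetric.homogeneousLagrangian (F : FinslerMetric n M) (p : M) :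
    HomogeneousLagrangian (chartLagrangian (fun u => F.toFun u ^ 2) p)
      (extChartAt 𝓘(ℝ, Euc n) p).target where
  isOpen := isOpen_target p
  contDiffOn := F.contDiffOn_chart p
  smul := by
    intro x _ v s hs
    have h1 : chartLagrangian (fun u => F.toFun u ^ 2) p (x, s • v) =
        F.toFun ⟨(extChartAt 𝓘(ℝ, Euc n) p).symm x, s • liftCLM p x v⟩ ^ 2 := by
      rw [← map_smul]; rfl
    rw [h1, F.homogeneous _ _ s hs, mul_pow]
    rfl
  hess_pos := by
    intro x hx v w hv hw
    set l := chartLagrangian (fun u => F.toFun u ^ 2) p with hl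
    have hlv : liftCLM p x v ≠ 0 := fun h => hv (liftCLM_injective hx (h.trans (map_zero _).symm))
    have hlw : liftCLM p x w ≠ 0 := fun h => hw (liftCLM_injective hx (h.trans (map_zero _).symm))
    have h1 := F.strongly_convex _ _ _ hlv hlw
    have h2 : (fun s : ℝ => F.toFun ⟨(extChartAt 𝓘(ℝ, Euc n) p).symm x,
        liftCLM p x v + s • liftCLM p x w⟩ ^ 2) = fun s : ℝ => l (x, v + s • w) := by
      funext s
      rw [← map_smul, ← map_add]
      rfl
    rw [h2] at h1
    have hsm : ∀ r : ℝ, v + r • w ≠ 0 → ContDiffAt ℝ ∞ l (x, v + r • w) := fun r hr =>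
      (F.contDiffOn_chart p).contDiffAt
        (((isOpen_target p).prod isOpen_compl_singleton).mem_nhds ⟨hx, hr⟩)
    have hev : ∀ᶠ r : ℝ in 𝓝 0, v + r • w ≠ 0 := by
      have hc : ContinuousAt (fun r : ℝ => v + r • w) 0 := by fun_prop
      exact hc.eventually_ne (by simpa using hv)
    -- Smoothness is available only while v + sw ≠ 0, hence near s = 0; the germ suffices for the
    -- second derivative there.
    have h3 : deriv (fun s : ℝ => l (x, v + s • w)) =ᶠ[𝓝 0]
        fun s => fderiv ℝ l (x, v + s • w) (0, w) := by
      filter_upwards [hev] with r hr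
      exact (((hsm r hr).differentiableAt (by simp)).hasFDerivAt.comp_hasDerivAt r
        (hasDerivAt_line x v w r)).deriv
    rw [iteratedDeriv_succ, iteratedDeriv_one, h3.deriv_eq,
      (hasDerivAt_fderiv_line (hsm 0 (by simpa using hv))).deriv, zero_smul, add_zero] at h1
    exact h1

theorem FinslerMetric.differentiableOn_chart (F : FinslerMetric n M) (p : M) :
    DifferentiableOn ℝ (chartLagrangian (fun u => F.toFun u ^ 2) p)
      ((extChartAt 𝓘(ℝ, Euc n) p).target ×ˢ (univ : Set (Euc n))) := fun z hz =>
  ((F.homogeneousLagrangian p).differentiableAt hz.1 z.2).differentiableWithinAt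

/-- The speed of a geodesic is constant. -/
theorem FinslerMetric.IsGeodesic.hasDerivWithinAt_energy {F : FinslerMetric n M} {γ : ℝ → M}
    (hγ : F.IsGeodesic γ) {t : ℝ} (ht : t ∈ Icc (0 : ℝ) 1) :
    HasDerivWithinAt (fun s => F.toFun (velocity n γ s) ^ 2) 0 (Icc 0 1) t := by
  set p := γ t with hp
  set l := chartLagrangian (fun u => F.toFun u ^ 2) p with hl
  have hL := F.homogeneousLagrangian p
  set a : ℝ → Euc n := fun s => extChartAt 𝓘(ℝ, Euc n) p (γ s) with ha
  set a' : ℝ → Euc n := derivWithin a (Icc 0 1) with ha'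
  have hsrc : γ t ∈ (extChartAt 𝓘(ℝ, Euc n) p).source := mem_extChartAt_source _
  have hcd := contDiffWithinAt_chart_comp hγ.1 ht hsrc
  have hda : HasDerivWithinAt a (a' t) (Icc 0 1) t :=
    (hcd.differentiableWithinAt (by simp)).hasDerivWithinAt
  have hda' : HasDerivWithinAt a' (derivWithin a' (Icc 0 1) t) (Icc 0 1) t :=
    ((contDiffWithinAt_derivWithin ht hcd).differentiableWithinAt (by simp)).hasDerivWithinAt
  have hu : UniqueDiffWithinAt ℝ (Icc (0 : ℝ) 1) t := uniqueDiffOn_Icc zero_lt_one t ht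
  have hat : a t ∈ (extChartAt 𝓘(ℝ, Euc n) p).target := (extChartAt 𝓘(ℝ, Euc n) p).map_source hsrc
  have h1 : HasDerivWithinAt (fun s => fderiv ℝ l (a s, a' s) (0, a' s))
      (fderiv ℝ l (a t, a' t) (a' t, derivWithin a' (Icc 0 1) t)) (Icc 0 1) t :=
    hasDerivWithinAt_momentum_apply (ℓ := fun s => fderiv ℝ l (a s, a' s))
      (fun w => IsExtremal.eulerLagrange F.differentiableOn_chart hγ ht hsrc w) hda'
  have h2 : HasDerivWithinAt (fun s => l (a s, a' s))
      (fderiv ℝ l (a t, a' t) (a' t, derivWithin a' (Icc 0 1) t)) (Icc 0 1) t :=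
    HasFDerivAt.comp_hasDerivWithinAt (f := fun s => (a s, a' s)) t
      (hL.differentiableAt hat (a' t)).hasFDerivAt (hda.prodMk hda')
  have hev := (eventually_mem_source hγ.1 ht hsrc).and
    (eventually_mem_nhdsWithin (a := t) (s := Icc (0 : ℝ) 1))
  -- By Euler's identity the momentum paired with the velocity is 2l. Its derivative by the
  -- Euler–Lagrange equation equals the derivative of l, so 2l' = l' and the energy is conserved.
  have h3 : HasDerivWithinAt (fun s => 2 * l (a s, a' s))
      (fderiv ℝ l (a t, a' t) (a' t, derivWithin a' (Icc 0 1) t)) (Icc 0 1) t := by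
    refine h1.congr_of_eventuallyEq ?_ (hL.euler hat _).symm
    filter_upwards [hev] with s hs
    exact (hL.euler ((extChartAt 𝓘(ℝ, Euc n) p).map_source hs.1) _).symm
  have h4 := hu.eq_deriv _ h3 (h2.const_mul 2)
  have h5 : fderiv ℝ l (a t, a' t) (a' t, derivWithin a' (Icc 0 1) t) = 0 := by linarith
  rw [h5] at h2
  have hval : ∀ s, γ s ∈ (extChartAt 𝓘(ℝ, Euc n) p).source → s ∈ Icc (0 : ℝ) 1 →
      F.toFun (velocity n γ s) ^ 2 = l (a s, a' s) := by
    intro s hs hs'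
    have hmd := (hγ.1 s hs').mdifferentiableWithinAt (by simp)
    have hv := chartLift_chartCoord (p := p) (u := velocity n γ s) hs
    rw [chartCoord_velocity hs' hmd hs] at hv
    change _ = F.toFun (chartLift p (a s, a' s)) ^ 2
    rw [hv]
  refine h2.congr_of_eventuallyEq ?_ (hval t hsrc ht)
  filter_upwards [hev] with s hs
  exact hval s hs.1 hs.2

theorem FinslerMetric.apply_eq_zero_iff (F : FinslerMetric n M)
    (u : TangentBundle 𝓘(ℝ, Euc n) M) : F.toFun u = 0 ↔ u.2 = 0 := by
  refine ⟨fun h => by_contra fun h0 => (F.pos u.1 u.2 h0).ne' h, fun h => ?_⟩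
  have h1 := F.homogeneous u.1 u.2 0 le_rfl
  rw [zero_smul, zero_mul, ← h] at h1
  exact h1

/-- A curve with vanishing velocity is constant. -/
theorem eq_of_velocity_eq_zero [T2Space M] {γ : ℝ → M}
    (hγ : ContMDiffOn 𝓘(ℝ, ℝ) 𝓘(ℝ, Euc n) ∞ γ (Icc 0 1))
    (h0 : ∀ t ∈ Icc (0 : ℝ) 1, (velocity n γ t).2 = 0) : ∀ t ∈ Icc (0 : ℝ) 1, γ t = γ 0 := by
  have hsub : Icc (0 : ℝ) 1 ⊆ {t | γ t = γ 0} := by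
    refine IsClosed.Icc_subset_of_forall_mem_nhdsWithin ?_ rfl ?_
    · rw [inter_comm]
      exact hγ.continuousOn.preimage_isClosed_of_isClosed isClosed_Icc isClosed_singleton
    · rintro t ⟨ht, ht0, ht1⟩
      have htI : t ∈ Icc (0 : ℝ) 1 := ⟨ht0, ht1.le⟩
      have hsrc : γ t ∈ (extChartAt 𝓘(ℝ, Euc n) (γ t)).source := mem_extChartAt_source _
      have hev : ∀ᶠ s in 𝓝[≥] t, γ s ∈ (extChartAt 𝓘(ℝ, Euc n) (γ t)).source :=
        ((hγ.continuousOn t htI).mono_of_mem_nhdsWithin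
          (mem_of_superset (Icc_mem_nhdsGE ht1) (Icc_subset_Icc_left ht0))).eventually
          ((isOpen_source (γ t)).mem_nhds hsrc)
      obtain ⟨u, hu, hus⟩ := mem_nhdsGE_iff_exists_Icc_subset.1 hev
      obtain ⟨b, hb, hbu⟩ : ∃ b ∈ Ioc t 1, b ≤ u :=
        ⟨min u 1, ⟨lt_min hu ht1, min_le_right _ _⟩, min_le_left _ _⟩
      have hbs : ∀ s ∈ Icc t b, γ s ∈ (extChartAt 𝓘(ℝ, Euc n) (γ t)).source :=
        fun s hs => hus ⟨hs.1, hs.2.trans hbu⟩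
      have hconst := constant_of_has_deriv_right_zero
        (f := fun s => extChartAt 𝓘(ℝ, Euc n) (γ t) (γ s)) (a := t) (b := b)
        (fun s hs => ((contDiffWithinAt_chart_comp hγ ⟨ht0.trans hs.1, hs.2.trans hb.2⟩
          (hbs s hs)).continuousWithinAt).mono (Icc_subset_Icc ht0 hb.2))
        (fun s hs => by
          have hsI : s ∈ Icc (0 : ℝ) 1 := ⟨ht0.trans hs.1, hs.2.le.trans hb.2⟩
          have hs' := hbs s ⟨hs.1, hs.2.le⟩
          have hd := ((contDiffWithinAt_chart_comp hγ hsI hs').differentiableWithinAt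
            (by simp)).hasDerivWithinAt
          have hv := chartCoord_velocity hsI ((hγ s hsI).mdifferentiableWithinAt (by simp)) hs'
          have hz : derivWithin (fun s => extChartAt 𝓘(ℝ, Euc n) (γ t) (γ s)) (Icc 0 1) s = 0 := by
            refine (congrArg Prod.snd hv).symm.trans ?_
            rw [chartCoord, h0 s hsI]
            exact map_zero _
          rw [hz] at hd
          exact hd.mono_of_mem_nhdsWithin (mem_of_superset
            (Icc_mem_nhdsGE (hs.2.trans_le hb.2)) (Icc_subset_Icc_left hsI.1)))
      filter_upwards [mem_of_superset (Icc_mem_nhdsGT hb.1) subset_rfl] with s hs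
      have := (extChartAt 𝓘(ℝ, Euc n) (γ t)).injOn (hbs s hs) hsrc (hconst s hs)
      exact this.trans ht
  exact hsub

/-- The velocity of a nonconstant geodesic does not vanish. -/
theorem FinslerMetric.IsGeodesic.velocity_ne_zero [T2Space M] {F : FinslerMetric n M} {γ : ℝ → M}
    (hγ : F.IsGeodesic γ) (hγ' : ∃ t ∈ Icc (0 : ℝ) 1, γ t ≠ γ 0) {t : ℝ}
    (ht : t ∈ Icc (0 : ℝ) 1) : (velocity n γ t).2 ≠ 0 := by
  intro h0
  -- If the speed vanished once it would vanish always by conservation, and the geodesic would be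
  -- constant.
  have hconst := constant_of_derivWithin_zero (f := fun s => F.toFun (velocity n γ s) ^ 2)
    (a := 0) (b := 1) (fun s hs => (hγ.hasDerivWithinAt_energy hs).differentiableWithinAt)
    (fun s hs => (hγ.hasDerivWithinAt_energy ⟨hs.1, hs.2.le⟩).derivWithin
      (uniqueDiffOn_Icc zero_lt_one s ⟨hs.1, hs.2.le⟩))
  obtain ⟨s, hs, hne⟩ := hγ'
  refine hne (eq_of_velocity_eq_zero hγ.1 (fun r hr => ?_) s hs)
  have h1 : F.toFun (velocity n γ r) ^ 2 = F.toFun (velocity n γ t) ^ 2 :=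
    (hconst r hr).trans (hconst t ht).symm
  rw [(F.apply_eq_zero_iff _).2 h0, zero_pow two_ne_zero, sq_eq_zero_iff,
    F.apply_eq_zero_iff] at h1
  exact h1

/-- The velocity of a nonconstant geodesic in a chart. -/
theorem FinslerMetric.IsGeodesic.derivWithin_chart_ne_zero [T2Space M] {F : FinslerMetric n M}
    {γ : ℝ → M} (hγ : F.IsGeodesic γ) (hγ' : ∃ t ∈ Icc (0 : ℝ) 1, γ t ≠ γ 0) {t : ℝ}
    (ht : t ∈ Icc (0 : ℝ) 1) {p : M} (hp : γ t ∈ (extChartAt 𝓘(ℝ, Euc n) p).source) :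
    derivWithin (fun s => extChartAt 𝓘(ℝ, Euc n) p (γ s)) (Icc 0 1) t ≠ 0 := by
  intro h0
  have hv := chartCoord_velocity ht ((hγ.1 t ht).mdifferentiableWithinAt (by simp)) hp
  have h1 := chartLift_chartCoord (p := p) (u := velocity n γ t) hp
  rw [hv, h0, chartLift_eq, map_zero] at h1
  refine hγ.velocity_ne_zero hγ' ht ?_
  rw [← h1]

end Finsler

end

noncomputable section

set_option maxSynthPendingDepth 3

/-! ## Homogeneous Lagrangians after a substitution that is affine in the velocity -/

section AffineSubstitution

variable {E : Type*} [NormedAddCommGroup E] [NormedSpace ℝ E] {l : E × E → ℝ} {T : Set E}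

namespace HomogeneousLagrangian

theorem fderiv_zero [FiniteDimensional ℝ E] (hl : HomogeneousLagrangian l T) {x : E} (hx : x ∈ T) :
    fderiv ℝ l (x, 0) = 0 := (hl.hasFDerivAt_zero hx).fderiv

theorem continuousAt_fderiv [FiniteDimensional ℝ E] (hl : HomogeneousLagrangian l T) {x : E}
    (hx : x ∈ T) (v : E) : ContinuousAt (fderiv ℝ l) (x, v) := by
  by_cases hv : v = 0
  · subst hv
    obtain ⟨r, hr, hrT⟩ := Metric.nhds_basis_closedBall.mem_iff.1 (hl.isOpen.mem_nhds hx)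
    obtain ⟨c, K, -, hK, h1, h2, -⟩ := hl.exists_estimates (isCompact_closedBall x r) hrT
    rw [ContinuousAt, hl.fderiv_zero hx]
    have hz : ∀ᶠ z : E × E in 𝓝 (x, 0), z.1 ∈ Metric.closedBall x r :=
      continuous_fst.continuousAt.eventually (Metric.closedBall_mem_nhds x hr)
    refine squeeze_zero_norm' (a := fun z : E × E => K * ‖z.2‖ ^ 2 + K * ‖z.2‖) ?_ ?_
    · filter_upwards [hz] with z hz
      refine ContinuousLinearMap.opNorm_le_bound _ (by positivity) fun w => ?_
      have e : w = (w.1, 0) + (0, w.2) := by simp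
      have e1 := h1 z.1 hz z.1 hz z.2 0 w.2
      have e2 := h2 z.1 hz z.1 hz z.2 0 w.1
      rw [hl.fderiv_zero (hrT hz)] at e1 e2
      simp only [zero_apply, sub_zero, sub_self, norm_zero, zero_mul, zero_add, add_zero] at e1 e2
      rw [e, map_add, ← e, Real.norm_eq_abs]
      refine (abs_add_le _ _).trans ?_
      have n1 := norm_fst_le w
      have n2 := norm_snd_le w
      have e3 : K * (‖z.2‖ * ‖z.2‖) * ‖w.1‖ ≤ K * ‖z.2‖ ^ 2 * ‖w‖ := by rw [sq]; gcongr
      have e4 : K * ‖z.2‖ * ‖w.2‖ ≤ K * ‖z.2‖ * ‖w‖ := by gcongr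
      linarith
    · have : ContinuousAt (fun z : E × E => K * ‖z.2‖ ^ 2 + K * ‖z.2‖) (x, 0) := by fun_prop
      simpa [ContinuousAt] using this
  · exact ((hl.contDiffAt hx hv).fderiv_right (m := ∞) (by simp)).continuousAt

end HomogeneousLagrangian

set_option maxHeartbeats 1000000 in
/-- Estimates for the differential of `(q, y) ↦ l (z(q), v(q) + W(q) y)` in terms of the
1-jets `σ`, `τ` of `(z, v, W)`. -/
theorem affine_jet_estimates {B : Set E} {K : ℝ} (hK : 0 ≤ K)
    (h0 : ∀ x ∈ B, fderiv ℝ l (x, 0) = 0)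
    (h1 : ∀ x ∈ B, ∀ x' ∈ B, ∀ v v' w, |fderiv ℝ l (x, v) (0, w) - fderiv ℝ l (x', v') (0, w)| ≤
        K * (‖x - x'‖ * ‖v‖ + ‖v - v'‖) * ‖w‖)
    (h2 : ∀ x ∈ B, ∀ x' ∈ B, ∀ v v' w, |fderiv ℝ l (x, v) (w, 0) - fderiv ℝ l (x', v') (w, 0)| ≤
        K * (‖x - x'‖ * ‖v‖ ^ 2 + ‖v - v'‖ * (‖v‖ + ‖v'‖)) * ‖w‖)
    {K₁ d : ℝ} (hK₁ : 1 ≤ K₁) (hd : 0 ≤ d) {σ σ' : E × E × (E →L[ℝ] E)}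
    {τ τ' : E →L[ℝ] E × E × (E →L[ℝ] E)} (hσB : σ.1 ∈ B) (hσB' : σ'.1 ∈ B)
    (hσ : ‖σ‖ ≤ K₁) (hσ' : ‖σ'‖ ≤ K₁) (hτ : ‖τ‖ ≤ K₁) (hτ' : ‖τ'‖ ≤ K₁)
    (hσσ : ‖σ - σ'‖ ≤ K₁ * d) (hττ : ‖τ - τ'‖ ≤ K₁ * d) (y y' w : E) :
    |fderiv ℝ l (σ.1, σ.2.1 + σ.2.2 y) (0, σ.2.2 w) -
        fderiv ℝ l (σ'.1, σ'.2.1 + σ'.2.2 y') (0, σ'.2.2 w)| ≤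
      7 * K * K₁ ^ 4 * (d * (1 + ‖y‖ + ‖y'‖) + ‖y - y'‖) * ‖w‖ ∧
    |fderiv ℝ l (σ.1, σ.2.1 + σ.2.2 y) ((τ w).1, (τ w).2.1 + (τ w).2.2 y) -
        fderiv ℝ l (σ'.1, σ'.2.1 + σ'.2.2 y') ((τ' w).1, (τ' w).2.1 + (τ' w).2.2 y')| ≤
      7 * K * K₁ ^ 4 * (d * (1 + ‖y‖ + ‖y'‖) ^ 2 + ‖y - y'‖ * (1 + ‖y‖ + ‖y'‖)) * ‖w‖ := by
  have affine_le : ∀ (ρ : E × E × (E →L[ℝ] E)) (k : ℝ), ‖ρ‖ ≤ k → ∀ u : E,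
      ‖ρ.2.1 + ρ.2.2 u‖ ≤ k * (1 + ‖u‖) := by
    intro ρ k hρ u
    have n1 : ‖ρ.2.1‖ ≤ k := ((norm_fst_le _).trans (norm_snd_le _)).trans hρ
    have n2 : ‖ρ.2.2‖ ≤ k := ((norm_snd_le _).trans (norm_snd_le _)).trans hρ
    have n3 := (ρ.2.2.le_opNorm u).trans (mul_le_mul_of_nonneg_right n2 (norm_nonneg u))
    linarith [norm_add_le ρ.2.1 (ρ.2.2 u)]
  have diff_le : ∀ (ρ ρ' : E × E × (E →L[ℝ] E)) (k k' : ℝ), 0 ≤ k → 0 ≤ k' → ‖ρ'‖ ≤ k →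
      ‖ρ - ρ'‖ ≤ k' →
      ‖(ρ.2.1 + ρ.2.2 y) - (ρ'.2.1 + ρ'.2.2 y')‖ ≤ k' * (1 + ‖y‖ + ‖y'‖) + k * ‖y - y'‖ := by
    intro ρ ρ' k k' hk hk' hρ hρρ
    have n1 := affine_le (ρ - ρ') k' hρρ y
    have n2 : ‖ρ'.2.2‖ ≤ k := ((norm_snd_le _).trans (norm_snd_le _)).trans hρ
    have n3 := (ρ'.2.2.le_opNorm (y - y')).trans (mul_le_mul_of_nonneg_right n2 (norm_nonneg _))
    have e : (ρ.2.1 + ρ.2.2 y) - (ρ'.2.1 + ρ'.2.2 y') =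
        ((ρ - ρ').2.1 + (ρ - ρ').2.2 y) + ρ'.2.2 (y - y') := by
      simp only [Prod.snd_sub, Prod.fst_sub, sub_apply, map_sub]
      abel
    rw [e]
    have := norm_add_le ((ρ - ρ').2.1 + (ρ - ρ').2.2 y) (ρ'.2.2 (y - y'))
    nlinarith [mul_nonneg hk' (norm_nonneg y')]
  set s := 1 + ‖y‖ + ‖y'‖ with hs
  set ε := ‖y - y'‖ with hε
  have hε0 : 0 ≤ ε := norm_nonneg _
  have hs1 : 1 ≤ s := by linarith [norm_nonneg y, norm_nonneg y']
  have hs0 : 0 ≤ s := by linarith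
  have hK₀ : 0 ≤ K₁ := by linarith
  set v := σ.2.1 + σ.2.2 y with hv
  set v' := σ'.2.1 + σ'.2.2 y' with hv'
  have nv : ‖v‖ ≤ K₁ * s := (affine_le σ K₁ hσ y).trans
    (mul_le_mul_of_nonneg_left (by linarith [norm_nonneg y']) hK₀)
  have nv' : ‖v'‖ ≤ K₁ * s := (affine_le σ' K₁ hσ' y').trans
    (mul_le_mul_of_nonneg_left (by linarith [norm_nonneg y]) hK₀)
  have nvv : ‖v - v'‖ ≤ K₁ * (d * s + ε) :=
    (diff_le σ σ' K₁ (K₁ * d) hK₀ (by positivity) hσ' hσσ).trans (le_of_eq (by ring))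
  have nz : ‖σ.1 - σ'.1‖ ≤ K₁ * d := (norm_fst_le (σ - σ')).trans hσσ
  -- Two moves: change the base point with the argument u fixed, then change the argument at a fixed
  -- base point. The second uses the growth of the differential, obtained by comparing with zero
  -- velocity.
  have lv : ∀ u u' : E, |fderiv ℝ l (σ.1, v) (0, u) - fderiv ℝ l (σ'.1, v') (0, u')| ≤
      2 * K * K₁ ^ 2 * (d * s + ε) * ‖u‖ + K * K₁ * s * ‖u - u'‖ := by
    intro u u'
    have e1 := h1 _ hσB _ hσB' v v' u
    have e2 := h1 _ hσB' _ hσB' v' 0 (u - u')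
    rw [h0 _ hσB'] at e2
    simp only [zero_apply, sub_zero, sub_self, norm_zero, zero_mul, zero_add] at e2
    have e : ((0 : E), u - u') = (0, u) - (0, u') := by simp
    rw [e, map_sub] at e2
    have e3 : K * (‖σ.1 - σ'.1‖ * ‖v‖ + ‖v - v'‖) * ‖u‖ ≤ 2 * K * K₁ ^ 2 * (d * s + ε) * ‖u‖ := by
      have : ‖σ.1 - σ'.1‖ * ‖v‖ + ‖v - v'‖ ≤ 2 * K₁ ^ 2 * (d * s + ε) := by
        have a1 := mul_le_mul nz nv (norm_nonneg _) (by positivity)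
        have a2 : K₁ * (d * s + ε) ≤ K₁ ^ 2 * (d * s + ε) := by
          gcongr; nlinarith
        nlinarith [mul_nonneg (sq_nonneg K₁) hε0]
      calc _ ≤ K * (2 * K₁ ^ 2 * (d * s + ε)) * ‖u‖ := by gcongr
        _ = _ := by ring
    have e4 : K * ‖v'‖ * ‖u - u'‖ ≤ K * K₁ * s * ‖u - u'‖ := by
      calc _ ≤ K * (K₁ * s) * ‖u - u'‖ := by gcongr
        _ = _ := by ring
    calc _ = |(fderiv ℝ l (σ.1, v) (0, u) - fderiv ℝ l (σ'.1, v') (0, u)) +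
          (fderiv ℝ l (σ'.1, v') (0, u) - fderiv ℝ l (σ'.1, v') (0, u'))| := by congr 1; ring
      _ ≤ _ := (abs_add_le _ _).trans (by linarith)
  have lx : ∀ u u' : E, |fderiv ℝ l (σ.1, v) (u, 0) - fderiv ℝ l (σ'.1, v') (u', 0)| ≤
      3 * K * K₁ ^ 3 * (d * s ^ 2 + ε * s) * ‖u‖ + K * K₁ ^ 2 * s ^ 2 * ‖u - u'‖ := by
    intro u u'
    have e1 := h2 _ hσB _ hσB' v v' u
    have e2 := h2 _ hσB' _ hσB' v' 0 (u - u')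
    rw [h0 _ hσB'] at e2
    simp only [zero_apply, sub_zero, sub_self, norm_zero, zero_mul, zero_add, add_zero] at e2
    have e : (u - u', (0 : E)) = (u, 0) - (u', 0) := by simp
    rw [e, map_sub] at e2
    have e3 : K * (‖σ.1 - σ'.1‖ * ‖v‖ ^ 2 + ‖v - v'‖ * (‖v‖ + ‖v'‖)) * ‖u‖ ≤
        3 * K * K₁ ^ 3 * (d * s ^ 2 + ε * s) * ‖u‖ := by
      have : ‖σ.1 - σ'.1‖ * ‖v‖ ^ 2 + ‖v - v'‖ * (‖v‖ + ‖v'‖) ≤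
          3 * K₁ ^ 3 * (d * s ^ 2 + ε * s) := by
        have a1 : ‖σ.1 - σ'.1‖ * ‖v‖ ^ 2 ≤ (K₁ * d) * (K₁ * s) ^ 2 := by gcongr
        have a2 : ‖v - v'‖ * (‖v‖ + ‖v'‖) ≤ (K₁ * (d * s + ε)) * (K₁ * s + K₁ * s) := by gcongr
        have a3 : 2 * K₁ ^ 2 * (d * s ^ 2 + ε * s) ≤ 2 * K₁ ^ 3 * (d * s ^ 2 + ε * s) := by
          gcongr; norm_num
        have a4 : 0 ≤ K₁ ^ 3 * (ε * s) := by positivity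
        nlinarith
      calc _ ≤ K * (3 * K₁ ^ 3 * (d * s ^ 2 + ε * s)) * ‖u‖ := by gcongr
        _ = _ := by ring
    have e4 : K * (‖v'‖ * ‖v'‖) * ‖u - u'‖ ≤ K * K₁ ^ 2 * s ^ 2 * ‖u - u'‖ := by
      calc _ ≤ K * ((K₁ * s) * (K₁ * s)) * ‖u - u'‖ := by gcongr
        _ = _ := by ring
    calc _ = |(fderiv ℝ l (σ.1, v) (u, 0) - fderiv ℝ l (σ'.1, v') (u, 0)) +
          (fderiv ℝ l (σ'.1, v') (u, 0) - fderiv ℝ l (σ'.1, v') (u', 0))| := by congr 1; ring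
      _ ≤ _ := (abs_add_le _ _).trans (by linarith)
  -- All powers of K₁ ≥ 1 are raised to the fourth. In the position estimate the factor 7 is 4 from
  -- the base component plus 3 from the velocity component; the velocity estimate has room to spare.
  have hp : K₁ ^ 3 ≤ K₁ ^ 4 := pow_le_pow_right₀ hK₁ (by norm_num)
  constructor
  · have n1 : ‖σ.2.2 w‖ ≤ K₁ * ‖w‖ :=
      (σ.2.2.le_opNorm w).trans (mul_le_mul_of_nonneg_right
        (((norm_snd_le _).trans (norm_snd_le _)).trans hσ) (norm_nonneg _))
    have n2 : ‖σ.2.2 w - σ'.2.2 w‖ ≤ K₁ * d * ‖w‖ :=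
      ((σ - σ').2.2.le_opNorm w).trans (mul_le_mul_of_nonneg_right
        (((norm_snd_le _).trans (norm_snd_le _)).trans hσσ) (norm_nonneg _))
    refine (lv _ _).trans ?_
    calc 2 * K * K₁ ^ 2 * (d * s + ε) * ‖σ.2.2 w‖ + K * K₁ * s * ‖σ.2.2 w - σ'.2.2 w‖
        ≤ 2 * K * K₁ ^ 2 * (d * s + ε) * (K₁ * ‖w‖) + K * K₁ * s * (K₁ * d * ‖w‖) := by gcongr
      _ = 2 * K * K₁ ^ 3 * (d * s + ε) * ‖w‖ + K * K₁ ^ 2 * (d * s) * ‖w‖ := by ring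
      _ ≤ 2 * K * K₁ ^ 4 * (d * s + ε) * ‖w‖ + 5 * K * K₁ ^ 4 * (d * s + ε) * ‖w‖ := by
        have : K₁ ^ 2 ≤ 5 * K₁ ^ 4 := by nlinarith [pow_le_pow_right₀ hK₁ (show 2 ≤ 4 by norm_num)]
        have h5 : K * K₁ ^ 2 * (d * s) * ‖w‖ ≤ K * (5 * K₁ ^ 4) * (d * s + ε) * ‖w‖ := by
          gcongr; linarith
        have h6 : 2 * K * K₁ ^ 3 * (d * s + ε) * ‖w‖ ≤ 2 * K * K₁ ^ 4 * (d * s + ε) * ‖w‖ := by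
          gcongr
        linarith
      _ = _ := by ring
  · have nτ : ‖τ w‖ ≤ K₁ * ‖w‖ :=
      (τ.le_opNorm w).trans (mul_le_mul_of_nonneg_right hτ (norm_nonneg _))
    have nτ' : ‖τ' w‖ ≤ K₁ * ‖w‖ :=
      (τ'.le_opNorm w).trans (mul_le_mul_of_nonneg_right hτ' (norm_nonneg _))
    have nττ : ‖τ w - τ' w‖ ≤ K₁ * d * ‖w‖ :=
      ((τ - τ').le_opNorm w).trans (mul_le_mul_of_nonneg_right hττ (norm_nonneg _))
    have m1 : ‖(τ w).2.1 + (τ w).2.2 y‖ ≤ K₁ * ‖w‖ * s := (affine_le _ _ nτ y).trans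
      (mul_le_mul_of_nonneg_left (by linarith [norm_nonneg y']) (by positivity))
    have m2 : ‖((τ w).2.1 + (τ w).2.2 y) - ((τ' w).2.1 + (τ' w).2.2 y')‖ ≤
        K₁ * d * ‖w‖ * s + K₁ * ‖w‖ * ε :=
      diff_le _ _ _ _ (by positivity) (by positivity) nτ' nττ
    have m3 : ‖(τ w).1‖ ≤ K₁ * ‖w‖ := (norm_fst_le _).trans nτ
    have m4 : ‖(τ w).1 - (τ' w).1‖ ≤ K₁ * d * ‖w‖ := (norm_fst_le (τ w - τ' w)).trans nττ
    have e1 := lx (τ w).1 (τ' w).1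
    have e2 := lv ((τ w).2.1 + (τ w).2.2 y) ((τ' w).2.1 + (τ' w).2.2 y')
    have e3 : 3 * K * K₁ ^ 3 * (d * s ^ 2 + ε * s) * ‖(τ w).1‖ +
        K * K₁ ^ 2 * s ^ 2 * ‖(τ w).1 - (τ' w).1‖ ≤ 4 * K * K₁ ^ 4 * (d * s ^ 2 + ε * s) * ‖w‖ := by
      calc _ ≤ 3 * K * K₁ ^ 3 * (d * s ^ 2 + ε * s) * (K₁ * ‖w‖) +
            K * K₁ ^ 2 * s ^ 2 * (K₁ * d * ‖w‖) := by gcongr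
        _ = 3 * K * K₁ ^ 4 * (d * s ^ 2 + ε * s) * ‖w‖ + K * K₁ ^ 3 * (d * s ^ 2) * ‖w‖ := by ring
        _ ≤ 3 * K * K₁ ^ 4 * (d * s ^ 2 + ε * s) * ‖w‖ +
            K * K₁ ^ 4 * (d * s ^ 2 + ε * s) * ‖w‖ := by
          gcongr
          linarith [mul_nonneg hε0 hs0]
        _ = _ := by ring
    have e4 : 2 * K * K₁ ^ 2 * (d * s + ε) * ‖(τ w).2.1 + (τ w).2.2 y‖ +
        K * K₁ * s * ‖((τ w).2.1 + (τ w).2.2 y) - ((τ' w).2.1 + (τ' w).2.2 y')‖ ≤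
        3 * K * K₁ ^ 4 * (d * s ^ 2 + ε * s) * ‖w‖ := by
      calc _ ≤ 2 * K * K₁ ^ 2 * (d * s + ε) * (K₁ * ‖w‖ * s) +
            K * K₁ * s * (K₁ * d * ‖w‖ * s + K₁ * ‖w‖ * ε) := by gcongr
        _ = 2 * K * K₁ ^ 3 * (d * s ^ 2 + ε * s) * ‖w‖ +
            K * K₁ ^ 2 * (d * s ^ 2 + ε * s) * ‖w‖ := by ring
        _ ≤ 2 * K * K₁ ^ 4 * (d * s ^ 2 + ε * s) * ‖w‖ +
            K * K₁ ^ 4 * (d * s ^ 2 + ε * s) * ‖w‖ := by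
          gcongr; norm_num
        _ = _ := by ring
    have split : ∀ (g : E × E →L[ℝ] ℝ) (p q : E), g (p, q) = g (p, 0) + g (0, q) := by
      intro g p q
      rw [← map_add]; simp
    rw [split (fderiv ℝ l (σ.1, v)), split (fderiv ℝ l (σ'.1, v')), add_sub_add_comm]
    refine (abs_add_le _ _).trans ?_
    linarith

end AffineSubstitution

end

noncomputable section

set_option maxSynthPendingDepth 3

/-! ### Affine substitutions depending on a parameter. -/

section AffineFamily

variable {E : Type*} [NormedAddCommGroup E] [NormedSpace ℝ E] {X : Type*} [NormedAddCommGroup X]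
  [NormedSpace ℝ X]

/-- The substitution `(q, y) ↦ (z(q), v(q) + W(q) y)` depending on a parameter, where
`S = (z, v, W)`. -/
def affineMap (S : X × E → E × E × (E →L[ℝ] E)) (x : X) (z : E × E) : E × E :=
  ((S (x, z.1)).1, (S (x, z.1)).2.1 + (S (x, z.1)).2.2 z.2)

/-- The Lagrangian `(q, y) ↦ l (z(q), v(q) + W(q) y)` depending on a parameter. -/
def affineLagrangian (l : E × E → ℝ) (S : X × E → E × E × (E →L[ℝ] E)) (x : X) (z : E × E) : ℝ :=
  l (affineMap S x z)

/-- The partial differential of `S` in the second variable. -/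
def sndDeriv {F : Type*} [NormedAddCommGroup F] [NormedSpace ℝ F] (S : X × E → F) (z : X × E) :
    E →L[ℝ] F :=
  (fderiv ℝ S z).comp (ContinuousLinearMap.inr ℝ X E)

variable {S : X × E → E × E × (E →L[ℝ] E)}

theorem contDiffAt_affineMap {k : WithTop ℕ∞} {x : X} {q y : E} (hS : ContDiffAt ℝ k S (x, q)) :
    ContDiffAt ℝ k (Function.uncurry (affineMap S)) (x, (q, y)) := by
  have h1 : ContDiffAt ℝ k (fun p : X × (E × E) => S (p.1, p.2.1)) (x, (q, y)) :=
    ContDiffAt.comp (x, (q, y)) (g := S) hS (by fun_prop)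
  have h2 : ContDiffAt ℝ k (fun p : X × (E × E) => p.2.2) (x, (q, y)) := by fun_prop
  exact h1.fst.prodMk (h1.snd.fst.add (h1.snd.snd.clm_apply h2))

theorem fderiv_affineMap_apply {x : X} {q y : E} (hS : DifferentiableAt ℝ S (x, q)) (w u : E) :
    fderiv ℝ (affineMap S x) (q, y) (w, u) =
      ((sndDeriv S (x, q) w).1, (sndDeriv S (x, q) w).2.1 + (sndDeriv S (x, q) w).2.2 y +
        (S (x, q)).2.2 u) := by
  have h0 : HasFDerivAt (fun z : E × E => (x, z.1))
      ((ContinuousLinearMap.inr ℝ X E).comp (ContinuousLinearMap.fst ℝ E E)) (q, y) := by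
    have e : (ContinuousLinearMap.inr ℝ X E).comp (ContinuousLinearMap.fst ℝ E E) =
        (0 : E × E →L[ℝ] X).prod (ContinuousLinearMap.fst ℝ E E) := by ext <;> simp
    rw [e]
    exact (hasFDerivAt_const x (q, y)).prodMk hasFDerivAt_fst
  have h1 : HasFDerivAt (fun z : E × E => S (x, z.1))
      ((fderiv ℝ S (x, q)).comp
        ((ContinuousLinearMap.inr ℝ X E).comp (ContinuousLinearMap.fst ℝ E E))) (q, y) :=
    HasFDerivAt.comp (q, y) (g := S) hS.hasFDerivAt h0
  have h2 := h1.fst.prodMk (h1.snd.fst.add (h1.snd.snd.clm_apply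
    (hasFDerivAt_snd (𝕜 := ℝ) (p := (q, y)))))
  have h3 : fderiv ℝ (affineMap S x) (q, y) = _ := h2.fderiv
  rw [h3]
  refine Prod.ext rfl ?_
  simp [sndDeriv]
  abel

variable {l : E × E → ℝ} {T : Set E}

/-- At the origin l is evaluated at the base velocity, which is nonzero, so its singularity at zero
velocity is avoided. Only this one phase point needs second derivatives. -/
theorem contDiffAt_affineLagrangian (hl : HomogeneousLagrangian l T) {x : X}
    (hS : ContDiffAt ℝ 2 S (x, 0)) (hT : (S (x, 0)).1 ∈ T) (hv : (S (x, 0)).2.1 ≠ 0) :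
    ContDiffAt ℝ 2 (Function.uncurry (affineLagrangian l S)) (x, (0, 0)) := by
  refine ContDiffAt.comp (g := l) (f := Function.uncurry (affineMap S)) (x, (0, 0)) ?_
    (contDiffAt_affineMap hS)
  have : Function.uncurry (affineMap S) (x, (0, 0)) = ((S (x, 0)).1, (S (x, 0)).2.1) := by
    simp [affineMap]
  rw [this]
  exact (hl.contDiffAt hT hv).of_le two_le_infty

variable [FiniteDimensional ℝ E]

theorem hasFDerivAt_affineLagrangian (hl : HomogeneousLagrangian l T) {x : X} {q y : E}
    (hS : ContDiffAt ℝ 2 S (x, q)) (hT : (S (x, q)).1 ∈ T) :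
    HasFDerivAt (affineLagrangian l S x)
      ((fderiv ℝ l (affineMap S x (q, y))).comp (fderiv ℝ (affineMap S x) (q, y))) (q, y) := by
  have h1 : DifferentiableAt ℝ (affineMap S x) (q, y) := by
    have : ContDiffAt ℝ 2 (fun z => Function.uncurry (affineMap S) (x, z)) (q, y) :=
      ContDiffAt.comp (q, y) (contDiffAt_affineMap (x := x) (y := y) hS)
        (contDiffAt_const.prodMk contDiffAt_id)
    exact this.differentiableAt (by simp)
  exact HasFDerivAt.comp (q, y) (g := l) (hl.differentiableAt hT _).hasFDerivAt h1.hasFDerivAt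

theorem fderiv_affineLagrangian_apply (hl : HomogeneousLagrangian l T) {x : X} {q y : E}
    (hS : ContDiffAt ℝ 2 S (x, q)) (hT : (S (x, q)).1 ∈ T) (w u : E) :
    fderiv ℝ (affineLagrangian l S x) (q, y) (w, u) =
      fderiv ℝ l ((S (x, q)).1, (S (x, q)).2.1 + (S (x, q)).2.2 y)
        ((sndDeriv S (x, q) w).1, (sndDeriv S (x, q) w).2.1 + (sndDeriv S (x, q) w).2.2 y +
        (S (x, q)).2.2 u) := by
  rw [(hasFDerivAt_affineLagrangian hl hS hT).fderiv, ContinuousLinearMap.comp_apply,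
    fderiv_affineMap_apply (hS.differentiableAt (by simp))]
  rfl

theorem continuousAt_affineLagrangian (hl : HomogeneousLagrangian l T) {x : X} {q y : E}
    (hS : ContDiffAt ℝ 2 S (x, q)) (hT : (S (x, q)).1 ∈ T) :
    ContinuousAt (fun p : X × (E × E) => affineLagrangian l S p.1 p.2) (x, (q, y)) :=
  ContinuousAt.comp (g := l) (f := Function.uncurry (affineMap S))
    (hl.differentiableAt hT _).continuousAt (contDiffAt_affineMap hS).continuousAt

theorem continuousAt_fderiv_affineLagrangian (hl : HomogeneousLagrangian l T) {x : X} {q y : E}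
    (hS : ContDiffAt ℝ 2 S (x, q)) (hT : (S (x, q)).1 ∈ T) :
    ContinuousAt (fun p : X × (E × E) => fderiv ℝ (affineLagrangian l S p.1) p.2)
      (x, (q, y)) := by
  have h1 : ContinuousAt (fun p : X × (E × E) => fderiv ℝ l (affineMap S p.1 p.2)) (x, (q, y)) :=
    ContinuousAt.comp (g := fderiv ℝ l) (f := Function.uncurry (affineMap S))
      (hl.continuousAt_fderiv hT _) (contDiffAt_affineMap hS).continuousAt
  have h2 : ContinuousAt (fun p : X × (E × E) => fderiv ℝ (affineMap S p.1) p.2) (x, (q, y)) := by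
    refine (ContDiffAt.fderiv (m := 1) (n := 2) (f := fun p : X × (E × E) => affineMap S p.1)
      (g := fun p => p.2) ?_ contDiffAt_snd (by norm_num)).continuousAt
    exact ContDiffAt.comp (g := Function.uncurry (affineMap S))
      (f := fun r : (X × (E × E)) × (E × E) => (r.1.1, r.2)) ((x, (q, y)), (q, y))
      (contDiffAt_affineMap hS) (by fun_prop)
  have hc : ContinuousAt (fun p : X × (E × E) => (p.1, p.2.1)) (x, (q, y)) := by fun_prop
  have hS0 : ∀ᶠ z in 𝓝 (x, q), ContDiffAt ℝ 2 S z := hS.eventually (by simp)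
  have hT0 : ∀ᶠ z in 𝓝 (x, q), (S z).1 ∈ T :=
    hS.continuousAt.fst.eventually (hl.isOpen.mem_nhds hT)
  refine (h1.clm_comp h2).congr ?_
  filter_upwards [hc.eventually (hS0.and hT0)] with p hp
  exact (hasFDerivAt_affineLagrangian (y := p.2.2) hl hp.1 hp.2).fderiv.symm

/-- A continuous linear map close to an injective one is uniformly bounded below. -/
theorem eventually_norm_ge_of_injective {F : Type*} [NormedAddCommGroup F] [NormedSpace ℝ F]
    {W : E →L[ℝ] F} (hW : Function.Injective W) :
    ∃ c : ℝ, 0 < c ∧ ∀ᶠ W' in 𝓝 W, ∀ u, c * ‖u‖ ≤ ‖W' u‖ := by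
  obtain ⟨k, hk, hW'⟩ := (LinearMap.injective_iff_antilipschitz (W : E →ₗ[ℝ] F)).1 hW
  have hk' : (0 : ℝ) < k := by exact_mod_cast hk
  refine ⟨1 / (2 * k), by positivity, ?_⟩
  filter_upwards [Metric.ball_mem_nhds W (show (0 : ℝ) < 1 / (2 * k) by positivity)] with W' hW1 u
  have h1 : ‖u‖ ≤ k * ‖W u‖ := by simpa using hW'.le_mul_dist u 0
  rw [Metric.mem_ball, dist_eq_norm] at hW1
  have h2 := (W' - W).le_of_opNorm_le hW1.le u
  rw [sub_apply] at h2
  have h3 : ‖W u‖ ≤ ‖W' u‖ + ‖W' u - W u‖ := by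
    have := norm_sub_le (W' u) (W' u - W u)
    rwa [sub_sub_cancel] at this
  have h4 : ‖u‖ / k ≤ ‖W u‖ := by rw [div_le_iff₀ hk']; linarith
  have h5 : ‖u‖ / k = 1 / (2 * k) * ‖u‖ + 1 / (2 * k) * ‖u‖ := by field_simp; ring
  linarith

theorem exists_eventually_bound {G F : Type*} [NormedAddCommGroup G] [NormedSpace ℝ G]
    [NormedAddCommGroup F] [NormedSpace ℝ F] {g : G → F} {z : G} (hg : ContDiffAt ℝ 1 g z) :
    ∃ K : ℝ, ∃ N ∈ 𝓝 z, ∀ a ∈ N, ‖g a‖ ≤ K ∧ ∀ b ∈ N, ‖g a - g b‖ ≤ K * ‖a - b‖ := by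
  obtain ⟨K, N, hN, hK⟩ := hg.exists_lipschitzOnWith
  have hb : ∀ᶠ a in 𝓝 z, ‖g a‖ < ‖g z‖ + 1 :=
    hg.continuousAt.norm.eventually (gt_mem_nhds (lt_add_one _))
  refine ⟨max K (‖g z‖ + 1), N ∩ {a | ‖g a‖ < ‖g z‖ + 1}, inter_mem hN hb, fun a ha =>
    ⟨ha.2.le.trans (le_max_right _ _), fun b hb => ?_⟩⟩
  have := hK.dist_le_mul a ha.1 b hb.1
  rw [dist_eq_norm, dist_eq_norm] at this
  exact this.trans (mul_le_mul_of_nonneg_right (le_max_left _ _) (norm_nonneg _))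

/-- Estimates for a parameter-dependent affine substitution in a homogeneous Lagrangian, locally
uniform in the parameter. -/
theorem exists_affineLagrangian_estimates (hl : HomogeneousLagrangian l T) {x₀ : X}
    (hS : ContDiffAt ℝ 2 S (x₀, 0)) (hT : (S (x₀, 0)).1 ∈ T) (hv : (S (x₀, 0)).2.1 ≠ 0)
    (hW : Function.Injective (S (x₀, 0)).2.2) :
    ∃ r c C : ℝ, 0 < r ∧ 0 < c ∧ 0 ≤ C ∧ ∀ x ∈ Metric.ball x₀ r,
      ((∀ q ∈ Metric.ball (0 : E) r, ContDiffAt ℝ 2 S (x, q) ∧ (S (x, q)).1 ∈ T ∧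
          (S (x, q)).2.1 ≠ 0) ∧
      (∀ q ∈ Metric.ball (0 : E) r, ∀ q' ∈ Metric.ball (0 : E) r, ∀ y y' w : E,
        |fderiv ℝ (affineLagrangian l S x) (q, y) (0, w) -
            fderiv ℝ (affineLagrangian l S x) (q', y') (0, w)| ≤
          C * (‖q - q'‖ * (1 + ‖y‖ + ‖y'‖) + ‖y - y'‖) * ‖w‖) ∧
      (∀ q ∈ Metric.ball (0 : E) r, ∀ q' ∈ Metric.ball (0 : E) r, ∀ y y' w : E,
        |fderiv ℝ (affineLagrangian l S x) (q, y) (w, 0) -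
            fderiv ℝ (affineLagrangian l S x) (q', y') (w, 0)| ≤
          C * (‖q - q'‖ * (1 + ‖y‖ + ‖y'‖) ^ 2 + ‖y - y'‖ * (1 + ‖y‖ + ‖y'‖)) * ‖w‖) ∧
      (∀ q ∈ Metric.ball (0 : E) r, ∀ y y' : E, c * ‖y - y'‖ ^ 2 ≤
        fderiv ℝ (affineLagrangian l S x) (q, y) (0, y - y') -
          fderiv ℝ (affineLagrangian l S x) (q, y') (0, y - y'))) := by
  obtain ⟨b, hb, hbT⟩ := Metric.nhds_basis_closedBall.mem_iff.1 (hl.isOpen.mem_nhds hT)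
  obtain ⟨c, K, hc, hK, e1, e2, e3⟩ := hl.exists_estimates (isCompact_closedBall _ b) hbT
  obtain ⟨c₁, hc₁, hWe⟩ := eventually_norm_ge_of_injective hW
  have hS' : ContDiffAt ℝ 1 (sndDeriv S) (x₀, 0) :=
    (hS.fderiv_right (m := 1) (by norm_num)).clm_comp contDiffAt_const
  obtain ⟨K₁, N₁, hN₁, hK₁⟩ := exists_eventually_bound (hS.of_le one_le_two)
  obtain ⟨K₂, N₂, hN₂, hK₂⟩ := exists_eventually_bound hS'
  have ev : ∀ᶠ z in 𝓝 (x₀, (0 : E)), z ∈ N₁ ∧ z ∈ N₂ ∧ ContDiffAt ℝ 2 S z ∧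
      (S z).1 ∈ Metric.closedBall (S (x₀, 0)).1 b ∧ (S z).2.1 ≠ 0 ∧
      ∀ u, c₁ * ‖u‖ ≤ ‖(S z).2.2 u‖ := by
    filter_upwards [hN₁, hN₂, hS.eventually (by simp),
      hS.continuousAt.fst.eventually (Metric.closedBall_mem_nhds _ hb),
      hS.continuousAt.snd.fst.eventually_ne hv, hS.continuousAt.snd.snd.eventually hWe]
      with z h1 h2 h3 h4 h5 h6
    exact ⟨h1, h2, h3, h4, h5, h6⟩
  obtain ⟨r, hr, hrs⟩ := Metric.eventually_nhds_iff_ball.1 ev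
  set K₃ := max 1 (max K₁ K₂) with hK₃
  have hK₃1 : 1 ≤ K₃ := le_max_left _ _
  have hle1 : K₁ ≤ K₃ := (le_max_left _ _).trans (le_max_right _ _)
  have hle2 : K₂ ≤ K₃ := (le_max_right _ _).trans (le_max_right _ _)
  -- The convexity constant of l loses the square of the lower bound c₁ of the linear part W. The
  -- Lipschitz constant comes from the jet estimates with a common bound K₃ for the substitution and
  -- its derivative.
  refine ⟨r, c * c₁ ^ 2, 7 * K * K₃ ^ 4, hr, by positivity, by positivity, fun x hx => ?_⟩
  have hnorm : ∀ q q' : E, ‖(x, q) - (x, q')‖ = ‖q - q'‖ := by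
    intro q q'
    rw [Prod.mk_sub_mk, sub_self, Prod.norm_mk, norm_zero, max_eq_right (norm_nonneg _)]
  have hmem : ∀ q ∈ Metric.ball (0 : E) r, (x, q) ∈ Metric.ball (x₀, (0 : E)) r := by
    intro q hq
    rw [← ball_prod_same]
    exact ⟨hx, hq⟩
  have hgood := fun q (hq : q ∈ Metric.ball (0 : E) r) => hrs _ (hmem q hq)
  have z0 : ∀ q ∈ Metric.ball (0 : E) r, (S (x, q)).1 ∈ T := fun q hq =>
    hbT (hgood q hq).2.2.2.1
  have jets : ∀ q ∈ Metric.ball (0 : E) r, ∀ q' ∈ Metric.ball (0 : E) r, ∀ y y' w : E, _ :=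
    fun q hq q' hq' y y' w => affine_jet_estimates (l := l) hK
      (fun z hz => hl.fderiv_zero (hbT hz)) e1 e2 hK₃1 (norm_nonneg (q - q'))
      (σ := S (x, q)) (σ' := S (x, q')) (τ := sndDeriv S (x, q)) (τ' := sndDeriv S (x, q'))
      (hgood q hq).2.2.2.1 (hgood q' hq').2.2.2.1
      ((hK₁ _ (hgood q hq).1).1.trans hle1) ((hK₁ _ (hgood q' hq').1).1.trans hle1)
      ((hK₂ _ (hgood q hq).2.1).1.trans hle2) ((hK₂ _ (hgood q' hq').2.1).1.trans hle2)
      (by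
        have h := (hK₁ _ (hgood q hq).1).2 _ (hgood q' hq').1
        rw [hnorm] at h
        exact h.trans (mul_le_mul_of_nonneg_right hle1 (norm_nonneg _)))
      (by
        have h := (hK₂ _ (hgood q hq).2.1).2 _ (hgood q' hq').2.1
        rw [hnorm] at h
        exact h.trans (mul_le_mul_of_nonneg_right hle2 (norm_nonneg _))) y y' w
  have fsnd : ∀ q ∈ Metric.ball (0 : E) r, ∀ y w : E,
      fderiv ℝ (affineLagrangian l S x) (q, y) (0, w) =
        fderiv ℝ l ((S (x, q)).1, (S (x, q)).2.1 + (S (x, q)).2.2 y) (0, (S (x, q)).2.2 w) := by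
    intro q hq y w
    rw [fderiv_affineLagrangian_apply hl (hgood q hq).2.2.1 (z0 q hq), map_zero]
    simp
  have ffst : ∀ q ∈ Metric.ball (0 : E) r, ∀ y w : E,
      fderiv ℝ (affineLagrangian l S x) (q, y) (w, 0) =
        fderiv ℝ l ((S (x, q)).1, (S (x, q)).2.1 + (S (x, q)).2.2 y)
          ((sndDeriv S (x, q) w).1, (sndDeriv S (x, q) w).2.1 + (sndDeriv S (x, q) w).2.2 y) := by
    intro q hq y w
    rw [fderiv_affineLagrangian_apply hl (hgood q hq).2.2.1 (z0 q hq), map_zero, add_zero]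
  refine ⟨fun q hq => ⟨(hgood q hq).2.2.1, z0 q hq, (hgood q hq).2.2.2.2.1⟩, ?_, ?_, ?_⟩
  · intro q hq q' hq' y y' w
    rw [fsnd q hq, fsnd q' hq']
    exact (jets q hq q' hq' y y' w).1
  · intro q hq q' hq' y y' w
    rw [ffst q hq, ffst q' hq']
    exact (jets q hq q' hq' y y' w).2
  · intro q hq y y'
    rw [fsnd q hq, fsnd q hq]
    have h1 := e3 _ (hgood q hq).2.2.2.1 ((S (x, q)).2.1 + (S (x, q)).2.2 y)
      ((S (x, q)).2.1 + (S (x, q)).2.2 y')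
    rw [add_sub_add_left_eq_sub, ← map_sub] at h1
    refine le_trans ?_ h1
    have h2 := (hgood q hq).2.2.2.2.2 (y - y')
    have h3 : (c₁ * ‖y - y'‖) ^ 2 ≤ ‖(S (x, q)).2.2 (y - y')‖ ^ 2 := by gcongr
    calc c * c₁ ^ 2 * ‖y - y'‖ ^ 2 = c * (c₁ * ‖y - y'‖) ^ 2 := by ring
      _ ≤ _ := by gcongr

end AffineFamily

end

noncomputable section

set_option maxSynthPendingDepth 3

/-! ## The affine substitution defined by an exponential map -/

section ExpJet

variable {E : Type*} [NormedAddCommGroup E] [NormedSpace ℝ E]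

theorem hasFDerivAt_sndDeriv {X F : Type*} [NormedAddCommGroup X] [NormedSpace ℝ X]
    [NormedAddCommGroup F] [NormedSpace ℝ F] {S : X × E → F} {x : X} {q : E}
    (hS : DifferentiableAt ℝ S (x, q)) :
    HasFDerivAt (fun q => S (x, q)) (sndDeriv S (x, q)) q := by
  have h0 : HasFDerivAt (fun q : E => (x, q)) (ContinuousLinearMap.inr ℝ X E) q := by
    have e : ContinuousLinearMap.inr ℝ X E = (0 : E →L[ℝ] X).prod (.id ℝ E) := by ext <;> simp
    rw [e]
    exact (hasFDerivAt_const x q).prodMk (hasFDerivAt_id q)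
  exact HasFDerivAt.comp q (g := S) hS.hasFDerivAt h0

/-- Parameters `(a, b, P, Q)`: the position and velocity of a curve and a frame along it with its
derivative. -/
abbrev FrameParam (E : Type*) [NormedAddCommGroup E] [NormedSpace ℝ E] : Type _ :=
  E × E × (E →L[ℝ] E) × (E →L[ℝ] E)

/-- The components of the differential of `(t, q) ↦ e (a t, P t q)`: the position and the
affine map which gives the velocity in the direction `(1, y)`. -/
def expJet (e : E × E → E) (z : FrameParam E × E) : E × E × (E →L[ℝ] E) :=
  (e (z.1.1, z.1.2.2.1 z.2), fderiv ℝ e (z.1.1, z.1.2.2.1 z.2) (z.1.2.1, z.1.2.2.2 z.2),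
    (fderiv ℝ e (z.1.1, z.1.2.2.1 z.2)).comp ((ContinuousLinearMap.inr ℝ E E).comp z.1.2.2.1))

variable {e : E × E → E}

theorem contDiffAt_expJet {π : FrameParam E} {q : E}
    (he : ContDiffAt ℝ 3 e (π.1, π.2.2.1 q)) : ContDiffAt ℝ 2 (expJet e) (π, q) := by
  have hP : ContDiffAt ℝ 2 (fun z : FrameParam E × E => z.1.2.2.1) (π, q) := by fun_prop
  have hQ : ContDiffAt ℝ 2 (fun z : FrameParam E × E => z.1.2.2.2) (π, q) := by fun_prop
  have hq : ContDiffAt ℝ 2 (fun z : FrameParam E × E => z.2) (π, q) := by fun_prop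
  have ha : ContDiffAt ℝ 2 (fun z : FrameParam E × E => z.1.1) (π, q) := by fun_prop
  have hb : ContDiffAt ℝ 2 (fun z : FrameParam E × E => z.1.2.1) (π, q) := by fun_prop
  have hpt : ContDiffAt ℝ 2 (fun z : FrameParam E × E => (z.1.1, z.1.2.2.1 z.2)) (π, q) :=
    ha.prodMk (hP.clm_apply hq)
  have h1 : ContDiffAt ℝ 2 (fun z : FrameParam E × E => e (z.1.1, z.1.2.2.1 z.2)) (π, q) :=
    ContDiffAt.comp (π, q) (g := e) (he.of_le (by norm_num)) hpt
  have h2 : ContDiffAt ℝ 2 (fun z : FrameParam E × E => fderiv ℝ e (z.1.1, z.1.2.2.1 z.2))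
      (π, q) :=
    ContDiffAt.comp (π, q) (g := fderiv ℝ e) (he.fderiv_right (m := 2) (by norm_num)) hpt
  exact h1.prodMk ((h2.clm_apply (hb.prodMk (hQ.clm_apply hq))).prodMk
    (h2.clm_comp (contDiffAt_const.clm_comp hP)))

theorem expJet_zero {π : FrameParam E} (h0 : e (π.1, 0) = π.1)
    (h1 : ∀ z, fderiv ℝ e (π.1, 0) z = z.1 + z.2) :
    expJet e (π, 0) = (π.1, π.2.1, π.2.2.1) := by
  refine Prod.ext ?_ (Prod.ext ?_ ?_)
  · simp [expJet, h0]
  · simp [expJet, h1]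
  · ext u
    simp [expJet, h1]

/-- The mixed second differential of an exponential map vanishes at zero velocity. -/
theorem fderiv_fderiv_exp_apply {x : E} (he : ContDiffAt ℝ 3 e (x, 0))
    (h1 : ∀ᶠ x' in 𝓝 x, ∀ z, fderiv ℝ e (x', 0) z = z.1 + z.2) (p b : E) :
    fderiv ℝ (fderiv ℝ e) (x, 0) (0, p) (b, 0) = 0 := by
  -- Symmetry allows differentiating first in the fibre: at zero velocity the fibre differential is
  -- the identity at every nearby base point, so its derivative in the base direction is zero.
  have hsymm : IsSymmSndFDerivAt ℝ e (x, 0) := he.isSymmSndFDerivAt (by simp; norm_num)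
  rw [hsymm (0, p) (b, 0)]
  have hd : HasFDerivAt (fderiv ℝ e) (fderiv ℝ (fderiv ℝ e) (x, 0)) (x, 0) :=
    ((he.fderiv_right (m := 2) (by norm_num)).differentiableAt (by simp)).hasFDerivAt
  have hline : HasDerivAt (fun r : ℝ => (x + r • b, (0 : E))) (b, 0) 0 := by
    simpa using (((hasDerivAt_id (0 : ℝ)).smul_const b).const_add x).prodMk
      (hasDerivAt_const (0 : ℝ) (0 : E))
  have hd0 : HasFDerivAt (fderiv ℝ e) (fderiv ℝ (fderiv ℝ e) (x, 0)) (x + (0 : ℝ) • b, (0 : E)) := by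
    rw [zero_smul, add_zero]; exact hd
  have h2 : HasDerivAt (fun r : ℝ => fderiv ℝ e (x + r • b, (0 : E)))
      (fderiv ℝ (fderiv ℝ e) (x, 0) (b, 0)) 0 := hd0.comp_hasDerivAt (0 : ℝ) hline
  have h3 : HasDerivAt (fun r : ℝ => fderiv ℝ e (x + r • b, (0 : E)) (0, p))
      (fderiv ℝ (fderiv ℝ e) (x, 0) (b, 0) (0, p)) 0 :=
    (ContinuousLinearMap.apply ℝ E ((0 : E), p)).hasFDerivAt.comp_hasDerivAt (0 : ℝ) h2
  refine h3.unique ((hasDerivAt_const (0 : ℝ) p).congr_of_eventuallyEq ?_)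
  have hc : ContinuousAt (fun r : ℝ => x + r • b) 0 := by fun_prop
  have ht : Tendsto (fun r : ℝ => x + r • b) (𝓝 0) (𝓝 x) := by simpa [ContinuousAt] using hc
  filter_upwards [ht.eventually h1] with r hr
  rw [hr]
  simp

/-- The product rule on the velocity component gives the differential of e at (0, Qw) plus a mixed
second differential; the latter vanishes, so only the derivative Q of the frame remains. -/
theorem sndDeriv_expJet_zero {π : FrameParam E} (he : ContDiffAt ℝ 3 e (π.1, 0))
    (h1 : ∀ᶠ x in 𝓝 π.1, ∀ z, fderiv ℝ e (x, 0) z = z.1 + z.2) (w : E) :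
    (sndDeriv (expJet e) (π, 0) w).1 = π.2.2.1 w ∧
      (sndDeriv (expJet e) (π, 0) w).2.1 = π.2.2.2 w := by
  have he' : ContDiffAt ℝ 3 e (π.1, π.2.2.1 0) := by rwa [map_zero]
  have hS := hasFDerivAt_sndDeriv ((contDiffAt_expJet (q := 0) he').differentiableAt (by simp))
  have hp : HasFDerivAt (fun q : E => (π.1, π.2.2.1 q))
      ((0 : E →L[ℝ] E).prod π.2.2.1) 0 := (hasFDerivAt_const _ _).prodMk π.2.2.1.hasFDerivAt
  have hb : HasFDerivAt (fun q : E => (π.2.1, π.2.2.2 q))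
      ((0 : E →L[ℝ] E).prod π.2.2.2) 0 := (hasFDerivAt_const _ _).prodMk π.2.2.2.hasFDerivAt
  have hfst : HasFDerivAt (fun q : E => e (π.1, π.2.2.1 q))
      ((fderiv ℝ e (π.1, π.2.2.1 0)).comp ((0 : E →L[ℝ] E).prod π.2.2.1)) 0 :=
    HasFDerivAt.comp (0 : E) (g := e) (he'.differentiableAt (by simp)).hasFDerivAt hp
  have hd : HasFDerivAt (fun q : E => fderiv ℝ e (π.1, π.2.2.1 q))
      ((fderiv ℝ (fderiv ℝ e) (π.1, π.2.2.1 0)).comp ((0 : E →L[ℝ] E).prod π.2.2.1)) 0 :=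
    HasFDerivAt.comp (0 : E) (g := fderiv ℝ e)
      ((he'.fderiv_right (m := 2) (by norm_num)).differentiableAt (by simp)).hasFDerivAt hp
  have hsnd := hd.clm_apply hb
  constructor
  · have := DFunLike.congr_fun (hS.fst.unique hfst) w
    refine this.trans ?_
    simp [h1.self_of_nhds]
  · have := DFunLike.congr_fun (hS.snd.fst.unique hsnd) w
    refine this.trans ?_
    simp [h1.self_of_nhds, fderiv_fderiv_exp_apply he h1]

variable [FiniteDimensional ℝ E] {l : E × E → ℝ} {T : Set E}

/-- To first order the exponential coordinates act on the differential like the linear substitution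
given by the frame and its derivative. Hence the Euler–Lagrange equation along the base curve passes
to the zero curve. -/
theorem fderiv_affineLagrangian_expJet_zero (hl : HomogeneousLagrangian l T) {π : FrameParam E}
    (hT : π.1 ∈ T) (he : ContDiffAt ℝ 3 e (π.1, 0))
    (h1 : ∀ᶠ x in 𝓝 π.1, e (x, 0) = x ∧ ∀ z, fderiv ℝ e (x, 0) z = z.1 + z.2) (w u : E) :
    fderiv ℝ (affineLagrangian l (expJet e) π) (0, 0) (w, u) =
      fderiv ℝ l (π.1, π.2.1) (π.2.2.1 w, π.2.2.2 w + π.2.2.1 u) := by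
  have h0 := expJet_zero h1.self_of_nhds.1 h1.self_of_nhds.2
  have hS : ContDiffAt ℝ 2 (expJet e) (π, 0) := contDiffAt_expJet (by rwa [map_zero])
  obtain ⟨h2, h3⟩ := sndDeriv_expJet_zero he (h1.mono fun x hx => hx.2) w
  rw [fderiv_affineLagrangian_apply hl hS (by rw [h0]; exact hT), h2, h3, h0, map_zero, map_zero,
    add_zero, add_zero]

end ExpJet

end

noncomputable section

set_option maxSynthPendingDepth 3

/-! ## From local to global tameness -/

section Local

variable {n : ℕ}

/-- The properties of a tame Lagrangian at a given time. -/
structure TameAt (L : ℝ → Euc n → Euc n → ℝ) (ρ c C t : ℝ) : Prop where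
  differentiableAt : ∀ q ∈ Metric.ball (0 : Euc n) ρ, ∀ y,
    DifferentiableAt ℝ (fun z : Euc n × Euc n => L t z.1 z.2) (q, y)
  continuousWithinAt : ∀ q ∈ Metric.ball (0 : Euc n) ρ, ∀ y, ContinuousWithinAt
    (fun p : ℝ × (Euc n × Euc n) => L p.1 p.2.1 p.2.2) (Icc 0 1 ×ˢ univ) (t, (q, y))
  continuousWithinAt_deriv : ∀ q ∈ Metric.ball (0 : Euc n) ρ, ∀ y, ContinuousWithinAt
    (fun p : ℝ × (Euc n × Euc n) => phaseDeriv L p.1 p.2) (Icc 0 1 ×ˢ univ) (t, (q, y))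
  lipschitz_snd : ∀ q ∈ Metric.ball (0 : Euc n) ρ, ∀ q' ∈ Metric.ball (0 : Euc n) ρ, ∀ y y' w,
    |phaseDeriv L t (q, y) (0, w) - phaseDeriv L t (q', y') (0, w)| ≤
      C * (‖q - q'‖ * (1 + ‖y‖ + ‖y'‖) + ‖y - y'‖) * ‖w‖
  lipschitz_fst : ∀ q ∈ Metric.ball (0 : Euc n) ρ, ∀ q' ∈ Metric.ball (0 : Euc n) ρ, ∀ y y' w,
    |phaseDeriv L t (q, y) (w, 0) - phaseDeriv L t (q', y') (w, 0)| ≤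
      C * (‖q - q'‖ * (1 + ‖y‖ + ‖y'‖) ^ 2 + ‖y - y'‖ * (1 + ‖y‖ + ‖y'‖)) * ‖w‖
  monotone_snd : ∀ q ∈ Metric.ball (0 : Euc n) ρ, ∀ y y', c * ‖y - y'‖ ^ 2 ≤
    phaseDeriv L t (q, y) (0, y - y') - phaseDeriv L t (q, y') (0, y - y')
  differentiableAt_deriv : DifferentiableAt ℝ (phaseDeriv L t) (0, 0)
  continuousWithinAt_hess : ContinuousWithinAt (hessAtZero L) (Icc 0 1) t
  eulerLagrange : ∀ w, HasDerivWithinAt (fun s => phaseDeriv L s (0, 0) (0, w))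
    (phaseDeriv L t (0, 0) (w, 0)) (Icc 0 1) t

theorem TameAt.mono {L : ℝ → Euc n → Euc n → ℝ} {ρ c C ρ' c' C' t : ℝ} (h : TameAt L ρ c C t)
    (hρ : ρ' ≤ ρ) (hc : c' ≤ c) (hC : C ≤ C') : TameAt L ρ' c' C' t where
  differentiableAt q hq := h.differentiableAt q (Metric.ball_subset_ball hρ hq)
  continuousWithinAt q hq := h.continuousWithinAt q (Metric.ball_subset_ball hρ hq)
  continuousWithinAt_deriv q hq := h.continuousWithinAt_deriv q (Metric.ball_subset_ball hρ hq)
  lipschitz_snd q hq q' hq' y y' w := (h.lipschitz_snd q (Metric.ball_subset_ball hρ hq) q'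
    (Metric.ball_subset_ball hρ hq') y y' w).trans (by gcongr)
  lipschitz_fst q hq q' hq' y y' w := (h.lipschitz_fst q (Metric.ball_subset_ball hρ hq) q'
    (Metric.ball_subset_ball hρ hq') y y' w).trans (by gcongr)
  monotone_snd q hq y y' := le_trans (by gcongr)
    (h.monotone_snd q (Metric.ball_subset_ball hρ hq) y y')
  differentiableAt_deriv := h.differentiableAt_deriv
  continuousWithinAt_hess := h.continuousWithinAt_hess
  eulerLagrange := h.eulerLagrange

/-- A Lagrangian that is tame near every time in `[0,1]` is tame. -/
theorem exists_tameLagrangian {L : ℝ → Euc n → Euc n → ℝ}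
    (h : ∀ t₀ ∈ Icc (0 : ℝ) 1, ∃ ρ c C : ℝ, 0 < ρ ∧ 0 < c ∧ 0 ≤ C ∧
      ∀ᶠ t in 𝓝[Icc 0 1] t₀, TameAt L ρ c C t) {r : ℝ} (hr : 0 < r) :
    ∃ ρ c C : ℝ, ρ ≤ r ∧ TameLagrangian L ρ c C := by
  obtain ⟨ρ, c, C, hρ, hc, hC, H⟩ : ∃ ρ c C : ℝ, 0 < ρ ∧ 0 < c ∧ 0 ≤ C ∧
      ∀ t ∈ Icc (0 : ℝ) 1, TameAt L ρ c C t := by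
    refine isCompact_Icc.induction_on
      (p := fun s => ∃ ρ c C : ℝ, 0 < ρ ∧ 0 < c ∧ 0 ≤ C ∧ ∀ t ∈ s, TameAt L ρ c C t) ?_ ?_ ?_ ?_
    · exact ⟨1, 1, 1, one_pos, one_pos, zero_le_one, fun t ht => ht.elim⟩
    · rintro s s' hs ⟨ρ, c, C, hρ, hc, hC, H⟩
      exact ⟨ρ, c, C, hρ, hc, hC, fun t ht => H t (hs ht)⟩
    · rintro s s' ⟨ρ, c, C, hρ, hc, hC, H⟩ ⟨ρ', c', C', hρ', hc', hC', H'⟩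
      refine ⟨min ρ ρ', min c c', max C C', lt_min hρ hρ', lt_min hc hc', le_max_of_le_left hC, ?_⟩
      rintro t (ht | ht)
      · exact (H t ht).mono (min_le_left _ _) (min_le_left _ _) (le_max_left _ _)
      · exact (H' t ht).mono (min_le_right _ _) (min_le_right _ _) (le_max_right _ _)
    · intro t ht
      obtain ⟨ρ, c, C, hρ, hc, hC, H⟩ := h t ht
      exact ⟨_, H, ρ, c, C, hρ, hc, hC, fun _ hs => hs⟩
  have hsub : Metric.ball (0 : Euc n) (min ρ (min r 1)) ⊆ Metric.ball 0 ρ :=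
    Metric.ball_subset_ball (min_le_left _ _)
  have hdom : tameDomain n (min ρ (min r 1)) ⊆ Icc 0 1 ×ˢ univ :=
    prod_mono subset_rfl (subset_univ _)
  -- The radius is cut down to 1, which tameness requires, and to `r`, below which the cut-off
  -- function will equal 1.
  refine ⟨min ρ (min r 1), c, C, (min_le_right _ _).trans (min_le_left _ _), ?_⟩
  exact
    { radius_pos := lt_min hρ (lt_min hr one_pos)
      radius_le := (min_le_right _ _).trans (min_le_right _ _)
      convexity_pos := hc
      bound_nonneg := hC
      differentiableAt := fun t ht q hq => (H t ht).differentiableAt q (hsub hq)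
      continuousOn := fun p hp =>
        ((H p.1 hp.1).continuousWithinAt p.2.1 (hsub hp.2.1) p.2.2).mono hdom
      continuousOn_deriv := fun p hp =>
        ((H p.1 hp.1).continuousWithinAt_deriv p.2.1 (hsub hp.2.1) p.2.2).mono hdom
      lipschitz_snd := fun t ht q hq q' hq' => (H t ht).lipschitz_snd q (hsub hq) q' (hsub hq')
      lipschitz_fst := fun t ht q hq q' hq' => (H t ht).lipschitz_fst q (hsub hq) q' (hsub hq')
      monotone_snd := fun t ht q hq => (H t ht).monotone_snd q (hsub hq)
      differentiableAt_deriv := fun t ht => (H t ht).differentiableAt_deriv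
      continuousOn_hess := fun t ht => (H t ht).continuousWithinAt_hess
      eulerLagrange := fun t ht => (H t ht).eulerLagrange }

/-- The second differential in the second variable depends continuously on the first one. -/
theorem continuousAt_partial_hessian {X E : Type*} [NormedAddCommGroup X] [NormedSpace ℝ X]
    [NormedAddCommGroup E] [NormedSpace ℝ E] {H : X → E → ℝ} {x : X} {z : E}
    (hH : ContDiffAt ℝ 2 (Function.uncurry H) (x, z)) :
    ContinuousAt (fun x => fderiv ℝ (fderiv ℝ (H x)) z) x ∧
      DifferentiableAt ℝ (fderiv ℝ (H x)) z := by
  have h1 : ContDiffAt ℝ 1 (Function.uncurry fun (x : X) (z : E) => fderiv ℝ (H x) z) (x, z) := by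
    refine ContDiffAt.fderiv (m := 1) (n := 2) (f := fun p : X × E => H p.1) (g := fun p => p.2) ?_
      contDiffAt_snd (by norm_num)
    exact ContDiffAt.comp (g := Function.uncurry H) (f := fun r : (X × E) × E => (r.1.1, r.2))
      ((x, z), z) hH (by fun_prop)
  refine ⟨(ContDiffAt.fderiv (m := 0) (n := 1) (f := fun (x : X) (z : E) => fderiv ℝ (H x) z)
    (g := fun _ => z) h1 contDiffAt_const (by norm_num)).continuousAt, ?_⟩
  have h2 : ContDiffAt ℝ 1 (fun z => fderiv ℝ (H x) z) z :=
    ContDiffAt.comp z (g := Function.uncurry fun (x : X) (z : E) => fderiv ℝ (H x) z)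
      (f := fun z => (x, z)) h1 (contDiffAt_const.prodMk contDiffAt_id)
  exact h2.differentiableAt (by simp)

/-- A Lagrangian is tame near `t₀` if it is given there by the substitution defined by an
exponential map along a solution of the Euler-Lagrange equation of a homogeneous Lagrangian. -/
theorem eventually_tameAt {l : Euc n × Euc n → ℝ} {T : Set (Euc n)}
    (hl : HomogeneousLagrangian l T) {L : ℝ → Euc n → Euc n → ℝ} {t₀ : ℝ}
    (ht₀ : t₀ ∈ Icc (0 : ℝ) 1) {e : Euc n × Euc n → Euc n} {π : ℝ → FrameParam (Euc n)}
    (hπ : ∀ᶠ t in 𝓝[Icc 0 1] t₀, ContinuousWithinAt π (Icc 0 1) t ∧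
      HasDerivWithinAt (fun s => (π s).2.2.1) (π t).2.2.2 (Icc 0 1) t ∧
      ∀ w, HasDerivWithinAt (fun s => fderiv ℝ l ((π s).1, (π s).2.1) (0, w))
        (fderiv ℝ l ((π t).1, (π t).2.1) (w, 0)) (Icc 0 1) t)
    (he : ContDiffAt ℝ 3 e ((π t₀).1, 0))
    (he' : ∀ᶠ x in 𝓝 (π t₀).1, e (x, 0) = x ∧ ∀ z, fderiv ℝ e (x, 0) z = z.1 + z.2)
    (hT : (π t₀).1 ∈ T) (hb : (π t₀).2.1 ≠ 0) (hP : Function.Injective (π t₀).2.2.1)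
    {r₀ : ℝ} (hr₀ : 0 < r₀)
    (hL : ∀ᶠ t in 𝓝[Icc 0 1] t₀, ∀ q ∈ Metric.ball (0 : Euc n) r₀, ∀ y,
      L t q y = affineLagrangian l (expJet e) (π t) (q, y)) :
    ∃ ρ c C : ℝ, 0 < ρ ∧ 0 < c ∧ 0 ≤ C ∧ ∀ᶠ t in 𝓝[Icc 0 1] t₀, TameAt L ρ c C t := by
  have hjet := expJet_zero he'.self_of_nhds.1 he'.self_of_nhds.2
  -- The estimates hold for all parameters near `π t₀` with the same constants, so continuity of `π`
  -- makes them uniform in time near `t₀`.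
  obtain ⟨r, c, C, hr, hc, hC, hest⟩ := exists_affineLagrangian_estimates hl (S := expJet e)
    (x₀ := π t₀) (contDiffAt_expJet (by rwa [map_zero])) (by rw [hjet]; exact hT)
    (by rw [hjet]; exact hb) (by rw [hjet]; exact hP)
  set H := affineLagrangian l (expJet e) with hH
  have hπ0 : ContinuousWithinAt π (Icc 0 1) t₀ := (hπ.self_of_nhdsWithin ht₀).1
  have hπ1 : ContinuousWithinAt (fun t => (π t).1) (Icc 0 1) t₀ := hπ0.fst
  have hx0 : ContinuousAt (fun x : Euc n => (x, (0 : Euc n))) (π t₀).1 := by fun_prop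
  have hgood : ∀ᶠ t in 𝓝[Icc 0 1] t₀, (π t ∈ Metric.ball (π t₀) r ∧
      ContDiffAt ℝ 3 e ((π t).1, 0) ∧ (π t).1 ∈ T) ∧
      (∀ᶠ x in 𝓝 (π t).1, e (x, 0) = x ∧ ∀ z, fderiv ℝ e (x, 0) z = z.1 + z.2) ∧
      ∀ q ∈ Metric.ball (0 : Euc n) r₀, ∀ y, L t q y = H (π t) (q, y) := by
    filter_upwards [hπ0.eventually (Metric.ball_mem_nhds _ hr),
      hπ1.eventually (hx0.eventually (he.eventually (by simp))),
      hπ1.eventually (hl.isOpen.mem_nhds hT),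
      hπ1.eventually (eventually_eventually_nhds.2 he'), hL] with t h1 h2 h3 h4 h5
    exact ⟨⟨h1, h2, h3⟩, h4, h5⟩
  have hrr : 0 < min r r₀ := lt_min hr hr₀
  have hball : ∀ {q : Euc n}, q ∈ Metric.ball 0 (min r r₀) → q ∈ Metric.ball 0 r := fun hq =>
    Metric.ball_subset_ball (min_le_left _ _) hq
  have hderiv : ∀ s, (∀ q ∈ Metric.ball (0 : Euc n) r₀, ∀ y, L s q y = H (π s) (q, y)) →
      ∀ q ∈ Metric.ball (0 : Euc n) (min r r₀), ∀ y,
        (fun z : Euc n × Euc n => L s z.1 z.2) =ᶠ[𝓝 (q, y)] H (π s) := by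
    intro s hs q hq y
    filter_upwards [continuous_fst.continuousAt.eventually (Metric.isOpen_ball.mem_nhds hq)]
      with z hz
    exact hs z.1 (Metric.ball_subset_ball (min_le_right _ _) hz) z.2
  have hphase : ∀ s, (∀ q ∈ Metric.ball (0 : Euc n) r₀, ∀ y, L s q y = H (π s) (q, y)) →
      ∀ q ∈ Metric.ball (0 : Euc n) (min r r₀), ∀ y,
        phaseDeriv L s (q, y) = fderiv ℝ (H (π s)) (q, y) := fun s hs q hq y =>
    (hderiv s hs q hq y).fderiv_eq
  have h00 : (0 : Euc n) ∈ Metric.ball (0 : Euc n) (min r r₀) := Metric.mem_ball_self hrr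
  have hphase' : ∀ s, (∀ q ∈ Metric.ball (0 : Euc n) r₀, ∀ y, L s q y = H (π s) (q, y)) →
      phaseDeriv L s =ᶠ[𝓝 (0, 0)] fderiv ℝ (H (π s)) := fun s hs => (hderiv s hs 0 h00 0).fderiv
  refine ⟨min r r₀, c, C, hrr, hc, hC, ?_⟩
  -- The good properties are required in a neighbourhood of each nearby time as well, because
  -- continuity and the Euler–Lagrange derivative involve germs in time.
  filter_upwards [eventually_eventually_nhdsWithin.2 hgood, hπ, eventually_mem_nhdsWithin]
    with t hgt hπt htI
  obtain ⟨⟨hball_t, het, hTt⟩, het', hLt⟩ := hgt.self_of_nhdsWithin htI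
  obtain ⟨hreg, hsnd, hfst, hmon⟩ := hest (π t) hball_t
  have hprod : ∀ z : Euc n × Euc n, Tendsto (fun p : ℝ × (Euc n × Euc n) => p.1)
      (𝓝[Icc 0 1 ×ˢ univ] (t, z)) (𝓝[Icc 0 1] t) := fun z => by
    rw [nhdsWithin_prod_eq]
    exact tendsto_fst
  have hπp : ∀ z : Euc n × Euc n, ContinuousWithinAt (fun p : ℝ × (Euc n × Euc n) => (π p.1, p.2))
      (Icc 0 1 ×ˢ univ) (t, z) := fun z =>
    ContinuousWithinAt.prodMk (hπt.1.tendsto.comp (hprod z)) continuousWithinAt_snd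
  have hpball : ∀ q ∈ Metric.ball (0 : Euc n) (min r r₀), ∀ y,
      ∀ᶠ p : ℝ × (Euc n × Euc n) in 𝓝[Icc 0 1 ×ˢ univ] (t, (q, y)),
        p.2.1 ∈ Metric.ball (0 : Euc n) (min r r₀) := fun q hq y => by
    have hc : ContinuousAt (fun p : ℝ × (Euc n × Euc n) => p.2.1) (t, (q, y)) := by fun_prop
    exact nhdsWithin_le_nhds (hc.eventually (Metric.isOpen_ball.mem_nhds hq))
  have hcd := continuousAt_partial_hessian (contDiffAt_affineLagrangian hl
    (hreg 0 (hball h00)).1 (hreg 0 (hball h00)).2.1 (hreg 0 (hball h00)).2.2)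
  constructor
  · intro q hq y
    exact (hasFDerivAt_affineLagrangian hl (hreg q (hball hq)).1
      (hreg q (hball hq)).2.1).differentiableAt.congr_of_eventuallyEq (hderiv t hLt q hq y)
  · intro q hq y
    have hcomp : ContinuousWithinAt (fun p : ℝ × (Euc n × Euc n) => H (π p.1) p.2)
        (Icc 0 1 ×ˢ univ) (t, (q, y)) :=
      ContinuousAt.comp_continuousWithinAt
        (g := fun p : FrameParam (Euc n) × (Euc n × Euc n) => H p.1 p.2)
        (f := fun p : ℝ × (Euc n × Euc n) => (π p.1, p.2))
        (continuousAt_affineLagrangian hl (hreg q (hball hq)).1 (hreg q (hball hq)).2.1) (hπp (q, y))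
    refine hcomp.congr_of_eventuallyEq ?_
      (hLt q (Metric.ball_subset_ball (min_le_right _ _) hq) y)
    filter_upwards [(hprod (q, y)).eventually hgt, hpball q hq y] with p hp hp'
    exact hp.2.2 _ (Metric.ball_subset_ball (min_le_right _ _) hp') _
  · intro q hq y
    have hcomp : ContinuousWithinAt
        (fun p : ℝ × (Euc n × Euc n) => fderiv ℝ (H (π p.1)) p.2) (Icc 0 1 ×ˢ univ) (t, (q, y)) :=
      ContinuousAt.comp_continuousWithinAt
        (g := fun p : FrameParam (Euc n) × (Euc n × Euc n) => fderiv ℝ (H p.1) p.2)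
        (f := fun p : ℝ × (Euc n × Euc n) => (π p.1, p.2))
        (continuousAt_fderiv_affineLagrangian hl (hreg q (hball hq)).1 (hreg q (hball hq)).2.1)
        (hπp (q, y))
    refine hcomp.congr_of_eventuallyEq ?_ (hphase t hLt q hq y)
    filter_upwards [(hprod (q, y)).eventually hgt, hpball q hq y] with p hp hp'
    exact hphase p.1 hp.2.2 _ hp' _
  · intro q hq q' hq' y y' w
    rw [hphase t hLt q hq, hphase t hLt q' hq']
    exact hsnd q (hball hq) q' (hball hq') y y' w
  · intro q hq q' hq' y y' w
    rw [hphase t hLt q hq, hphase t hLt q' hq']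
    exact hfst q (hball hq) q' (hball hq') y y' w
  · intro q hq y y'
    rw [hphase t hLt q hq, hphase t hLt q hq]
    exact hmon q (hball hq) y y'
  · exact hcd.2.congr_of_eventuallyEq (hphase' t hLt)
  · refine (hcd.1.comp_continuousWithinAt hπt.1).congr_of_eventuallyEq ?_
      (hphase' t hLt).fderiv_eq
    filter_upwards [hgt] with s hs
    exact (hphase' s hs.2.2).fderiv_eq
  · intro w
    have hval : ∀ s, (π s ∈ Metric.ball (π t₀) r ∧ ContDiffAt ℝ 3 e ((π s).1, 0) ∧ (π s).1 ∈ T) ∧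
        (∀ᶠ x in 𝓝 (π s).1, e (x, 0) = x ∧ ∀ z, fderiv ℝ e (x, 0) z = z.1 + z.2) ∧
        (∀ q ∈ Metric.ball (0 : Euc n) r₀, ∀ y, L s q y = H (π s) (q, y)) → ∀ w u,
        phaseDeriv L s (0, 0) (w, u) = fderiv ℝ l ((π s).1, (π s).2.1)
          ((π s).2.2.1 w, (π s).2.2.2 w + (π s).2.2.1 u) := by
      intro s hs w u
      rw [hphase s hs.2.2 0 h00 0,
        fderiv_affineLagrangian_expJet_zero hl hs.1.2.2 hs.1.2.1 hs.2.1]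
    -- The momentum of the base curve is tested with the moving vector P(s)w; the product rule
    -- yields precisely the position derivative of the transformed Lagrangian.
    have hm := hasDerivWithinAt_momentum_apply
      (ℓ := fun s => fderiv ℝ l ((π s).1, (π s).2.1)) hπt.2.2
      (β := fun s => (π s).2.2.1 w) (β' := (π t).2.2.2 w)
      ((ContinuousLinearMap.apply ℝ (Euc n) w).hasFDerivAt.comp_hasDerivWithinAt t hπt.2.1)
    rw [hval t (hgt.self_of_nhdsWithin htI), map_zero, add_zero]
    refine hm.congr_of_eventuallyEq ?_ ?_
    · filter_upwards [hgt] with s hs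
      rw [hval s hs, map_zero, map_zero, zero_add]
    · rw [hval t (hgt.self_of_nhdsWithin htI), map_zero, map_zero, zero_add]

end Local

end

noncomputable section

set_option maxSynthPendingDepth 3

/-! ## The tubular coordinates in charts -/

section Tube

variable {n : ℕ} {M : Type*} [TopologicalSpace M] [ChartedSpace (Euc n) M] {γ : ℝ → M}
  {E : Fin n → ∀ t : ℝ, TangentSpace 𝓘(ℝ, Euc n) (γ t)}

/-- The frame `E` in the chart around `p`, as a linear map. -/
def frameCoord (γ : ℝ → M) (E : Fin n → ∀ t : ℝ, TangentSpace 𝓘(ℝ, Euc n) (γ t)) (p : M) (t : ℝ) :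
    Euc n →L[ℝ] Euc n :=
  ∑ i, (EuclideanSpace.proj i : Euc n →L[ℝ] ℝ).smulRight (chartCoord p ⟨γ t, E i t⟩).2

theorem chartCoord_frame (p : M) (t : ℝ) (q : Euc n) :
    chartCoord p ⟨γ t, ∑ i, q i • E i t⟩ =
      (extChartAt 𝓘(ℝ, Euc n) p (γ t), frameCoord γ E p t q) := by
  refine Prod.ext rfl ?_
  have h1 : (frameCoord γ E p t q) = ∑ i, q i • (chartCoord p ⟨γ t, E i t⟩).2 := by
    simp [frameCoord]
  rw [h1]
  show mfderiv 𝓘(ℝ, Euc n) 𝓘(ℝ, Euc n) (extChartAt 𝓘(ℝ, Euc n) p) (γ t) (∑ i, q i • E i t) = _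
  rw [map_sum]
  exact Finset.sum_congr rfl fun i _ => map_smul _ _ _

theorem tangentMapWithin_eq_of_eventuallyEq {f g : ℝ × Euc n → M} {s : Set (ℝ × Euc n)}
    {z : ℝ × Euc n} (hfg : f =ᶠ[𝓝[s] z] g) (hz : f z = g z) (v : ℝ × Euc n) :
    tangentMapWithin 𝓘(ℝ, ℝ × Euc n) 𝓘(ℝ, Euc n) f s ⟨z, v⟩ =
      tangentMapWithin 𝓘(ℝ, ℝ × Euc n) 𝓘(ℝ, Euc n) g s ⟨z, v⟩ := by
  have h1 := hfg.mfderivWithin_eq (I := 𝓘(ℝ, ℝ × Euc n)) (I' := 𝓘(ℝ, Euc n)) hz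
  have hmk : ∀ {x x' : M} (_ : x = x') (v : Euc n),
      (⟨x, v⟩ : TangentBundle 𝓘(ℝ, Euc n) M) = ⟨x', v⟩ := by
    rintro x _ rfl v; rfl
  exact (hmk hz _).trans (congrArg (fun L : ℝ × Euc n →L[ℝ] Euc n =>
    (⟨g z, L v⟩ : TangentBundle 𝓘(ℝ, Euc n) M)) h1)

variable [IsManifold 𝓘(ℝ, Euc n) ∞ M] {h : RiemMetric n M}

theorem IsOrthonormalFrameAlong.inner_sum (hE : IsOrthonormalFrameAlong h γ E) {t : ℝ}
    (ht : t ∈ Icc (0 : ℝ) 1) (q : Euc n) :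
    h.inner (γ t) (∑ i, q i • E i t) (∑ i, q i • E i t) = ‖q‖ ^ 2 := by
  rw [EuclideanSpace.norm_sq_eq]
  simp only [map_sum, map_smul, sum_apply, _root_.smul_apply, hE.2 t ht]
  simp [sq]

/-- The injectivity radius is a supremum that need not be attained. Since δ < 2δ, some admissible
radius exceeds δ, and orthonormality identifies the Euclidean norm with the h-norm. -/
theorem IsOrthonormalFrameAlong.inExpDomain (hE : IsOrthonormalFrameAlong h γ E) {δ : ℝ}
    (hδ : 0 < δ) {t : ℝ} (ht : t ∈ Icc (0 : ℝ) 1)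
    (hinj : ENNReal.ofReal (2 * δ) ≤ injRadius h (γ t)) {q : Euc n} (hq : ‖q‖ < δ) :
    InExpDomain h ⟨γ t, ∑ i, q i • E i t⟩ := by
  have h1 : ENNReal.ofReal δ < injRadius h (γ t) :=
    lt_of_lt_of_le ((ENNReal.ofReal_lt_ofReal_iff (by linarith)).2 (by linarith)) hinj
  obtain ⟨r, hr⟩ := lt_iSup_iff.1 h1
  obtain ⟨hexp, hr⟩ := lt_iSup_iff.1 hr
  have hr' : δ < r := by
    rw [ENNReal.ofReal, ENNReal.coe_lt_coe] at hr
    exact (Real.toNNReal_lt_iff_lt_coe hδ.le).1 hr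
  refine hexp.1 _ ?_
  show h.inner (γ t) (∑ i, q i • E i t) (∑ i, q i • E i t) < (r : ℝ) ^ 2
  rw [hE.inner_sum ht]
  exact pow_lt_pow_left₀ (hq.trans hr') (norm_nonneg _) two_ne_zero

theorem IsOrthonormalFrameAlong.frameCoord_injective (hE : IsOrthonormalFrameAlong h γ E) {t : ℝ}
    (ht : t ∈ Icc (0 : ℝ) 1) {p : M} (hp : γ t ∈ (extChartAt 𝓘(ℝ, Euc n) p).source) :
    Function.Injective (frameCoord γ E p t) := by
  rw [injective_iff_map_eq_zero]
  intro q hq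
  have h1 : chartCoord p ⟨γ t, ∑ i, q i • E i t⟩ = chartCoord p ⟨γ t, 0⟩ := by
    rw [chartCoord_frame, hq]
    exact Prod.ext rfl (map_zero _).symm
  have h2 := congrArg (chartLift p) h1
  rw [chartLift_chartCoord hp, chartLift_chartCoord hp] at h2
  have h3 : ∑ i, q i • E i t = 0 := by simpa using h2
  have h4 := hE.inner_sum ht q
  rw [h3, map_zero] at h4
  simpa using h4.symm

theorem IsOrthonormalFrameAlong.contDiffWithinAt_frameCoord (hE : IsOrthonormalFrameAlong h γ E)
    {t : ℝ} (ht : t ∈ Icc (0 : ℝ) 1) {p : M} (hp : γ t ∈ (extChartAt 𝓘(ℝ, Euc n) p).source) :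
    ContDiffWithinAt ℝ ∞ (frameCoord γ E p) (Icc 0 1) t := by
  refine ContDiffWithinAt.sum fun i _ => ?_
  have hopen : IsOpen {u : TangentBundle 𝓘(ℝ, Euc n) M |
      u.1 ∈ (extChartAt 𝓘(ℝ, Euc n) p).source} :=
    (isOpen_source p).preimage (FiberBundle.continuous_proj (Euc n) (TangentSpace 𝓘(ℝ, Euc n)))
  have h1 := ContMDiffAt.comp_contMDiffWithinAt t
    ((contMDiffOn_chartCoord p).contMDiffAt (hopen.mem_nhds hp)) (hE.1 i t ht)
  have h2 := (contMDiffWithinAt_iff_contDiffWithinAt.1 h1).snd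
  exact contDiffWithinAt_const.smulRight h2

theorem tangentMapWithin_chart_symm_comp {p : M} {g : ℝ × Euc n → Euc n} {s : Set (ℝ × Euc n)}
    {z : ℝ × Euc n} {g' : ℝ × Euc n →L[ℝ] Euc n} (hg : HasFDerivWithinAt g g' s z)
    (hs : UniqueDiffWithinAt ℝ s z) (hz : g z ∈ (extChartAt 𝓘(ℝ, Euc n) p).target)
    (v : ℝ × Euc n) :
    tangentMapWithin 𝓘(ℝ, ℝ × Euc n) 𝓘(ℝ, Euc n) ((extChartAt 𝓘(ℝ, Euc n) p).symm ∘ g) s ⟨z, v⟩ =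
      chartLift p (g z, g' v) := by
  have h1 : mfderivWithin 𝓘(ℝ, ℝ × Euc n) 𝓘(ℝ, Euc n) ((extChartAt 𝓘(ℝ, Euc n) p).symm ∘ g) s z =
      (mfderiv 𝓘(ℝ, Euc n) 𝓘(ℝ, Euc n) (extChartAt 𝓘(ℝ, Euc n) p).symm (g z)).comp
        (mfderivWithin 𝓘(ℝ, ℝ × Euc n) 𝓘(ℝ, Euc n) g s z) :=
    mfderiv_comp_mfderivWithin z (mdifferentiableAt_chart_symm hz)
      hg.differentiableWithinAt.mdifferentiableWithinAt
      (uniqueMDiffWithinAt_iff_uniqueDiffWithinAt.2 hs)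
  rw [mfderivWithin_eq_fderivWithin, hg.fderivWithin hs] at h1
  exact congrArg (fun L : ℝ × Euc n →L[ℝ] Euc n =>
    (⟨(extChartAt 𝓘(ℝ, Euc n) p).symm (g z), L v⟩ : TangentBundle 𝓘(ℝ, Euc n) M)) h1

/-- The differential of `(t, q) ↦ e (a t, P t q)`. -/
theorem hasFDerivWithinAt_exp_comp {e : Euc n × Euc n → Euc n} {a : ℝ → Euc n} {a' : Euc n}
    {P : ℝ → Euc n →L[ℝ] Euc n} {P' : Euc n →L[ℝ] Euc n} {t : ℝ} {q : Euc n} {B : Set (Euc n)}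
    (ha : HasDerivWithinAt a a' (Icc 0 1) t) (hP : HasDerivWithinAt P P' (Icc 0 1) t)
    (he : DifferentiableAt ℝ e (a t, P t q)) :
    ∃ g' : ℝ × Euc n →L[ℝ] Euc n,
      HasFDerivWithinAt (fun z : ℝ × Euc n => e (a z.1, P z.1 z.2)) g' (Icc 0 1 ×ˢ B) (t, q) ∧
      ∀ y, g' (1, y) = fderiv ℝ e (a t, P t q) (a', P' q + P t y) := by
  have hf : HasFDerivWithinAt (fun z : ℝ × Euc n => z.1) (ContinuousLinearMap.fst ℝ ℝ (Euc n))
      (Icc 0 1 ×ˢ B) (t, q) := hasFDerivWithinAt_fst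
  have hm : MapsTo (fun z : ℝ × Euc n => z.1) (Icc (0 : ℝ) 1 ×ˢ B) (Icc 0 1) := fun z hz => hz.1
  have h1 : HasFDerivWithinAt (fun z : ℝ × Euc n => a z.1) _ (Icc 0 1 ×ˢ B) (t, q) :=
    HasFDerivWithinAt.comp (t, q) (g := a) ha.hasFDerivWithinAt hf hm
  have h2 : HasFDerivWithinAt (fun z : ℝ × Euc n => P z.1) _ (Icc 0 1 ×ˢ B) (t, q) :=
    HasFDerivWithinAt.comp (t, q) (g := P) hP.hasFDerivWithinAt hf hm
  have h3 := h1.prodMk (h2.clm_apply (hasFDerivWithinAt_snd (𝕜 := ℝ) (p := (t, q))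
    (s := Icc (0 : ℝ) 1 ×ˢ B)))
  refine ⟨_, HasFDerivAt.comp_hasFDerivWithinAt (t, q) (g := e) he.hasFDerivAt h3, fun y => ?_⟩
  rw [ContinuousLinearMap.comp_apply]
  congr 1
  refine Prod.ext ?_ ?_
  · simp
  · simp [add_comm]

end Tube

end

noncomputable section

set_option maxSynthPendingDepth 3

/-! ### Tameness of the Lagrangian in tubular coordinates, and the theorem. -/

section TubeLagrangian

variable {n : ℕ} {M : Type*} [TopologicalSpace M] [ChartedSpace (Euc n) M]
  [IsManifold 𝓘(ℝ, Euc n) ∞ M] {h : RiemMetric n M} {γ : ℝ → M}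
  {E : Fin n → ∀ t : ℝ, TangentSpace 𝓘(ℝ, Euc n) (γ t)}

/-- The position and velocity of `γ` and the frame `E` with its derivative, in the chart
around `p`. -/
def frameParam (γ : ℝ → M) (E : Fin n → ∀ t : ℝ, TangentSpace 𝓘(ℝ, Euc n) (γ t)) (p : M) (t : ℝ) :
    FrameParam (Euc n) :=
  (extChartAt 𝓘(ℝ, Euc n) p (γ t),
    derivWithin (fun s => extChartAt 𝓘(ℝ, Euc n) p (γ s)) (Icc 0 1) t,
    frameCoord γ E p t, derivWithin (frameCoord γ E p) (Icc 0 1) t)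

theorem IsOrthonormalFrameAlong.continuousWithinAt_frameParam
    (hE : IsOrthonormalFrameAlong h γ E) (hγ : ContMDiffOn 𝓘(ℝ, ℝ) 𝓘(ℝ, Euc n) ∞ γ (Icc 0 1))
    {t : ℝ} (ht : t ∈ Icc (0 : ℝ) 1) {p : M} (hp : γ t ∈ (extChartAt 𝓘(ℝ, Euc n) p).source) :
    ContinuousWithinAt (frameParam γ E p) (Icc 0 1) t := by
  have h1 := contDiffWithinAt_chart_comp hγ ht hp
  have h2 := hE.contDiffWithinAt_frameCoord ht hp
  have h3 : ContDiffWithinAt ℝ ∞ (derivWithin (frameCoord γ E p) (Icc 0 1)) (Icc 0 1) t :=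
    h2.derivWithin (uniqueDiffOn_Icc zero_lt_one) (by simp) ht
  exact h1.continuousWithinAt.prodMk ((contDiffWithinAt_derivWithin ht h1).continuousWithinAt.prodMk
    (h2.continuousWithinAt.prodMk h3.continuousWithinAt))

/-- The tubular coordinates in the chart around `γ t₀`. -/
theorem eventually_tubeMap_eq (hE : IsOrthonormalFrameAlong h γ E)
    (hγ : ContMDiffOn 𝓘(ℝ, ℝ) 𝓘(ℝ, Euc n) ∞ γ (Icc 0 1)) {δ : ℝ} (hδ : 0 < δ)
    (hinj : ∀ t ∈ Icc (0 : ℝ) 1, ENNReal.ofReal (2 * δ) ≤ injRadius h (γ t))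
    {t₀ : ℝ} (ht₀ : t₀ ∈ Icc (0 : ℝ) 1) {p : M} (hp : γ t₀ ∈ (extChartAt 𝓘(ℝ, Euc n) p).source)
    {e : Euc n × Euc n → Euc n} (he : ContDiffAt ℝ 3 e (extChartAt 𝓘(ℝ, Euc n) p (γ t₀), 0))
    (he0 : e (extChartAt 𝓘(ℝ, Euc n) p (γ t₀), 0) = extChartAt 𝓘(ℝ, Euc n) p (γ t₀))
    (hexp : ∀ᶠ z in 𝓝 (extChartAt 𝓘(ℝ, Euc n) p (γ t₀), (0 : Euc n)),
        ∀ u : TangentBundle 𝓘(ℝ, Euc n) M, u.1 ∈ (extChartAt 𝓘(ℝ, Euc n) p).source →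
          chartCoord p u = z → InExpDomain h u →
          riemExp h u = (extChartAt 𝓘(ℝ, Euc n) p).symm (e z)) :
    ∃ r : ℝ, 0 < r ∧ r ≤ δ ∧ ∀ᶠ t in 𝓝[Icc 0 1] t₀, ∀ q ∈ Metric.ball (0 : Euc n) r,
      tubeMap h γ E (t, q) = (extChartAt 𝓘(ℝ, Euc n) p).symm
        (e (extChartAt 𝓘(ℝ, Euc n) p (γ t), frameCoord γ E p t q)) ∧
      e (extChartAt 𝓘(ℝ, Euc n) p (γ t), frameCoord γ E p t q) ∈
        (extChartAt 𝓘(ℝ, Euc n) p).target ∧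
      DifferentiableAt ℝ e (extChartAt 𝓘(ℝ, Euc n) p (γ t), frameCoord γ E p t q) := by
  have ha := (contDiffWithinAt_chart_comp hγ ht₀ hp).continuousWithinAt
  have hP := (hE.contDiffWithinAt_frameCoord ht₀ hp).continuousWithinAt
  have hlim : Tendsto (fun z : ℝ × Euc n =>
      (extChartAt 𝓘(ℝ, Euc n) p (γ z.1), frameCoord γ E p z.1 z.2))
      (𝓝[Icc 0 1] t₀ ×ˢ 𝓝 0) (𝓝 (extChartAt 𝓘(ℝ, Euc n) p (γ t₀), 0)) := by
    refine (ha.tendsto.comp tendsto_fst).prodMk_nhds ?_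
    have hev : Tendsto (fun w : (Euc n →L[ℝ] Euc n) × Euc n => w.1 w.2)
        (𝓝 (frameCoord γ E p t₀, 0)) (𝓝 (frameCoord γ E p t₀ 0)) :=
      (isBoundedBilinearMap_apply (𝕜 := ℝ) (E := Euc n) (F := Euc n)).continuous.tendsto _
    rw [map_zero] at hev
    exact hev.comp ((hP.tendsto.comp tendsto_fst).prodMk_nhds tendsto_snd)
  have htgt : ∀ᶠ z in 𝓝 (extChartAt 𝓘(ℝ, Euc n) p (γ t₀), (0 : Euc n)),
      e z ∈ (extChartAt 𝓘(ℝ, Euc n) p).target :=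
    he.continuousAt.eventually ((isOpen_target p).mem_nhds (by
      rw [he0]; exact (extChartAt 𝓘(ℝ, Euc n) p).map_source hp))
  have hall := hlim.eventually (hexp.and (htgt.and (he.eventually (by simp))))
  obtain ⟨pa, hpa, pb, hpb, hpab⟩ := eventually_prod_iff.1 hall
  obtain ⟨r, hr, hrb⟩ := Metric.eventually_nhds_iff_ball.1 hpb
  refine ⟨min r δ, lt_min hr hδ, min_le_right _ _, ?_⟩
  filter_upwards [hpa, eventually_mem_source hγ ht₀ hp, eventually_mem_nhdsWithin]
    with t hta hts htI q hq
  obtain ⟨h1, h2, h3⟩ := hpab hta (hrb q (Metric.ball_subset_ball (min_le_left _ _) hq))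
  have hqδ : ‖q‖ < δ := by simpa using Metric.ball_subset_ball (min_le_right r δ) hq
  exact ⟨h1 ⟨γ t, ∑ i, q i • E i t⟩ hts (chartCoord_frame p t q)
    (hE.inExpDomain hδ htI (hinj t htI) hqδ), h2, h3.differentiableAt (by simp)⟩

/-- The Lagrangian in tubular coordinates is tame near every time. -/
theorem tubeLagrangian_tameAt [T2Space M] {F : FinslerMetric n M} (hγ : F.IsGeodesic γ)
    (hγ' : ∃ t ∈ Icc (0 : ℝ) 1, γ t ≠ γ 0) (hE : IsOrthonormalFrameAlong h γ E) {δ : ℝ}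
    (hδ : 0 < δ) (hinj : ∀ t ∈ Icc (0 : ℝ) 1, ENNReal.ofReal (2 * δ) ≤ injRadius h (γ t))
    {t₀ : ℝ} (ht₀ : t₀ ∈ Icc (0 : ℝ) 1) :
    ∃ ρ c C : ℝ, 0 < ρ ∧ 0 < c ∧ 0 ≤ C ∧
      ∀ᶠ t in 𝓝[Icc 0 1] t₀, TameAt (tubeLagrangian F h γ E δ) ρ c C t := by
  obtain ⟨e, he, he', hexp⟩ := exists_local_exp h (γ t₀)
  set p := γ t₀ with hpdef
  have hp : γ t₀ ∈ (extChartAt 𝓘(ℝ, Euc n) p).source := mem_extChartAt_source _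
  have he3 : ContDiffAt ℝ 3 e (extChartAt 𝓘(ℝ, Euc n) p (γ t₀), 0) :=
    he.of_le (WithTop.coe_le_coe.2 (le_top : (3 : ℕ∞) ≤ ⊤))
  obtain ⟨r, hr, hrδ, hev⟩ := eventually_tubeMap_eq hE hγ.1 hδ hinj ht₀ hp he3
    he'.self_of_nhds.1 hexp
  have hsrc := eventually_mem_source hγ.1 ht₀ hp
  refine eventually_tameAt (F.homogeneousLagrangian p) ht₀ (π := frameParam γ E p) (e := e) ?_ he3
    he' ((extChartAt 𝓘(ℝ, Euc n) p).map_source hp) (hγ.derivWithin_chart_ne_zero hγ' ht₀ hp)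
    (hE.frameCoord_injective ht₀ hp) hr ?_
  · filter_upwards [hsrc, eventually_mem_nhdsWithin] with t hts htI
    exact ⟨hE.continuousWithinAt_frameParam hγ.1 htI hts,
      ((hE.contDiffWithinAt_frameCoord htI hts).differentiableWithinAt
        (by simp)).hasDerivWithinAt,
      fun w => IsExtremal.eulerLagrange F.differentiableOn_chart hγ htI hts w⟩
  · filter_upwards [eventually_eventually_nhdsWithin.2 hev, hsrc, eventually_mem_nhdsWithin]
      with t hevt hts htI q hq y
    have ha := ((contDiffWithinAt_chart_comp hγ.1 htI hts).differentiableWithinAt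
      (by simp)).hasDerivWithinAt
    have hP := ((hE.contDiffWithinAt_frameCoord htI hts).differentiableWithinAt
      (by simp)).hasDerivWithinAt
    obtain ⟨htube, htgt, hdiff⟩ := hevt.self_of_nhdsWithin htI q hq
    obtain ⟨g', hg', hg'y⟩ := hasFDerivWithinAt_exp_comp (B := Metric.ball (0 : Euc n) δ) ha hP hdiff
    have hqδ : q ∈ Metric.ball (0 : Euc n) δ := Metric.ball_subset_ball hrδ hq
    have hu : UniqueDiffWithinAt ℝ (Icc (0 : ℝ) 1 ×ˢ Metric.ball (0 : Euc n) δ) (t, q) :=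
      (uniqueDiffOn_Icc zero_lt_one t htI).prod (Metric.isOpen_ball.uniqueDiffWithinAt hqδ)
    -- The differential within the tube depends only on the germ of the map, so the chosen
    -- exponential may be replaced by its smooth chart expression.
    have hloc : tubeMap h γ E =ᶠ[𝓝[Icc 0 1 ×ˢ Metric.ball 0 δ] (t, q)]
        (extChartAt 𝓘(ℝ, Euc n) p).symm ∘ fun z : ℝ × Euc n =>
          e (extChartAt 𝓘(ℝ, Euc n) p (γ z.1), frameCoord γ E p z.1 z.2) := by
      rw [nhdsWithin_prod_eq, Metric.isOpen_ball.nhdsWithin_eq hqδ]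
      filter_upwards [hevt.prod_mk (Metric.isOpen_ball.mem_nhds hq)] with z hz
      exact (hz.1 z.2 hz.2).1
    have htm := (tangentMapWithin_eq_of_eventuallyEq hloc htube (1, y)).trans
      (tangentMapWithin_chart_symm_comp hg' hu htgt (1, y))
    rw [hg'y] at htm
    -- By linearity the velocity in the direction (1, y) splits into a part independent of y and a
    -- linear part in y, which is the affine substitution.
    have hsplit : fderiv ℝ e (extChartAt 𝓘(ℝ, Euc n) p (γ t), frameCoord γ E p t q)
        (derivWithin (fun s => extChartAt 𝓘(ℝ, Euc n) p (γ s)) (Icc 0 1) t,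
          derivWithin (frameCoord γ E p) (Icc 0 1) t q + frameCoord γ E p t y) =
        (affineMap (expJet e) (frameParam γ E p t) (q, y)).2 := by
      show _ = fderiv ℝ e _ _ + fderiv ℝ e _ (0, frameCoord γ E p t y)
      rw [← map_add]
      simp [frameParam]
    rw [hsplit] at htm
    show F.toFun _ ^ 2 = _
    rw [htm]
    rfl

end TubeLagrangian

theorem mainTheorem2 {n : ℕ} {M : Type*} [TopologicalSpace M] [T2Space M]
    [ChartedSpace (Euc n) M] [IsManifold 𝓘(ℝ, Euc n) ∞ M]
    -- a Finsler metric and an auxiliary Riemannian metric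
    (F : FinslerMetric n M) (h : RiemMetric n M)
    -- a nonconstant Finsler geodesic
    (γ : ℝ → M) (hγ : F.IsGeodesic γ) (hγ' : ∃ t ∈ Icc (0 : ℝ) 1, γ t ≠ γ 0)
    -- an `h`-orthonormal frame along it, and a radius not exceeding half the injectivity radii
    (E : Fin n → ∀ t : ℝ, TangentSpace 𝓘(ℝ, Euc n) (γ t)) (hE : IsOrthonormalFrameAlong h γ E)
    (δ : ℝ) (hδ : 0 < δ) (hδ' : ∀ t ∈ Icc (0 : ℝ) 1, ENNReal.ofReal (2 * δ) ≤ injRadius h (γ t))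
    -- the endpoints are not conjugate along the geodesic
    (hconj : NonConjugate (tubeLagrangian F h γ E δ))
    -- the cut-off function
    (U' : Set (Euc n)) (hU'o : IsOpen U') (hU'0 : (0 : Euc n) ∈ U')
    (hU' : closure U' ⊆ Metric.ball 0 δ)
    (α : Euc n → ℝ) (hα : ContDiff ℝ ∞ α) (hα1 : ∀ q ∈ U', α q = 1)
    (hα0 : ∀ q ∉ Metric.ball (0 : Euc n) δ, α q = 0) :
    let G := tubeLagrangian F h γ E δ
    let 𝒜 : H10 n → ℝ := action (modLagrangian α G)
    let sp : H10 n → H10 n → ℝ := scalarProd G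
    -- the scalar product is equivalent to the standard one
    (∃ c C : ℝ, 0 < c ∧ ∀ x, c * ‖x‖ ^ 2 ≤ sp x x ∧ sp x x ≤ C * ‖x‖ ^ 2) ∧
    ∃ A : H10 n →L[ℝ] H10 n,
      RepresentsSecondGateauxAtZero 𝒜 sp A ∧
      (∃ K : H10 n →L[ℝ] H10 n, IsCompactOperator K ∧ A = ContinuousLinearMap.id ℝ (H10 n) + K) ∧
      ∀ 𝓑 ∈ 𝓝 (0 : H10 n), ∃ 𝓤 ∈ 𝓝 (0 : H10 n), 𝓤 ⊆ 𝓑 ∧ ∃ μ₀ : ℝ, 0 < μ₀ ∧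
        ∀ x ∈ 𝓤, ∃ g : H10 n, IsGradientAt 𝒜 sp x g ∧
          fderiv ℝ 𝒜 x (A x) ≥ μ₀ * sp g g := by
  intro G 𝒜 sp
  obtain ⟨r, hr, hrU⟩ := Metric.isOpen_iff.1 hU'o 0 hU'0
  obtain ⟨ρ, c, C, hρr, hT⟩ := exists_tameLagrangian (L := G)
    (fun t₀ ht₀ => tubeLagrangian_tameAt hγ hγ' hE hδ hδ' ht₀) hr
  refine hT.gradient_estimate hconj fun x hx => ?_
  refine congrArg (fun a : ℝ => 1 / 2 * a) (intervalIntegral.integral_congr fun t ht => ?_)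
  rw [uIcc_of_le zero_le_one] at ht
  -- The supremum of the curve is below its H¹ norm, hence it stays where `α` equals 1 and the two
  -- Lagrangians agree along it.
  have hq : H10.curve x t ∈ U' := hrU (by
    rw [mem_ball_zero_iff]
    exact (H10.norm_curve_le x ht).trans_lt (hx.trans_le hρr))
  simp [modLagrangian, hα1 _ hq]

end
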